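/- **Conventions.** Let $M$ be a 3-manifold and $B\subset M$ a branched surface: a compact subset locally modelled on a plane, on two sheets merging tangentially along a branch curve, or on three sheets merging along two branch curves that cross at a double point. Let $N(B)$ be its fibred regular neighbourhood, foliated by interval fibres $J$ (the foliation $\mathcal V$), and let $\pi:N(B)\to B$ be the map collapsing the fibres. The vertical boundary $\partial_vN(B)$ is the set of frontier points of $N(B)$ that are not endpoints of their fibre; it is a union of annuli foliated by subarcs of fibres. Fix a pared locus $p(B)\subset int(\partial_vN(B))$: a closed set that meets each of these subarcs in exactly one point (a union of cores of the annuli). Everything is taken in the topological category. A *lamination* $\mathcal L$ in $M$ is a closed set covered by open sets $U\cong\mathbb R^2\times\mathbb R$ with $\mathcal L\cap U=\mathbb R^2\times C$, $C\subset\mathbb R$ closed, such that the transition maps preserve the plaques $\mathbb R^2\times\{c\}$, $c\in C$. It is *carried* by $B$ if $\mathcal L\subset N(B)$ and it is transverse to $\mathcal V$ (around each of its points it has such a chart in which the fibres are vertical), and *fully carried* if moreover it meets every fibre. A *$B$-isotopy* is an isotopy that moves each point inside its fibre; for laminations its end map and the inverse preserve plaques. A *splitting surface* for $B$ is a 1-1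 immersed surface $S\subset N(B)$, transverse to $\mathcal V$, with $\partial S=p(B)$, such that $S$ is complete (in the path metric pulled back from $B$ by $\pi$: a half-open path in $S$ whose image in $B$ converges also converges in $S$), such that $S\cap J$ is discrete for each fibre $J$, and such that $S$ has a *regular open neighbourhood* $\mathcal N(S)$: a relatively open subset of $N(B)$ that fibres over $S$, the fibre over $s$ being an open segment, containing $s$, of the interval fibre through $s$, with endpoints depending continuously on $s\in S$ (so that they sweep out an immersed surface transverse to $\mathcal V$), and with $\mathcal N(S)\cap\partial_vN(B)=int(\partial_vN(B))$. Given $S$ and $\mathcal N(S)$, a fully carried lamination $\mathcal L$ *is associated to* $S$, written $\mathcal L=\mathcal L_S$, if there is a continuous map $q:N(B)\to N(B)$ that maps each fibre $J$ into itself weakly monotonically, that identifies two distinct points of $J$ exactly when the segment of $J$ between them misses $\mathcal N(S)$ (so $q$ collapses each component of $J-\mathcal N(S)$ to a point), and such that $\mathcal L=q(N(B)-\mathcal N(S))$. For a fully carried lamination $\mathcal L$, let $G$ be the set of points of $N(B)-\mathcal L$ that lie, in their fibre, between two points of $\mathcal L$, and let $G_v$ be the union of the components of $G$ that meet $int(\partial_vN(B))$.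 A splitting surface $S$ *is determined by* $\mathcal L$ if $S\subset G_v$ and $S$ meets each component of each $G_v\cap J$ in exactly one point. **Theorem.** (1) Let $S$ be a splitting surface for $B$. For every regular open neighbourhood $\mathcal N(S)$ there is a lamination $\mathcal L_S$, fully carried by $B$, associated to $S$ and $\mathcal N(S)$. Any two fully carried laminations associated to $S$, even for different choices of $\mathcal N(S)$, are $B$-isotopic. (2) Let $\mathcal L$ be a lamination fully carried by $B$. There is a splitting surface $S$ determined by $\mathcal L$, and any two such are $B$-isotopic through splitting surfaces. For every such $S$, every $\mathcal N(S)$ and every fully carried lamination $\mathcal L_S$ associated to them by a collapsing map $q$, there is a blow-down $b:\mathcal L\to\mathcal L_S$, i.e. a continuous surjection that preserves each fibre, is weakly monotone on it, and maps plaques into plaques. It satisfies, for $y,z\in\mathcal L$ in the same fibre, $b(y)=b(z)$ if and only if the segment of the fibre from $y$ to $z$ misses $S$; and it is canonical: for $y\in\mathcal L\cap J$ and $z\in J-\mathcal N(S)$, $b(y)=q(z)$ if and only if the segment of $J$ from $y$ to $z$ misses $S$. -/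

import Mathlib

open Set Filter Topology

universe u

/-! ### Local models -/

/-- Euclidean 3-space, split as (horizontal plane) x (vertical line). -/
abbrev Space3 : Type := (ℝ × ℝ) × ℝ

/-- The profile of a sheet that leaves the horizontal plane tangentially along `t = -1`
and has reached height `2` at `t = 0`. -/
noncomputable def bend (t : ℝ) : ℝ := 2 * (max 0 (min 1 (t + 1))) ^ 2

/-- Local models of a branched surface: a plane; two sheets merging along a branch curve;
three sheets merging along two branch curves that cross at a double point. -/
def modelB : Fin 3 → Set Space3
  | 0 => {q | q.2 = 0}
  | 1 => {q | q.2 = 0 ∨ q.2 = bend q.1.1}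
  | 2 => {q | q.2 = 0 ∨ q.2 = bend q.1.1 ∨ q.2 = -bend q.1.2}

/-- Local models of the fibred regular neighbourhood: a slab from which one open slot
has been removed between any two sheets that have separated. -/
def modelN : Fin 3 → Set Space3
  | 0 => {q | |q.2| ≤ 3}
  | 1 => {q | |q.2| ≤ 3 ∧ ¬ (0 < q.1.1 ∧ 1 / 2 < q.2 ∧ q.2 < 3 / 2)}
  | 2 => {q | |q.2| ≤ 3 ∧ ¬ (0 < q.1.1 ∧ 1 / 2 < q.2 ∧ q.2 < 3 / 2) ∧
      ¬ (0 < q.1.2 ∧ -(3 / 2) < q.2 ∧ q.2 < -(1 / 2))}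

/-- The fibre of the model through `q`: the maximal vertical segment of `modelN k` through `q`. -/
def modelFibre (k : Fin 3) (q : Space3) : Set Space3 :=
  {r | r.1 = q.1 ∧ ∀ z ∈ uIcc q.2 r.2, (q.1, z) ∈ modelN k}

/-! ### Branched surfaces with their fibred neighbourhoods -/

/-- A chart `ψ` of the ambient manifold, onto all of 3-space, that carries the branched surface
`B`, its neighbourhood `N` and the interval fibres onto the `k`-th local model. -/
def IsModelChart {M : Type u} [TopologicalSpace M] (B N : Set M) (fibre : M → Set M)
    (k : Fin 3) (ψ : OpenPartialHomeomorph M Space3) : Prop :=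
  ψ.target = univ ∧
  (∀ y ∈ ψ.source, y ∈ B ↔ ψ y ∈ modelB k) ∧
  (∀ y ∈ ψ.source, y ∈ N ↔ ψ y ∈ modelN k) ∧
  (∀ y ∈ ψ.source ∩ N, fibre y ⊆ ψ.source ∧ ψ '' fibre y = modelFibre k (ψ y))

/-- A branched surface `B` in `M` together with its regular neighbourhood `N(B)`, foliated by
interval fibres; `fibre y` is the fibre of the foliation through the point `y` of `N(B)`. -/
structure BranchedSurface (M : Type u) [TopologicalSpace M] where
  /-- The branched surface itself. -/
  carrier : Set M
  /-- The regular neighbourhood `N(B)`. -/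
  nbhd : Set M
  /-- The interval fibre through a point of `N(B)`. -/
  fibre : M → Set M
  isCompact_carrier : IsCompact carrier
  isCompact_nbhd : IsCompact nbhd
  carrier_subset : carrier ⊆ nbhd
  fibre_eq : ∀ y ∈ nbhd, ∀ z ∈ fibre y, fibre z = fibre y
  locally_modelled : ∀ y ∈ nbhd, ∃ k ψ, IsModelChart carrier nbhd fibre k ψ ∧ y ∈ ψ.source

/-! ### Laminations of a 3-manifold -/

/-- A product chart of a closed set: `U ≅ ℝ² × ℝ`, in which the set is `ℝ² × C`, `C` closed. -/
def IsProductChart {M : Type u} [TopologicalSpace M] (L : Set M)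
    (φ : OpenPartialHomeomorph M Space3) : Prop :=
  φ.target = univ ∧ ∃ C : Set ℝ, IsClosed C ∧ ∀ y ∈ φ.source, y ∈ L ↔ (φ y).2 ∈ C

/-- Two product charts of `L` have locally the same plaques, that is, the transition map
preserves the product structures. -/
def SamePlaques {M : Type u} [TopologicalSpace M] (L : Set M)
    (φ ψ : OpenPartialHomeomorph M Space3) : Prop :=
  ∀ y ∈ L ∩ (φ.source ∩ ψ.source), ∃ O ∈ 𝓝 y, ∀ y₁ ∈ O ∩ L, ∀ y₂ ∈ O ∩ L,
    (φ y₁).2 = (φ y₂).2 ↔ (ψ y₁).2 = (ψ y₂).2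

/-- A codimension one lamination: a foliated closed subset. -/
structure Lamination (M : Type u) [TopologicalSpace M] where
  /-- The underlying closed set. -/
  carrier : Set M
  /-- The foliated charts. -/
  charts : Set (OpenPartialHomeomorph M Space3)
  isClosed_carrier : IsClosed carrier
  isProductChart : ∀ φ ∈ charts, IsProductChart carrier φ
  covered : ∀ y ∈ carrier, ∃ φ ∈ charts, y ∈ φ.source
  samePlaques : ∀ φ ∈ charts, ∀ ψ ∈ charts, SamePlaques carrier φ ψ

/-- The map `b` sends plaques of `L` into plaques of `L'`, locally. -/
def Lamination.PlaquePreserving {M : Type u} [TopologicalSpace M] (L L' : Lamination M)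
    (b : M → M) : Prop :=
  ∀ φ ∈ L.charts, ∀ ψ ∈ L'.charts, ∀ y ∈ L.carrier ∩ φ.source, b y ∈ ψ.source →
    ∃ O ∈ 𝓝 y, ∀ y₁ ∈ O ∩ L.carrier, ∀ y₂ ∈ O ∩ L.carrier,
      (φ y₁).2 = (φ y₂).2 → (ψ (b y₁)).2 = (ψ (b y₂)).2

/-- A coordinate on an arc `J`: a continuous injective real function on `J`. (Any two are
increasing or decreasing functions of one another.) -/
def IsCoordinate {M : Type u} [TopologicalSpace M] (J : Set M) (c : M → ℝ) : Prop :=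
  ContinuousOn c J ∧ InjOn c J

namespace BranchedSurface

variable {M : Type u} [TopologicalSpace M]

/-! ### The geometry of the neighbourhood -/

/-- The closed segment of the fibre through `y` with endpoints `y` and `z`
(`z` is meant to lie in the fibre through `y`). -/
def seg (B : BranchedSurface M) (y z : M) : Set M :=
  {w | w ∈ B.fibre y ∧ ∀ c, IsCoordinate (B.fibre y) c → c w ∈ uIcc (c y) (c z)}

/-- The vertical boundary of `N(B)`: the points of the frontier of `N(B)` that are not
endpoints of their fibre. -/
def vertBoundary (B : BranchedSurface M) : Set M :=
  {y | y ∈ B.nbhd ∧ y ∈ frontier B.nbhd ∧ ¬ IsPreconnected (B.fibre y \ {y})}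

/-- The interior of the vertical boundary: each vertical arc loses its two endpoints. -/
def vertInterior (B : BranchedSurface M) : Set M :=
  {y | y ∈ B.vertBoundary ∧ B.vertBoundary ∈ 𝓝[B.fibre y] y}

/-- A pared locus `p(B)`: cores of the annuli forming the vertical boundary, that is,
a closed subset of the interior of the vertical boundary that meets every vertical arc
in exactly one point. -/
def IsParedLocus (B : BranchedSurface M) (p : Set M) : Prop :=
  IsClosed p ∧ p ⊆ B.vertInterior ∧
  ∀ y ∈ B.vertBoundary, ∃! q, q ∈ p ∧ q ∈ connectedComponentIn (B.vertBoundary ∩ B.fibre y) y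

/-- The chart `φ : U ≅ ℝ² × ℝ` is vertical: inside a model chart, its vertical lines are
the vertical lines of the model (so that pieces of interval fibres are vertical in `φ`). -/
def IsVertical (B : BranchedSurface M) (φ : OpenPartialHomeomorph M Space3) : Prop :=
  φ.target = univ ∧ ∃ k ψ, IsModelChart B.carrier B.nbhd B.fibre k ψ ∧ φ.source ⊆ ψ.source ∧
    ∃ e : ℝ × ℝ → ℝ × ℝ, IsOpenEmbedding e ∧ ∀ y ∈ φ.source, (ψ y).1 = e (φ y).1

/-! ### Laminations carried by a branched surface -/

/-- `L` is carried by `B`: it lies in `N(B)` and is transverse to the interval fibres, i.e.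
around each of its points it has a foliated chart in which the fibres are vertical. -/
def Carries (B : BranchedSurface M) (L : Lamination M) : Prop :=
  L.carrier ⊆ B.nbhd ∧
  ∀ y ∈ L.carrier, ∃ φ, y ∈ φ.source ∧ B.IsVertical φ ∧ IsProductChart L.carrier φ ∧
    ∀ ψ ∈ L.charts, SamePlaques L.carrier φ ψ

/-- `L` is fully carried by `B`: it is carried and meets every fibre. -/
def FullyCarries (B : BranchedSurface M) (L : Lamination M) : Prop :=
  B.Carries L ∧ ∀ y ∈ B.nbhd, (L.carrier ∩ B.fibre y).Nonempty

/-- `L` and `L'` are isotopic along the fibres (a `B`-isotopy, or normal isotopy). -/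
def IsotopicLaminations (B : BranchedSurface M) (L L' : Lamination M) : Prop :=
  ∃ H : ℝ → M → M,
    ContinuousOn (fun x : ℝ × M => H x.1 x.2) (Icc (0 : ℝ) 1 ×ˢ L.carrier) ∧
    (∀ t ∈ Icc (0 : ℝ) 1, InjOn (H t) L.carrier ∧ ∀ y ∈ L.carrier, H t y ∈ B.fibre y) ∧
    (∀ y ∈ L.carrier, H 0 y = y) ∧
    H 1 '' L.carrier = L'.carrier ∧
    L.PlaquePreserving L' (H 1) ∧
    ∃ g : M → M, InvOn g (H 1) L.carrier L'.carrier ∧ L'.PlaquePreserving L g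

/-- `b` is a blow-down of `L` onto `L'`: a continuous surjection that maps each fibre to itself
monotonically and plaques into plaques. -/
def IsBlowDown (B : BranchedSurface M) (L L' : Lamination M) (b : M → M) : Prop :=
  ContinuousOn b L.carrier ∧ b '' L.carrier = L'.carrier ∧ L.PlaquePreserving L' b ∧
  ∀ y ∈ L.carrier, b y ∈ B.fibre y ∧
    ∀ z ∈ L.carrier ∩ B.fibre y, ∀ c, IsCoordinate (B.fibre y) c → c y ≤ c z → c (b y) ≤ c (b z)

/-! ### Splitting surfaces -/

/-- The injective map `ι : S → M` exhibits `S`, with its own topology, as a 1-1 immersed surface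
in `N(B)` that is transverse to the interval fibres and has boundary `p`: locally, in a vertical
chart, `S` is embedded as the plane at height zero (away from `p`) or as a half-plane at height
zero, whose edge is the part on `p`. -/
def IsCarriedSurface (B : BranchedSurface M) (p : Set M) {S : Type u} [TopologicalSpace S]
    (ι : S → M) : Prop :=
  Function.Injective ι ∧ range ι ⊆ B.nbhd ∧ p ⊆ range ι ∧
  ∀ s, ∃ W : Set S, IsOpen W ∧ s ∈ W ∧ IsEmbedding (fun w : W => ι w) ∧ ∃ φ, B.IsVertical φ ∧
    ((ι '' W = {y | y ∈ φ.source ∧ (φ y).2 = 0} ∧ ∀ w ∈ W, ι w ∉ p) ∨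
     (ι '' W = {y | y ∈ φ.source ∧ (φ y).2 = 0 ∧ (φ y).1.1 ≤ 0} ∧
        ∀ w ∈ W, ι w ∈ p ↔ (φ (ι w)).1.1 = 0))

/-- The surface is complete, for the path metric pulled back from `B` under the map that
collapses the fibres: a half-open path in `S` whose image in `B` converges (to the point of `B`
given by the fibre through `y`) converges in `S`. -/
def IsCompleteSurface (B : BranchedSurface M) {S : Type u} [TopologicalSpace S]
    (ι : S → M) : Prop :=
  ∀ γ : ℝ → S, ContinuousOn γ (Ico 0 1) → ∀ y ∈ B.nbhd,
    Tendsto (fun t => ι (γ t)) (𝓝[<] 1) (𝓝ˢ (B.fibre y)) → ∃ s, Tendsto γ (𝓝[<] 1) (𝓝 s)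

/-- `O` is a regular open neighbourhood of the surface in `N(B)`: it fibres over `S` by `ρ`, the
fibre over `s` being an open segment of the interval fibre through `s`; the endpoints `a`, `b` of
these segments sweep out an immersed surface transverse to the fibres; and `O` meets the vertical
boundary in its interior. -/
def IsRegularNbhd (B : BranchedSurface M) {S : Type u} [TopologicalSpace S]
    (ι : S → M) (O : Set M) : Prop :=
  (∃ U, IsOpen U ∧ O = B.nbhd ∩ U) ∧
  O ∩ B.vertBoundary = B.vertInterior ∧
  ∃ ρ : O → S, Continuous ρ ∧
    (∀ s, ∃ h : ι s ∈ O, ρ ⟨ι s, h⟩ = s) ∧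
    ∀ s, ∃ W : Set S, IsOpen W ∧ s ∈ W ∧ ∃ a b : S → M, ContinuousOn a W ∧ ContinuousOn b W ∧
      ∀ w ∈ W, a w ∈ B.fibre (ι w) ∧ b w ∈ B.fibre (ι w) ∧
        (fun y : O => (y : M)) '' {y | ρ y = w} = B.seg (a w) (b w) \ {a w, b w}

/-- A splitting surface for `B` (with pared locus `p`). -/
def IsSplittingSurface (B : BranchedSurface M) (p : Set M) {S : Type u} [TopologicalSpace S]
    (ι : S → M) : Prop :=
  B.IsCarriedSurface p ι ∧ B.IsCompleteSurface ι ∧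
  (∀ y ∈ B.nbhd, DiscreteTopology ↥(range ι ∩ B.fibre y)) ∧
  ∃ O, B.IsRegularNbhd ι O

/-- Two splitting surfaces are isotopic along the fibres, through splitting surfaces. -/
def IsotopicSurfaces (B : BranchedSurface M) (p : Set M) {S S' : Type u} [TopologicalSpace S]
    [TopologicalSpace S'] (ι : S → M) (ι' : S' → M) : Prop :=
  ∃ (θ : S ≃ₜ S') (H : ℝ → S → M),
    ContinuousOn (fun x : ℝ × S => H x.1 x.2) (Icc (0 : ℝ) 1 ×ˢ univ) ∧
    H 0 = ι ∧ H 1 = ι' ∘ θ ∧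
    ∀ t ∈ Icc (0 : ℝ) 1, B.IsSplittingSurface p (H t) ∧ ∀ s, H t s ∈ B.fibre (ι s)

/-! ### The lamination of a splitting surface -/

/-- `L` is the lamination obtained from the regular neighbourhood `O` of a splitting surface:
`q` is the quotient map that collapses, in each fibre `J`, each component of `J \ O` to a point
(its image is the quotient `N(B)'`, realized inside `N(B)` respecting fibres and the order on
them), and `L` is the complement of `O` in the quotient. -/
def IsCollapse (B : BranchedSurface M) (O : Set M) (L : Lamination M) (q : M → M) : Prop :=
  ContinuousOn q B.nbhd ∧
  (∀ y ∈ B.nbhd, q y ∈ B.fibre y ∧ ∀ z ∈ B.fibre y,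
    (q y = q z ↔ y = z ∨ Disjoint (B.seg y z) O) ∧
    ∀ c, IsCoordinate (B.fibre y) c → c y ≤ c z → c (q y) ≤ c (q z)) ∧
  L.carrier = q '' (B.nbhd \ O)

/-! ### The splitting surface of a lamination -/

/-- The complementary region of `L` in the part of `N(B)` lying between points of `L` (the parts of
the fibres beyond the first and the last point of `L` are discarded, as if `L` were pushed onto
the endpoints of the fibres). -/
def gapRegion (B : BranchedSurface M) (L : Lamination M) : Set M :=
  {y | y ∈ B.nbhd \ L.carrier ∧ ∃ l ∈ L.carrier ∩ B.fibre y, ∃ l' ∈ L.carrier ∩ B.fibre y,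
    y ∈ B.seg l l'}

/-- The union of the complementary regions (components of the gap region) that meet the vertical
boundary. -/
def cuspRegion (B : BranchedSurface M) (L : Lamination M) : Set M :=
  {y | ∃ v ∈ B.vertInterior, y ∈ connectedComponentIn (B.gapRegion L) v}

/-- The complementary regions of `L` that meet the vertical boundary are interval bundles over
the surface `S`: the surface lies in them and meets each of their interval fibres exactly once. -/
def IsCoreSurface (B : BranchedSurface M) (L : Lamination M) {S : Type u} (ι : S → M) : Prop :=
  range ι ⊆ B.cuspRegion L ∧
  ∀ y ∈ B.cuspRegion L, ∃! s, ι s ∈ connectedComponentIn (B.cuspRegion L ∩ B.fibre y) y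

end BranchedSurface

set_option linter.unusedSectionVars false

namespace BranchedSurface

variable {M : Type u} [TopologicalSpace M]

/-! ### Vertical charts and their reparametrizations -/

/-- A vertical chart in which the neighbourhood is `A` and the fibres are the maximal vertical
segments of `A`. -/
def FibreChart (B : BranchedSurface M) (A : Set Space3) (ψ : OpenPartialHomeomorph M Space3) :
    Prop :=
  B.IsVertical ψ ∧ (∀ y ∈ ψ.source, y ∈ B.nbhd ↔ ψ y ∈ A) ∧
  ∀ y ∈ ψ.source ∩ B.nbhd, ∀ w, w ∈ B.fibre y ↔
    w ∈ ψ.source ∧ (ψ w).1 = (ψ y).1 ∧ ∀ t ∈ uIcc (ψ y).2 (ψ w).2, ((ψ y).1, t) ∈ A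

theorem IsModelChart.fibreChart {B : BranchedSurface M} {k : Fin 3}
    {ψ : OpenPartialHomeomorph M Space3} (h : IsModelChart B.carrier B.nbhd B.fibre k ψ) :
    B.FibreChart (modelN k) ψ := by
  refine ⟨⟨h.1, k, ψ, h, subset_rfl, id, IsOpenEmbedding.id, fun _ _ => rfl⟩, h.2.2.1, ?_⟩
  intro y hy w
  obtain ⟨hs, him⟩ := h.2.2.2 y hy
  constructor
  · intro hw
    have : ψ w ∈ modelFibre k (ψ y) := him ▸ mem_image_of_mem _ hw
    exact ⟨hs hw, this.1, this.2⟩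
  · rintro ⟨hw, h1, h2⟩
    have : ψ w ∈ ψ '' B.fibre y := him ▸ ⟨h1, h2⟩
    obtain ⟨w', hw', he⟩ := this
    rwa [← ψ.injOn (hs hw') hw he]

/-- Change of the base coordinate by an open embedding, followed by a homeomorphism. -/
noncomputable def reparam (ψ : OpenPartialHomeomorph M Space3) {e : ℝ × ℝ → ℝ × ℝ}
    (he : IsOpenEmbedding e) (Ξ : Space3 ≃ₜ Space3) : OpenPartialHomeomorph M Space3 :=
  (ψ.trans ((he.prodMap IsOpenEmbedding.id).toOpenPartialHomeomorph
    (Prod.map e (id : ℝ → ℝ))).symm).trans Ξ.toOpenPartialHomeomorph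

section reparam
variable {ψ : OpenPartialHomeomorph M Space3} {e : ℝ × ℝ → ℝ × ℝ}
  {he : IsOpenEmbedding e} {Ξ : Space3 ≃ₜ Space3}

theorem mem_reparam_source {y : M} :
    y ∈ (reparam ψ he Ξ).source ↔ y ∈ ψ.source ∧ (ψ y).1 ∈ range e := by
  simp [reparam]

theorem reparam_target (h : ψ.target = univ) : (reparam ψ he Ξ).target = univ := by
  ext q
  simp [reparam, h]

theorem apply_eq_reparam {y : M} (hy : y ∈ (reparam ψ he Ξ).source) :
    ψ y = (e (Ξ.symm (reparam ψ he Ξ y)).1, (Ξ.symm (reparam ψ he Ξ y)).2) := by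
  have h : (ψ y).1 ∈ range e := (mem_reparam_source.1 hy).2
  set Θ := (he.prodMap IsOpenEmbedding.id).toOpenPartialHomeomorph (Prod.map e (id : ℝ → ℝ))
    with hΘ
  have h1 : ψ y ∈ Θ.target := by
    simp only [hΘ, IsOpenEmbedding.toOpenPartialHomeomorph_target, range_prodMap]
    exact ⟨h, by simp⟩
  have h2 : Ξ.symm (reparam ψ he Ξ y) = Θ.symm (ψ y) := by
    simp [reparam, ← hΘ]
  rw [h2]
  have := Θ.right_inv h1
  conv_lhs => rw [← this]
  rfl

theorem IsVertical.reparam {B : BranchedSurface M} (h : B.IsVertical ψ)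
    (hΞ : ∀ q, (Ξ q).1 = q.1) : B.IsVertical (reparam ψ he Ξ) := by
  obtain ⟨ht, k, ψ₀, hm, hs, e₀, he₀, h0⟩ := h
  refine ⟨reparam_target ht, k, ψ₀, hm, fun y hy => hs (mem_reparam_source.1 hy).1, e₀ ∘ e,
    he₀.comp he, ?_⟩
  intro y hy
  rw [h0 y (mem_reparam_source.1 hy).1, apply_eq_reparam hy]
  have := hΞ (Ξ.symm (BranchedSurface.reparam ψ he Ξ y))
  rw [Ξ.apply_symm_apply] at this
  simp [this]

theorem uIcc_image_of_injective {f : ℝ → ℝ} (hf : Continuous f) (hi : Function.Injective f)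
    (a b : ℝ) : f '' uIcc a b = uIcc (f a) (f b) := by
  refine Subset.antisymm ?_ (intermediate_value_uIcc hf.continuousOn)
  rintro _ ⟨t, ht, rfl⟩
  rcases hf.strictMono_of_inj hi with h | h
  · exact h.monotone.image_uIcc_subset (mem_image_of_mem _ ht)
  · exact h.antitone.image_uIcc_subset (mem_image_of_mem _ ht)

theorem FibreChart.reparam {B : BranchedSurface M} {A A' : Set Space3} (h : B.FibreChart A ψ)
    (hΞ : ∀ q, (Ξ q).1 = q.1) (hA : ∀ q, Ξ q ∈ A' ↔ (e q.1, q.2) ∈ A) :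
    B.FibreChart A' (BranchedSurface.reparam ψ he Ξ) := by
  refine ⟨h.1.reparam hΞ, ?_, ?_⟩
  · intro y hy
    rw [h.2.1 y (mem_reparam_source.1 hy).1, apply_eq_reparam hy, ← hA, Ξ.apply_symm_apply]
  · rintro y ⟨hy, hyN⟩ w
    have hys := mem_reparam_source.1 hy
    rw [h.2.2 y ⟨hys.1, hyN⟩ w, mem_reparam_source]
    have key : ∀ w ∈ (BranchedSurface.reparam ψ he Ξ).source, (ψ w).1 = (ψ y).1 →
        ((BranchedSurface.reparam ψ he Ξ w).1 = (BranchedSurface.reparam ψ he Ξ y).1 ∧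
        ((∀ t ∈ uIcc (ψ y).2 (ψ w).2, ((ψ y).1, t) ∈ A) ↔
         ∀ t ∈ uIcc (BranchedSurface.reparam ψ he Ξ y).2 (BranchedSurface.reparam ψ he Ξ w).2,
          ((BranchedSurface.reparam ψ he Ξ y).1, t) ∈ A')) := by
      intro w hw h1
      have ey := apply_eq_reparam hy
      have ew := apply_eq_reparam hw
      set a := Ξ.symm (BranchedSurface.reparam ψ he Ξ y) with ha
      set b := Ξ.symm (BranchedSurface.reparam ψ he Ξ w) with hb
      have eqa : BranchedSurface.reparam ψ he Ξ y = Ξ a := by simp [ha]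
      have eqb : BranchedSurface.reparam ψ he Ξ w = Ξ b := by simp [hb]
      have hab : b.1 = a.1 := by
        apply he.injective; rw [ey, ew] at h1; exact h1
      rw [eqa, eqb, hΞ, hΞ, ey, ew]
      refine ⟨hab, ?_⟩
      have hf : Continuous fun t => (Ξ (a.1, t)).2 := by fun_prop
      have hi : Function.Injective fun t => (Ξ (a.1, t)).2 := by
        intro s t hst
        have : Ξ (a.1, s) = Ξ (a.1, t) := Prod.ext (by rw [hΞ, hΞ]) hst
        exact (Prod.ext_iff.1 (Ξ.injective this)).2
      have him := uIcc_image_of_injective hf hi a.2 b.2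
      have e1 : (Ξ (a.1, a.2)).2 = (Ξ a).2 := rfl
      have e2 : (Ξ (a.1, b.2)).2 = (Ξ b).2 := by rw [← hab]
      rw [e1, e2] at him
      rw [← him]
      simp only [forall_mem_image]
      refine forall₂_congr fun t _ => ?_
      rw [← hA (a.1, t)]
      have : Ξ (a.1, t) = (a.1, (Ξ (a.1, t)).2) := Prod.ext (hΞ _) rfl
      rw [← this]
    constructor
    · rintro ⟨h1, h2, h3⟩
      have hw : w ∈ (BranchedSurface.reparam ψ he Ξ).source :=
        mem_reparam_source.2 ⟨h1, h2 ▸ hys.2⟩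
      obtain ⟨k1, k2⟩ := key w hw h2
      exact ⟨⟨h1, h2 ▸ hys.2⟩, k1, k2.1 h3⟩
    · rintro ⟨h1, h2, h3⟩
      have hw : w ∈ (BranchedSurface.reparam ψ he Ξ).source := mem_reparam_source.2 h1
      have h4 : (ψ w).1 = (ψ y).1 := by
        rw [apply_eq_reparam hw, apply_eq_reparam hy]
        have e1 : ∀ q, (Ξ.symm q).1 = q.1 := fun q => by
          rw [← hΞ (Ξ.symm q), Ξ.apply_symm_apply]
        simp [e1, h2]
      exact ⟨h1.1, h4, (key w hw h4).2.2 h3⟩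

end reparam

/-! ### Columns -/

/-- The state of a slot over the base of a column: absent, present everywhere, or present
exactly over the positive half of the base. -/
inductive SlotMode
  | absent
  | full
  | branch

/-- Over the coordinate `t` the slot is present. -/
def SlotMode.Active : SlotMode → ℝ → Prop
  | absent, _ => False
  | full, _ => True
  | branch, t => 0 < t

theorem SlotMode.isOpen_active (m : SlotMode) : IsOpen {t | m.Active t} := by
  cases m
  · simp [SlotMode.Active]
  · simp [SlotMode.Active]
  · exact isOpen_Ioi

/-- The slab over the plane with an upper slot of mode `m` and a lower slot of mode `n`. -/
def slab (m n : SlotMode) : Set Space3 :=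
  {q | |q.2| ≤ 3 ∧ ¬ (m.Active q.1.1 ∧ 1 / 2 < q.2 ∧ q.2 < 3 / 2) ∧
    ¬ (n.Active q.1.2 ∧ -(3 / 2) < q.2 ∧ q.2 < -(1 / 2))}

theorem isClosed_slab (m n : SlotMode) : IsClosed (slab m n) := by
  have c1 : Continuous fun q : Space3 => q.1.1 := by fun_prop
  have c2 : Continuous fun q : Space3 => q.1.2 := by fun_prop
  have c3 : Continuous fun q : Space3 => q.2 := by fun_prop
  have h1 : IsOpen {q : Space3 | m.Active q.1.1 ∧ 1 / 2 < q.2 ∧ q.2 < 3 / 2} :=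
    (m.isOpen_active.preimage c1).inter
      ((isOpen_lt continuous_const c3).inter (isOpen_lt c3 continuous_const))
  have h2 : IsOpen {q : Space3 | n.Active q.1.2 ∧ -(3 / 2) < q.2 ∧ q.2 < -(1 / 2)} :=
    (n.isOpen_active.preimage c2).inter
      ((isOpen_lt continuous_const c3).inter (isOpen_lt c3 continuous_const))
  exact (isClosed_le c3.abs continuous_const).inter
    (h1.isClosed_compl.inter h2.isClosed_compl)

/-- A column: a vertical chart in which the neighbourhood is a slab with slots. -/
structure Column (B : BranchedSurface M) where
  /-- The chart. -/
  chart : OpenPartialHomeomorph M Space3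
  /-- The mode of the upper slot. -/
  m : SlotMode
  /-- The mode of the lower slot. -/
  n : SlotMode
  fibreChart : B.FibreChart (slab m n) chart

/-- Reparametrization of the line about `c`, preserving signs. -/
noncomputable def signChart (c t : ℝ) : ℝ := if c = 0 then t else c * Real.exp t

/-- The mode of a slot near the coordinate `c`. -/
noncomputable def signMode (c : ℝ) : SlotMode :=
  if c = 0 then .branch else if 0 < c then .full else .absent

theorem signMode_active (c t : ℝ) : (signMode c).Active t ↔ 0 < signChart c t := by
  unfold signMode signChart
  split_ifs with h1 h2
  · rfl
  · simp [SlotMode.Active, h2, Real.exp_pos]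
  · have : c < 0 := lt_of_le_of_ne (not_lt.1 h2) h1
    simp only [SlotMode.Active, false_iff, not_lt]
    exact (mul_neg_of_neg_of_pos this (Real.exp_pos t)).le

theorem isOpenEmbedding_signChart (c : ℝ) : IsOpenEmbedding (signChart c) := by
  unfold signChart
  split_ifs with h
  · exact IsOpenEmbedding.id
  · exact (Homeomorph.mulLeft₀ c h).isOpenEmbedding.comp Real.isOpenEmbedding_exp

theorem signChart_zero (c : ℝ) : signChart c 0 = c := by
  unfold signChart; split_ifs with h <;> simp [h]

theorem exists_column (B : BranchedSurface M) {y : M} (hy : y ∈ B.nbhd) :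
    ∃ κ : Column B, y ∈ κ.chart.source ∧ (κ.chart y).1 = 0 := by
  obtain ⟨k, ψ, hψ, hyψ⟩ := B.locally_modelled y hy
  have hF := IsModelChart.fibreChart hψ
  have fin : ∀ (e : ℝ × ℝ → ℝ × ℝ) (he : IsOpenEmbedding e) (m n : SlotMode),
      e 0 = (ψ y).1 → (∀ q : Space3, q ∈ slab m n ↔ (e q.1, q.2) ∈ modelN k) →
      ∃ κ : Column B, y ∈ κ.chart.source ∧ (κ.chart y).1 = 0 := by
    intro e he m n h0 hA
    have hs : y ∈ (reparam ψ he (Homeomorph.refl _)).source :=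
      mem_reparam_source.2 ⟨hyψ, 0, h0⟩
    refine ⟨⟨reparam ψ he (Homeomorph.refl _), m, n,
      hF.reparam (fun _ => rfl) (fun q => hA q)⟩, hs, ?_⟩
    have := apply_eq_reparam hs
    apply he.injective
    rw [h0, this]
    rfl
  have ht : ∀ c : ℝ, IsOpenEmbedding fun t : ℝ => c + t := fun c =>
    (Homeomorph.addLeft c).isOpenEmbedding
  fin_cases k
  · refine fin (Prod.map (fun t => (ψ y).1.1 + t) (fun t => (ψ y).1.2 + t))
      ((ht _).prodMap (ht _)) .absent .absent (Prod.ext (add_zero _) (add_zero _)) ?_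
    intro q; simp [slab, modelN, SlotMode.Active]
  · refine fin (Prod.map (signChart (ψ y).1.1) (fun t => (ψ y).1.2 + t))
      ((isOpenEmbedding_signChart _).prodMap (ht _)) (signMode (ψ y).1.1) .absent
      (Prod.ext (signChart_zero _) (add_zero _)) ?_
    intro q
    change (_ ∧ ¬ (_ ∧ _) ∧ ¬ (False ∧ _)) ↔ (_ ∧ ¬ (_ ∧ _))
    rw [signMode_active]
    simp
  · refine fin (Prod.map (signChart (ψ y).1.1) (signChart (ψ y).1.2))
      ((isOpenEmbedding_signChart _).prodMap (isOpenEmbedding_signChart _))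
      (signMode (ψ y).1.1) (signMode (ψ y).1.2)
      (Prod.ext (signChart_zero _) (signChart_zero _)) ?_
    intro q
    change (_ ∧ ¬ (_ ∧ _) ∧ ¬ (_ ∧ _)) ↔ (_ ∧ ¬ (_ ∧ _) ∧ ¬ (_ ∧ _))
    rw [signMode_active, signMode_active]
    rfl

/-- Turning a column upside down exchanges the slots. -/
noncomputable def Column.flip {B : BranchedSurface M} (κ : Column B) : Column B where
  chart := reparam κ.chart (Homeomorph.prodComm ℝ ℝ).isOpenEmbedding
    ((Homeomorph.refl (ℝ × ℝ)).prodCongr (Homeomorph.neg ℝ))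
  m := κ.n
  n := κ.m
  fibreChart := by
    refine κ.fibreChart.reparam (fun _ => rfl) ?_
    rintro ⟨⟨a, b⟩, z⟩
    change (|-z| ≤ 3 ∧ ¬ (κ.n.Active a ∧ 1 / 2 < -z ∧ -z < 3 / 2) ∧
      ¬ (κ.m.Active b ∧ -(3 / 2) < -z ∧ -z < -(1 / 2))) ↔
      (|z| ≤ 3 ∧ ¬ (κ.m.Active b ∧ 1 / 2 < z ∧ z < 3 / 2) ∧
      ¬ (κ.n.Active a ∧ -(3 / 2) < z ∧ z < -(1 / 2)))
    rw [abs_neg]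
    constructor
    · rintro ⟨h1, h2, h3⟩
      exact ⟨h1, fun ⟨k1, k2, k3⟩ => h3 ⟨k1, by linarith, by linarith⟩,
        fun ⟨k1, k2, k3⟩ => h2 ⟨k1, by linarith, by linarith⟩⟩
    · rintro ⟨h1, h2, h3⟩
      exact ⟨h1, fun ⟨k1, k2, k3⟩ => h3 ⟨k1, by linarith, by linarith⟩,
        fun ⟨k1, k2, k3⟩ => h2 ⟨k1, by linarith, by linarith⟩⟩

variable {M : Type u} [TopologicalSpace M] {B : BranchedSurface M}

namespace Column

/-- The base coordinate. -/
noncomputable def v (κ : Column B) (y : M) : ℝ × ℝ := (κ.chart y).1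

/-- The height. -/
noncomputable def z (κ : Column B) (y : M) : ℝ := (κ.chart y).2

/-- The point with given base coordinate and height. -/
noncomputable def pt (κ : Column B) (a : ℝ × ℝ) (t : ℝ) : M := κ.chart.symm (a, t)

/-- The points of the slab over `a`. -/
def S (κ : Column B) (a : ℝ × ℝ) (t : ℝ) : Prop := (a, t) ∈ slab κ.m κ.n

variable (κ : Column B)

theorem target_eq : κ.chart.target = univ := κ.fibreChart.1.1

@[simp] theorem pt_mem (a : ℝ × ℝ) (t : ℝ) : κ.pt a t ∈ κ.chart.source :=
  κ.chart.map_target (by simp [κ.target_eq])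

@[simp] theorem v_pt (a : ℝ × ℝ) (t : ℝ) : κ.v (κ.pt a t) = a := by
  simp [v, pt, κ.chart.right_inv (x := (a, t)) (by simp [κ.target_eq])]

@[simp] theorem z_pt (a : ℝ × ℝ) (t : ℝ) : κ.z (κ.pt a t) = t := by
  simp [z, pt, κ.chart.right_inv (x := (a, t)) (by simp [κ.target_eq])]

theorem pt_v_z {y : M} (hy : y ∈ κ.chart.source) : κ.pt (κ.v y) (κ.z y) = y :=
  κ.chart.left_inv hy

theorem ext {y w : M} (hy : y ∈ κ.chart.source) (hw : w ∈ κ.chart.source)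
    (h1 : κ.v y = κ.v w) (h2 : κ.z y = κ.z w) : y = w := by
  rw [← κ.pt_v_z hy, ← κ.pt_v_z hw, h1, h2]

theorem continuous_pt : Continuous fun q : (ℝ × ℝ) × ℝ => κ.pt q.1 q.2 := by
  have := κ.chart.continuousOn_symm
  rw [κ.target_eq] at this
  exact continuousOn_univ.1 this

theorem continuousAt_v {y : M} (hy : y ∈ κ.chart.source) : ContinuousAt κ.v y :=
  continuous_fst.continuousAt.comp (κ.chart.continuousAt hy)

theorem continuousAt_z {y : M} (hy : y ∈ κ.chart.source) : ContinuousAt κ.z y :=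
  continuous_snd.continuousAt.comp (κ.chart.continuousAt hy)

theorem isOpen_source : IsOpen κ.chart.source := κ.chart.open_source

theorem source_mem_nhds {y : M} (hy : y ∈ κ.chart.source) : κ.chart.source ∈ 𝓝 y :=
  κ.isOpen_source.mem_nhds hy

theorem mem_nbhd {y : M} (hy : y ∈ κ.chart.source) : y ∈ B.nbhd ↔ κ.S (κ.v y) (κ.z y) :=
  κ.fibreChart.2.1 y hy

@[simp] theorem pt_mem_nbhd (a : ℝ × ℝ) (t : ℝ) : κ.pt a t ∈ B.nbhd ↔ κ.S a t := by
  rw [κ.mem_nbhd (κ.pt_mem a t), κ.v_pt, κ.z_pt]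

theorem mem_fibre {y w : M} (hy : y ∈ κ.chart.source) (hN : y ∈ B.nbhd) :
    w ∈ B.fibre y ↔ w ∈ κ.chart.source ∧ κ.v w = κ.v y ∧
      ∀ t ∈ uIcc (κ.z y) (κ.z w), κ.S (κ.v y) t :=
  κ.fibreChart.2.2 y ⟨hy, hN⟩ w

theorem S_iff (a : ℝ × ℝ) (t : ℝ) : κ.S a t ↔ |t| ≤ 3 ∧
    ¬ (κ.m.Active a.1 ∧ 1 / 2 < t ∧ t < 3 / 2) ∧
    ¬ (κ.n.Active a.2 ∧ -(3 / 2) < t ∧ t < -(1 / 2)) := Iff.rfl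

theorem isClosed_S : IsClosed {q : (ℝ × ℝ) × ℝ | κ.S q.1 q.2} := isClosed_slab _ _

variable {κ}

theorem S.le {a : ℝ × ℝ} {t : ℝ} (h : κ.S a t) : t ≤ 3 := (abs_le.1 h.1).2

theorem S.ge {a : ℝ × ℝ} {t : ℝ} (h : κ.S a t) : -3 ≤ t := (abs_le.1 h.1).1

theorem S_uIcc {a : ℝ × ℝ} {s t : ℝ} (hs : κ.S a s) (ht : κ.S a t) (h : |s - t| < 1) :
    ∀ r ∈ uIcc s t, κ.S a r := by
  intro r hr
  rw [abs_lt] at h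
  have h1 := hs.le; have h2 := hs.ge; have h3 := ht.le; have h4 := ht.ge
  obtain ⟨-, s1, s2⟩ := hs
  obtain ⟨-, t1, t2⟩ := ht
  simp only [not_and, not_lt] at s1 s2 t1 t2
  rw [mem_uIcc] at hr
  refine ⟨abs_le.2 ⟨?_, ?_⟩, ?_, ?_⟩
  · rcases hr with hr | hr <;> linarith
  · rcases hr with hr | hr <;> linarith
  · rintro ⟨k1, k2, k3⟩
    have u1 := s1 k1
    have u2 := t1 k1
    simp only at k2 k3
    by_cases c1 : 1 / 2 < s <;> by_cases c2 : 1 / 2 < t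
    · have := u1 c1; have := u2 c2; rcases hr with hr | hr <;> linarith
    · have := u1 c1; rcases hr with hr | hr <;> linarith
    · have := u2 c2; rcases hr with hr | hr <;> linarith
    · rcases hr with hr | hr <;> linarith
  · rintro ⟨k1, k2, k3⟩
    have u1 := s2 k1
    have u2 := t2 k1
    simp only at k2 k3
    by_cases c1 : -(3 / 2) < s <;> by_cases c2 : -(3 / 2) < t
    · have := u1 c1; have := u2 c2; rcases hr with hr | hr <;> linarith
    · have := u1 c1; rcases hr with hr | hr <;> linarith
    · have := u2 c2; rcases hr with hr | hr <;> linarith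
    · rcases hr with hr | hr <;> linarith

end Column

/-! ### Fibres -/

theorem self_mem_fibre {y : M} (hy : y ∈ B.nbhd) : y ∈ B.fibre y := by
  obtain ⟨κ, hκ, -⟩ := B.exists_column hy
  rw [κ.mem_fibre hκ hy]
  refine ⟨hκ, rfl, fun t ht => ?_⟩
  rw [uIcc_self, mem_singleton_iff] at ht
  exact ht ▸ (κ.mem_nbhd hκ).1 hy

theorem fibre_subset {y : M} (hy : y ∈ B.nbhd) : B.fibre y ⊆ B.nbhd := by
  obtain ⟨κ, hκ, -⟩ := B.exists_column hy
  intro w hw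
  obtain ⟨h1, h2, h3⟩ := (κ.mem_fibre hκ hy).1 hw
  rw [κ.mem_nbhd h1, h2]
  exact h3 _ right_mem_uIcc

theorem mem_fibre_symm {y w : M} (hy : y ∈ B.nbhd) (hw : w ∈ B.fibre y) : y ∈ B.fibre w := by
  rw [B.fibre_eq y hy w hw]; exact self_mem_fibre hy

namespace Column

variable {κ : Column B}

theorem fibre_source {y w : M} (hy : y ∈ κ.chart.source) (hN : y ∈ B.nbhd) (hw : w ∈ B.fibre y) :
    w ∈ κ.chart.source := ((κ.mem_fibre hy hN).1 hw).1

theorem fibre_v {y w : M} (hy : y ∈ κ.chart.source) (hN : y ∈ B.nbhd) (hw : w ∈ B.fibre y) :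
    κ.v w = κ.v y := ((κ.mem_fibre hy hN).1 hw).2.1

theorem fibre_S {y w : M} (hy : y ∈ κ.chart.source) (hN : y ∈ B.nbhd) (hw : w ∈ B.fibre y) :
    κ.S (κ.v y) (κ.z w) := ((κ.mem_fibre hy hN).1 hw).2.2 _ right_mem_uIcc

theorem fibre_uIcc {y w w' : M} (hy : y ∈ κ.chart.source) (hN : y ∈ B.nbhd) (hw : w ∈ B.fibre y)
    (hw' : w' ∈ B.fibre y) {t : ℝ} (ht : t ∈ uIcc (κ.z w) (κ.z w')) : κ.pt (κ.v y) t ∈ B.fibre y := by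
  have e := B.fibre_eq y hN w hw
  rw [← e] at hw' ⊢
  have hwN := fibre_subset hN hw
  have hws := fibre_source hy hN hw
  obtain ⟨h1, h2, h3⟩ := (κ.mem_fibre hws hwN).1 hw'
  rw [κ.mem_fibre hws hwN, v_pt, z_pt, fibre_v hy hN hw]
  refine ⟨κ.pt_mem _ _, rfl, fun r hr => ?_⟩
  rw [← fibre_v hy hN hw]
  exact h3 r (uIcc_subset_uIcc left_mem_uIcc ht hr)

theorem pt_mem_fibre {a : ℝ × ℝ} {s t : ℝ} (hs : κ.S a s) :
    κ.pt a t ∈ B.fibre (κ.pt a s) ↔ ∀ r ∈ uIcc s t, κ.S a r := by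
  rw [κ.mem_fibre (κ.pt_mem _ _) ((κ.pt_mem_nbhd _ _).2 hs)]
  simp

/-- The heights of the fibre through `y` form a compact interval. -/
theorem exists_Icc {y : M} (hy : y ∈ κ.chart.source) (hN : y ∈ B.nbhd) :
    ∃ lo hi, lo < hi ∧ κ.z y ∈ Icc lo hi ∧
      ∀ t, κ.pt (κ.v y) t ∈ B.fibre y ↔ t ∈ Icc lo hi := by
  set I : Set ℝ := {t | κ.pt (κ.v y) t ∈ B.fibre y} with hI
  have hmem : ∀ t, t ∈ I ↔ ∀ r ∈ uIcc (κ.z y) t, κ.S (κ.v y) r := by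
    intro t
    have := pt_mem_fibre (κ := κ) (t := t) ((κ.mem_nbhd hy).1 hN)
    rw [κ.pt_v_z hy] at this
    exact this
  have hSy := (κ.mem_nbhd hy).1 hN
  have hyI : κ.z y ∈ I := by
    rw [hmem]; intro r hr; rw [uIcc_self, mem_singleton_iff] at hr; exact hr ▸ hSy
  have hord : I.OrdConnected := by
    rw [ordConnected_iff_uIcc_subset]
    intro s hs t ht r hr
    exact fibre_uIcc hy hN hs ht (by simpa using hr)
  have hclS : IsClosed {t | κ.S (κ.v y) t} :=
    κ.isClosed_S.preimage (by fun_prop : Continuous fun t : ℝ => (κ.v y, t))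
  have hcl : IsClosed I := by
    refine isClosed_of_closure_subset fun t ht => (hmem t).2 fun r hr => ?_
    by_cases hrt : r = t
    · subst hrt
      refine hclS.closure_subset_iff.2 ?_ ht
      intro s hs; exact (hmem s).1 hs _ right_mem_uIcc
    · rw [mem_uIcc] at hr
      rcases hr with hr | hr
      · obtain ⟨s, h1, h2⟩ := mem_closure_iff.1 ht (Ioi r) isOpen_Ioi
          (lt_of_le_of_ne hr.2 hrt)
        exact (hmem s).1 h2 r (mem_uIcc.2 (Or.inl ⟨hr.1, le_of_lt h1⟩))
      · obtain ⟨s, h1, h2⟩ := mem_closure_iff.1 ht (Iio r) isOpen_Iio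
          (lt_of_le_of_ne hr.1 (Ne.symm hrt))
        exact (hmem s).1 h2 r (mem_uIcc.2 (Or.inr ⟨le_of_lt h1, hr.2⟩))
  have hcomp : IsCompact I := by
    refine (isCompact_Icc (a := (-3 : ℝ)) (b := 3)).of_isClosed_subset hcl fun t ht => ?_
    have := (hmem t).1 ht _ right_mem_uIcc
    exact ⟨this.ge, this.le⟩
  have hconn : IsConnected I := ⟨⟨_, hyI⟩, isPreconnected_iff_ordConnected.2 hord⟩
  have heq := eq_Icc_of_connected_compact hconn hcomp
  refine ⟨sInf I, sSup I, ?_, heq ▸ hyI, fun t => by rw [← heq]; exact Iff.rfl⟩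
  obtain ⟨s, hs, hne⟩ : ∃ s ∈ I, s ≠ κ.z y := by
    have mk : ∀ l r : ℝ, κ.z y ∈ Icc l r → l < r → (∀ t ∈ Icc l r, κ.S (κ.v y) t) →
        ∃ s ∈ I, s ≠ κ.z y := fun l r hz hlr h => by
      rcases eq_or_ne l (κ.z y) with e | e
      · exact ⟨r, (hmem r).2 fun t ht => h t (uIcc_subset_Icc hz ⟨hlr.le, le_rfl⟩ ht), e ▸ hlr.ne'⟩
      · exact ⟨l, (hmem l).2 fun t ht => h t (uIcc_subset_Icc hz ⟨le_rfl, hlr.le⟩ ht), e⟩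
    have hz := abs_le.1 hSy.1
    simp only [S_iff, abs_le] at hSy mk
    rcases le_or_gt (κ.z y) (-(3 / 2)) with c | c
    · exact mk (-3) (-(3 / 2)) ⟨hz.1, c⟩ (by norm_num) (by grind)
    rcases lt_or_ge (κ.z y) (-(1 / 2)) with c' | c'
    · exact mk (-(3 / 2)) (-(1 / 2)) ⟨c.le, c'.le⟩ (by norm_num) (by grind)
    rcases le_or_gt (κ.z y) (1 / 2) with d | d
    · exact mk (-(1 / 2)) (1 / 2) ⟨c', d⟩ (by norm_num) (by grind)
    rcases lt_or_ge (κ.z y) (3 / 2) with d' | d'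
    · exact mk (1 / 2) (3 / 2) ⟨d.le, d'.le⟩ (by norm_num) (by grind)
    · exact mk (3 / 2) 3 ⟨d', hz.2⟩ (by norm_num) (by grind)
  have h1 : sInf I ≤ s ∧ s ≤ sSup I := by rw [heq] at hs; simpa using hs
  have h2 : sInf I ≤ κ.z y ∧ κ.z y ≤ sSup I := by rw [heq] at hyI; simpa using hyI
  rcases lt_or_gt_of_ne hne with h | h <;> linarith

theorem isCoordinate_z {y : M} (hy : y ∈ κ.chart.source) (hN : y ∈ B.nbhd) :
    IsCoordinate (B.fibre y) κ.z := by
  refine ⟨fun w hw => (κ.continuousAt_z (fibre_source hy hN hw)).continuousWithinAt,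
    fun w hw w' hw' h => ?_⟩
  exact κ.ext (fibre_source hy hN hw) (fibre_source hy hN hw')
    (by rw [fibre_v hy hN hw, fibre_v hy hN hw']) h

/-- A coordinate on a fibre is an increasing or a decreasing function of the height. -/
theorem coordinate_iff {y : M} (hy : y ∈ κ.chart.source) (hN : y ∈ B.nbhd) {c : M → ℝ}
    (hc : IsCoordinate (B.fibre y) c) :
    (∀ w ∈ B.fibre y, ∀ w' ∈ B.fibre y, c w ≤ c w' ↔ κ.z w ≤ κ.z w') ∨
    (∀ w ∈ B.fibre y, ∀ w' ∈ B.fibre y, c w ≤ c w' ↔ κ.z w' ≤ κ.z w) := by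
  obtain ⟨lo, hi, hlt, -, hI⟩ := exists_Icc hy hN
  have hmap : ∀ t ∈ Icc lo hi, κ.pt (κ.v y) t ∈ B.fibre y := fun t ht => (hI t).2 ht
  have hpt : ∀ w ∈ B.fibre y, κ.pt (κ.v y) (κ.z w) = w := fun w hw => by
    rw [← fibre_v hy hN hw, κ.pt_v_z (fibre_source hy hN hw)]
  have hz : ∀ w ∈ B.fibre y, κ.z w ∈ Icc lo hi := fun w hw => by
    rw [← hI, hpt w hw]; exact hw
  have hcont : ContinuousOn (fun t => c (κ.pt (κ.v y) t)) (Icc lo hi) :=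
    hc.1.comp (κ.continuous_pt.comp (by fun_prop : Continuous fun t : ℝ => (κ.v y, t))).continuousOn
      hmap
  have hinj : InjOn (fun t => c (κ.pt (κ.v y) t)) (Icc lo hi) := by
    intro s hs t ht hst
    have := hc.2 (hmap s hs) (hmap t ht) hst
    simpa using congrArg κ.z this
  rcases hcont.strictMonoOn_of_injOn_Icc' hlt.le hinj with h | h
  · left
    intro w hw w' hw'
    have := h.le_iff_le (hz w hw) (hz w' hw')
    simpa only [hpt w hw, hpt w' hw'] using this
  · right
    intro w hw w' hw'
    have := h.le_iff_ge (hz w hw) (hz w' hw')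
    simpa only [hpt w hw, hpt w' hw'] using this

theorem mem_seg {y w x : M} (hy : y ∈ κ.chart.source) (hN : y ∈ B.nbhd) (hw : w ∈ B.fibre y) :
    x ∈ B.seg y w ↔ x ∈ B.fibre y ∧ κ.z x ∈ uIcc (κ.z y) (κ.z w) := by
  constructor
  · rintro ⟨h1, h2⟩
    exact ⟨h1, h2 _ (isCoordinate_z hy hN)⟩
  · rintro ⟨h1, h2⟩
    refine ⟨h1, fun c hc => ?_⟩
    have hyy := self_mem_fibre hN
    rw [mem_uIcc] at h2 ⊢
    rcases coordinate_iff hy hN hc with h | h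
    · rw [h y hyy x h1, h x h1 w hw, h w hw x h1, h x h1 y hyy]; exact h2
    · rw [h y hyy x h1, h x h1 w hw, h w hw x h1, h x h1 y hyy]; tauto

/-- The form of the segment lemma in which the fibre is given by a base point. -/
theorem mem_seg' {y w w' x : M} (hy : y ∈ κ.chart.source) (hN : y ∈ B.nbhd) (hw : w ∈ B.fibre y)
    (hw' : w' ∈ B.fibre y) :
    x ∈ B.seg w w' ↔ x ∈ B.fibre y ∧ κ.z x ∈ uIcc (κ.z w) (κ.z w') := by
  have e := B.fibre_eq y hN w hw
  rw [mem_seg (fibre_source hy hN hw) (fibre_subset hN hw) (e ▸ hw'), e]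

end Column

theorem left_mem_seg {y : M} (hy : y ∈ B.nbhd) (w : M) : y ∈ B.seg y w :=
  ⟨self_mem_fibre hy, fun _ _ => left_mem_uIcc⟩

theorem right_mem_seg {y w : M} (hw : w ∈ B.fibre y) : w ∈ B.seg y w :=
  ⟨hw, fun _ _ => right_mem_uIcc⟩

theorem seg_comm {y w : M} (hy : y ∈ B.nbhd) (hw : w ∈ B.fibre y) : B.seg y w = B.seg w y := by
  ext x
  simp only [seg, B.fibre_eq y hy w hw, uIcc_comm]

theorem seg_self {y : M} (hy : y ∈ B.nbhd) : B.seg y y = {y} := by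
  obtain ⟨κ, hκ, -⟩ := B.exists_column hy
  ext x
  rw [κ.mem_seg hκ hy (self_mem_fibre hy), uIcc_self, mem_singleton_iff, mem_singleton_iff]
  constructor
  · rintro ⟨h1, h2⟩
    exact (Column.isCoordinate_z hκ hy).2 h1 (self_mem_fibre hy) h2
  · rintro rfl
    exact ⟨self_mem_fibre hy, rfl⟩

/-! ### Limits of points in fibres -/

section limits
variable [T2Space M]

theorem isClosed_nbhd : IsClosed B.nbhd := B.isCompact_nbhd.isClosed

namespace Column
variable (κ : Column B)

/-- The compact box over a ball of the base. -/
def box (a : ℝ × ℝ) (r : ℝ) : Set M :=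
  (fun q : (ℝ × ℝ) × ℝ => κ.pt q.1 q.2) '' (Metric.closedBall a r ×ˢ Icc (-3) 3)

theorem mem_box {a : ℝ × ℝ} {r : ℝ} {y : M} :
    y ∈ κ.box a r ↔ y ∈ κ.chart.source ∧ κ.v y ∈ Metric.closedBall a r ∧ κ.z y ∈ Icc (-3) 3 := by
  constructor
  · rintro ⟨q, hq, rfl⟩
    simpa using hq
  · rintro ⟨h1, h2⟩
    exact ⟨(κ.v y, κ.z y), h2, κ.pt_v_z h1⟩

theorem isCompact_box (a : ℝ × ℝ) (r : ℝ) : IsCompact (κ.box a r) :=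
  ((isCompact_closedBall a r).prod isCompact_Icc).image κ.continuous_pt

theorem isClosed_box (a : ℝ × ℝ) (r : ℝ) : IsClosed (κ.box a r) := (κ.isCompact_box a r).isClosed

variable {κ}

theorem z_mem_Icc {y : M} (hy : y ∈ κ.chart.source) (hN : y ∈ B.nbhd) : κ.z y ∈ Icc (-3) 3 :=
  ⟨((κ.mem_nbhd hy).1 hN).ge, ((κ.mem_nbhd hy).1 hN).le⟩

variable {α : Type*} {l : Filter α} [l.NeBot] {y w x : α → M} {y₀ w₀ x₀ : M}

theorem mem_source_of_tendsto (hy₀ : y₀ ∈ κ.chart.source) (hy : Tendsto y l (𝓝 y₀))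
    (hN : ∀ᶠ i in l, y i ∈ B.nbhd) (hw : Tendsto w l (𝓝 w₀))
    (hyw : ∀ᶠ i in l, w i ∈ B.fibre (y i)) : w₀ ∈ κ.chart.source := by
  have h1 : ∀ᶠ i in l, w i ∈ κ.box (κ.v y₀) 1 := by
    have hv : Tendsto (fun i => κ.v (y i)) l (𝓝 (κ.v y₀)) :=
      (κ.continuousAt_v hy₀).tendsto.comp hy
    filter_upwards [hN, hyw, hy (κ.source_mem_nhds hy₀),
      hv (Metric.closedBall_mem_nhds _ one_pos)] with i h1 h2 h3 h4
    rw [mem_box, fibre_v h3 h1 h2]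
    exact ⟨fibre_source h3 h1 h2, h4, z_mem_Icc (fibre_source h3 h1 h2) (fibre_subset h1 h2)⟩
  exact ((κ.mem_box).1 ((κ.isClosed_box _ _).mem_of_tendsto hw h1)).1

end Column

variable {α : Type*} {l : Filter α} [l.NeBot] {y w x : α → M} {y₀ w₀ x₀ : M}

theorem fibre_of_tendsto (hy : Tendsto y l (𝓝 y₀))
    (hN : ∀ᶠ i in l, y i ∈ B.nbhd) (hw : Tendsto w l (𝓝 w₀))
    (hyw : ∀ᶠ i in l, w i ∈ B.fibre (y i)) : w₀ ∈ B.fibre y₀ := by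
  have hy₀N : y₀ ∈ B.nbhd := isClosed_nbhd.mem_of_tendsto hy hN
  obtain ⟨κ, hκ, -⟩ := B.exists_column hy₀N
  have hw₀ := κ.mem_source_of_tendsto hκ hy hN hw hyw
  have hv : Tendsto (fun i => κ.v (y i)) l (𝓝 (κ.v y₀)) := (κ.continuousAt_v hκ).tendsto.comp hy
  have hvw : Tendsto (fun i => κ.v (w i)) l (𝓝 (κ.v w₀)) := (κ.continuousAt_v hw₀).tendsto.comp hw
  have hz : Tendsto (fun i => κ.z (y i)) l (𝓝 (κ.z y₀)) := (κ.continuousAt_z hκ).tendsto.comp hy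
  have hzw : Tendsto (fun i => κ.z (w i)) l (𝓝 (κ.z w₀)) := (κ.continuousAt_z hw₀).tendsto.comp hw
  have hev : ∀ᶠ i in l, y i ∈ B.nbhd ∧ y i ∈ κ.chart.source ∧ w i ∈ B.fibre (y i) := by
    filter_upwards [hN, hy (κ.source_mem_nhds hκ), hyw] with i h1 h2 h3 using ⟨h1, h2, h3⟩
  rw [κ.mem_fibre hκ hy₀N]
  refine ⟨hw₀, tendsto_nhds_unique hvw (hv.congr' ?_), fun t ht => ?_⟩
  · filter_upwards [hev] with i h using (κ.fibre_v h.2.1 h.1 h.2.2).symm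
  · rw [← segment_eq_uIcc] at ht
    obtain ⟨a, b, ha, hb, hab, rfl⟩ := ht
    refine κ.isClosed_S.mem_of_tendsto
      (hv.prodMk_nhds ((hz.const_smul a).add (hzw.const_smul b))) ?_
    filter_upwards [hev] with i h
    refine ((κ.mem_fibre h.2.1 h.1).1 h.2.2).2.2 _ ?_
    rw [← segment_eq_uIcc]
    exact ⟨a, b, ha, hb, hab, rfl⟩

theorem seg_of_tendsto (hy : Tendsto y l (𝓝 y₀))
    (hN : ∀ᶠ i in l, y i ∈ B.nbhd) (hw : Tendsto w l (𝓝 w₀))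
    (hyw : ∀ᶠ i in l, w i ∈ B.fibre (y i)) (hx : Tendsto x l (𝓝 x₀))
    (hxs : ∀ᶠ i in l, x i ∈ B.seg (y i) (w i)) : x₀ ∈ B.seg y₀ w₀ := by
  have hy₀N : y₀ ∈ B.nbhd := isClosed_nbhd.mem_of_tendsto hy hN
  obtain ⟨κ, hκ, -⟩ := B.exists_column hy₀N
  have hw₀ := fibre_of_tendsto hy hN hw hyw
  have hx₀ := fibre_of_tendsto hy hN hx (hxs.mono fun i h => h.1)
  have hz : Tendsto (fun i => κ.z (y i)) l (𝓝 (κ.z y₀)) := (κ.continuousAt_z hκ).tendsto.comp hy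
  have hzw : Tendsto (fun i => κ.z (w i)) l (𝓝 (κ.z w₀)) :=
    (κ.continuousAt_z (κ.fibre_source hκ hy₀N hw₀)).tendsto.comp hw
  have hzx : Tendsto (fun i => κ.z (x i)) l (𝓝 (κ.z x₀)) :=
    (κ.continuousAt_z (κ.fibre_source hκ hy₀N hx₀)).tendsto.comp hx
  rw [κ.mem_seg hκ hy₀N hw₀]
  have hev : ∀ᶠ i in l, κ.z (x i) ∈ uIcc (κ.z (y i)) (κ.z (w i)) := by
    filter_upwards [hN, hy (κ.source_mem_nhds hκ), hyw, hxs] with i h1 h2 h3 h4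
    exact ((κ.mem_seg h2 h1 h3).1 h4).2
  exact ⟨hx₀, le_of_tendsto_of_tendsto (hz.min hzw) hzx (hev.mono fun i h => h.1),
    le_of_tendsto_of_tendsto hzx (hz.max hzw) (hev.mono fun i h => h.2)⟩

/-- A point strictly inside a segment stays strictly inside nearby segments. -/
theorem eventually_mem_seg (hy : Tendsto y l (𝓝 y₀)) (hy₀ : y₀ ∈ B.nbhd)
    (hN : ∀ᶠ i in l, y i ∈ B.nbhd) (hw : Tendsto w l (𝓝 w₀)) (hw₀ : w₀ ∈ B.fibre y₀)
    (hyw : ∀ᶠ i in l, w i ∈ B.fibre (y i)) (hx₀ : x₀ ∈ B.seg y₀ w₀) (h1 : x₀ ≠ y₀) (h2 : x₀ ≠ w₀)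
    (hx : Tendsto x l (𝓝 x₀)) (hxs : ∀ᶠ i in l, x i ∈ B.fibre (y i)) :
    ∀ᶠ i in l, x i ∈ B.seg (y i) (w i) ∧ x i ≠ y i ∧ x i ≠ w i := by
  obtain ⟨κ, hκ, -⟩ := B.exists_column hy₀
  have hws := κ.fibre_source hκ hy₀ hw₀
  have hxs' := κ.fibre_source hκ hy₀ hx₀.1
  have hz : Tendsto (fun i => κ.z (y i)) l (𝓝 (κ.z y₀)) := (κ.continuousAt_z hκ).tendsto.comp hy
  have hzw : Tendsto (fun i => κ.z (w i)) l (𝓝 (κ.z w₀)) := (κ.continuousAt_z hws).tendsto.comp hw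
  have hzx : Tendsto (fun i => κ.z (x i)) l (𝓝 (κ.z x₀)) := (κ.continuousAt_z hxs').tendsto.comp hx
  have hm := ((κ.mem_seg hκ hy₀ hw₀).1 hx₀).2
  have n1 : κ.z x₀ ≠ κ.z y₀ := fun h =>
    h1 ((κ.isCoordinate_z hκ hy₀).2 hx₀.1 (self_mem_fibre hy₀) h)
  have n2 : κ.z x₀ ≠ κ.z w₀ := fun h => h2 ((κ.isCoordinate_z hκ hy₀).2 hx₀.1 hw₀ h)
  have hev : ∀ᶠ i in l, (κ.z (y i) < κ.z (x i) ∧ κ.z (x i) < κ.z (w i)) ∨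
      (κ.z (w i) < κ.z (x i) ∧ κ.z (x i) < κ.z (y i)) := by
    rw [mem_uIcc] at hm
    rcases hm with hm | hm
    · filter_upwards [hz.eventually_lt hzx (lt_of_le_of_ne hm.1 n1.symm),
        hzx.eventually_lt hzw (lt_of_le_of_ne hm.2 n2)] with i a b using Or.inl ⟨a, b⟩
    · filter_upwards [hzw.eventually_lt hzx (lt_of_le_of_ne hm.1 n2.symm),
        hzx.eventually_lt hz (lt_of_le_of_ne hm.2 n1)] with i a b using Or.inr ⟨a, b⟩
  filter_upwards [hev, hN, hy (κ.source_mem_nhds hκ), hyw, hxs] with i k1 k2 k3 k4 k5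
  refine ⟨(κ.mem_seg k3 k2 k4).2 ⟨k5, ?_⟩, ?_, ?_⟩
  · rw [mem_uIcc]; rcases k1 with k | k
    · exact Or.inl ⟨k.1.le, k.2.le⟩
    · exact Or.inr ⟨k.1.le, k.2.le⟩
  · rintro e; rw [e] at k1; rcases k1 with k | k <;> linarith
  · rintro e; rw [e] at k1; rcases k1 with k | k <;> linarith

/-- A point strictly inside a segment is a limit of points of nearby segments. -/
theorem exists_tendsto_seg (hy : Tendsto y l (𝓝 y₀)) (hy₀ : y₀ ∈ B.nbhd)
    (hN : ∀ᶠ i in l, y i ∈ B.nbhd) (hw : Tendsto w l (𝓝 w₀)) (hw₀ : w₀ ∈ B.fibre y₀)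
    (hyw : ∀ᶠ i in l, w i ∈ B.fibre (y i)) (hx₀ : x₀ ∈ B.seg y₀ w₀) (h1 : x₀ ≠ y₀)
    (h2 : x₀ ≠ w₀) :
    ∃ x : α → M, Tendsto x l (𝓝 x₀) ∧ ∀ᶠ i in l, x i ∈ B.seg (y i) (w i) := by
  obtain ⟨κ, hκ, -⟩ := B.exists_column hy₀
  have hws := κ.fibre_source hκ hy₀ hw₀
  have hxs' := κ.fibre_source hκ hy₀ hx₀.1
  have hz : Tendsto (fun i => κ.z (y i)) l (𝓝 (κ.z y₀)) := (κ.continuousAt_z hκ).tendsto.comp hy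
  have hv : Tendsto (fun i => κ.v (y i)) l (𝓝 (κ.v y₀)) := (κ.continuousAt_v hκ).tendsto.comp hy
  have hzw : Tendsto (fun i => κ.z (w i)) l (𝓝 (κ.z w₀)) := (κ.continuousAt_z hws).tendsto.comp hw
  have hm := ((κ.mem_seg hκ hy₀ hw₀).1 hx₀).2
  have n1 : κ.z x₀ ≠ κ.z y₀ := fun h =>
    h1 ((κ.isCoordinate_z hκ hy₀).2 hx₀.1 (self_mem_fibre hy₀) h)
  have n2 : κ.z x₀ ≠ κ.z w₀ := fun h => h2 ((κ.isCoordinate_z hκ hy₀).2 hx₀.1 hw₀ h)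
  have hev : ∀ᶠ i in l, κ.z x₀ ∈ uIcc (κ.z (y i)) (κ.z (w i)) := by
    rw [mem_uIcc] at hm
    rcases hm with hm | hm
    · filter_upwards [hz.eventually_lt_const (lt_of_le_of_ne hm.1 n1.symm),
        hzw.eventually_const_lt (lt_of_le_of_ne hm.2 n2)] with i a b
      exact mem_uIcc.2 (Or.inl ⟨a.le, b.le⟩)
    · filter_upwards [hzw.eventually_lt_const (lt_of_le_of_ne hm.1 n2.symm),
        hz.eventually_const_lt (lt_of_le_of_ne hm.2 n1)] with i a b
      exact mem_uIcc.2 (Or.inr ⟨a.le, b.le⟩)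
  refine ⟨fun i => κ.pt (κ.v (y i)) (κ.z x₀), ?_, ?_⟩
  · have := (κ.continuous_pt.tendsto (κ.v y₀, κ.z x₀)).comp
      (hv.prodMk_nhds (tendsto_const_nhds (x := κ.z x₀)))
    simp only [← κ.fibre_v hκ hy₀ hx₀.1, κ.pt_v_z hxs'] at this
    exact this
  · filter_upwards [hev, hN, hy (κ.source_mem_nhds hκ), hyw] with i k1 k2 k3 k4
    have := κ.fibre_uIcc k3 k2 (self_mem_fibre k2) k4 k1
    exact (κ.mem_seg k3 k2 k4).2 ⟨this, by rwa [κ.z_pt]⟩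

end limits

/-! ### The vertical boundary in a column -/

theorem SlotMode.eventually_not_active {m : SlotMode} {t : ℝ} (h : ¬ m.Active t)
    (h' : ¬ (m = .branch ∧ t = 0)) : ∀ᶠ s in 𝓝 t, ¬ m.Active s := by
  cases m
  · exact Eventually.of_forall fun s => id
  · exact absurd trivial h
  · have : t < 0 := lt_of_le_of_ne (not_lt.1 h) fun e => h' ⟨rfl, e⟩
    filter_upwards [gt_mem_nhds this] with s hs using not_lt.2 hs.le

namespace Column
variable (κ : Column B)

/-- The closed arcs of the vertical boundary. -/
def Arc (a : ℝ × ℝ) (t : ℝ) : Prop :=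
  (κ.m = .branch ∧ a.1 = 0 ∧ t ∈ Icc (1 / 2) (3 / 2)) ∨
  (κ.n = .branch ∧ a.2 = 0 ∧ t ∈ Icc (-(3 / 2)) (-(1 / 2)))

/-- The open arcs of the vertical boundary. -/
def OpenArc (a : ℝ × ℝ) (t : ℝ) : Prop :=
  (κ.m = .branch ∧ a.1 = 0 ∧ t ∈ Ioo (1 / 2) (3 / 2)) ∨
  (κ.n = .branch ∧ a.2 = 0 ∧ t ∈ Ioo (-(3 / 2)) (-(1 / 2)))

theorem flip_source {y : M} : y ∈ κ.flip.chart.source ↔ y ∈ κ.chart.source := by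
  simp [flip, mem_reparam_source]

theorem flip_apply {y : M} (hy : y ∈ κ.chart.source) :
    κ.v y = (κ.flip.v y).swap ∧ κ.z y = - κ.flip.z y := by
  have h := apply_eq_reparam (he := (Homeomorph.prodComm ℝ ℝ).isOpenEmbedding)
    (κ.flip_source.2 hy)
  exact ⟨congrArg Prod.fst h, congrArg Prod.snd h⟩

theorem flip_v {y : M} (hy : y ∈ κ.chart.source) : κ.flip.v y = (κ.v y).swap := by
  rw [(κ.flip_apply hy).1, Prod.swap_swap]

theorem flip_z {y : M} (hy : y ∈ κ.chart.source) : κ.flip.z y = - κ.z y := by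
  rw [(κ.flip_apply hy).2, neg_neg]

theorem flip_pt (a : ℝ × ℝ) (t : ℝ) : κ.flip.pt a t = κ.pt a.swap (-t) := by
  have h : κ.flip.pt a t ∈ κ.chart.source := κ.flip_source.1 (κ.flip.pt_mem a t)
  refine κ.ext h (κ.pt_mem _ _) ?_ ?_
  · rw [(κ.flip_apply h).1, κ.flip.v_pt, κ.v_pt]
  · rw [(κ.flip_apply h).2, κ.flip.z_pt, κ.z_pt]

variable {κ}

theorem OpenArc.arc {a : ℝ × ℝ} {t : ℝ} (h : κ.OpenArc a t) : κ.Arc a t :=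
  h.imp (fun h => ⟨h.1, h.2.1, Ioo_subset_Icc_self h.2.2⟩)
    (fun h => ⟨h.1, h.2.1, Ioo_subset_Icc_self h.2.2⟩)

/-- Off the open arcs, the slab continues horizontally. -/
theorem S.eventually {a : ℝ × ℝ} {t : ℝ} (h : κ.S a t) (h' : ¬ κ.OpenArc a t) :
    ∀ᶠ b in 𝓝 a, κ.S b t := by
  obtain ⟨h0, h1, h2⟩ := h
  simp only at h0 h1 h2
  have k1 : ∀ᶠ b : ℝ × ℝ in 𝓝 a, ¬ (κ.m.Active b.1 ∧ 1 / 2 < t ∧ t < 3 / 2) := by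
    by_cases ht : 1 / 2 < t ∧ t < 3 / 2
    · have := SlotMode.eventually_not_active (fun h => h1 ⟨h, ht⟩)
        (fun h => h' (Or.inl ⟨h.1, h.2, ht⟩))
      filter_upwards [continuous_fst.continuousAt.eventually this] with b hb h using hb h.1
    · exact Eventually.of_forall fun b h => ht h.2
  have k2 : ∀ᶠ b : ℝ × ℝ in 𝓝 a, ¬ (κ.n.Active b.2 ∧ -(3 / 2) < t ∧ t < -(1 / 2)) := by
    by_cases ht : -(3 / 2) < t ∧ t < -(1 / 2)
    · have := SlotMode.eventually_not_active (fun h => h2 ⟨h, ht⟩)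
        (fun h => h' (Or.inr ⟨h.1, h.2, ht⟩))
      filter_upwards [continuous_snd.continuousAt.eventually this] with b hb h using hb h.1
    · exact Eventually.of_forall fun b h => ht h.2
  filter_upwards [k1, k2] with b c1 c2 using ⟨h0, c1, c2⟩

/-- A point strictly inside a fibre and off the arcs is an interior point of the slab. -/
theorem S_mem_nhds {a : ℝ × ℝ} {s t r : ℝ} (hs : s < t) (hr : t < r)
    (h : ∀ x ∈ Icc s r, κ.S a x) (h' : ¬ κ.Arc a t) :
    ∀ᶠ q : (ℝ × ℝ) × ℝ in 𝓝 (a, t), κ.S q.1 q.2 := by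
  have h0 : -3 < t ∧ t < 3 := ⟨(h s ⟨le_rfl, by linarith⟩).ge.trans_lt hs,
    hr.trans_le (h r ⟨by linarith, le_rfl⟩).le⟩
  have k0 : ∀ᶠ q : (ℝ × ℝ) × ℝ in 𝓝 (a, t), |q.2| ≤ 3 := by
    filter_upwards [continuous_snd.continuousAt.eventually (Ioo_mem_nhds h0.1 h0.2)] with q hq
    exact abs_le.2 ⟨hq.1.le, hq.2.le⟩
  have hbet : ∀ {l u : ℝ}, t ∈ Icc l u → l < u → ∃ x ∈ Icc s r, x ∈ Ioo l u := fun ht hlu => by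
    obtain ⟨x, h1, h2⟩ := exists_between (max_lt (lt_min (hs.trans hr) (hs.trans_le ht.2))
      (lt_min (ht.1.trans_lt hr) hlu))
    rw [max_lt_iff] at h1
    rw [lt_min_iff] at h2
    exact ⟨x, ⟨h1.1.le, h2.1.le⟩, h1.2, h2.2⟩
  have k1 : ∀ᶠ q : (ℝ × ℝ) × ℝ in 𝓝 (a, t), ¬ (κ.m.Active q.1.1 ∧ 1 / 2 < q.2 ∧ q.2 < 3 / 2) := by
    by_cases ht : t ∈ Icc (1 / 2 : ℝ) (3 / 2)
    · have hn : ¬ κ.m.Active a.1 := fun hact => by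
        obtain ⟨x, h1, h2⟩ := hbet ht (by norm_num)
        exact (h x h1).2.1 ⟨hact, h2⟩
      have := SlotMode.eventually_not_active hn (fun e => h' (Or.inl ⟨e.1, e.2, ht⟩))
      have c : Continuous fun q : (ℝ × ℝ) × ℝ => q.1.1 := by fun_prop
      filter_upwards [c.continuousAt.eventually this] with q hq hh using hq hh.1
    · have : ∀ᶠ q : (ℝ × ℝ) × ℝ in 𝓝 (a, t), q.2 ∈ (Icc (1 / 2 : ℝ) (3 / 2))ᶜ :=
        continuous_snd.continuousAt.eventually (isClosed_Icc.isOpen_compl.mem_nhds ht)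
      filter_upwards [this] with q hq hh using hq ⟨hh.2.1.le, hh.2.2.le⟩
  have k2 : ∀ᶠ q : (ℝ × ℝ) × ℝ in 𝓝 (a, t),
      ¬ (κ.n.Active q.1.2 ∧ -(3 / 2) < q.2 ∧ q.2 < -(1 / 2)) := by
    by_cases ht : t ∈ Icc (-(3 / 2) : ℝ) (-(1 / 2))
    · have hn : ¬ κ.n.Active a.2 := fun hact => by
        obtain ⟨x, h1, h2⟩ := hbet ht (by norm_num)
        exact (h x h1).2.2 ⟨hact, h2⟩
      have := SlotMode.eventually_not_active hn (fun e => h' (Or.inr ⟨e.1, e.2, ht⟩))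
      have c : Continuous fun q : (ℝ × ℝ) × ℝ => q.1.2 := by fun_prop
      filter_upwards [c.continuousAt.eventually this] with q hq hh using hq hh.1
    · have : ∀ᶠ q : (ℝ × ℝ) × ℝ in 𝓝 (a, t), q.2 ∈ (Icc (-(3 / 2) : ℝ) (-(1 / 2)))ᶜ :=
        continuous_snd.continuousAt.eventually (isClosed_Icc.isOpen_compl.mem_nhds ht)
      filter_upwards [this] with q hq hh using hq ⟨hh.2.1.le, hh.2.2.le⟩
  filter_upwards [k0, k1, k2] with q c0 c1 c2 using ⟨c0, c1, c2⟩

/-- Around a point of an arc the fibre contains a definite segment. -/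
theorem Arc.exists_segment {a : ℝ × ℝ} {t : ℝ} (h : κ.Arc a t) :
    ∃ s r, s < t ∧ t < r ∧ ∀ x ∈ Icc s r, κ.S a x := by
  rcases h with ⟨h1, h2, h3⟩ | ⟨h1, h2, h3⟩
  · refine ⟨0, 2, by linarith [h3.1], by linarith [h3.2], fun x hx => ⟨?_, ?_, ?_⟩⟩
    · exact abs_le.2 ⟨by simp only; linarith [hx.1], by simp only; linarith [hx.2]⟩
    · rintro ⟨h, -⟩; simp [h1, SlotMode.Active, h2] at h
    · rintro ⟨-, -, h⟩; simp only at h; linarith [hx.1]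
  · refine ⟨-2, 0, by linarith [h3.1], by linarith [h3.2], fun x hx => ⟨?_, ?_, ?_⟩⟩
    · exact abs_le.2 ⟨by simp only; linarith [hx.1], by simp only; linarith [hx.2]⟩
    · rintro ⟨-, h, -⟩; simp only at h; linarith [hx.2]
    · rintro ⟨h, -⟩; simp [h1, SlotMode.Active, h2] at h

theorem Arc.S {a : ℝ × ℝ} {t : ℝ} (h : κ.Arc a t) : κ.S a t := by
  obtain ⟨s, r, h1, h2, h3⟩ := h.exists_segment
  exact h3 t ⟨h1.le, h2.le⟩

theorem Arc.not_mem_nhds {a : ℝ × ℝ} {t : ℝ} (h : κ.Arc a t) :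
    ¬ ∀ᶠ q : (ℝ × ℝ) × ℝ in 𝓝 (a, t), κ.S q.1 q.2 := by
  intro hev
  rcases h with ⟨h1, h2, h3⟩ | ⟨h1, h2, h3⟩
  · have c : Tendsto (fun ε : ℝ => (((ε, a.2), t + ε * (1 - t)) : (ℝ × ℝ) × ℝ)) (𝓝[>] 0)
        (𝓝 (a, t)) := by
      have : Continuous fun ε : ℝ => (((ε, a.2), t + ε * (1 - t)) : (ℝ × ℝ) × ℝ) := by fun_prop
      have := this.tendsto 0
      rw [show (((0, a.2), t + 0 * (1 - t)) : (ℝ × ℝ) × ℝ) = (a, t) by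
        ext <;> simp [h2]] at this
      exact this.mono_left nhdsWithin_le_nhds
    have := (c.eventually hev).and (Ioo_mem_nhdsGT (zero_lt_one (α := ℝ)))
    obtain ⟨ε, hε, hε0⟩ := this.exists
    refine hε.2.1 ⟨?_, ?_, ?_⟩
    · rw [h1]; exact hε0.1
    · simp only; nlinarith [h3.1, h3.2, hε0.1, hε0.2]
    · simp only; nlinarith [h3.1, h3.2, hε0.1, hε0.2]
  · have c : Tendsto (fun ε : ℝ => (((a.1, ε), t + ε * (-1 - t)) : (ℝ × ℝ) × ℝ)) (𝓝[>] 0)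
        (𝓝 (a, t)) := by
      have : Continuous fun ε : ℝ => (((a.1, ε), t + ε * (-1 - t)) : (ℝ × ℝ) × ℝ) := by fun_prop
      have := this.tendsto 0
      rw [show (((a.1, 0), t + 0 * (-1 - t)) : (ℝ × ℝ) × ℝ) = (a, t) by
        ext <;> simp [h2]] at this
      exact this.mono_left nhdsWithin_le_nhds
    have := (c.eventually hev).and (Ioo_mem_nhdsGT (zero_lt_one (α := ℝ)))
    obtain ⟨ε, hε, hε0⟩ := this.exists
    refine hε.2.2 ⟨?_, ?_, ?_⟩
    · rw [h1]; exact hε0.1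
    · simp only; nlinarith [h3.1, h3.2, hε0.1, hε0.2]
    · simp only; nlinarith [h3.1, h3.2, hε0.1, hε0.2]

theorem nbhd_mem_nhds_iff {y : M} (hy : y ∈ κ.chart.source) :
    B.nbhd ∈ 𝓝 y ↔ ∀ᶠ q : (ℝ × ℝ) × ℝ in 𝓝 (κ.v y, κ.z y), κ.S q.1 q.2 := by
  constructor
  · intro h
    have := (κ.continuous_pt.tendsto (κ.v y, κ.z y))
    simp only [κ.pt_v_z hy] at this
    filter_upwards [this h] with q hq using (κ.pt_mem_nbhd _ _).1 hq
  · intro h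
    have := ((κ.continuousAt_v hy).prodMk (κ.continuousAt_z hy)).eventually h
    filter_upwards [this, κ.source_mem_nhds hy] with w h1 h2 using (κ.mem_nbhd h2).2 h1

theorem mem_vertBoundary [T2Space M] {y : M} (hy : y ∈ κ.chart.source) :
    y ∈ B.vertBoundary ↔ κ.Arc (κ.v y) (κ.z y) := by
  have hfr : y ∈ frontier B.nbhd ↔ y ∈ B.nbhd ∧ ¬ B.nbhd ∈ 𝓝 y := by
    rw [isClosed_nbhd.frontier_eq, Set.mem_sdiff, mem_interior_iff_mem_nhds]
  constructor
  · rintro ⟨hN, h1, h2⟩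
    by_contra hA
    obtain ⟨lo, hi, -, hz, hI⟩ := κ.exists_Icc hy hN
    have hinj : ∀ w ∈ B.fibre y, κ.pt (κ.v y) (κ.z w) = w := fun w hw => by
      rw [← κ.fibre_v hy hN hw, κ.pt_v_z (κ.fibre_source hy hN hw)]
    have hc : Continuous fun t => κ.pt (κ.v y) t :=
      κ.continuous_pt.comp (by fun_prop : Continuous fun t : ℝ => (κ.v y, t))
    have himage : ∀ I : Set ℝ, Icc lo hi \ {κ.z y} = I →
        B.fibre y \ {y} = (fun t => κ.pt (κ.v y) t) '' I := by
      rintro I rfl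
      ext w
      constructor
      · rintro ⟨hw, hne⟩
        refine ⟨κ.z w, ⟨(hI _).1 (by rwa [hinj w hw]), fun e => hne ?_⟩, hinj w hw⟩
        exact (κ.isCoordinate_z hy hN).2 hw (self_mem_fibre hN) e
      · rintro ⟨t, ⟨ht, hne⟩, rfl⟩
        refine ⟨(hI t).2 ht, fun e => hne ?_⟩
        rw [mem_singleton_iff] at e ⊢
        rw [← e, κ.z_pt]
    have hlo : lo < κ.z y := by
      refine lt_of_le_of_ne hz.1 fun e => h2 ?_
      rw [himage (Ioc lo hi) (by rw [← e, Icc_sdiff_left])]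
      exact isPreconnected_Ioc.image _ hc.continuousOn
    have hhi : κ.z y < hi := by
      refine lt_of_le_of_ne hz.2 fun e => h2 ?_
      rw [himage (Ico lo hi) (by rw [e, Icc_sdiff_right])]
      exact isPreconnected_Ico.image _ hc.continuousOn
    refine (hfr.1 h1).2 ((nbhd_mem_nhds_iff hy).2 (S_mem_nhds hlo hhi (fun x hx => ?_) hA))
    exact (κ.pt_mem_nbhd _ _).1 (fibre_subset hN ((hI x).2 hx))
  · intro hA
    have hN : y ∈ B.nbhd := (κ.mem_nbhd hy).2 hA.S
    refine ⟨hN, hfr.2 ⟨hN, fun h => hA.not_mem_nhds ((nbhd_mem_nhds_iff hy).1 h)⟩, fun hp => ?_⟩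
    obtain ⟨s, r, h1, h2, h3⟩ := hA.exists_segment
    have mem : ∀ x ∈ Icc s r, κ.pt (κ.v y) x ∈ B.fibre y := by
      intro x hx
      have := κ.pt_mem_fibre (t := x) hA.S
      rw [κ.pt_v_z hy] at this
      refine this.2 fun t ht => h3 t ?_
      rw [mem_uIcc] at ht
      rcases ht with ht | ht
      · exact ⟨h1.le.trans ht.1, ht.2.trans hx.2⟩
      · exact ⟨hx.1.trans ht.1, ht.2.trans h2.le⟩
    have him := (hp.image κ.z ((κ.isCoordinate_z hy hN).1.mono sdiff_subset)).ordConnected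
    have ne : ∀ x, x ≠ κ.z y → κ.pt (κ.v y) x ≠ y := fun x hx e => hx (by rw [← e, κ.z_pt])
    have a1 : s ∈ κ.z '' (B.fibre y \ {y}) :=
      ⟨_, ⟨mem s ⟨le_rfl, by linarith⟩, ne s h1.ne⟩, κ.z_pt _ _⟩
    have a2 : r ∈ κ.z '' (B.fibre y \ {y}) :=
      ⟨_, ⟨mem r ⟨by linarith, le_rfl⟩, ne r h2.ne'⟩, κ.z_pt _ _⟩
    obtain ⟨w, ⟨hw, hne⟩, e⟩ := him.out a1 a2 ⟨h1.le, h2.le⟩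
    exact hne ((κ.isCoordinate_z hy hN).2 hw (self_mem_fibre hN) e)

theorem mem_vertInterior [T2Space M] {y : M} (hy : y ∈ κ.chart.source) :
    y ∈ B.vertInterior ↔ κ.OpenArc (κ.v y) (κ.z y) := by
  have key : κ.Arc (κ.v y) (κ.z y) → (B.vertBoundary ∈ 𝓝[B.fibre y] y ↔
      ∀ᶠ t in 𝓝 (κ.z y), κ.Arc (κ.v y) t) := by
    intro hA
    have hN : y ∈ B.nbhd := (κ.mem_nbhd hy).2 hA.S
    obtain ⟨s, r, h1, h2, h3⟩ := hA.exists_segment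
    constructor
    · intro h
      have hc : Continuous fun t => κ.pt (κ.v y) t :=
        κ.continuous_pt.comp (by fun_prop : Continuous fun t : ℝ => (κ.v y, t))
      have hlim : Tendsto (fun t => κ.pt (κ.v y) t) (𝓝 (κ.z y)) (𝓝[B.fibre y] y) := by
        refine tendsto_nhdsWithin_iff.2 ⟨?_, ?_⟩
        · have := hc.tendsto (κ.z y)
          rwa [κ.pt_v_z hy] at this
        · filter_upwards [Ioo_mem_nhds h1 h2] with x hx
          have := κ.pt_mem_fibre (t := x) hA.S
          rw [κ.pt_v_z hy] at this
          refine this.2 fun t ht => h3 t ?_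
          rw [mem_uIcc] at ht
          rcases ht with ht | ht
          · exact ⟨h1.le.trans ht.1, ht.2.trans hx.2.le⟩
          · exact ⟨hx.1.le.trans ht.1, ht.2.trans h2.le⟩
      filter_upwards [hlim h] with t ht
      have := (mem_vertBoundary (κ.pt_mem _ _)).1 ht
      rwa [κ.v_pt, κ.z_pt] at this
    · intro h
      have : ∀ᶠ w in 𝓝[B.fibre y] y, κ.Arc (κ.v y) (κ.z w) :=
        ((κ.continuousAt_z hy).eventually h).filter_mono nhdsWithin_le_nhds
      filter_upwards [this, self_mem_nhdsWithin] with w hw hwf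
      rw [mem_vertBoundary (κ.fibre_source hy hN hwf), κ.fibre_v hy hN hwf]
      exact hw
  constructor
  · rintro ⟨h1, h2⟩
    have hA := (mem_vertBoundary hy).1 h1
    have hev := (key hA).1 h2
    obtain ⟨t, t3, t2, t1⟩ := ((hev.filter_mono nhdsWithin_le_nhds).and
      (Ioo_mem_nhdsLT (show κ.z y - 1 / 4 < κ.z y by linarith))).exists
    obtain ⟨s, s3, s1, s2⟩ := ((hev.filter_mono nhdsWithin_le_nhds).and
      (Ioo_mem_nhdsGT (show κ.z y < κ.z y + 1 / 4 by linarith))).exists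
    rcases hA with ⟨a1, a2, a3⟩ | ⟨a1, a2, a3⟩
    · refine Or.inl ⟨a1, a2, ?_, ?_⟩
      · rcases t3 with h | h
        · exact h.2.2.1.trans_lt t1
        · linarith [h.2.2.2, a3.1]
      · rcases s3 with h | h
        · exact s1.trans_le h.2.2.2
        · linarith [h.2.2.2, a3.1]
    · refine Or.inr ⟨a1, a2, ?_, ?_⟩
      · rcases t3 with h | h
        · linarith [h.2.2.1, a3.2]
        · exact h.2.2.1.trans_lt t1
      · rcases s3 with h | h
        · linarith [h.2.2.1, a3.2]
        · exact s1.trans_le h.2.2.2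
  · intro h
    refine ⟨(mem_vertBoundary hy).2 h.arc, (key h.arc).2 ?_⟩
    rcases h with ⟨h1, h2, h3⟩ | ⟨h1, h2, h3⟩
    · filter_upwards [Ioo_mem_nhds h3.1 h3.2] with t ht
      exact Or.inl ⟨h1, h2, Ioo_subset_Icc_self ht⟩
    · filter_upwards [Ioo_mem_nhds h3.1 h3.2] with t ht
      exact Or.inr ⟨h1, h2, Ioo_subset_Icc_self ht⟩

end Column

end BranchedSurface

/-! ### Limits tested on ultrafilters -/

theorem IsCompact.tendsto_of_ultrafilter {α X : Type*} [TopologicalSpace X] {K : Set X}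
    (hK : IsCompact K) {f : α → X} {l : Filter α} {x : X} (hf : ∀ᶠ a in l, f a ∈ K)
    (h : ∀ U : Ultrafilter α, (U : Filter α) ≤ l → ∀ y, Tendsto f U (𝓝 y) → y = x) :
    Tendsto f l (𝓝 x) := by
  rw [tendsto_iff_ultrafilter]
  intro U hU
  obtain ⟨y, -, hy⟩ := hK.ultrafilter_le_nhds (U.map f)
    (le_principal_iff.2 (hU hf))
  have : Tendsto f U (𝓝 y) := hy
  rwa [← h U hU y this]

/-- A fibred map that is strictly increasing and surjective on each line is a homeomorphism. -/
noncomputable def fibredHomeomorph {X : Type*} [TopologicalSpace X] (F : X → ℝ → ℝ)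
    (hF : Continuous fun q : X × ℝ => F q.1 q.2) (hm : ∀ x, StrictMono (F x))
    (hs : ∀ x, Function.Surjective (F x)) : X × ℝ ≃ₜ X × ℝ where
  toFun q := (q.1, F q.1 q.2)
  invFun q := (q.1, (hs q.1 q.2).choose)
  left_inv q := Prod.ext rfl ((hm q.1).injective (hs q.1 (F q.1 q.2)).choose_spec)
  right_inv q := Prod.ext rfl (hs q.1 q.2).choose_spec
  continuous_toFun := continuous_fst.prodMk hF
  continuous_invFun := by
    refine continuous_fst.prodMk (continuous_iff_continuousAt.2 fun q => ?_)
    have hc : F q.1 (hs q.1 q.2).choose = q.2 := (hs q.1 q.2).choose_spec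
    refine tendsto_order.2 ⟨fun t ht => ?_, fun t ht => ?_⟩
    · have h1 : F q.1 t < q.2 := by rw [← hc]; exact hm q.1 ht
      have h2 : Continuous fun q : X × ℝ => F q.1 t := hF.comp (continuous_fst.prodMk continuous_const)
      filter_upwards [(h2.tendsto q).eventually_lt (continuous_snd.tendsto q) h1] with q' hq'
      rwa [← (hm q'.1).lt_iff_lt, (hs q'.1 q'.2).choose_spec]
    · have h1 : q.2 < F q.1 t := by rw [← hc]; exact hm q.1 ht
      have h2 : Continuous fun q : X × ℝ => F q.1 t := hF.comp (continuous_fst.prodMk continuous_const)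
      filter_upwards [(continuous_snd.tendsto q).eventually_lt (h2.tendsto q) h1] with q' hq'
      rwa [← (hm q'.1).lt_iff_lt, (hs q'.1 q'.2).choose_spec]

theorem surjective_of_eq_of_large {f : ℝ → ℝ} (hf : Continuous f) {C : ℝ}
    (h : ∀ t, |f t - t| ≤ C) : Function.Surjective f := by
  refine hf.surjective ?_ ?_
  · refine tendsto_atTop_mono (fun t => ?_) (tendsto_atTop_add_const_right _ (-C) tendsto_id)
    have := (abs_le.1 (h t)).1; simp only [id]; linarith
  · refine tendsto_atBot_mono (fun t => ?_) (tendsto_atBot_add_const_right _ C tendsto_id)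
    have := (abs_le.1 (h t)).2; simp only [id]; linarith

/-- A reparametrization of the line that moves `P` to `1`, supported in `[1/2, 3/2]`. -/
noncomputable def moveToOne (P t : ℝ) : ℝ :=
  min t (1 / 2) + (max (1 / 2) (min t P) - 1 / 2) / (2 * P - 1) +
    (max P (min t (3 / 2)) - P) / (3 - 2 * P) + (max t (3 / 2) - 3 / 2)

section moveToOne
variable {P : ℝ} (hP : P ∈ Ioo (1 / 2 : ℝ) (3 / 2))
include hP

theorem moveToOne_of_le {t : ℝ} (ht : t ≤ 1 / 2) : moveToOne P t = t := by
  have h1 := hP.1; have h2 := hP.2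
  unfold moveToOne
  rw [min_eq_left ht, min_eq_left (by linarith), max_eq_left ht, min_eq_left (by linarith),
    max_eq_left (by linarith), max_eq_right (by linarith)]
  ring

theorem moveToOne_of_ge {t : ℝ} (ht : 3 / 2 ≤ t) : moveToOne P t = t := by
  have h1 := hP.1; have h2 := hP.2
  unfold moveToOne
  rw [min_eq_right (by linarith : 1 / 2 ≤ t), min_eq_right (by linarith : P ≤ t),
    max_eq_right (by linarith : 1 / 2 ≤ P), min_eq_right ht,
    max_eq_right (by linarith : P ≤ 3 / 2), max_eq_left ht]
  have h3 : 2 * P - 1 ≠ 0 := by linarith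
  have h4 : 3 - 2 * P ≠ 0 := by linarith
  field_simp
  ring

theorem moveToOne_self : moveToOne P P = 1 := by
  have h1 := hP.1; have h2 := hP.2
  unfold moveToOne
  rw [min_eq_right (by linarith : 1 / 2 ≤ P), min_self,
    max_eq_right (by linarith : 1 / 2 ≤ P), min_eq_left (by linarith : P ≤ 3 / 2),
    max_self, max_eq_right (by linarith : P ≤ 3 / 2)]
  have h3 : 2 * P - 1 ≠ 0 := by linarith
  field_simp
  ring

theorem moveToOne_strictMono : StrictMono (moveToOne P) := by
  have h1 := hP.1; have h2 := hP.2
  intro s t hst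
  have p1 : 0 < 2 * P - 1 := by linarith
  have p2 : 0 < 3 - 2 * P := by linarith
  have m1 : min s (1 / 2) ≤ min t (1 / 2) := min_le_min_right _ hst.le
  have m2 : (max (1 / 2) (min s P) - 1 / 2) / (2 * P - 1) ≤
      (max (1 / 2) (min t P) - 1 / 2) / (2 * P - 1) := by gcongr
  have m3 : (max P (min s (3 / 2)) - P) / (3 - 2 * P) ≤
      (max P (min t (3 / 2)) - P) / (3 - 2 * P) := by gcongr
  have m4 : max s (3 / 2) - 3 / 2 ≤ max t (3 / 2) - 3 / 2 := by gcongr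
  unfold moveToOne
  rcases lt_or_ge s (1 / 2) with c | c
  · have : min s (1 / 2) < min t (1 / 2) := by
      rw [min_eq_left c.le]; exact lt_min hst c
    linarith
  rcases lt_or_ge s P with c' | c'
  · have : (max (1 / 2) (min s P) - 1 / 2) / (2 * P - 1) <
      (max (1 / 2) (min t P) - 1 / 2) / (2 * P - 1) := by
      have : max (1 / 2) (min s P) < max (1 / 2) (min t P) := by
        rw [min_eq_left c'.le, max_eq_right c]
        exact lt_max_of_lt_right (lt_min hst c')
      gcongr
    linarith
  rcases lt_or_ge s (3 / 2) with c'' | c''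
  · have : (max P (min s (3 / 2)) - P) / (3 - 2 * P) <
      (max P (min t (3 / 2)) - P) / (3 - 2 * P) := by
      have : max P (min s (3 / 2)) < max P (min t (3 / 2)) := by
        rw [min_eq_left c''.le, max_eq_right c']
        exact lt_max_of_lt_right (lt_min hst c'')
      gcongr
    linarith
  · have : max s (3 / 2) - 3 / 2 < max t (3 / 2) - 3 / 2 := by
      rw [max_eq_left c'', max_eq_left (c''.trans hst.le)]; linarith
    linarith

end moveToOne

theorem continuous_moveToOne {X : Type*} [TopologicalSpace X] {f g : X → ℝ} (hf : Continuous f)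
    (hg : Continuous g) (h : ∀ x, f x ∈ Ioo (1 / 2 : ℝ) (3 / 2)) :
    Continuous fun x => moveToOne (f x) (g x) := by
  unfold moveToOne
  have h1 : ∀ x, 2 * f x - 1 ≠ 0 := fun x => by have := (h x).1; linarith
  have h2 : ∀ x, 3 - 2 * f x ≠ 0 := fun x => by have := (h x).2; linarith
  fun_prop (disch := assumption)

namespace BranchedSurface

variable {M : Type u} [TopologicalSpace M] [T2Space M] {B : BranchedSurface M} {p : Set M}

/-! ### Normalized columns -/

namespace Column

/-- In the upper slot, the pared locus is at height one. -/
def UpperNormal (κ : Column B) (p : Set M) : Prop :=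
  ∀ a t, κ.m = .branch → a.1 = 0 → t ∈ Ioo (1 / 2 : ℝ) (3 / 2) → (κ.pt a t ∈ p ↔ t = 1)

theorem continuous_pt_right (κ : Column B) (a : ℝ × ℝ) : Continuous fun t => κ.pt a t :=
  κ.continuous_pt.comp (by fun_prop : Continuous fun t : ℝ => (a, t))

theorem exists_pared_height (κ : Column B) (hp : B.IsParedLocus p) (hm : κ.m = .branch)
    {a : ℝ × ℝ} (ha : a.1 = 0) :
    ∃ t ∈ Ioo (1 / 2 : ℝ) (3 / 2), ∀ s ∈ Icc (1 / 2 : ℝ) (3 / 2), κ.pt a s ∈ p ↔ s = t := by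
  have arc : ∀ s ∈ Icc (1 / 2 : ℝ) (3 / 2), κ.Arc a s := fun s hs => Or.inl ⟨hm, ha, hs⟩
  have h1 : (1 : ℝ) ∈ Icc (1 / 2 : ℝ) (3 / 2) := ⟨by norm_num, by norm_num⟩
  set y := κ.pt a 1 with hy
  have hyb : y ∈ B.vertBoundary := by
    rw [κ.mem_vertBoundary (κ.pt_mem _ _), v_pt, z_pt]; exact arc 1 h1
  have hyN : y ∈ B.nbhd := hyb.1
  have hys : y ∈ κ.chart.source := κ.pt_mem _ _
  have hvy : κ.v y = a := by simp [hy]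
  have hcomp : connectedComponentIn (B.vertBoundary ∩ B.fibre y) y =
      (fun t => κ.pt a t) '' Icc (1 / 2 : ℝ) (3 / 2) := by
    apply Subset.antisymm
    · intro w hw
      have hwf : w ∈ B.fibre y := (connectedComponentIn_subset _ _ hw).2
      have hws := κ.fibre_source hys hyN hwf
      have hwv := κ.fibre_v hys hyN hwf
      have hcon : IsPreconnected (κ.z '' connectedComponentIn (B.vertBoundary ∩ B.fibre y) y) :=
        isPreconnected_connectedComponentIn.image _ ((κ.isCoordinate_z hys hyN).1.mono
          fun x hx => (connectedComponentIn_subset _ _ hx).2)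
      have hsub : ∀ t ∈ κ.z '' connectedComponentIn (B.vertBoundary ∩ B.fibre y) y, κ.Arc a t := by
        rintro _ ⟨x, hx, rfl⟩
        have hx' := connectedComponentIn_subset _ _ hx
        have := (κ.mem_vertBoundary (κ.fibre_source hys hyN hx'.2)).1 hx'.1
        rwa [κ.fibre_v hys hyN hx'.2, hvy] at this
      have m1 : (1 : ℝ) ∈ κ.z '' connectedComponentIn (B.vertBoundary ∩ B.fibre y) y :=
        ⟨y, mem_connectedComponentIn ⟨hyb, self_mem_fibre hyN⟩, by simp [hy]⟩
      have m2 := mem_image_of_mem κ.z hw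
      have hA := hsub _ m2
      refine ⟨κ.z w, ?_, by
        change κ.pt a (κ.z w) = w
        rw [← hvy, ← hwv, κ.pt_v_z hws]⟩
      rcases hA with h | h
      · exact h.2.2
      · exfalso
        have := hsub 0 (hcon.ordConnected.out m2 m1 ⟨by linarith [h.2.2.2], by norm_num⟩)
        rcases this with h | h
        · have := h.2.2.1; norm_num at this
        · have := h.2.2.2; norm_num at this
    · refine IsPreconnected.subset_connectedComponentIn
        (isPreconnected_Icc.image _ (κ.continuous_pt_right a).continuousOn) ⟨1, h1, rfl⟩ ?_
      rintro _ ⟨t, ht, rfl⟩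
      refine ⟨by rw [κ.mem_vertBoundary (κ.pt_mem _ _), v_pt, z_pt]; exact arc t ht, ?_⟩
      rw [hy, κ.pt_mem_fibre (arc 1 h1).S]
      intro r hr
      exact (arc r ((convex_Icc (1 / 2 : ℝ) (3 / 2)).ordConnected.uIcc_subset h1 ht hr)).S
  obtain ⟨q, ⟨hq, hqc⟩, huniq⟩ := hp.2.2 y hyb
  rw [hcomp] at hqc huniq
  obtain ⟨t, ht, rfl⟩ := hqc
  refine ⟨t, ?_, fun s hs => ⟨fun h => ?_, fun h => h ▸ hq⟩⟩
  · have := (κ.mem_vertInterior (κ.pt_mem a t)).1 (hp.2.1 hq)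
    rw [v_pt, z_pt] at this
    rcases this with h | h
    · exact h.2.2
    · linarith [h.2.2.2, ht.1]
  · have := huniq _ ⟨h, s, hs, rfl⟩
    simpa using congrArg κ.z this

theorem exists_upperNormal (κ : Column B) (hp : B.IsParedLocus p) :
    ∃ κ' : Column B, κ'.m = κ.m ∧ κ'.n = κ.n ∧ (∀ y, y ∈ κ'.chart.source ↔ y ∈ κ.chart.source) ∧
      (∀ y ∈ κ.chart.source, κ'.v y = κ.v y) ∧
      (∀ y ∈ κ.chart.source, κ.z y ≤ 1 / 2 → κ'.z y = κ.z y) ∧ κ'.UpperNormal p := by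
  by_cases hm : κ.m = .branch
  swap
  · exact ⟨κ, rfl, rfl, fun _ => Iff.rfl, fun _ _ => rfl, fun _ _ _ => rfl,
      fun _ _ h => absurd h hm⟩
  choose P hP hPp using fun s : ℝ => κ.exists_pared_height hp hm (a := (0, s)) rfl
  have hPc : Continuous P := by
    refine continuous_iff_continuousAt.2 fun s => ?_
    refine (isCompact_Icc (a := (1 / 2 : ℝ)) (b := 3 / 2)).tendsto_of_ultrafilter
      (Eventually.of_forall fun s => Ioo_subset_Icc_self (hP s)) fun U hU t ht => ?_
    have htI : t ∈ Icc (1 / 2 : ℝ) (3 / 2) :=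
      isClosed_Icc.mem_of_tendsto ht (Eventually.of_forall fun s => Ioo_subset_Icc_self (hP s))
    refine (hPp s t htI).1 ?_
    have hid : Tendsto (fun s : ℝ => s) U (𝓝 s) := hU
    have hlim : Tendsto (fun s => (((0, s), P s) : (ℝ × ℝ) × ℝ)) U (𝓝 ((0, s), t)) :=
      (tendsto_const_nhds.prodMk_nhds hid).prodMk_nhds ht
    exact hp.1.mem_of_tendsto ((κ.continuous_pt.tendsto _).comp hlim)
      (Eventually.of_forall fun s => (hPp s (P s) (Ioo_subset_Icc_self (hP s))).2 rfl)
  set F : ℝ × ℝ → ℝ → ℝ := fun a t => moveToOne (P a.2) t with hF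
  have hFc : Continuous fun q : (ℝ × ℝ) × ℝ => F q.1 q.2 :=
    continuous_moveToOne (by fun_prop) (by fun_prop) fun q => hP _
  have hFm : ∀ a, StrictMono (F a) := fun a => moveToOne_strictMono (hP _)
  have hFs : ∀ a, Function.Surjective (F a) := fun a => by
    refine surjective_of_eq_of_large (C := 1)
      (hFc.comp (by fun_prop : Continuous fun t : ℝ => (a, t))) fun t => ?_
    rcases le_or_gt t (1 / 2) with h | h
    · simp only [hF, moveToOne_of_le (hP _) h, sub_self, abs_zero]; norm_num
    rcases le_or_gt (3 / 2) t with h' | h'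
    · simp only [hF, moveToOne_of_ge (hP _) h', sub_self, abs_zero]; norm_num
    · have a1 := (hFm a).monotone h.le
      have a2 := (hFm a).monotone h'.le
      simp only [hF] at a1 a2 ⊢
      rw [moveToOne_of_le (hP _) le_rfl] at a1
      rw [moveToOne_of_ge (hP _) le_rfl] at a2
      rw [abs_le]; constructor <;> linarith
  set Ξ := fibredHomeomorph F hFc hFm hFs with hΞ
  have hΞ1 : ∀ q, Ξ q = (q.1, F q.1 q.2) := fun q => rfl
  have lt_low : ∀ a (c t : ℝ), c ≤ 1 / 2 → (F a t < c ↔ t < c) := fun a c t hc => by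
    have := (hFm a).lt_iff_lt (a := t) (b := c)
    rwa [show F a c = c from moveToOne_of_le (hP _) hc] at this
  have lt_low' : ∀ a (c t : ℝ), c ≤ 1 / 2 → (c < F a t ↔ c < t) := fun a c t hc => by
    have := (hFm a).lt_iff_lt (a := c) (b := t)
    rwa [show F a c = c from moveToOne_of_le (hP _) hc] at this
  have lt_high : ∀ a (c t : ℝ), 3 / 2 ≤ c → (F a t < c ↔ t < c) := fun a c t hc => by
    have := (hFm a).lt_iff_lt (a := t) (b := c)
    rwa [show F a c = c from moveToOne_of_ge (hP _) hc] at this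
  have lt_high' : ∀ a (c t : ℝ), 3 / 2 ≤ c → (c < F a t ↔ c < t) := fun a c t hc => by
    have := (hFm a).lt_iff_lt (a := c) (b := t)
    rwa [show F a c = c from moveToOne_of_ge (hP _) hc] at this
  have hA : ∀ q, Ξ q ∈ slab κ.m κ.n ↔ (id q.1, q.2) ∈ slab κ.m κ.n := by
    rintro ⟨a, t⟩
    rw [hΞ1]
    simp only [slab, mem_ofPred_eq, id]
    rw [abs_le, abs_le, ← not_lt, ← not_lt (b := F a t), ← not_lt, ← not_lt (b := t),
      lt_low a (-3) t (by norm_num), lt_high' a 3 t (by norm_num), lt_low' a (1 / 2) t le_rfl,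
      lt_high a (3 / 2) t le_rfl, lt_low' a (-(3 / 2)) t (by norm_num),
      lt_low a (-(1 / 2)) t (by norm_num)]
  have hid : IsOpenEmbedding (id : ℝ × ℝ → ℝ × ℝ) := IsOpenEmbedding.id
  let κ' : Column B := ⟨reparam κ.chart hid Ξ, κ.m, κ.n,
    κ.fibreChart.reparam (fun q => rfl) hA⟩
  have hsrc : ∀ y, y ∈ κ'.chart.source ↔ y ∈ κ.chart.source := fun y => by
    simp [κ', mem_reparam_source]
  have happ : ∀ y ∈ κ.chart.source, κ'.v y = κ.v y ∧ κ'.z y = F (κ.v y) (κ.z y) := by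
    intro y hy
    have h := apply_eq_reparam (he := hid) (Ξ := Ξ) ((hsrc y).2 hy)
    set b := Ξ.symm (reparam κ.chart hid Ξ y) with hb
    have hb' : κ'.chart y = Ξ b := by simp [hb, κ']
    have h1 : κ.v y = b.1 := congrArg Prod.fst h
    have h2 : κ.z y = b.2 := congrArg Prod.snd h
    constructor
    · change (κ'.chart y).1 = _; rw [hb', hΞ1, h1]
    · change (κ'.chart y).2 = _; rw [hb', hΞ1, h1, h2]
  refine ⟨κ', rfl, rfl, hsrc, fun y hy => (happ y hy).1, fun y hy h => ?_, ?_⟩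
  · rw [(happ y hy).2]; exact moveToOne_of_le (hP _) h
  · intro a t _ ha ht
    have hys : κ'.pt a t ∈ κ.chart.source := (hsrc _).1 (κ'.pt_mem a t)
    have h1 := (happ _ hys).1
    have h2 := (happ _ hys).2
    rw [v_pt] at h1
    rw [z_pt, ← h1] at h2
    set s := κ.z (κ'.pt a t) with hs
    have hpt : κ'.pt a t = κ.pt (0, a.2) s := by
      rw [hs, ← κ.pt_v_z hys, ← h1, z_pt]
      congr 1
      exact Prod.ext ha rfl
    have hsI : s ∈ Icc (1 / 2 : ℝ) (3 / 2) :=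
      ⟨((lt_low' a _ s le_rfl).1 (h2 ▸ ht.1)).le, ((lt_high a _ s le_rfl).1 (h2 ▸ ht.2)).le⟩
    rw [hpt, hPp a.2 s hsI, h2]
    have e1 : F a (P a.2) = 1 := moveToOne_self (hP _)
    constructor
    · intro h; rw [h, e1]
    · intro h; exact (hFm a).injective (by rw [h, e1])

/-- Both slots are normalized. -/
def Normal (κ : Column B) (p : Set M) : Prop := κ.UpperNormal p ∧ κ.flip.UpperNormal p

theorem exists_normal (hp : B.IsParedLocus p) {y : M} (hy : y ∈ B.nbhd) :
    ∃ κ : Column B, y ∈ κ.chart.source ∧ κ.v y = 0 ∧ κ.Normal p := by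
  obtain ⟨κ₀, hy₀, hv₀⟩ := B.exists_column hy
  obtain ⟨κ₁, m1, n1, s1, v1, z1, u1⟩ := κ₀.exists_upperNormal hp
  obtain ⟨κ₂, m2, n2, s2, v2, z2, u2⟩ := κ₁.flip.exists_upperNormal hp
  have hs : y ∈ κ₁.flip.chart.source := κ₁.flip_source.2 ((s1 y).2 hy₀)
  refine ⟨κ₂, (s2 y).2 hs, ?_, u2, ?_⟩
  · rw [v2 y hs, κ₁.flip_v ((s1 y).2 hy₀), v1 y hy₀]
    rw [show κ₀.v y = 0 from hv₀]; rfl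
  · intro a t hm ha ht
    have h1 : κ₁.m = .branch := n2.symm.trans hm
    rw [← u1 a t h1 ha ht, flip_pt]
    have e : κ₂.pt a.swap (-t) = κ₁.flip.pt a.swap (-t) := by
      have hq : κ₁.flip.pt a.swap (-t) ∈ κ₁.flip.chart.source := κ₁.flip.pt_mem _ _
      refine κ₂.ext (κ₂.pt_mem _ _) ((s2 _).2 hq) ?_ ?_
      · rw [v2 _ hq, v_pt, v_pt]
      · rw [z2 _ hq (by rw [z_pt]; linarith [ht.1]), z_pt, z_pt]
    rw [e, flip_pt, Prod.swap_swap, neg_neg]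

end Column

namespace Column
variable {κ : Column B}

theorem Normal.height (hκ : κ.Normal p) (hp : B.IsParedLocus p) {q : M} (hq : q ∈ κ.chart.source)
    (hqp : q ∈ p) : (κ.m = .branch ∧ (κ.v q).1 = 0 ∧ κ.z q = 1) ∨
      (κ.n = .branch ∧ (κ.v q).2 = 0 ∧ κ.z q = -1) := by
  have hA := (κ.mem_vertInterior hq).1 (hp.2.1 hqp)
  rcases hA with ⟨h1, h2, h3⟩ | ⟨h1, h2, h3⟩
  · refine Or.inl ⟨h1, h2, (hκ.1 _ _ h1 h2 h3).1 ?_⟩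
    rwa [κ.pt_v_z hq]
  · refine Or.inr ⟨h1, h2, ?_⟩
    have := (hκ.2 (κ.v q).swap (- κ.z q) h1 h2 ⟨by linarith [h3.2], by linarith [h3.1]⟩).1
    rw [flip_pt, Prod.swap_swap, neg_neg, κ.pt_v_z hq] at this
    linarith [this hqp]

theorem Normal.upper_mem (hκ : κ.Normal p) {a : ℝ × ℝ} (h1 : κ.m = .branch) (h2 : a.1 = 0) :
    κ.pt a 1 ∈ p := (hκ.1 a 1 h1 h2 ⟨by norm_num, by norm_num⟩).2 rfl

theorem Normal.lower_mem (hκ : κ.Normal p) {a : ℝ × ℝ} (h1 : κ.n = .branch) (h2 : a.2 = 0) :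
    κ.pt a (-1) ∈ p := by
  have := (hκ.2 a.swap 1 h1 h2 ⟨by norm_num, by norm_num⟩).2 rfl
  rwa [flip_pt, Prod.swap_swap] at this

/-- The arc through a point of the pared locus is the ball of radius one half around it. -/
theorem Normal.seg_subset_iff (hκ : κ.Normal p) (hp : B.IsParedLocus p) {q y : M}
    (hq : q ∈ κ.chart.source) (hqp : q ∈ p) (hy : y ∈ B.fibre q) :
    B.seg q y ⊆ B.vertInterior ↔ |κ.z q - κ.z y| < 1 / 2 := by
  have hqN : q ∈ B.nbhd := (hp.2.1 hqp).1.1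
  have hys := κ.fibre_source hq hqN hy
  have hyv := κ.fibre_v hq hqN hy
  have hfw : ∀ t ∈ uIcc (κ.z q) (κ.z y), B.seg q y ⊆ B.vertInterior → κ.OpenArc (κ.v q) t := by
    intro t ht hsub
    have hf := κ.fibre_uIcc hq hqN (self_mem_fibre hqN) hy ht
    have := hsub ((κ.mem_seg hq hqN hy).2 ⟨hf, by rwa [z_pt]⟩)
    rwa [κ.mem_vertInterior (κ.pt_mem _ _), v_pt, z_pt] at this
  have hbw : (∀ t ∈ uIcc (κ.z q) (κ.z y), κ.OpenArc (κ.v q) t) →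
      B.seg q y ⊆ B.vertInterior := by
    intro h x hx
    obtain ⟨h1, h2⟩ := (κ.mem_seg hq hqN hy).1 hx
    rw [κ.mem_vertInterior (κ.fibre_source hq hqN h1), κ.fibre_v hq hqN h1]
    exact h _ h2
  rw [abs_lt]
  rcases hκ.height hp hq hqp with ⟨h1, h2, h3⟩ | ⟨h1, h2, h3⟩
  · rw [h3] at hfw hbw ⊢
    constructor
    · intro hsub
      rcases hfw _ right_mem_uIcc hsub with h | h
      · constructor <;> linarith [h.2.2.1, h.2.2.2]
      · exfalso
        rcases hfw 0 (mem_uIcc.2 (Or.inr ⟨by linarith [h.2.2.2], by norm_num⟩)) hsub with h' | h'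
        · have := h'.2.2.1; norm_num at this
        · have := h'.2.2.2; norm_num at this
    · rintro ⟨k1, k2⟩
      refine hbw fun t ht => Or.inl ⟨h1, h2, ?_⟩
      rw [mem_uIcc] at ht
      constructor <;> rcases ht with h | h <;> linarith
  · rw [h3] at hfw hbw ⊢
    constructor
    · intro hsub
      rcases hfw _ right_mem_uIcc hsub with h | h
      · exfalso
        rcases hfw 0 (mem_uIcc.2 (Or.inl ⟨by norm_num, by linarith [h.2.2.1]⟩)) hsub with h' | h'
        · have := h'.2.2.1; norm_num at this
        · have := h'.2.2.2; norm_num at this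
      · constructor <;> linarith [h.2.2.1, h.2.2.2]
    · rintro ⟨k1, k2⟩
      refine hbw fun t ht => Or.inr ⟨h1, h2, ?_⟩
      rw [mem_uIcc] at ht
      constructor <;> rcases ht with h | h <;> linarith

/-! ### Partitions of unity that are constant on the fibres -/

/-- A bump function of the base coordinate. -/
noncomputable def bump (κ : Column B) (r : ℝ) (y : M) : ℝ :=
  open Classical in if y ∈ κ.chart.source then max 0 (r - ‖κ.v y‖) else 0

theorem bump_nonneg (r : ℝ) (y : M) : 0 ≤ κ.bump r y := by
  unfold bump; split_ifs <;> simp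

theorem bump_ne_zero {r : ℝ} {y : M} (h : κ.bump r y ≠ 0) : y ∈ κ.chart.source ∧ ‖κ.v y‖ < r := by
  unfold bump at h
  split_ifs at h with hs
  · refine ⟨hs, ?_⟩
    by_contra hr
    exact h (max_eq_left (by linarith))
  · exact absurd rfl h

theorem bump_fibre {r : ℝ} {y w : M} (hy : y ∈ B.nbhd) (hw : w ∈ B.fibre y) :
    κ.bump r w = κ.bump r y := by
  by_cases hs : y ∈ κ.chart.source
  · have hws := κ.fibre_source hs hy hw
    simp [bump, hs, hws, κ.fibre_v hs hy hw]
  · have hws : w ∉ κ.chart.source := fun h =>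
      hs (κ.fibre_source h (fibre_subset hy hw) (mem_fibre_symm hy hw))
    simp [bump, hs, hws]

theorem continuousOn_bump (r : ℝ) : ContinuousOn (κ.bump r) B.nbhd := by
  intro y hy
  by_cases hs : y ∈ κ.chart.source
  · have h1 : ContinuousAt (fun y => max 0 (r - ‖κ.v y‖)) y :=
      continuousAt_const.max (continuousAt_const.sub (κ.continuousAt_v hs).norm)
    refine (h1.congr ?_).continuousWithinAt
    filter_upwards [κ.source_mem_nhds hs] with w hw
    simp [bump, hw]
  · have h0 : κ.bump r y = 0 := by simp [bump, hs]
    rw [ContinuousWithinAt, h0]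
    refine tendsto_const_nhds.congr' ?_
    have hc : (κ.box 0 r)ᶜ ∈ 𝓝 y := (κ.isClosed_box 0 r).isOpen_compl.mem_nhds
      fun h => hs (κ.mem_box.1 h).1
    filter_upwards [mem_nhdsWithin_of_mem_nhds hc, self_mem_nhdsWithin] with w hw hwN
    by_contra hne
    obtain ⟨h1, h2⟩ := bump_ne_zero (Ne.symm hne)
    exact hw (κ.mem_box.2 ⟨h1, by simpa using h2.le, z_mem_Icc h1 hwN⟩)

end Column

/-- Finitely many weights, constant on the fibres, subordinate to given columns. -/
theorem exists_partition (B : BranchedSurface M) (κ : B.nbhd → Column B) (r : B.nbhd → ℝ)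
    (h : ∀ y : B.nbhd, 0 < r y ∧ (y : M) ∈ (κ y).chart.source ∧ (κ y).v y = 0) :
    ∃ (s : Finset B.nbhd) (wt : B.nbhd → M → ℝ),
      (∀ i, ContinuousOn (wt i) B.nbhd) ∧ (∀ i, ∀ y ∈ B.nbhd, 0 ≤ wt i y) ∧
      (∀ y ∈ B.nbhd, ∑ i ∈ s, wt i y = 1) ∧
      (∀ i, ∀ y ∈ B.nbhd, ∀ w ∈ B.fibre y, wt i w = wt i y) ∧
      (∀ i, ∀ y ∈ B.nbhd, wt i y ≠ 0 → y ∈ (κ i).chart.source ∧ ‖(κ i).v y‖ < r i) := by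
  obtain ⟨s, hcov⟩ := B.isCompact_nbhd.elim_nhds_subcover'
    (fun y hy => (κ ⟨y, hy⟩).chart.source ∩ {w | ‖(κ ⟨y, hy⟩).v w‖ < r ⟨y, hy⟩}) (by
      intro y hy
      obtain ⟨h1, h2, h3⟩ := h ⟨y, hy⟩
      refine inter_mem ((κ _).source_mem_nhds h2)
        (((κ _).continuousAt_v h2).norm.eventually (gt_mem_nhds ?_))
      simpa [h3] using h1)
  set f : B.nbhd → M → ℝ := fun i => (κ i).bump (r i) with hf
  have hpos : ∀ y ∈ B.nbhd, 0 < ∑ i ∈ s, f i y := by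
    intro y hy
    obtain ⟨i, hi⟩ := mem_iUnion.1 (hcov hy)
    obtain ⟨hi1, hi2⟩ := mem_iUnion.1 hi
    refine Finset.sum_pos' (fun j _ => Column.bump_nonneg _ _) ⟨i, hi1, ?_⟩
    have h1 : y ∈ (κ i).chart.source := hi2.1
    have h2 : ‖(κ i).v y‖ < r i := hi2.2
    simp only [hf, Column.bump, h1, if_true]
    exact lt_max_of_lt_right (by linarith)
  refine ⟨s, fun i y => f i y / ∑ j ∈ s, f j y, fun i => ?_, fun i y hy => ?_, fun y hy => ?_,
    fun i y hy w hw => ?_, fun i y hy hne => ?_⟩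
  · exact (Column.continuousOn_bump _).div
      (continuousOn_finsetSum _ fun j _ => Column.continuousOn_bump _) fun y hy => (hpos y hy).ne'
  · exact div_nonneg (Column.bump_nonneg _ _) (hpos y hy).le
  · rw [← Finset.sum_div, div_self (hpos y hy).ne']
  · simp only [hf, Column.bump_fibre hy hw]
  · exact Column.bump_ne_zero fun h0 => hne (by simp [hf, h0])

/-! ### A metric on the fibres -/

/-- `c` is a coordinate of the fibre through `y` that measures the distance `d`. -/
def IsIsometric (B : BranchedSurface M) (d : M → M → ℝ) (y : M) (c : M → ℝ) : Prop :=
  IsCoordinate (B.fibre y) c ∧ ∀ w ∈ B.fibre y, ∀ w' ∈ B.fibre y, d w w' = |c w - c w'|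

/-- A continuous length on the fibres. -/
structure FibreMetric (B : BranchedSurface M) where
  /-- The distance of two points of the same fibre. -/
  d : M → M → ℝ
  continuousOn : ContinuousOn (fun q : M × M => d q.1 q.2) {q | q.1 ∈ B.nbhd ∧ q.2 ∈ B.fibre q.1}
  coord : ∀ y ∈ B.nbhd, ∃ c, B.IsIsometric d y c
  le : ∀ y ∈ B.nbhd, ∀ w ∈ B.fibre y, d y w ≤ 6

/-- There is a length on the fibres such that each arc of the vertical boundary has length one,
with its midpoint on the pared locus. -/
theorem exists_fibreMetric (hp : B.IsParedLocus p) : ∃ D : FibreMetric B,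
    ∀ q ∈ p, ∀ y ∈ B.fibre q, (B.seg q y ⊆ B.vertInterior ↔ D.d q y < 1 / 2) := by
  choose κ hκs hκv hκn using fun y : B.nbhd => Column.exists_normal hp y.2
  obtain ⟨s, wt, wc, w0, w1, wf, wne⟩ := B.exists_partition κ (fun _ => 1)
    fun y => ⟨one_pos, hκs y, hκv y⟩
  have hle : ∀ i, ∀ y ∈ B.nbhd, ∀ w ∈ B.fibre y,
      wt i y * |(κ i).z y - (κ i).z w| ≤ 6 * wt i y := by
    intro i y hy w hw
    rcases eq_or_ne (wt i y) 0 with h | h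
    · simp [h]
    · have hs := (wne i y hy h).1
      have h1 := (κ i).z_mem_Icc hs hy
      have h2 := (κ i).z_mem_Icc ((κ i).fibre_source hs hy hw) (fibre_subset hy hw)
      have : |(κ i).z y - (κ i).z w| ≤ 6 :=
        abs_le.2 ⟨by linarith [h1.1, h2.2], by linarith [h1.2, h2.1]⟩
      nlinarith [w0 i y hy]
  have hterm : ∀ i, ∀ y ∈ B.nbhd, ∀ w ∈ B.fibre y, 0 ≤ wt i y * |(κ i).z y - (κ i).z w| :=
    fun i y hy w hw => mul_nonneg (w0 i y hy) (abs_nonneg _)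
  refine ⟨⟨fun y w => ∑ i ∈ s, wt i y * |(κ i).z y - (κ i).z w|, ?_, ?_, ?_⟩, ?_⟩
  · refine continuousOn_finsetSum _ fun i _ => ?_
    rintro ⟨y, w⟩ ⟨hy, hw⟩
    have hc1 : ContinuousWithinAt (fun q : M × M => wt i q.1)
        {q | q.1 ∈ B.nbhd ∧ q.2 ∈ B.fibre q.1} (y, w) :=
      ((wc i) y hy).comp continuousWithinAt_fst fun q hq => hq.1
    rcases eq_or_ne (wt i y) 0 with h | h
    · rw [ContinuousWithinAt]
      simp only [h, zero_mul]
      refine squeeze_zero' (g := fun q : M × M => 6 * wt i q.1) ?_ ?_ ?_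
      · filter_upwards [self_mem_nhdsWithin] with q hq using hterm i _ hq.1 _ hq.2
      · filter_upwards [self_mem_nhdsWithin] with q hq using hle i _ hq.1 _ hq.2
      · have := hc1.tendsto.const_mul 6
        simpa [h] using this
    · have hs := (wne i y hy h).1
      have hz1 : ContinuousAt (fun q : M × M => (κ i).z q.1) (y, w) :=
        ContinuousAt.comp (f := Prod.fst) ((κ i).continuousAt_z hs) continuousAt_fst
      have hz2 : ContinuousAt (fun q : M × M => (κ i).z q.2) (y, w) :=
        ContinuousAt.comp (f := Prod.snd)
          ((κ i).continuousAt_z ((κ i).fibre_source hs hy hw)) continuousAt_snd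
      exact hc1.mul (hz1.sub hz2).abs.continuousWithinAt
  · intro y hy
    obtain ⟨κ₀, hκ₀, -⟩ := B.exists_column hy
    have hyy := self_mem_fibre hy
    have hsign : ∀ i, ∃ ε : ℝ, |ε| = 1 ∧ (wt i y ≠ 0 → ∀ w ∈ B.fibre y, ∀ w' ∈ B.fibre y,
        κ₀.z w ≤ κ₀.z w' → ε * (κ i).z w ≤ ε * (κ i).z w') := by
      intro i
      by_cases h : wt i y = 0
      · exact ⟨1, abs_one, fun h' => absurd h h'⟩
      · have hs := (wne i y hy h).1
        rcases κ₀.coordinate_iff hκ₀ hy ((κ i).isCoordinate_z hs hy) with k | k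
        · exact ⟨1, abs_one, fun _ w hw w' hw' hle => by
            rw [one_mul, one_mul]; exact (k w hw w' hw').2 hle⟩
        · refine ⟨-1, by simp, fun _ w hw w' hw' hle => ?_⟩
          have := (k w' hw' w hw).2 hle
          linarith
    choose ε hε1 hε using hsign
    set c : M → ℝ := fun w => ∑ i ∈ s, wt i y * (ε i * (κ i).z w) with hc
    have hd : ∀ w ∈ B.fibre y, ∀ w' ∈ B.fibre y,
        ∑ i ∈ s, wt i w * |(κ i).z w - (κ i).z w'| = |c w - c w'| := by
      have main : ∀ w ∈ B.fibre y, ∀ w' ∈ B.fibre y, κ₀.z w ≤ κ₀.z w' →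
          ∑ i ∈ s, wt i y * |(κ i).z w - (κ i).z w'| = |c w - c w'| := by
        intro w hw w' hw' hle
        have e1 : ∀ i, wt i y * |(κ i).z w - (κ i).z w'| =
            wt i y * (ε i * (κ i).z w') - wt i y * (ε i * (κ i).z w) := by
          intro i
          rcases eq_or_ne (wt i y) 0 with h | h
          · simp [h]
          · rw [← mul_sub]
            congr 1
            have := hε i h w hw w' hw' hle
            rw [← one_mul |(κ i).z w - (κ i).z w'|, ← hε1 i, ← abs_mul, mul_sub,
              abs_of_nonpos (by linarith)]
            ring
        have e2 : ∑ i ∈ s, wt i y * |(κ i).z w - (κ i).z w'| = c w' - c w := by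
          rw [hc, ← Finset.sum_sub_distrib]
          exact Finset.sum_congr rfl fun i _ => e1 i
        have e3 : 0 ≤ c w' - c w := by
          rw [← e2]
          exact Finset.sum_nonneg fun i _ => mul_nonneg (w0 i y hy) (abs_nonneg _)
        rw [e2, abs_sub_comm, abs_of_nonneg e3]
      intro w hw w' hw'
      simp only [wf _ y hy w hw]
      rcases le_total (κ₀.z w) (κ₀.z w') with h | h
      · exact main w hw w' hw' h
      · rw [abs_sub_comm, ← main w' hw' w hw h]
        exact Finset.sum_congr rfl fun i _ => by rw [abs_sub_comm]
    refine ⟨c, ⟨?_, fun w hw w' hw' hcw => ?_⟩, hd⟩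
    · refine continuousOn_finsetSum _ fun i _ => ?_
      rcases eq_or_ne (wt i y) 0 with h | h
      · simp only [h, zero_mul]; exact continuousOn_const
      · exact continuousOn_const.mul (continuousOn_const.mul
          ((κ i).isCoordinate_z (wne i y hy h).1 hy).1)
    · have h0 := hd w hw w' hw'
      rw [hcw, sub_self, abs_zero] at h0
      have hN := fibre_subset hy hw
      have hw'f : w' ∈ B.fibre w := by rwa [B.fibre_eq y hy w hw]
      rw [Finset.sum_eq_zero_iff_of_nonneg fun i _ => hterm i w hN w' hw'f] at h0
      obtain ⟨i, hi, hne⟩ : ∃ i ∈ s, wt i w ≠ 0 := by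
        by_contra hcon
        push Not at hcon
        have := w1 w hN
        rw [Finset.sum_eq_zero hcon] at this
        exact zero_ne_one this
      have := (mul_eq_zero.1 (h0 i hi)).resolve_left hne
      have hs := (wne i w hN hne).1
      exact ((κ i).isCoordinate_z hs hN).2 (self_mem_fibre hN) hw'f (sub_eq_zero.1 (abs_eq_zero.1 this))
  · intro y hy w hw
    calc ∑ i ∈ s, wt i y * |(κ i).z y - (κ i).z w| ≤ ∑ i ∈ s, 6 * wt i y :=
          Finset.sum_le_sum fun i _ => hle i y hy w hw
      _ = 6 := by rw [← Finset.mul_sum, w1 y hy, mul_one]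
  · intro q hq y hy
    have hqN : q ∈ B.nbhd := (hp.2.1 hq).1.1
    have key : ∀ i, wt i q ≠ 0 →
        (B.seg q y ⊆ B.vertInterior ↔ |(κ i).z q - (κ i).z y| < 1 / 2) := fun i hi =>
      (hκn i).seg_subset_iff hp (wne i q hqN hi).1 hq hy
    change _ ↔ ∑ i ∈ s, wt i q * |(κ i).z q - (κ i).z y| < 1 / 2
    have hhalf : ∑ i ∈ s, wt i q * (1 / 2 : ℝ) = 1 / 2 := by
      rw [← Finset.sum_mul, w1 q hqN, one_mul]
    constructor
    · intro hsub
      rw [← hhalf]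
      obtain ⟨i, hi, hne⟩ : ∃ i ∈ s, wt i q ≠ 0 := by
        by_contra hcon
        push Not at hcon
        have := w1 q hqN
        rw [Finset.sum_eq_zero hcon] at this
        exact zero_ne_one this
      refine Finset.sum_lt_sum (fun j _ => ?_) ⟨i, hi, ?_⟩
      · rcases eq_or_ne (wt j q) 0 with h | h
        · simp [h]
        · exact mul_le_mul_of_nonneg_left ((key j h).1 hsub).le (w0 j q hqN)
      · exact mul_lt_mul_of_pos_left ((key i hne).1 hsub) (lt_of_le_of_ne (w0 i q hqN) hne.symm)
    · intro hlt
      by_contra hsub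
      refine absurd hlt (not_lt.2 ?_)
      rw [← hhalf]
      refine Finset.sum_le_sum fun j _ => ?_
      rcases eq_or_ne (wt j q) 0 with h | h
      · simp [h]
      · exact mul_le_mul_of_nonneg_left (not_lt.1 fun hh => hsub ((key j h).2 hh)) (w0 j q hqN)

namespace FibreMetric

variable (D : FibreMetric B) {ι : Type*} (s : Finset ι)

/-- `m` is the barycentre of the points `x i` with weights `wt i`, in a fibre. -/
def IsBary (wt : ι → ℝ) (x : ι → M) (m : M) : Prop :=
  ∑ i ∈ s, wt i * D.d m (x i) ^ 2 = (∑ i ∈ s, ∑ j ∈ s, wt i * wt j * D.d (x i) (x j) ^ 2) / 2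

variable {D s}

theorem isBary_iff {y m : M} {c : M → ℝ} (hc : B.IsIsometric D.d y c) {wt : ι → ℝ} {x : ι → M}
    (hx : ∀ i ∈ s, wt i ≠ 0 → x i ∈ B.fibre y) (h1 : ∑ i ∈ s, wt i = 1) (hm : m ∈ B.fibre y) :
    D.IsBary s wt x m ↔ c m = ∑ i ∈ s, wt i * c (x i) := by
  have e1 : ∑ i ∈ s, wt i * D.d m (x i) ^ 2 = ∑ i ∈ s, wt i * (c m - c (x i)) ^ 2 := by
    refine Finset.sum_congr rfl fun i hi => ?_
    rcases eq_or_ne (wt i) 0 with h | h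
    · simp [h]
    · rw [hc.2 m hm _ (hx i hi h), sq_abs]
  have e2 : ∑ i ∈ s, ∑ j ∈ s, wt i * wt j * D.d (x i) (x j) ^ 2 =
      ∑ i ∈ s, ∑ j ∈ s, wt i * wt j * (c (x i) - c (x j)) ^ 2 := by
    refine Finset.sum_congr rfl fun i hi => Finset.sum_congr rfl fun j hj => ?_
    rcases eq_or_ne (wt i) 0 with h | h
    · simp [h]
    rcases eq_or_ne (wt j) 0 with h' | h'
    · simp [h']
    · rw [hc.2 _ (hx i hi h) _ (hx j hj h'), sq_abs]
  set μ := ∑ i ∈ s, wt i * c (x i) with hμ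
  set Q := ∑ i ∈ s, wt i * c (x i) ^ 2 with hQ
  have e3 : ∑ i ∈ s, wt i * (c m - c (x i)) ^ 2 = c m ^ 2 - 2 * c m * μ + Q := by
    calc ∑ i ∈ s, wt i * (c m - c (x i)) ^ 2
        = ∑ i ∈ s, (c m ^ 2 * wt i - 2 * c m * (wt i * c (x i)) + wt i * c (x i) ^ 2) :=
          Finset.sum_congr rfl fun i _ => by ring
      _ = _ := by
          rw [Finset.sum_add_distrib, Finset.sum_sub_distrib, ← Finset.mul_sum, ← Finset.mul_sum,
            h1, mul_one]
  have e4 : ∑ i ∈ s, ∑ j ∈ s, wt i * wt j * (c (x i) - c (x j)) ^ 2 = 2 * Q - 2 * μ ^ 2 := by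
    calc ∑ i ∈ s, ∑ j ∈ s, wt i * wt j * (c (x i) - c (x j)) ^ 2
        = ∑ i ∈ s, (wt i * c (x i) ^ 2 - 2 * μ * (wt i * c (x i)) + Q * wt i) := by
          refine Finset.sum_congr rfl fun i _ => ?_
          calc ∑ j ∈ s, wt i * wt j * (c (x i) - c (x j)) ^ 2
              = ∑ j ∈ s, ((wt i * c (x i) ^ 2) * wt j - (2 * (wt i * c (x i))) * (wt j * c (x j)) +
                  wt i * (wt j * c (x j) ^ 2)) := Finset.sum_congr rfl fun j _ => by ring
            _ = _ := by
                rw [Finset.sum_add_distrib, Finset.sum_sub_distrib, ← Finset.mul_sum,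
                  ← Finset.mul_sum, ← Finset.mul_sum, h1]
                ring
      _ = _ := by
          rw [Finset.sum_add_distrib, Finset.sum_sub_distrib, ← Finset.mul_sum, ← Finset.mul_sum,
            h1]
          ring
  rw [IsBary, e1, e2, e3, e4]
  constructor
  · intro h
    have : (c m - μ) ^ 2 = 0 := by nlinarith
    have := pow_eq_zero_iff (two_ne_zero) |>.1 this
    linarith
  · intro h; rw [h]; ring

variable (D s) in
/-- The barycentre, in the fibre through `y`. -/
noncomputable def bary (y : M) (wt : ι → ℝ) (x : ι → M) : M :=
  open Classical in
  if h : ∃ m, m ∈ B.fibre y ∧ D.IsBary s wt x m then h.choose else y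

theorem bary_spec {y : M} (hy : y ∈ B.nbhd) {wt : ι → ℝ} {x : ι → M} (h0 : ∀ i ∈ s, 0 ≤ wt i)
    (h1 : ∑ i ∈ s, wt i = 1) (hx : ∀ i ∈ s, wt i ≠ 0 → x i ∈ B.fibre y) :
    D.bary s y wt x ∈ B.fibre y ∧ D.IsBary s wt x (D.bary s y wt x) := by
  have hex : ∃ m, m ∈ B.fibre y ∧ D.IsBary s wt x m := by
    obtain ⟨c, hc⟩ := D.coord y hy
    have hconn : IsPreconnected (B.fibre y) := by
      obtain ⟨κ, hκ, -⟩ := B.exists_column hy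
      obtain ⟨lo, hi, -, -, hI⟩ := κ.exists_Icc hκ hy
      have : B.fibre y = (fun t => κ.pt (κ.v y) t) '' Icc lo hi := by
        ext w
        constructor
        · intro hw
          have e : κ.pt (κ.v y) (κ.z w) = w := by
            rw [← κ.fibre_v hκ hy hw, κ.pt_v_z (κ.fibre_source hκ hy hw)]
          exact ⟨κ.z w, (hI _).1 (by rwa [e]), e⟩
        · rintro ⟨t, ht, rfl⟩
          exact (hI t).2 ht
      rw [this]
      exact isPreconnected_Icc.image _ (κ.continuous_pt_right _).continuousOn
    have hconv : Convex ℝ (c '' B.fibre y) :=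
      (hconn.image c hc.1.1).convex
    have hmem : ∑ i ∈ s.filter (fun i => wt i ≠ 0), wt i • c (x i) ∈ c '' B.fibre y := by
      refine hconv.sum_mem (fun i hi => h0 i (Finset.mem_filter.1 hi).1) ?_
        fun i hi => mem_image_of_mem _ (hx i (Finset.mem_filter.1 hi).1 (Finset.mem_filter.1 hi).2)
      rw [Finset.sum_filter_ne_zero, h1]
    obtain ⟨m, hm, hcm⟩ := hmem
    refine ⟨m, hm, (isBary_iff hc hx h1 hm).2 ?_⟩
    rw [hcm]
    refine Finset.sum_filter_of_ne fun i _ hne h => hne (by simp [h])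
  unfold bary
  rw [dif_pos hex]
  exact hex.choose_spec

theorem coord_bary {y : M} (hy : y ∈ B.nbhd) {c : M → ℝ} (hc : B.IsIsometric D.d y c)
    {wt : ι → ℝ} {x : ι → M} (h0 : ∀ i ∈ s, 0 ≤ wt i)
    (h1 : ∑ i ∈ s, wt i = 1) (hx : ∀ i ∈ s, wt i ≠ 0 → x i ∈ B.fibre y) :
    c (D.bary s y wt x) = ∑ i ∈ s, wt i * c (x i) := by
  obtain ⟨h2, h3⟩ := bary_spec (D := D) hy h0 h1 hx
  exact (isBary_iff hc hx h1 h2).1 h3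

theorem tendsto_d {α : Type*} {l : Filter α} {y w : α → M} {y₀ w₀ : M} (hy : Tendsto y l (𝓝 y₀))
    (hw : Tendsto w l (𝓝 w₀)) (h0 : y₀ ∈ B.nbhd) (h1 : w₀ ∈ B.fibre y₀)
    (h : ∀ᶠ a in l, y a ∈ B.nbhd ∧ w a ∈ B.fibre (y a)) :
    Tendsto (fun a => D.d (y a) (w a)) l (𝓝 (D.d y₀ w₀)) :=
  (D.continuousOn (y₀, w₀) ⟨h0, h1⟩).tendsto.comp
    (tendsto_nhdsWithin_iff.2 ⟨hy.prodMk_nhds hw, h⟩)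

theorem d_nonneg {y w : M} (hy : y ∈ B.nbhd) (hw : w ∈ B.fibre y) : 0 ≤ D.d y w := by
  obtain ⟨c, hc⟩ := D.coord y hy
  rw [hc.2 y (self_mem_fibre hy) w hw]
  exact abs_nonneg _

theorem tendsto_bary {α : Type*} {l : Filter α} {y : α → M} {wt : α → ι → ℝ} {x : α → ι → M}
    {y₀ : M} {wt₀ : ι → ℝ} {x₀ : ι → M} (hy₀ : y₀ ∈ B.nbhd) (hy : Tendsto y l (𝓝 y₀))
    (hN : ∀ᶠ a in l, y a ∈ B.nbhd) (h0 : ∀ᶠ a in l, ∀ i ∈ s, 0 ≤ wt a i)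
    (h1 : ∀ᶠ a in l, ∑ i ∈ s, wt a i = 1)
    (hx : ∀ᶠ a in l, ∀ i ∈ s, wt a i ≠ 0 → x a i ∈ B.fibre (y a))
    (hwt : ∀ i ∈ s, Tendsto (fun a => wt a i) l (𝓝 (wt₀ i))) (h00 : ∀ i ∈ s, 0 ≤ wt₀ i)
    (h10 : ∑ i ∈ s, wt₀ i = 1) (hx0 : ∀ i ∈ s, wt₀ i ≠ 0 → x₀ i ∈ B.fibre y₀)
    (hxl : ∀ i ∈ s, wt₀ i ≠ 0 → Tendsto (fun a => x a i) l (𝓝 (x₀ i))) :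
    Tendsto (fun a => D.bary s (y a) (wt a) (x a)) l (𝓝 (D.bary s y₀ wt₀ x₀)) := by
  have hev : ∀ᶠ a in l, y a ∈ B.nbhd ∧ D.bary s (y a) (wt a) (x a) ∈ B.fibre (y a) ∧
      D.IsBary s (wt a) (x a) (D.bary s (y a) (wt a) (x a)) := by
    filter_upwards [hN, h0, h1, hx] with a k1 k2 k3 k4 using ⟨k1, bary_spec k1 k2 k3 k4⟩
  refine B.isCompact_nbhd.tendsto_of_ultrafilter
    (hev.mono fun a h => fibre_subset h.1 h.2.1) fun U hU m hm => ?_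
  have hyU := hy.mono_left hU
  have hmf : m ∈ B.fibre y₀ := fibre_of_tendsto hyU (hU hN) hm (hU (hev.mono fun a h => h.2.1))
  have hmN := fibre_subset hy₀ hmf
  have hmb : D.IsBary s wt₀ x₀ m := by
    have t1 : Tendsto (fun a => ∑ i ∈ s, wt a i * D.d (D.bary s (y a) (wt a) (x a)) (x a i) ^ 2) U
        (𝓝 (∑ i ∈ s, wt₀ i * D.d m (x₀ i) ^ 2)) := by
      refine tendsto_finsetSum _ fun i hi => ?_
      have hwU := (hwt i hi).mono_left hU
      rcases eq_or_ne (wt₀ i) 0 with h | h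
      · rw [h] at hwU ⊢
        rw [zero_mul]
        refine squeeze_zero' (g := fun a => 36 * wt a i) ?_ ?_ (by simpa using hwU.const_mul 36)
        · filter_upwards [hU h0] with a ha using mul_nonneg (ha i hi) (sq_nonneg _)
        · filter_upwards [hU h0, hU hx, hU hev] with a ha hxa hb
          rcases eq_or_ne (wt a i) 0 with h' | h'
          · simp [h']
          · have hf : x a i ∈ B.fibre (D.bary s (y a) (wt a) (x a)) := by
              rw [B.fibre_eq _ hb.1 _ hb.2.1]; exact hxa i hi h'
            have hn := fibre_subset hb.1 hb.2.1
            have := D.le _ hn _ hf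
            have := D.d_nonneg hn hf
            have h36 : D.d (D.bary s (y a) (wt a) (x a)) (x a i) ^ 2 ≤ 36 := by nlinarith
            nlinarith [mul_le_mul_of_nonneg_left h36 (ha i hi)]
      · refine hwU.mul ((tendsto_d hm ((hxl i hi h).mono_left hU) hmN ?_ ?_).pow 2)
        · rw [B.fibre_eq _ hy₀ _ hmf]; exact hx0 i hi h
        · filter_upwards [hwU.eventually_ne h, hU hx, hU hev] with a ha hxa hb
          refine ⟨fibre_subset hb.1 hb.2.1, ?_⟩
          rw [B.fibre_eq _ hb.1 _ hb.2.1]; exact hxa i hi ha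
    have t2 : Tendsto (fun a => (∑ i ∈ s, ∑ j ∈ s, wt a i * wt a j * D.d (x a i) (x a j) ^ 2) / 2) U
        (𝓝 ((∑ i ∈ s, ∑ j ∈ s, wt₀ i * wt₀ j * D.d (x₀ i) (x₀ j) ^ 2) / 2)) := by
      refine Tendsto.div_const (tendsto_finsetSum _ fun i hi => tendsto_finsetSum _ fun j hj => ?_) _
      have hwi := (hwt i hi).mono_left hU
      have hwj := (hwt j hj).mono_left hU
      rcases eq_or_ne (wt₀ i * wt₀ j) 0 with h | h
      · have hij := hwi.mul hwj
        rw [h] at hij ⊢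
        rw [zero_mul]
        refine squeeze_zero' (g := fun a => 36 * (wt a i * wt a j)) ?_ ?_
          (by simpa using hij.const_mul 36)
        · filter_upwards [hU h0] with a ha
          exact mul_nonneg (mul_nonneg (ha i hi) (ha j hj)) (sq_nonneg _)
        · filter_upwards [hU h0, hU hx, hU hev] with a ha hxa hb
          rcases eq_or_ne (wt a i * wt a j) 0 with h' | h'
          · simp [h']
          · have h1 := hxa i hi (left_ne_zero_of_mul h')
            have hf : x a j ∈ B.fibre (x a i) := by
              rw [B.fibre_eq _ hb.1 _ h1]; exact hxa j hj (right_ne_zero_of_mul h')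
            have hn := fibre_subset hb.1 h1
            have := D.le _ hn _ hf
            have := D.d_nonneg hn hf
            have h36 : D.d (x a i) (x a j) ^ 2 ≤ 36 := by nlinarith
            nlinarith [mul_le_mul_of_nonneg_left h36 (mul_nonneg (ha i hi) (ha j hj))]
      · have hi0 := left_ne_zero_of_mul h
        have hj0 := right_ne_zero_of_mul h
        refine (hwi.mul hwj).mul ((tendsto_d ((hxl i hi hi0).mono_left hU)
          ((hxl j hj hj0).mono_left hU) (fibre_subset hy₀ (hx0 i hi hi0)) ?_ ?_).pow 2)
        · rw [B.fibre_eq _ hy₀ _ (hx0 i hi hi0)]; exact hx0 j hj hj0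
        · filter_upwards [hwi.eventually_ne hi0, hwj.eventually_ne hj0, hU hx, hU hN]
            with a ha ha' hxa hb
          refine ⟨fibre_subset hb (hxa i hi ha), ?_⟩
          rw [B.fibre_eq _ hb _ (hxa i hi ha)]; exact hxa j hj ha'
    refine tendsto_nhds_unique t1 (t2.congr' ?_)
    filter_upwards [hU hev] with a ha using ha.2.2.symm
  obtain ⟨c, hc⟩ := D.coord y₀ hy₀
  obtain ⟨b1, b2⟩ := bary_spec (D := D) hy₀ h00 h10 hx0
  exact hc.1.2 hmf b1 (((isBary_iff hc hx0 h10 hmf).1 hmb).trans ((isBary_iff hc hx0 h10 b1).1 b2).symm)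

end FibreMetric

/-! ### Regular neighbourhoods -/

/-- The projection `ρ` exhibits `O` as a regular neighbourhood of the surface `ι`. -/
structure IsTube (B : BranchedSurface M) {S : Type u} [TopologicalSpace S] (ι : S → M)
    (O : Set M) (ρ : O → S) : Prop where
  continuous_ι : Continuous ι
  isOpen : ∃ U, IsOpen U ∧ O = B.nbhd ∩ U
  vert : O ∩ B.vertBoundary = B.vertInterior
  continuous_ρ : Continuous ρ
  sect : ∀ s, ∃ h : ι s ∈ O, ρ ⟨ι s, h⟩ = s
  fib : ∀ s, ∃ a ∈ B.fibre (ι s), ∃ b ∈ B.fibre (ι s),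
    (fun y : O => (y : M)) '' {y | ρ y = s} = B.seg a b \ {a, b}

variable {S : Type u} [TopologicalSpace S] {ι : S → M} {O : Set M} {ρ : O → S}

theorem IsCarriedSurface.continuous (h : B.IsCarriedSurface p ι) : Continuous ι := by
  rw [continuous_iff_continuousAt]
  intro s
  obtain ⟨W, hW, hs, he, -⟩ := h.2.2.2 s
  have h1 : ContinuousOn ι W := continuousOn_iff_continuous_domRestrict.2 he.continuous
  exact h1.continuousAt (hW.mem_nhds hs)

/-- The ends of the fibres of the tube depend continuously on the point of the surface. -/
def ContinuousEnds (B : BranchedSurface M) (ι : S → M) (ρ : O → S) : Prop :=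
  ∀ s, ∃ a b : S → M, ContinuousAt a s ∧ ContinuousAt b s ∧
    ∀ᶠ w in 𝓝 s, a w ∈ B.fibre (ι w) ∧ b w ∈ B.fibre (ι w) ∧
      (fun y : O => (y : M)) '' {y | ρ y = w} = B.seg (a w) (b w) \ {a w, b w}

theorem IsRegularNbhd.exists_tube (h : B.IsRegularNbhd ι O) (hc : Continuous ι) :
    ∃ ρ, B.IsTube ι O ρ ∧ ContinuousEnds B ι ρ := by
  obtain ⟨h1, h2, ρ, h3, h4, h5⟩ := h
  refine ⟨ρ, ⟨hc, h1, h2, h3, h4, fun s => ?_⟩, fun s => ?_⟩ <;>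
    obtain ⟨W, hW, hs, a, b, ha, hb, h⟩ := h5 s
  · exact ⟨a s, (h s hs).1, b s, (h s hs).2.1, (h s hs).2.2⟩
  · exact ⟨a, b, ha.continuousAt (hW.mem_nhds hs), hb.continuousAt (hW.mem_nhds hs),
      (hW.eventually_mem hs).mono h⟩

namespace IsTube

theorem subset (h : B.IsTube ι O ρ) : O ⊆ B.nbhd := by
  obtain ⟨U, -, rfl⟩ := h.isOpen
  exact inter_subset_left

theorem mem (h : B.IsTube ι O ρ) (s : S) : ι s ∈ O := (h.sect s).1

theorem ι_mem (h : B.IsTube ι O ρ) (s : S) : ι s ∈ B.nbhd := h.subset (h.mem s)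

theorem ι_fibre (h : B.IsTube ι O ρ) {y : M} (hy : y ∈ O) : ι (ρ ⟨y, hy⟩) ∈ B.fibre y := by
  obtain ⟨a, ha, b, hb, e⟩ := h.fib (ρ ⟨y, hy⟩)
  have : y ∈ B.seg a b \ {a, b} := e ▸ ⟨⟨y, hy⟩, rfl, rfl⟩
  have h1 : y ∈ B.fibre a := this.1.1
  rw [B.fibre_eq _ (h.ι_mem _) _ ha] at h1
  exact mem_fibre_symm (h.ι_mem _) h1

theorem isClosed_sdiff (h : B.IsTube ι O ρ) : IsClosed (B.nbhd \ O) := by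
  obtain ⟨U, hU, rfl⟩ := h.isOpen
  rw [Set.sdiff_self_inter]
  exact isClosed_nbhd.sdiff hU

theorem isCompact_sdiff (h : B.IsTube ι O ρ) : IsCompact (B.nbhd \ O) :=
  B.isCompact_nbhd.of_isClosed_subset h.isClosed_sdiff sdiff_subset

theorem eventually_mem (h : B.IsTube ι O ρ) {y : M} (hy : y ∈ O) : ∀ᶠ w in 𝓝 y, w ∈ B.nbhd → w ∈ O := by
  obtain ⟨U, hU, rfl⟩ := h.isOpen
  filter_upwards [hU.mem_nhds hy.2] with w hw hN using ⟨hN, hw⟩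

/-- The points of a column that project to a given point of the surface. -/
theorem sect_iff {κ : Column B} {y a b : M} (hy : y ∈ κ.chart.source) (hN : y ∈ B.nbhd)
    (ha : a ∈ B.fibre y) (hb : b ∈ B.fibre y) {s : S}
    (e : (fun x : O => (x : M)) '' {x | ρ x = s} = B.seg a b \ {a, b}) {w : M}
    (hw : w ∈ B.fibre y) : (∃ h : w ∈ O, ρ ⟨w, h⟩ = s) ↔
      κ.z w ∈ Ioo (min (κ.z a) (κ.z b)) (max (κ.z a) (κ.z b)) := by
  have h1 : (∃ h : w ∈ O, ρ ⟨w, h⟩ = s) ↔ w ∈ (fun y : O => (y : M)) '' {y | ρ y = s} :=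
    ⟨fun ⟨h1, h2⟩ => ⟨⟨w, h1⟩, h2, rfl⟩, fun ⟨⟨x, hx⟩, h1, h2⟩ => by subst h2; exact ⟨hx, h1⟩⟩
  have hinj := (κ.isCoordinate_z hy hN).2
  rw [h1, e, Set.mem_sdiff, κ.mem_seg' hy hN ha hb, mem_insert_iff, mem_singleton_iff,
    ← hinj.eq_iff hw ha, ← hinj.eq_iff hw hb]
  simp only [hw, true_and, mem_uIcc, mem_Ioo]
  grind

/-- The fibre of the regular neighbourhood, in a column. -/
theorem exists_ends (h : B.IsTube ι O ρ) {κ : Column B} {y : M} (hy : y ∈ κ.chart.source)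
    (hN : y ∈ B.nbhd) {s : S} (hs : ι s ∈ B.fibre y) :
    ∃ a ∈ B.fibre y \ O, ∃ b ∈ B.fibre y \ O, κ.z a < κ.z (ι s) ∧ κ.z (ι s) < κ.z b ∧
      ∀ w ∈ B.fibre y, (∃ h : w ∈ O, ρ ⟨w, h⟩ = s) ↔ κ.z a < κ.z w ∧ κ.z w < κ.z b := by
  have main : ∀ s, ι s ∈ B.fibre y → ∃ a ∈ B.fibre y, ∃ b ∈ B.fibre y,
      κ.z a < κ.z (ι s) ∧ κ.z (ι s) < κ.z b ∧
      ∀ w ∈ B.fibre y, (∃ h : w ∈ O, ρ ⟨w, h⟩ = s) ↔ κ.z a < κ.z w ∧ κ.z w < κ.z b := by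
    intro s hs
    obtain ⟨a, ha, b, hb, e⟩ := h.fib s
    rw [B.fibre_eq _ hN _ hs] at ha hb
    have key := fun w hw => sect_iff (w := w) hy hN ha hb e hw
    have h2 := (key _ hs).1 (h.sect s)
    rcases le_total (κ.z a) (κ.z b) with hab | hab
    · rw [min_eq_left hab, max_eq_right hab] at *
      exact ⟨a, ha, b, hb, h2.1, h2.2, key⟩
    · rw [min_eq_right hab, max_eq_left hab] at *
      exact ⟨b, hb, a, ha, h2.1, h2.2, key⟩
  obtain ⟨a, ha, b, hb, h1, h2, h3⟩ := main s hs
  have aux : ∀ x ∈ B.fibre y, (κ.z x = κ.z a ∨ κ.z x = κ.z b) → x ∉ O := by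
    intro x hx hxa hxO
    have hs' := h.ι_fibre hxO
    rw [B.fibre_eq _ hN _ hx] at hs'
    obtain ⟨a', ha', b', hb', h1', h2', h3'⟩ := main _ hs'
    have hx' := (h3' x hx).1 ⟨hxO, rfl⟩
    have hw : ∃ t, max (κ.z a) (κ.z a') < t ∧ t < min (κ.z b) (κ.z b') := by
      refine exists_between (max_lt (lt_min (h1.trans h2) ?_) (lt_min ?_ (h1'.trans h2')))
      · rcases hxa with e | e <;> linarith
      · rcases hxa with e | e <;> linarith
    obtain ⟨t, ht1, ht2⟩ := hw
    rw [max_lt_iff] at ht1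
    rw [lt_min_iff] at ht2
    have hwf : κ.pt (κ.v y) t ∈ B.fibre y :=
      κ.fibre_uIcc hy hN ha hb (by rw [uIcc_of_le (h1.trans h2).le]; exact ⟨ht1.1.le, ht2.1.le⟩)
    obtain ⟨hO, e1⟩ := (h3 _ hwf).2 (by simpa using ⟨ht1.1, ht2.1⟩)
    obtain ⟨_, e2⟩ := (h3' _ hwf).2 (by simpa using ⟨ht1.2, ht2.2⟩)
    have := (h3 x hx).1 ⟨hxO, e2.symm.trans e1⟩
    rcases hxa with e | e <;> linarith
  exact ⟨a, ⟨ha, aux a ha (.inl rfl)⟩, b, ⟨hb, aux b hb (.inr rfl)⟩, h1, h2, h3⟩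

theorem fibre_sdiff_nonempty (h : B.IsTube ι O ρ) {y : M} (hN : y ∈ B.nbhd) :
    ((B.nbhd \ O) ∩ B.fibre y).Nonempty := by
  by_cases hy : y ∈ O
  · obtain ⟨κ, hκ, -⟩ := exists_column B hN
    obtain ⟨a, ha, -⟩ := h.exists_ends hκ hN (h.ι_fibre hy)
    exact ⟨a, ⟨fibre_subset hN ha.1, ha.2⟩, ha.1⟩
  · exact ⟨y, ⟨hN, hy⟩, self_mem_fibre hN⟩

end IsTube

/-! ### Points of a fibre that are not separated by the surface -/

/-- The points `y` and `z` of a fibre are not separated by `X`. -/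
def Joined (B : BranchedSurface M) (X : Set M) (y z : M) : Prop := Disjoint (B.seg y z) X

theorem joined_iff {X : Set M} {κ : Column B} {y w w' : M} (hy : y ∈ κ.chart.source)
    (hN : y ∈ B.nbhd) (hw : w ∈ B.fibre y) (hw' : w' ∈ B.fibre y) :
    B.Joined X w w' ↔ ∀ x ∈ X ∩ B.fibre y, κ.z x ∉ uIcc (κ.z w) (κ.z w') := by
  rw [Joined, Set.disjoint_left]
  simp only [κ.mem_seg' hy hN hw hw']
  exact ⟨fun k x hx hz => k ⟨hx.2, hz⟩ hx.1, fun k x hx hX => k x ⟨hX, hx.1⟩ hx.2⟩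

theorem Joined.symm {X : Set M} {y z : M} (h : B.Joined X y z) (hy : y ∈ B.nbhd)
    (hz : z ∈ B.fibre y) : B.Joined X z y := by
  rwa [Joined, ← seg_comm hy hz]

theorem joined_self {X : Set M} {y : M} (hy : y ∈ B.nbhd) : B.Joined X y y ↔ y ∉ X := by
  rw [Joined, seg_self hy, disjoint_singleton_left]

theorem Joined.trans {X : Set M} {y z w : M} (h : B.Joined X y z) (h' : B.Joined X z w)
    (hy : y ∈ B.nbhd) (hz : z ∈ B.fibre y) (hw : w ∈ B.fibre y) : B.Joined X y w := by
  obtain ⟨κ, hκ, -⟩ := exists_column B hy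
  have h0 := self_mem_fibre hy
  rw [joined_iff hκ hy h0 hz] at h
  rw [joined_iff hκ hy hz hw] at h'
  rw [joined_iff hκ hy h0 hw]
  intro x hx hxz
  rcases uIcc_subset_uIcc_union_uIcc hxz with k | k
  exacts [h x hx k, h' x hx k]

theorem exists_joined_real {X Z : Set ℝ} (hX : IsCompact X) (hne : X.Nonempty) (hd : Disjoint X Z)
    (h : ∀ s ∈ Z, ∃ l ∈ X, ∃ r ∈ X, s ∈ Icc l r ∧ ∀ s' ∈ Z, s' ∈ Icc l r → s' = s) {z : ℝ}
    (hz : z ∉ Z) : ∃ y ∈ X, ∀ s ∈ Z, s ∉ uIcc z y := by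
  by_contra! hcon
  have below : (X ∩ Iic z).Nonempty → ∃ y ∈ X, y ≤ z ∧ (∀ x ∈ X, x ≤ z → x ≤ y) ∧
      ∃ s ∈ Z, y < s ∧ s < z := by
    intro hne
    obtain ⟨y, hy, hmax⟩ := (hX.inter_right isClosed_Iic).exists_isGreatest hne
    obtain ⟨s, hs, hsy⟩ := hcon y hy.1
    rw [uIcc_of_ge hy.2] at hsy
    refine ⟨y, hy.1, hy.2, fun x hx hxz => hmax ⟨hx, hxz⟩, s, hs, lt_of_le_of_ne hsy.1 ?_,
      lt_of_le_of_ne hsy.2 fun e => hz (e ▸ hs)⟩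
    rintro rfl
    exact hd.le_bot ⟨hy.1, hs⟩
  have above : (X ∩ Ici z).Nonempty → ∃ y ∈ X, z ≤ y ∧ (∀ x ∈ X, z ≤ x → y ≤ x) ∧
      ∃ s ∈ Z, z < s ∧ s < y := by
    intro hne
    obtain ⟨y, hy, hmin⟩ := (hX.inter_right isClosed_Ici).exists_isLeast hne
    obtain ⟨s, hs, hsy⟩ := hcon y hy.1
    rw [uIcc_of_le hy.2] at hsy
    refine ⟨y, hy.1, hy.2, fun x hx hxz => hmin ⟨hx, hxz⟩, s, hs,
      lt_of_le_of_ne hsy.1 fun e => hz (e ▸ hs), lt_of_le_of_ne hsy.2 ?_⟩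
    rintro rfl
    exact hd.le_bot ⟨hy.1, hs⟩
  have both : (X ∩ Iic z).Nonempty ∧ (X ∩ Ici z).Nonempty := by
    obtain ⟨x, hx⟩ := hne
    rcases le_total x z with hxz | hxz
    · refine ⟨⟨x, hx, hxz⟩, ?_⟩
      obtain ⟨y, -, -, hm, s, hs, h1, h2⟩ := below ⟨x, hx, hxz⟩
      obtain ⟨l, -, r, hr, hlr, -⟩ := h s hs
      by_contra hemp
      have : r ≤ z := by
        by_contra hrz
        exact hemp ⟨r, hr, (not_le.1 hrz).le⟩
      linarith [hm r hr this, hlr.2]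
    · refine ⟨?_, ⟨x, hx, hxz⟩⟩
      obtain ⟨y, -, -, hm, s, hs, h1, h2⟩ := above ⟨x, hx, hxz⟩
      obtain ⟨l, hl, r, -, hlr, -⟩ := h s hs
      by_contra hemp
      have : z ≤ l := by
        by_contra hrz
        exact hemp ⟨l, hl, (not_le.1 hrz).le⟩
      linarith [hm l hl this, hlr.1]
  obtain ⟨y, -, -, hm, s, hs, h1, h2⟩ := below both.1
  obtain ⟨y', -, -, hm', s', hs', h1', h2'⟩ := above both.2
  obtain ⟨l, hl, r, hr, hlr, hu⟩ := h s hs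
  have hrz : z ≤ r := by
    by_contra hrz
    linarith [hm r hr (not_le.1 hrz).le, hlr.2]
  have := hu s' hs' ⟨by linarith [hlr.1], by linarith [hm' r hr hrz]⟩
  linarith

/-- The points of the surface are separated from each other by `X`. -/
def Cuts (B : BranchedSurface M) {S : Type u} (ι : S → M) (X : Set M) : Prop :=
  ∀ s, ∃ l ∈ X ∩ B.fibre (ι s), ∃ r ∈ X ∩ B.fibre (ι s), ι s ∈ B.seg l r ∧
    ∀ s', ι s' ∈ B.seg l r → s' = s

theorem exists_joined {X : Set M} (hX : IsClosed X) (hne : ∀ y ∈ B.nbhd, (X ∩ B.fibre y).Nonempty)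
    (hd : Disjoint X (range ι)) (hc : B.Cuts ι X) {z : M}
    (hz : z ∈ B.nbhd) (hzS : z ∉ range ι) : ∃ y ∈ X ∩ B.fibre z, B.Joined (range ι) z y := by
  obtain ⟨κ, hκ, -⟩ := exists_column B hz
  have h0 := self_mem_fibre hz
  have hinj := (κ.isCoordinate_z hκ hz).2
  have hcomp : IsCompact (κ.z '' (X ∩ B.fibre z)) := by
    obtain ⟨lo, hi, hlt, -, hI⟩ := κ.exists_Icc hκ hz
    have e : κ.z '' (X ∩ B.fibre z) = Icc lo hi ∩ (fun t => κ.pt (κ.v z) t) ⁻¹' X := by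
      ext t
      constructor
      · rintro ⟨x, ⟨hx, hxf⟩, rfl⟩
        have e : κ.pt (κ.v z) (κ.z x) = x := by
          rw [← κ.fibre_v hκ hz hxf]; exact κ.pt_v_z (κ.fibre_source hκ hz hxf)
        exact ⟨(hI _).1 (by rwa [e]), by rwa [mem_preimage, e]⟩
      · rintro ⟨ht, hx⟩
        exact ⟨_, ⟨hx, (hI _).2 ht⟩, κ.z_pt _ _⟩
    rw [e]
    exact isCompact_Icc.inter_right (hX.preimage (κ.continuous_pt_right _))
  have main := exists_joined_real (X := κ.z '' (X ∩ B.fibre z))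
    (Z := κ.z '' (range ι ∩ B.fibre z)) (z := κ.z z) hcomp ((hne z hz).image _) ?_ ?_ ?_
  · obtain ⟨t, ⟨y, hy, rfl⟩, ht⟩ := main
    exact ⟨y, hy, (joined_iff hκ hz h0 hy.2).2 fun x hx => ht _ ⟨x, hx, rfl⟩⟩
  · rw [Set.disjoint_left]
    rintro _ ⟨x, hx, rfl⟩ ⟨x', hx', e⟩
    rw [hinj hx'.2 hx.2 e] at hx'
    exact hd.le_bot ⟨hx.1, hx'.1⟩
  · rintro _ ⟨_, ⟨⟨s, rfl⟩, hs⟩, rfl⟩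
    obtain ⟨l, hl, r, hr, hlr, hu⟩ := hc s
    rw [B.fibre_eq _ hz _ hs] at hl hr
    have hms := fun x => κ.mem_seg' (x := x) hκ hz hl.2 hr.2
    have hu' : ∀ s' ∈ κ.z '' (range ι ∩ B.fibre z), s' ∈ uIcc (κ.z l) (κ.z r) → s' = κ.z (ι s) := by
      rintro _ ⟨_, ⟨⟨s', rfl⟩, hs'⟩, rfl⟩ hm
      rw [hu s' ((hms _).2 ⟨hs', hm⟩)]
    have hm := ((hms _).1 hlr).2
    rcases le_total (κ.z l) (κ.z r) with h | h
    · rw [uIcc_of_le h] at hu' hm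
      exact ⟨_, ⟨l, hl, rfl⟩, _, ⟨r, hr, rfl⟩, hm, hu'⟩
    · rw [uIcc_of_ge h] at hu' hm
      exact ⟨_, ⟨r, hr, rfl⟩, _, ⟨l, hl, rfl⟩, hm, hu'⟩
  · rintro ⟨x, hx, e⟩
    rw [hinj hx.2 h0 e] at hx
    exact hzS hx.1

namespace IsTube

theorem cuts (h : B.IsTube ι O ρ) : B.Cuts ι (B.nbhd \ O) := by
  intro s
  have hN := h.ι_mem s
  obtain ⟨κ, hκ, -⟩ := exists_column B hN
  obtain ⟨a, ha, b, hb, h1, h2, h3⟩ := h.exists_ends hκ hN (self_mem_fibre hN)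
  have hab := (h1.trans h2).le
  refine ⟨a, ⟨⟨fibre_subset hN ha.1, ha.2⟩, ha.1⟩, b, ⟨⟨fibre_subset hN hb.1, hb.2⟩, hb.1⟩,
    (κ.mem_seg' hκ hN ha.1 hb.1).2 ⟨self_mem_fibre hN, ?_⟩, fun s' hs' => ?_⟩
  · rw [uIcc_of_le hab]; exact ⟨h1.le, h2.le⟩
  · rw [κ.mem_seg' hκ hN ha.1 hb.1, uIcc_of_le hab] at hs'
    have hinj := (κ.isCoordinate_z hκ hN).2
    have main := (h3 _ hs'.1).2 ⟨lt_of_le_of_ne hs'.2.1 fun e => ?_,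
      lt_of_le_of_ne hs'.2.2 fun e => ?_⟩
    · obtain ⟨_, e⟩ := main
      obtain ⟨_, e'⟩ := h.sect s'
      rw [← e', e]
    · exact ha.2 (hinj ha.1 hs'.1 e ▸ h.mem s')
    · exact hb.2 (hinj hs'.1 hb.1 e ▸ h.mem s')

theorem disjoint_sdiff (h : B.IsTube ι O ρ) : Disjoint (B.nbhd \ O) (range ι) := by
  rw [Set.disjoint_left]
  rintro _ hx ⟨s, rfl⟩
  exact hx.2 (h.mem s)

theorem exists_joined (h : B.IsTube ι O ρ) {z : M} (hz : z ∈ B.nbhd) (hzS : z ∉ range ι) :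
    ∃ y ∈ (B.nbhd \ O) ∩ B.fibre z, B.Joined (range ι) z y :=
  BranchedSurface.exists_joined h.isClosed_sdiff (fun _ hy => h.fibre_sdiff_nonempty hy)
    h.disjoint_sdiff h.cuts hz hzS

/-- For points outside the regular neighbourhood, being separated by the surface or by its
neighbourhood is the same. -/
theorem joined_iff (h : B.IsTube ι O ρ) {y z : M} (hy : y ∈ B.nbhd \ O) (hz : z ∈ B.fibre y \ O) :
    B.Joined (range ι) y z ↔ B.Joined O y z := by
  refine ⟨fun k => ?_, fun k => k.mono_right (range_subset_iff.2 h.mem)⟩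
  obtain ⟨κ, hκ, -⟩ := exists_column B hy.1
  have h0 := self_mem_fibre hy.1
  rw [BranchedSurface.joined_iff hκ hy.1 h0 hz.1] at k ⊢
  intro x hx hxz
  have hs := h.ι_fibre hx.1
  rw [B.fibre_eq _ hy.1 _ hx.2] at hs
  obtain ⟨a, ha, b, hb, h1, h2, h3⟩ := h.exists_ends hκ hy.1 hs
  have hxab := (h3 x hx.2).1 ⟨hx.1, rfl⟩
  have aux : ∀ w ∈ B.fibre y \ O, κ.z w ≤ κ.z a ∨ κ.z b ≤ κ.z w := by
    intro w hw
    by_contra! hcon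
    exact hw.2 ((h3 w hw.1).2 hcon).1
  refine k _ ⟨⟨_, rfl⟩, hs⟩ ?_
  rw [mem_uIcc] at hxz ⊢
  rcases aux y ⟨h0, hy.2⟩ with k1 | k1 <;> rcases aux z hz with k2 | k2 <;>
    rcases hxz with k3 | k3 <;> first | (exfalso; linarith) | (left; constructor <;> linarith) |
      (right; constructor <;> linarith)

/-- The relation of not being separated by the surface is closed off the surface. -/
theorem joined_of_tendsto (h : B.IsTube ι O ρ) {α : Type*} {l : Filter α} [l.NeBot] {y z : α → M}
    {y₀ z₀ : M} (hy : Tendsto y l (𝓝 y₀)) (hz : Tendsto z l (𝓝 z₀)) (hy₀ : y₀ ∈ B.nbhd)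
    (hj : ∀ᶠ i in l, y i ∈ B.nbhd ∧ z i ∈ B.fibre (y i) ∧ B.Joined (range ι) (y i) (z i))
    (hyS : y₀ ∉ range ι) (hzS : z₀ ∉ range ι) : B.Joined (range ι) y₀ z₀ := by
  have hN := hj.mono fun i k => k.1
  have hzf := hj.mono fun i k => k.2.1
  have hz₀ := fibre_of_tendsto hy hN hz hzf
  rw [Joined, Set.disjoint_left]
  rintro _ hs ⟨s, rfl⟩
  have h1 : ι s ≠ y₀ := fun e => hyS ⟨s, e⟩
  have h2 : ι s ≠ z₀ := fun e => hzS ⟨s, e⟩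
  obtain ⟨x, hx, hxs⟩ := exists_tendsto_seg hy hy₀ hN hz hz₀ hzf hs h1 h2
  have hxO : ∀ᶠ i in l, x i ∈ O := by
    filter_upwards [hx.eventually (h.eventually_mem (h.mem s)), hxs, hN] with i k1 k2 k3
    exact k1 (fibre_subset k3 k2.1)
  classical
  let w : α → M := fun i => if k : x i ∈ O then ι (ρ ⟨x i, k⟩) else x i
  have hw : Tendsto w l (𝓝 (ι s)) := by
    obtain ⟨k1, k2⟩ := h.sect s
    have hc : ContinuousAt (fun y : O => ι (ρ y)) ⟨ι s, k1⟩ :=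
      (h.continuous_ι.comp h.continuous_ρ).continuousAt
    rw [ContinuousAt, k2, tendsto_def] at hc
    intro V hV
    have := hc V hV
    rw [nhds_subtype_eq_comap, mem_comap] at this
    obtain ⟨V', hV', hsub⟩ := this
    rw [mem_map]
    filter_upwards [hx.eventually hV', hxO] with i k3 k4
    simp only [mem_preimage, w, k4, dif_pos]
    exact hsub (show (⟨x i, k4⟩ : O) ∈ Subtype.val ⁻¹' V' from k3)
  have hwS : ∀ᶠ i in l, w i ∈ range ι ∧ w i ∈ B.fibre (y i) := by
    filter_upwards [hxO, hxs, hN] with i k1 k2 k3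
    have := h.ι_fibre k1
    rw [B.fibre_eq _ k3 _ k2.1] at this
    simp only [w, k1, dif_pos]
    exact ⟨⟨_, rfl⟩, this⟩
  have := eventually_mem_seg hy hy₀ hN hz hz₀ hzf hs h1 h2 hw (hwS.mono fun i k => k.2)
  obtain ⟨i, k1, k2, k3⟩ := (this.and (hwS.and hj)).exists
  exact k3.2.2.le_bot ⟨k1.1, k2.1⟩

end IsTube

end BranchedSurface

/-! ### Continuous factors and plaques -/

theorem IsCompact.exists_continuousOn_factor {X Y Z : Type*} [TopologicalSpace X]
    [TopologicalSpace Y] [TopologicalSpace Z] [T2Space Y] [T2Space Z] {T : Set X} (g₀ : Y → Z)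
    (hT : IsCompact T) {q : X → Y} {f : X → Z} (hq : ContinuousOn q T) (hf : ContinuousOn f T)
    (h : ∀ x ∈ T, ∀ y ∈ T, q x = q y → f x = f y) :
    ∃ g : Y → Z, ContinuousOn g (q '' T) ∧ ∀ x ∈ T, g (q x) = f x := by
  classical
  let g : Y → Z := fun m => if k : m ∈ q '' T then f k.choose else g₀ m
  have hg : ∀ x ∈ T, g (q x) = f x := by
    intro x hx
    have k : q x ∈ q '' T := ⟨x, hx, rfl⟩
    simp only [g, k, dif_pos]
    exact h _ k.choose_spec.1 _ hx k.choose_spec.2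
  refine ⟨g, ?_, hg⟩
  rintro _ ⟨x₀, hx₀, rfl⟩
  refine (hT.image_of_continuousOn hf).tendsto_of_ultrafilter ?_ fun U hU m hm => ?_
  · filter_upwards [self_mem_nhdsWithin] with y hy
    obtain ⟨x, hx, rfl⟩ := hy
    exact ⟨x, hx, (hg x hx).symm⟩
  · have hsub : ∀ᶠ y in (U : Filter Y), y ∈ q '' T := hU self_mem_nhdsWithin
    let r : Y → X := fun m => if k : m ∈ q '' T then k.choose else x₀
    have hr : ∀ y ∈ q '' T, r y ∈ T ∧ q (r y) = y := by
      intro y hy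
      simp only [r, hy, dif_pos]
      exact hy.choose_spec
    obtain ⟨x, hx, hrx⟩ := hT.ultrafilter_le_nhds (U.map r)
      (le_principal_iff.2 (hsub.mono fun y hy => (hr y hy).1))
    have hrx : Tendsto r U (𝓝[T] x) := tendsto_nhdsWithin_iff.2 ⟨hrx, hsub.mono fun y hy => (hr y hy).1⟩
    have h1 : Tendsto (fun y => q (r y)) U (𝓝 (q x)) := (hq x hx).tendsto.comp hrx
    have h2 : Tendsto (fun y => f (r y)) U (𝓝 (f x)) := (hf x hx).tendsto.comp hrx
    have e1 : q x = q x₀ := tendsto_nhds_unique (h1.congr' (hsub.mono fun y hy => (hr y hy).2))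
      (hU.trans inf_le_left)
    have e2 : f x = m := by
      refine tendsto_nhds_unique (h2.congr' (hsub.mono fun y hy => ?_)) hm
      rw [← hg _ (hr y hy).1, (hr y hy).2]
    rw [hg x₀ hx₀, ← e2]
    exact h _ hx _ hx₀ e1

theorem subsingleton_of_interior_eq_empty {M : Type u} [TopologicalSpace M] {L : Set M}
    (hL : interior L = ∅) {φ : OpenPartialHomeomorph M Space3} {C : Set ℝ}
    (ht : φ.target = univ) (hC : ∀ y ∈ φ.source, y ∈ L ↔ (φ y).2 ∈ C) {P : Set ℝ}
    (hP : IsPreconnected P) (hPC : P ⊆ C) : P.Subsingleton := by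
  by_contra hns
  rw [Set.not_subsingleton_iff] at hns
  obtain ⟨x, hx, y, hy, hxy⟩ := hns.exists_lt
  have hsub : Ioo x y ⊆ C := (Ioo_subset_Icc_self.trans (hP.Icc_subset hx hy)).trans hPC
  have hopen : IsOpen (φ.source ∩ φ ⁻¹' {q : Space3 | q.2 ∈ Ioo x y}) :=
    φ.isOpen_inter_preimage (isOpen_Ioo.preimage continuous_snd)
  have hin : φ.source ∩ φ ⁻¹' {q : Space3 | q.2 ∈ Ioo x y} ⊆ interior L :=
    interior_maximal (fun w hw => (hC w hw.1).2 (hsub hw.2)) hopen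
  obtain ⟨t, ht'⟩ := exists_between hxy
  have hm : ((0, t) : Space3) ∈ φ.target := by rw [ht]; trivial
  have : φ.symm (0, t) ∈ interior L := hin ⟨φ.map_target hm, by
    rw [mem_preimage, φ.right_inv hm]; exact ht'⟩
  rw [hL] at this
  exact this

/-- A continuous map into a foliated set without interior maps small plaques into plaques. -/
theorem IsProductChart.exists_plaque_subset {M : Type u} [TopologicalSpace M] {L L' : Set M}
    (hL' : interior L' = ∅) {φ ψ : OpenPartialHomeomorph M Space3} (hφ : IsProductChart L φ)
    (hψ : IsProductChart L' ψ) {b : M → M} (hb : ContinuousOn b L) (hbL : MapsTo b L L') {y : M}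
    (hy : y ∈ L ∩ φ.source) (hby : b y ∈ ψ.source) :
    ∃ O ∈ 𝓝 y, ∀ y₁ ∈ O ∩ L, ∀ y₂ ∈ O ∩ L,
      (φ y₁).2 = (φ y₂).2 → (ψ (b y₁)).2 = (ψ (b y₂)).2 := by
  obtain ⟨ht, C, -, hC⟩ := hφ
  obtain ⟨ht', C', -, hC'⟩ := hψ
  have h1 : b ⁻¹' ψ.source ∈ 𝓝[L] y := (hb y hy.1) (ψ.open_source.mem_nhds hby)
  obtain ⟨V, hV, hVL⟩ := mem_nhdsWithin_iff_exists_mem_nhds_inter.1 h1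
  have hφy : φ y ∈ φ.target := φ.map_source hy.2
  have h2 : φ.symm ⁻¹' V ∈ 𝓝 (φ y) :=
    (φ.continuousAt_symm hφy) (by rwa [φ.left_inv hy.2])
  obtain ⟨r, hr, hball⟩ := Metric.mem_nhds_iff.1 h2
  refine ⟨φ.source ∩ φ ⁻¹' Metric.ball (φ y) r,
    (φ.isOpen_inter_preimage Metric.isOpen_ball).mem_nhds ⟨hy.2, Metric.mem_ball_self hr⟩, ?_⟩
  intro y₁ hy₁ y₂ hy₂ e
  set D : Set (ℝ × ℝ) := Metric.ball (φ y).1 r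
  have hDball : ∀ x ∈ D, ((x, (φ y₁).2) : Space3) ∈ Metric.ball (φ y) r := by
    intro x hx
    have := hy₁.1.2
    rw [mem_preimage, Metric.mem_ball, Prod.dist_eq, max_lt_iff] at this
    rw [Metric.mem_ball, Prod.dist_eq, max_lt_iff]
    exact ⟨hx, this.2⟩
  have htar : ∀ q, q ∈ φ.target := fun q => by rw [ht]; trivial
  have hL : ∀ x ∈ D, φ.symm (x, (φ y₁).2) ∈ L := by
    intro x hx
    rw [hC _ (φ.map_target (htar _)), φ.right_inv (htar _)]
    exact (hC _ hy₁.1.1).1 hy₁.2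
  have hsrc : ∀ x ∈ D, b (φ.symm (x, (φ y₁).2)) ∈ ψ.source := fun x hx =>
    hVL ⟨hball (hDball x hx), hL x hx⟩
  have hcont : ContinuousOn (fun x => (ψ (b (φ.symm (x, (φ y₁).2)))).2) D := by
    have c1 : ContinuousOn (fun x : ℝ × ℝ => φ.symm (x, (φ y₁).2)) D :=
      φ.continuousOn_symm.comp (by fun_prop) fun x _ => htar _
    exact continuous_snd.comp_continuousOn
      (ψ.continuousOn.comp (hb.comp c1 hL) hsrc)
  have hpre := ((convex_ball _ _).isPreconnected (s := D)).image _ hcont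
  have hsub := subsingleton_of_interior_eq_empty hL' ht' hC' hpre (by
    rintro _ ⟨x, hx, rfl⟩
    exact (hC' _ (hsrc x hx)).1 (hbL (hL x hx)))
  have hmem : ∀ w ∈ φ.source ∩ φ ⁻¹' Metric.ball (φ y) r, (φ w).2 = (φ y₁).2 →
      (φ w).1 ∈ D ∧ φ.symm ((φ w).1, (φ y₁).2) = w := by
    intro w hw e
    have := hw.2
    rw [mem_preimage, Metric.mem_ball, Prod.dist_eq, max_lt_iff] at this
    exact ⟨this.1, by rw [← e]; exact φ.left_inv hw.1⟩
  obtain ⟨k1, k2⟩ := hmem y₁ hy₁.1 rfl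
  obtain ⟨k3, k4⟩ := hmem y₂ hy₂.1 e.symm
  have := hsub ⟨_, k1, rfl⟩ ⟨_, k3, rfl⟩
  simpa only [k2, k4] using this

theorem Lamination.plaquePreserving {M : Type u} [TopologicalSpace M] {L L' : Lamination M}
    (hL' : interior L'.carrier = ∅) {b : M → M} (hb : ContinuousOn b L.carrier)
    (hbL : MapsTo b L.carrier L'.carrier) : L.PlaquePreserving L' b :=
  fun φ hφ ψ hψ _ hy hby =>
    (L.isProductChart φ hφ).exists_plaque_subset hL' (L'.isProductChart ψ hψ) hb hbL hy hby

theorem samePlaques_of_interior_eq_empty {M : Type u} [TopologicalSpace M] {L : Set M}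
    (hL : interior L = ∅) {φ ψ : OpenPartialHomeomorph M Space3} (hφ : IsProductChart L φ)
    (hψ : IsProductChart L ψ) : SamePlaques L φ ψ := by
  intro y hy
  obtain ⟨O, hO, h⟩ := hφ.exists_plaque_subset hL hψ (b := id) continuousOn_id (mapsTo_id _)
    ⟨hy.1, hy.2.1⟩ hy.2.2
  obtain ⟨O', hO', h'⟩ := hψ.exists_plaque_subset hL hφ (b := id) continuousOn_id (mapsTo_id _)
    ⟨hy.1, hy.2.2⟩ hy.2.1
  exact ⟨O ∩ O', inter_mem hO hO', fun y₁ h₁ y₂ h₂ =>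
    ⟨h y₁ ⟨h₁.1.1, h₁.2⟩ y₂ ⟨h₂.1.1, h₂.2⟩, h' y₁ ⟨h₁.1.2, h₁.2⟩ y₂ ⟨h₂.1.2, h₂.2⟩⟩⟩

namespace BranchedSurface

variable {M : Type u} [TopologicalSpace M] [T2Space M] {B : BranchedSurface M} {p : Set M}
variable {S : Type u} [TopologicalSpace S] {ι : S → M} {O : Set M} {ρ : O → S}

/-! ### Collapsing maps -/

/-- A map that preserves the fibres and their order. -/
def FibreMono (B : BranchedSurface M) (X : Set M) (f : M → M) : Prop :=
  ∀ y ∈ X, f y ∈ B.fibre y ∧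
    ∀ z ∈ X ∩ B.fibre y, ∀ c, IsCoordinate (B.fibre y) c → c y ≤ c z → c (f y) ≤ c (f z)

theorem fibreMono_of_height {X : Set M} {f : M → M} (hX : X ⊆ B.nbhd)
    (hf : ∀ y ∈ X, f y ∈ B.fibre y) (h : ∀ y ∈ X, ∀ z ∈ X ∩ B.fibre y, ∀ κ : Column B,
      y ∈ κ.chart.source → κ.z y ≤ κ.z z → κ.z (f y) ≤ κ.z (f z)) : B.FibreMono X f := by
  intro y hy
  refine ⟨hf y hy, fun z hz c hc hle => ?_⟩
  obtain ⟨κ, hκ, -⟩ := exists_column B (hX hy)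
  have hfz : f z ∈ B.fibre y := B.fibre_eq _ (hX hy) _ hz.2 ▸ hf z hz.1
  rcases κ.coordinate_iff hκ (hX hy) hc with k | k
  · rw [k _ (self_mem_fibre (hX hy)) _ hz.2] at hle
    rw [k _ (hf y hy) _ hfz]
    exact h y hy z hz κ hκ hle
  · rw [k _ (self_mem_fibre (hX hy)) _ hz.2] at hle
    rw [k _ (hf y hy) _ hfz]
    exact h z hz.1 y ⟨hy, mem_fibre_symm (hX hy) hz.2⟩ κ (κ.fibre_source hκ (hX hy) hz.2) hle

theorem IsCollapse.fibreMono {L : Lamination M} {q : M → M} (hq : B.IsCollapse O L q) :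
    B.FibreMono B.nbhd q := fun y hy =>
  ⟨(hq.2.1 y hy).1, fun z hz => ((hq.2.1 y hy).2 z hz.2).2⟩

theorem FibreMono.height {X : Set M} {f : M → M} (h : B.FibreMono X f) (hX : X ⊆ B.nbhd)
    {κ : Column B} {y z : M} (hκ : y ∈ κ.chart.source) (hy : y ∈ X) (hz : z ∈ X ∩ B.fibre y)
    (hle : κ.z y ≤ κ.z z) : κ.z (f y) ≤ κ.z (f z) :=
  (h y hy).2 z hz _ (κ.isCoordinate_z hκ (hX hy)) hle

theorem IsCollapse.eq_iff {L : Lamination M} {q : M → M} (hq : B.IsCollapse O L q) {y z : M}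
    (hy : y ∈ B.nbhd) (hz : z ∈ B.fibre y) : q y = q z ↔ y = z ∨ B.Joined O y z :=
  ((hq.2.1 y hy).2 z hz).1

namespace IsTube

theorem eq_iff (h : B.IsTube ι O ρ) {L : Lamination M} {q : M → M} (hq : B.IsCollapse O L q)
    {y z : M} (hy : y ∈ B.nbhd \ O) (hz : z ∈ B.fibre y \ O) :
    q y = q z ↔ B.Joined (range ι) y z := by
  rw [hq.eq_iff hy.1 hz.1, h.joined_iff hy hz]
  refine ⟨?_, .inr⟩
  rintro (rfl | k)
  exacts [(joined_self hy.1).2 hy.2, k]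

/-- The map to the lamination of the surface, from a set that meets all complementary parts. -/
theorem exists_transfer (h : B.IsTube ι O ρ) {L : Lamination M} {q : M → M}
    (hq : B.IsCollapse O L q) {X : Set M} (hX : IsCompact X) (hXN : X ⊆ B.nbhd)
    (hne : ∀ y ∈ B.nbhd, (X ∩ B.fibre y).Nonempty) (hd : Disjoint X (range ι))
    (hc : B.Cuts ι X) :
    ∃ f : M → M, ContinuousOn f X ∧ f '' X = L.carrier ∧ B.FibreMono X f ∧
      (∀ y ∈ X, ∀ z ∈ X ∩ B.fibre y, f y = f z ↔ B.Joined (range ι) y z) ∧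
      ∀ y ∈ X, ∀ z ∈ B.fibre y \ O, f y = q z ↔ B.Joined (range ι) y z := by
  have hXS : ∀ y ∈ X, y ∉ range ι := fun y hy k => hd.le_bot ⟨hy, k⟩
  have hex : ∀ y, ∃ z, y ∈ X → z ∈ (B.nbhd \ O) ∩ B.fibre y ∧ B.Joined (range ι) y z := by
    intro y
    by_cases hy : y ∈ X
    · obtain ⟨z, hz, hj⟩ := h.exists_joined (hXN hy) (hXS y hy)
      exact ⟨z, fun _ => ⟨hz, hj⟩⟩
    · exact ⟨y, fun k => absurd k hy⟩
  choose ζ hζ using hex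
  have hζO : ∀ y ∈ X, ζ y ∈ B.nbhd \ O := fun y hy => (hζ y hy).1.1
  have hζf : ∀ y ∈ X, ζ y ∈ B.fibre y := fun y hy => (hζ y hy).1.2
  have hζj : ∀ y ∈ X, B.Joined (range ι) y (ζ y) := fun y hy => (hζ y hy).2
  have canon : ∀ y ∈ X, ∀ z ∈ B.fibre y \ O, q (ζ y) = q z ↔ B.Joined (range ι) y z := by
    intro y hy z hz
    have hz' : z ∈ B.fibre (ζ y) \ O := by rwa [B.fibre_eq _ (hXN hy) _ (hζf y hy)]
    rw [h.eq_iff hq (hζO y hy) hz']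
    exact ⟨fun k => (hζj y hy).trans k (hXN hy) (hζf y hy) hz.1, fun k =>
      ((hζj y hy).symm (hXN hy) (hζf y hy)).trans k (hζO y hy).1
        (mem_fibre_symm (hXN hy) (hζf y hy)) hz'.1⟩
  have hfib : ∀ y ∈ X, q (ζ y) ∈ B.fibre y := fun y hy =>
    B.fibre_eq _ (hXN hy) _ (hζf y hy) ▸ (hq.fibreMono _ (hζO y hy).1).1
  have heq : ∀ y ∈ X, ∀ z ∈ X ∩ B.fibre y, q (ζ y) = q (ζ z) ↔ B.Joined (range ι) y z := by
    intro y hy z hz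
    have e := B.fibre_eq _ (hXN hy) _ hz.2
    have k1 := hζf z hz.1
    rw [e] at k1
    rw [canon y hy _ ⟨k1, (hζO z hz.1).2⟩]
    have k2 := hζj z hz.1
    have hz' := hXN hz.1
    refine ⟨fun k => k.trans (k2.symm hz' (e ▸ k1)) (hXN hy) k1 hz.2, fun k =>
      k.trans k2 (hXN hy) hz.2 k1⟩
  refine ⟨fun y => q (ζ y), ?_, ?_, ?_, heq, canon⟩
  · intro y₀ hy₀
    refine (B.isCompact_nbhd.image_of_continuousOn hq.1).tendsto_of_ultrafilter ?_ fun U hU m hm => ?_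
    · filter_upwards [self_mem_nhdsWithin] with y hy using ⟨_, (hζO y hy).1, rfl⟩
    · have hUX : ∀ᶠ y in (U : Filter M), y ∈ X := hU self_mem_nhdsWithin
      have hUy : Tendsto id (U : Filter M) (𝓝 y₀) := hU.trans inf_le_left
      obtain ⟨z₀, hz₀, hz⟩ := h.isCompact_sdiff.ultrafilter_le_nhds (U.map ζ)
        (le_principal_iff.2 (hUX.mono fun y hy => hζO y hy))
      have hz : Tendsto ζ U (𝓝 z₀) := hz
      have hzN : Tendsto ζ U (𝓝[B.nbhd] z₀) :=
        tendsto_nhdsWithin_iff.2 ⟨hz, hUX.mono fun y hy => (hζO y hy).1⟩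
      have hqz : Tendsto (fun y => q (ζ y)) U (𝓝 (q z₀)) := (hq.1 z₀ hz₀.1).tendsto.comp hzN
      have hj := h.joined_of_tendsto hUy hz (hXN hy₀)
        (hUX.mono fun y hy => ⟨hXN hy, hζf y hy, hζj y hy⟩) (hXS y₀ hy₀)
        fun k => h.disjoint_sdiff.le_bot ⟨hz₀, k⟩
      have hf := fibre_of_tendsto hUy (hUX.mono fun y hy => hXN hy) hz (hUX.mono fun y hy => hζf y hy)
      rw [tendsto_nhds_unique hm hqz]
      exact ((canon y₀ hy₀ z₀ ⟨hf, hz₀.2⟩).2 hj).symm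
  · rw [hq.2.2]
    apply Subset.antisymm
    · rintro _ ⟨y, hy, rfl⟩
      exact ⟨_, hζO y hy, rfl⟩
    · rintro _ ⟨z, hz, rfl⟩
      obtain ⟨y, hy, hj⟩ := BranchedSurface.exists_joined hX.isClosed hne hd hc hz.1
        (fun k => h.disjoint_sdiff.le_bot ⟨hz, k⟩)
      exact ⟨y, hy.1, (canon y hy.1 z ⟨mem_fibre_symm hz.1 hy.2, hz.2⟩).2 (hj.symm hz.1 hy.2)⟩
  · refine fibreMono_of_height hXN hfib fun y hy z hz κ hκ hle => ?_
    by_cases hj : B.Joined (range ι) y z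
    · rw [(heq y hy z hz).2 hj]
    have hyN := hXN hy
    have hy0 := self_mem_fibre hyN
    rw [BranchedSurface.joined_iff hκ hyN hy0 hz.2] at hj
    push Not at hj
    obtain ⟨x, hx, hxz⟩ := hj
    have e := B.fibre_eq _ hyN _ hz.2
    have k1 := hζf z hz.1
    rw [e] at k1
    have hj1 := (BranchedSurface.joined_iff hκ hyN hy0 (hζf y hy)).1 (hζj y hy) x hx
    have hj2 := (BranchedSurface.joined_iff hκ hyN hz.2 k1).1 (hζj z hz.1) x hx
    rw [uIcc_of_le hle] at hxz
    have hle' : κ.z (ζ y) ≤ κ.z (ζ z) := by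
      by_contra! hlt
      rw [mem_uIcc] at hj1 hj2
      push Not at hj1 hj2
      have := hj1.1 hxz.1
      have := hj2.2
      by_contra
      rcases le_or_gt (κ.z (ζ z)) (κ.z x) with k | k
      · linarith [hj2.2 k, hxz.2]
      · linarith
    exact hq.fibreMono.height subset_rfl (κ.fibre_source hκ hyN (hζf y hy)) (hζO y hy).1
      ⟨(hζO z hz.1).1, by rwa [B.fibre_eq _ hyN _ (hζf y hy)]⟩ hle'

end IsTube

namespace FibreMetric

/-- The point that divides the segment from `y` to `w` in the ratio `t : 1 - t`. -/
noncomputable def mix (D : FibreMetric B) (t : ℝ) (y w : M) : M :=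
  D.bary Finset.univ y ![1 - t, t] ![y, w]

variable {D : FibreMetric B} {t : ℝ} {y w : M}

theorem mix_aux (hy : y ∈ B.nbhd) (hw : w ∈ B.fibre y) (ht : t ∈ Icc (0 : ℝ) 1) :
    (∀ i ∈ Finset.univ, 0 ≤ (![1 - t, t] : Fin 2 → ℝ) i) ∧
    (∑ i, (![1 - t, t] : Fin 2 → ℝ) i = 1) ∧
    ∀ i ∈ Finset.univ, (![1 - t, t] : Fin 2 → ℝ) i ≠ 0 → (![y, w] : Fin 2 → M) i ∈ B.fibre y := by
  refine ⟨fun i _ => ?_, by simp, fun i _ _ => ?_⟩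
  · fin_cases i <;> simp <;> linarith [ht.1, ht.2]
  · fin_cases i
    exacts [self_mem_fibre hy, hw]

theorem mix_mem (hy : y ∈ B.nbhd) (hw : w ∈ B.fibre y) (ht : t ∈ Icc (0 : ℝ) 1) :
    D.mix t y w ∈ B.fibre y := by
  obtain ⟨h0, h1, h2⟩ := mix_aux hy hw ht
  exact (bary_spec hy h0 h1 h2).1

theorem coord_mix (hy : y ∈ B.nbhd) (hw : w ∈ B.fibre y) (ht : t ∈ Icc (0 : ℝ) 1) {c : M → ℝ}
    (hc : B.IsIsometric D.d y c) : c (D.mix t y w) = (1 - t) * c y + t * c w := by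
  obtain ⟨h0, h1, h2⟩ := mix_aux hy hw ht
  rw [mix, coord_bary hy hc h0 h1 h2]
  simp

theorem mix_zero (hy : y ∈ B.nbhd) (hw : w ∈ B.fibre y) : D.mix 0 y w = y := by
  obtain ⟨c, hc⟩ := D.coord y hy
  refine hc.1.2 (mix_mem hy hw (by simp)) (self_mem_fibre hy) ?_
  rw [coord_mix hy hw (by simp) hc]
  ring

theorem mix_one (hy : y ∈ B.nbhd) (hw : w ∈ B.fibre y) : D.mix 1 y w = w := by
  obtain ⟨c, hc⟩ := D.coord y hy
  refine hc.1.2 (mix_mem hy hw (by simp)) hw ?_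
  rw [coord_mix hy hw (by simp) hc]
  ring

theorem tendsto_mix {α : Type*} {l : Filter α} {τ : α → ℝ} {f g : α → M} (hy : y ∈ B.nbhd)
    (hw : w ∈ B.fibre y) (ht : t ∈ Icc (0 : ℝ) 1) (hf : Tendsto f l (𝓝 y)) (hg : Tendsto g l (𝓝 w))
    (hτ : Tendsto τ l (𝓝 t))
    (h : ∀ᶠ a in l, f a ∈ B.nbhd ∧ g a ∈ B.fibre (f a) ∧ τ a ∈ Icc (0 : ℝ) 1) :
    Tendsto (fun a => D.mix (τ a) (f a) (g a)) l (𝓝 (D.mix t y w)) := by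
  obtain ⟨h0, h1, h2⟩ := mix_aux hy hw ht
  refine tendsto_bary hy hf (h.mono fun a k => k.1)
    (h.mono fun a k => (mix_aux k.1 k.2.1 k.2.2).1) (h.mono fun a k => (mix_aux k.1 k.2.1 k.2.2).2.1)
    (h.mono fun a k => (mix_aux k.1 k.2.1 k.2.2).2.2) (fun i _ => ?_) h0 h1 h2 fun i _ _ => ?_
  · fin_cases i
    exacts [hτ.const_sub 1, hτ]
  · fin_cases i
    exacts [hf, hg]

/-- Moving along the fibres by a monotone injection is injective at all times. -/
theorem mix_injOn {X : Set M} (hX : X ⊆ B.nbhd) {g : M → M} (hg : B.FibreMono X g)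
    (hi : InjOn g X) (ht : t ∈ Icc (0 : ℝ) 1) : InjOn (fun y => D.mix t y (g y)) X := by
  have main : ∀ y ∈ X, ∀ z ∈ X ∩ B.fibre y, ∀ c, B.IsIsometric D.d y c → c y ≤ c z →
      D.mix t y (g y) = D.mix t z (g z) → y = z := by
    intro y hy z hz c hc hle e
    have hyN := hX hy
    have hcz : B.IsIsometric D.d z c := by
      rw [IsIsometric, B.fibre_eq _ hyN _ hz.2]; exact hc
    have e' := congrArg c e
    rw [coord_mix hyN (hg y hy).1 ht hc, coord_mix (hX hz.1) (hg z hz.1).1 ht hcz] at e'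
    have h2 := (hg y hy).2 z hz c hc.1 hle
    rcases ht.2.lt_or_eq with h | rfl
    · refine hc.1.2 (self_mem_fibre hyN) hz.2 (le_antisymm hle ?_)
      nlinarith [mul_le_mul_of_nonneg_left h2 ht.1]
    · refine hi hy hz.1 (hc.1.2 (hg y hy).1 ?_ (by linarith))
      rw [← B.fibre_eq _ hyN _ hz.2]
      exact (hg z hz.1).1
  intro y hy z hz e
  have hyN := hX hy
  have h1 := mix_mem (D := D) hyN (hg y hy).1 ht
  have h2 := mix_mem (D := D) (hX hz) (hg z hz).1 ht
  have h3 : B.fibre y = B.fibre z := by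
    rw [← B.fibre_eq _ hyN _ h1, ← B.fibre_eq _ (hX hz) _ h2]
    exact congrArg B.fibre e
  have hzy : z ∈ B.fibre y := h3 ▸ self_mem_fibre (hX hz)
  obtain ⟨c, hc⟩ := D.coord y hyN
  rcases le_total (c y) (c z) with h | h
  · exact main y hy z ⟨hz, hzy⟩ c hc h e
  · refine (main z hz y ⟨hy, h3 ▸ self_mem_fibre hyN⟩ c ?_ h e.symm).symm
    rw [IsIsometric, ← h3]
    exact hc

end FibreMetric

variable {S : Type u} [TopologicalSpace S] {ι : S → M} {O O' : Set M} {ρ : O → S} {ρ' : O' → S}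

/-- The laminations of two regular neighbourhoods of the same surface are isotopic. -/
theorem IsTube.isotopicLaminations (D : FibreMetric B) (h : B.IsTube ι O ρ)
    (h' : B.IsTube ι O' ρ') {L L' : Lamination M} {q q' : M → M} (hq : B.IsCollapse O L q)
    (hq' : B.IsCollapse O' L' q') (hint : interior L.carrier = ∅)
    (hint' : interior L'.carrier = ∅) : B.IsotopicLaminations L L' := by
  obtain ⟨f, hfc, hfim, hfm, hfj, -⟩ := h'.exists_transfer hq' h.isCompact_sdiff sdiff_subset
    (fun y hy => h.fibre_sdiff_nonempty hy) h.disjoint_sdiff h.cuts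
  have hqc : ContinuousOn q (B.nbhd \ O) := hq.1.mono sdiff_subset
  have hqim : q '' (B.nbhd \ O) = L.carrier := hq.2.2.symm
  have hqm := hq.fibreMono
  have same : ∀ k : M → M, B.FibreMono (B.nbhd \ O) k → ∀ y ∈ B.nbhd \ O, ∀ z ∈ B.nbhd \ O,
      k y = k z → z ∈ B.fibre y := by
    intro k hk y hy z hz e
    rw [← B.fibre_eq _ hy.1 _ (hk y hy).1, e, B.fibre_eq _ hz.1 _ (hk z hz).1]
    exact self_mem_fibre hz.1
  have hqm' : B.FibreMono (B.nbhd \ O) q := fun y hy =>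
    ⟨(hqm y hy.1).1, fun z hz => (hqm y hy.1).2 z ⟨hz.1.1, hz.2⟩⟩
  have hiff : ∀ y ∈ B.nbhd \ O, ∀ z ∈ B.nbhd \ O, q y = q z ↔ f y = f z := by
    intro y hy z hz
    constructor
    · intro e
      have hzy := same q hqm' y hy z hz e
      rwa [hfj y hy z ⟨hz, hzy⟩, ← h.eq_iff hq hy ⟨hzy, hz.2⟩]
    · intro e
      have hzy := same f hfm y hy z hz e
      rwa [hfj y hy z ⟨hz, hzy⟩, ← h.eq_iff hq hy ⟨hzy, hz.2⟩] at e
  obtain ⟨g, hgc, hg⟩ := h.isCompact_sdiff.exists_continuousOn_factor id hqc hfc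
    fun y hy z hz => (hiff y hy z hz).1
  obtain ⟨g', hgc', hg'⟩ := h.isCompact_sdiff.exists_continuousOn_factor id hfc hqc
    fun y hy z hz => (hiff y hy z hz).2
  rw [hqim] at hgc
  rw [hfim] at hgc'
  have hLN : L.carrier ⊆ B.nbhd := by
    rw [← hqim]
    rintro _ ⟨y, hy, rfl⟩
    exact fibre_subset hy.1 (hqm y hy.1).1
  have hgm : B.FibreMono L.carrier g := by
    refine fibreMono_of_height hLN ?_ ?_
    · rw [← hqim]
      rintro _ ⟨y, hy, rfl⟩
      rw [hg y hy, B.fibre_eq _ hy.1 _ (hqm y hy.1).1]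
      exact (hfm y hy).1
    · rw [← hqim]
      rintro _ ⟨y, hy, rfl⟩ _ ⟨⟨z, hz, rfl⟩, hzy⟩ κ hκ hle
      rw [hg y hy, hg z hz]
      have hqy := (hqm y hy.1).1
      have hqz := (hqm z hz.1).1
      have hyκ : y ∈ κ.chart.source :=
        κ.fibre_source hκ (fibre_subset hy.1 hqy) (mem_fibre_symm hy.1 hqy)
      rw [B.fibre_eq _ hy.1 _ hqy] at hzy
      have hzf : z ∈ B.fibre y := by
        rw [← B.fibre_eq _ hy.1 _ hzy]; exact mem_fibre_symm hz.1 hqz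
      have hzκ := κ.fibre_source hyκ hy.1 hzf
      rcases le_total (κ.z y) (κ.z z) with k | k
      · exact hfm.height sdiff_subset hyκ hy ⟨hz, hzf⟩ k
      · have := hqm'.height sdiff_subset hzκ hz ⟨hy, mem_fibre_symm hy.1 hzf⟩ k
        have e := (κ.isCoordinate_z hyκ hy.1).2 hqy hzy (le_antisymm hle this)
        rw [(hiff y hy z hz).1 e]
  have hinv : InvOn g' g L.carrier L'.carrier := by
    rw [← hqim, ← hfim]
    constructor
    · rintro _ ⟨y, hy, rfl⟩
      rw [hg y hy, hg' y hy]
    · rintro _ ⟨y, hy, rfl⟩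
      rw [hg' y hy, hg y hy]
  have hmaps : MapsTo g L.carrier L'.carrier := by
    rw [← hqim, ← hfim]
    rintro _ ⟨y, hy, rfl⟩
    exact ⟨y, hy, (hg y hy).symm⟩
  have hmaps' : MapsTo g' L'.carrier L.carrier := by
    rw [← hqim, ← hfim]
    rintro _ ⟨y, hy, rfl⟩
    exact ⟨y, hy, (hg' y hy).symm⟩
  have h1 : EqOn (fun y => D.mix 1 y (g y)) g L.carrier := fun y hy =>
    D.mix_one (hLN hy) (hgm y hy).1
  refine ⟨fun t y => D.mix t y (g y), ?_, fun t ht => ⟨FibreMetric.mix_injOn hLN hgm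
    hinv.1.injOn ht, fun y hy => D.mix_mem (hLN hy) (hgm y hy).1 ht⟩,
    fun y hy => D.mix_zero (hLN hy) (hgm y hy).1, ?_, ?_, g', ?_, ?_⟩
  · rintro ⟨t, y⟩ ⟨ht, hy⟩
    refine D.tendsto_mix (hLN hy) (hgm y hy).1 ht ?_ ?_ ?_ ?_
    · exact continuousAt_snd.tendsto.mono_left inf_le_left
    · have : Tendsto (Prod.snd : ℝ × M → M) (𝓝[Icc (0 : ℝ) 1 ×ˢ L.carrier] (t, y))
          (𝓝[L.carrier] y) := tendsto_nhdsWithin_iff.2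
        ⟨continuousAt_snd.tendsto.mono_left inf_le_left,
          eventually_mem_nhdsWithin.mono fun x hx => hx.2⟩
      exact (hgc y hy).tendsto.comp this
    · exact continuousAt_fst.tendsto.mono_left inf_le_left
    · filter_upwards [eventually_mem_nhdsWithin] with x hx
      exact ⟨hLN hx.2, (hgm _ hx.2).1, hx.1⟩
  · rw [h1.image_eq]
    apply Subset.antisymm (image_subset_iff.2 hmaps)
    exact fun y hy => ⟨g' y, hmaps' hy, hinv.2 hy⟩
  · exact Lamination.plaquePreserving hint' (hgc.congr h1)
      fun y hy => Set.mem_of_eq_of_mem (h1 hy) (hmaps hy)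
  · exact ⟨fun y hy => (congrArg g' (h1 hy)).trans (hinv.1 hy),
      fun y hy => (h1 (hmaps' hy)).trans (hinv.2 hy)⟩
  · exact Lamination.plaquePreserving hint hgc' hmaps'

/-! ### The local product structure of a carried lamination -/

theorem modelN_eq_slab (k : Fin 3) : ∃ m n, modelN k = slab m n := by
  fin_cases k
  · refine ⟨.absent, .absent, ?_⟩
    ext q; simp [modelN, slab, SlotMode.Active]
  · refine ⟨.branch, .absent, ?_⟩
    ext q; simp [modelN, slab, SlotMode.Active]
  · refine ⟨.branch, .branch, ?_⟩
    ext q; simp [modelN, slab, SlotMode.Active]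

theorem IsVertical.exists_column {φ : OpenPartialHomeomorph M Space3} (h : B.IsVertical φ) :
    ∃ κ : Column B, φ.source ⊆ κ.chart.source ∧
      ∃ e : ℝ × ℝ → ℝ × ℝ, IsOpenEmbedding e ∧ ∀ y ∈ φ.source, κ.v y = e (φ y).1 := by
  obtain ⟨-, k, ψ, hψ, hs, e, he, h⟩ := h
  obtain ⟨m, n, hmn⟩ := modelN_eq_slab k
  exact ⟨⟨ψ, m, n, hmn ▸ BranchedSurface.IsModelChart.fibreChart hψ⟩, hs, e, he, h⟩

variable {L : Lamination M}

/-- A vertical product chart around a point of the lamination. -/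
theorem Carries.exists_chart (hL : B.Carries L) {l₀ : M} (hl₀ : l₀ ∈ L.carrier) :
    ∃ (φ : OpenPartialHomeomorph M Space3) (C : Set ℝ), l₀ ∈ φ.source ∧ φ.target = univ ∧
      (∀ y ∈ φ.source, y ∈ L.carrier ↔ (φ y).2 ∈ C) ∧
      (∃ κ : Column B, φ.source ⊆ κ.chart.source ∧
        ∃ e : ℝ × ℝ → ℝ × ℝ, IsOpenEmbedding e ∧ ∀ y ∈ φ.source, κ.v y = e (φ y).1) ∧
      (∀ y ∈ φ.source ∩ B.nbhd, ∀ w ∈ φ.source ∩ B.fibre y, (φ w).1 = (φ y).1) ∧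
      ∀ᶠ q : M × ℝ in 𝓝 (l₀, (φ l₀).2), q.1 ∈ φ.source ∧ (q.1 ∈ B.nbhd → q.2 ∈ C →
        φ.symm ((φ q.1).1, q.2) ∈ L.carrier ∩ B.fibre q.1) := by
  obtain ⟨φ, hl, hv, ⟨ht, C, -, hC⟩, -⟩ := hL.2 l₀ hl₀
  obtain ⟨κ, hs, e, he, hκ⟩ := hv.exists_column
  refine ⟨φ, C, hl, ht, hC, ⟨κ, hs, e, he, hκ⟩, ?_, ?_⟩
  · intro y hy w hw
    have := κ.fibre_v (hs hy.1) hy.2 hw.2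
    rw [hκ _ hy.1, hκ _ hw.1] at this
    exact he.injective this
  have htar : ∀ q, q ∈ φ.target := fun q => by rw [ht]; trivial
  have hc : ContinuousAt (fun q : M × ℝ => φ.symm ((φ q.1).1, q.2)) (l₀, (φ l₀).2) := by
    have h1 : ContinuousAt (fun q : M × ℝ => ((φ q.1).1, q.2)) (l₀, (φ l₀).2) := by
      have := (φ.continuousAt hl)
      exact (ContinuousAt.fst (ContinuousAt.comp (f := Prod.fst) (x := (l₀, (φ l₀).2)) this
        continuousAt_fst)).prodMk continuousAt_snd
    exact ContinuousAt.comp (f := fun q : M × ℝ => ((φ q.1).1, q.2))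
      (φ.continuousAt_symm (htar _)) h1
  have e0 : φ.symm ((φ l₀).1, (φ l₀).2) = l₀ := φ.left_inv hl
  have hz1 : ∀ᶠ w in 𝓝 l₀, |κ.z w - κ.z l₀| < 1 / 2 := by
    have := (κ.continuousAt_z (hs hl)).sub_const (κ.z l₀)
    have := this.abs
    refine this.eventually_lt_const ?_
    simp
  have h2 : ∀ᶠ q : M × ℝ in 𝓝 (l₀, (φ l₀).2),
      |κ.z (φ.symm ((φ q.1).1, q.2)) - κ.z l₀| < 1 / 2 := by
    have hc' := hc.tendsto
    dsimp only at hc'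
    rw [e0] at hc'
    exact hc'.eventually hz1
  have h3 : ∀ᶠ q : M × ℝ in 𝓝 (l₀, (φ l₀).2), q.1 ∈ φ.source ∧ |κ.z q.1 - κ.z l₀| < 1 / 2 :=
    (continuousAt_fst (p := (l₀, (φ l₀).2))).eventually
      (p := fun w => w ∈ φ.source ∧ |κ.z w - κ.z l₀| < 1 / 2) ((show ∀ᶠ w in 𝓝 l₀, w ∈ φ.source from φ.open_source.mem_nhds hl).and hz1)
  filter_upwards [h2, h3] with q h2 h3
  refine ⟨h3.1, fun hN hqC => ?_⟩
  set G := φ.symm ((φ q.1).1, q.2) with hG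
  have hGs : G ∈ φ.source := φ.map_target (htar _)
  have hGφ : φ G = ((φ q.1).1, q.2) := φ.right_inv (htar _)
  have hGL : G ∈ L.carrier := by rw [hC _ hGs, hGφ]; exact hqC
  have hv : κ.v G = κ.v q.1 := by rw [hκ _ hGs, hκ _ h3.1, hGφ]
  refine ⟨hGL, (κ.mem_fibre (hs h3.1) hN).2 ⟨hs hGs, hv, ?_⟩⟩
  have k1 := (κ.mem_nbhd (hs h3.1)).1 hN
  have k2 := (κ.mem_nbhd (hs hGs)).1 (hL.1 hGL)
  rw [hv] at k2
  refine Column.S_uIcc k1 k2 ?_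
  have := h3.2
  rw [abs_lt] at h2 this ⊢
  constructor <;> linarith

/-- Lower semicontinuity: points of `N(B)` near a point of the lamination have points of the
lamination nearby in their fibres. -/
theorem Carries.exists_tendsto (hL : B.Carries L) {α : Type*} {l : Filter α} {x : α → M}
    {l₀ : M} (hl₀ : l₀ ∈ L.carrier) (hx : Tendsto x l (𝓝 l₀)) (hN : ∀ᶠ i in l, x i ∈ B.nbhd) :
    ∃ w : α → M, Tendsto w l (𝓝 l₀) ∧ ∀ᶠ i in l, w i ∈ L.carrier ∩ B.fibre (x i) := by
  obtain ⟨φ, C, hl, ht, hC, -, -, hev⟩ := hL.exists_chart hl₀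
  refine ⟨fun i => φ.symm ((φ (x i)).1, (φ l₀).2), ?_, ?_⟩
  · have h1 : Tendsto (fun i => ((φ (x i)).1, (φ l₀).2)) l (𝓝 (φ l₀)) :=
      (((φ.continuousAt hl).tendsto.comp hx).fst_nhds.prodMk_nhds tendsto_const_nhds)
    have h2 := (φ.continuousAt_symm (x := φ l₀) (by rw [ht]; trivial)).tendsto
    rw [φ.left_inv hl] at h2
    exact h2.comp h1
  · have := (hx.prodMk_nhds tendsto_const_nhds).eventually hev
    filter_upwards [this, hN] with i h1 h2
    exact h1.2 h2 ((hC _ hl).1 hl₀)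

theorem Carries.not_mem_vertInterior (hL : B.Carries L) {l₀ : M} (hl₀ : l₀ ∈ L.carrier) :
    l₀ ∉ B.vertInterior := by
  obtain ⟨φ, C, hl, ht, hC, ⟨κ, hs, e, he, hκ⟩, -, -⟩ := hL.exists_chart hl₀
  intro hv
  rw [κ.mem_vertInterior (hs hl)] at hv
  have htar : ∀ q, q ∈ φ.target := fun q => by rw [ht]; trivial
  set P : ℝ × ℝ → M := fun x => φ.symm (x, (φ l₀).2) with hP
  have hPc : ContinuousAt P (φ l₀).1 := by
    refine ContinuousAt.comp (f := fun x => (x, (φ l₀).2)) (φ.continuousAt_symm (htar _)) ?_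
    fun_prop
  have hP0 : P (φ l₀).1 = l₀ := φ.left_inv hl
  have hS : ∀ x, κ.S (e x) (κ.z (P x)) := by
    intro x
    have k1 : P x ∈ φ.source := φ.map_target (htar _)
    have k2 : φ (P x) = (x, (φ l₀).2) := φ.right_inv (htar _)
    have k3 : P x ∈ L.carrier := by rw [hC _ k1, k2]; exact (hC _ hl).1 hl₀
    have := (κ.mem_nbhd (hs k1)).1 (hL.1 k3)
    rwa [hκ _ k1, k2] at this
  have hz : Tendsto (fun x => κ.z (P x)) (𝓝 (φ l₀).1) (𝓝 (κ.z l₀)) := by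
    have := κ.continuousAt_z (hs hl)
    rw [← hP0] at this
    have h2 := ContinuousAt.comp (f := P) this hPc
    rw [ContinuousAt] at h2
    rwa [Function.comp_apply, hP0] at h2
  have hmap : map e (𝓝 (φ l₀).1) = 𝓝 (κ.v l₀) := by
    rw [he.map_nhds_eq, hκ _ hl]
  have freq : ∀ (P1 : ℝ × ℝ → Prop), (∃ᶠ u in 𝓝 (κ.v l₀), P1 u) →
      ∃ᶠ x in 𝓝 (φ l₀).1, P1 (e x) := by
    intro P1 h
    rwa [← hmap, frequently_map] at h
  rcases hv with ⟨h1, h2, h3⟩ | ⟨h1, h2, h3⟩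
  · have hf : ∃ᶠ u in 𝓝 (κ.v l₀), 0 < u.1 := by
      have hc : Tendsto (fun t : ℝ => κ.v l₀ + (t, 0)) (𝓝[>] 0) (𝓝 (κ.v l₀)) := by
        refine tendsto_nhdsWithin_of_tendsto_nhds ?_
        have : Continuous fun t : ℝ => κ.v l₀ + (t, 0) := by fun_prop
        convert this.tendsto 0 using 2
        simp
      refine hc.frequently (Eventually.frequently ?_)
      filter_upwards [self_mem_nhdsWithin] with t ht
      simpa [h2] using ht
    obtain ⟨x, hx1, hx2⟩ := ((freq _ hf).and_eventually (hz.eventually (Ioo_mem_nhds h3.1 h3.2))).exists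
    exact (hS x).2.1 ⟨by rw [h1]; exact hx1, hx2.1, hx2.2⟩
  · have hf : ∃ᶠ u in 𝓝 (κ.v l₀), 0 < u.2 := by
      have hc : Tendsto (fun t : ℝ => κ.v l₀ + (0, t)) (𝓝[>] 0) (𝓝 (κ.v l₀)) := by
        refine tendsto_nhdsWithin_of_tendsto_nhds ?_
        have : Continuous fun t : ℝ => κ.v l₀ + (0, t) := by fun_prop
        convert this.tendsto 0 using 2
        simp
      refine hc.frequently (Eventually.frequently ?_)
      filter_upwards [self_mem_nhdsWithin] with t ht
      simpa [h2] using ht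
    obtain ⟨x, hx1, hx2⟩ := ((freq _ hf).and_eventually (hz.eventually (Ioo_mem_nhds h3.1 h3.2))).exists
    exact (hS x).2.2 ⟨by rw [h1]; exact hx1, hx2.1, hx2.2⟩

theorem Carries.isCompact (hL : B.Carries L) : IsCompact L.carrier :=
  B.isCompact_nbhd.of_isClosed_subset L.isClosed_carrier hL.1

/-! ### Gaps -/

/-- Not being separated by a closed set is an open condition. -/
theorem Joined.eventually {X : Set M} (hX : IsClosed X) {α : Type*} {l : Filter α} {y w : α → M}
    {y₀ w₀ : M} (h : B.Joined X y₀ w₀) (hy : Tendsto y l (𝓝 y₀)) (hw : Tendsto w l (𝓝 w₀))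
    (hf : ∀ᶠ i in l, y i ∈ B.nbhd ∧ w i ∈ B.fibre (y i)) : ∀ᶠ i in l, B.Joined X (y i) (w i) := by
  by_contra hcon
  have hfr : ∃ᶠ i in l, ¬ B.Joined X (y i) (w i) := not_eventually.1 hcon
  set l' := l ⊓ 𝓟 {i | ¬ B.Joined X (y i) (w i)} with hl'
  have : l'.NeBot := frequently_iff_neBot.1 hfr
  let U := Ultrafilter.of l'
  have hU : (U : Filter α) ≤ l := (Ultrafilter.of_le l').trans inf_le_left
  have hUn : ∀ᶠ i in (U : Filter α), ¬ B.Joined X (y i) (w i) :=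
    (Ultrafilter.of_le l').trans inf_le_right (mem_principal_self _)
  have hex : ∀ i, ∃ x, ¬ B.Joined X (y i) (w i) → x ∈ B.seg (y i) (w i) ∧ x ∈ X := by
    intro i
    by_cases hi : B.Joined X (y i) (w i)
    · exact ⟨y i, fun k => absurd hi k⟩
    · obtain ⟨x, hx⟩ := Set.not_disjoint_iff.1 hi
      exact ⟨x, fun _ => hx⟩
  choose x hx using hex
  have hUf := hf.filter_mono hU
  obtain ⟨x₀, -, hx₀⟩ := B.isCompact_nbhd.ultrafilter_le_nhds (U.map x) (le_principal_iff.2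
    ((hUn.and hUf).mono fun i k => fibre_subset k.2.1 (hx i k.1).1.1))
  have hx₀ : Tendsto x U (𝓝 x₀) := hx₀
  have hxX : x₀ ∈ X := hX.mem_of_tendsto hx₀ (hUn.mono fun i k => (hx i k).2)
  have hxs := seg_of_tendsto (hy.mono_left hU) (hUf.mono fun i k => k.1) (hw.mono_left hU)
    (hUf.mono fun i k => k.2) hx₀ (hUn.mono fun i k => (hx i k).1)
  exact h.le_bot ⟨hxs, hxX⟩

/-- `a` and `b` are the lower and upper ends of the gap of `X` that contains `y`. -/
structure Ends (B : BranchedSurface M) (X : Set M) (κ : Column B) (y a b : M) : Prop where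
  left : a ∈ X ∩ B.fibre y
  right : b ∈ X ∩ B.fibre y
  left_lt : κ.z a < κ.z y
  lt_right : κ.z y < κ.z b
  out : ∀ x ∈ X ∩ B.fibre y, κ.z x ≤ κ.z a ∨ κ.z b ≤ κ.z x

variable {κ : Column B}

theorem gapRegion_subset : B.gapRegion L ⊆ B.nbhd := fun _ hy => hy.1.1

theorem cuspRegion_subset : B.cuspRegion L ⊆ B.gapRegion L := by
  rintro y ⟨v, -, hy⟩
  exact connectedComponentIn_subset _ _ hy

theorem isCompact_heights {X : Set M} (hX : IsClosed X) {y : M} (hκ : y ∈ κ.chart.source)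
    (hy : y ∈ B.nbhd) : IsCompact (κ.z '' (X ∩ B.fibre y)) := by
  obtain ⟨lo, hi, hlt, -, hI⟩ := κ.exists_Icc hκ hy
  have e : κ.z '' (X ∩ B.fibre y) = Icc lo hi ∩ (fun t => κ.pt (κ.v y) t) ⁻¹' X := by
    ext t
    constructor
    · rintro ⟨x, ⟨hx, hxf⟩, rfl⟩
      have e : κ.pt (κ.v y) (κ.z x) = x := by
        rw [← κ.fibre_v hκ hy hxf]; exact κ.pt_v_z (κ.fibre_source hκ hy hxf)
      exact ⟨(hI _).1 (by rwa [e]), by rwa [mem_preimage, e]⟩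
    · rintro ⟨ht, hx⟩
      exact ⟨_, ⟨hx, (hI _).2 ht⟩, κ.z_pt _ _⟩
  rw [e]
  exact isCompact_Icc.inter_right (hX.preimage (κ.continuous_pt_right _))

theorem exists_ends {y : M} (hκ : y ∈ κ.chart.source) (hy : y ∈ B.gapRegion L) :
    ∃ a b, B.Ends L.carrier κ y a b := by
  obtain ⟨⟨hN, hyL⟩, l, hl, l', hl', hs⟩ := hy
  have hinj := (κ.isCoordinate_z hκ hN).2
  have h0 := self_mem_fibre hN
  have hcpt := isCompact_heights (κ := κ) L.isClosed_carrier hκ hN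
  rw [κ.mem_seg' hκ hN hl.2 hl'.2, mem_uIcc] at hs
  have hb : (κ.z '' (L.carrier ∩ B.fibre y) ∩ Iic (κ.z y)).Nonempty := by
    rcases hs.2 with k | k
    exacts [⟨_, ⟨l, hl, rfl⟩, k.1⟩, ⟨_, ⟨l', hl', rfl⟩, k.1⟩]
  have ha : (κ.z '' (L.carrier ∩ B.fibre y) ∩ Ici (κ.z y)).Nonempty := by
    rcases hs.2 with k | k
    exacts [⟨_, ⟨l', hl', rfl⟩, k.2⟩, ⟨_, ⟨l, hl, rfl⟩, k.2⟩]
  obtain ⟨_, ⟨⟨a, ha1, rfl⟩, ha2⟩, ha3⟩ := (hcpt.inter_right isClosed_Iic).exists_isGreatest hb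
  obtain ⟨_, ⟨⟨b, hb1, rfl⟩, hb2⟩, hb3⟩ := (hcpt.inter_right isClosed_Ici).exists_isLeast ha
  refine ⟨a, b, ha1, hb1, lt_of_le_of_ne ha2 fun e => ?_, lt_of_le_of_ne hb2 fun e => ?_, ?_⟩
  · exact hyL (hinj ha1.2 h0 e ▸ ha1.1)
  · exact hyL (hinj h0 hb1.2 e ▸ hb1.1)
  · intro x hx
    rcases le_total (κ.z x) (κ.z y) with k | k
    · exact .inl (ha3 ⟨⟨x, hx, rfl⟩, k⟩)
    · exact .inr (hb3 ⟨⟨x, hx, rfl⟩, k⟩)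

namespace Ends

variable {X : Set M} {y a b w : M}

theorem unique (h : B.Ends X κ y a b) {a' b' : M} (h' : B.Ends X κ y a' b')
    (hκ : y ∈ κ.chart.source) (hy : y ∈ B.nbhd) : a' = a ∧ b' = b := by
  have hinj := (κ.isCoordinate_z hκ hy).2
  have h1 := h.left_lt
  have h2 := h.lt_right
  have h3 := h'.left_lt
  have h4 := h'.lt_right
  constructor
  · refine hinj h'.left.2 h.left.2 (le_antisymm ?_ ?_)
    · rcases h.out a' h'.left with k | k <;> linarith
    · rcases h'.out a h.left with k | k <;> linarith
  · refine hinj h'.right.2 h.right.2 (le_antisymm ?_ ?_)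
    · rcases h'.out b h.right with k | k <;> linarith
    · rcases h.out b' h'.right with k | k <;> linarith

theorem joined_iff (h : B.Ends X κ y a b) (hκ : y ∈ κ.chart.source) (hy : y ∈ B.nbhd)
    (hw : w ∈ B.fibre y) : B.Joined X y w ↔ κ.z a < κ.z w ∧ κ.z w < κ.z b := by
  rw [BranchedSurface.joined_iff hκ hy (self_mem_fibre hy) hw]
  have h1 := h.left_lt
  have h2 := h.lt_right
  constructor
  · intro k
    have k1 := k a h.left
    have k2 := k b h.right
    rw [mem_uIcc] at k1 k2
    push Not at k1 k2
    constructor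
    · by_contra hc
      linarith [k1.2 (not_lt.1 hc)]
    · by_contra hc
      linarith [k2.1 h2.le]
  · rintro ⟨h3, h4⟩ x hx hxz
    rw [mem_uIcc] at hxz
    rcases h.out x hx with k | k <;> rcases hxz with k' | k' <;> linarith

theorem of_joined (h : B.Ends X κ y a b) (hκ : y ∈ κ.chart.source) (hy : y ∈ B.nbhd)
    (hw : w ∈ B.fibre y) (hj : B.Joined X y w) : B.Ends X κ w a b := by
  have e := B.fibre_eq _ hy _ hw
  obtain ⟨h1, h2⟩ := (h.joined_iff hκ hy hw).1 hj
  exact ⟨e ▸ h.left, e ▸ h.right, h1, h2, fun x hx => h.out x (e ▸ hx)⟩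

theorem flip (h : B.Ends X κ y a b) (hκ : y ∈ κ.chart.source) (hy : y ∈ B.nbhd) :
    B.Ends X κ.flip y b a := by
  have hs : ∀ x ∈ B.fibre y, κ.flip.z x = - κ.z x := fun x hx =>
    κ.flip_z (κ.fibre_source hκ hy hx)
  refine ⟨h.right, h.left, ?_, ?_, fun x hx => ?_⟩
  · rw [hs _ h.right.2, hs _ (self_mem_fibre hy)]; exact neg_lt_neg h.lt_right
  · rw [hs _ h.left.2, hs _ (self_mem_fibre hy)]; exact neg_lt_neg h.left_lt
  · rw [hs _ h.right.2, hs _ h.left.2, hs _ hx.2, neg_le_neg_iff, neg_le_neg_iff]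
    exact (h.out x hx).symm

end Ends

theorem Ends.mem_gapRegion {y a b : M} (h : B.Ends L.carrier κ y a b) (hκ : y ∈ κ.chart.source)
    (hy : y ∈ B.nbhd) : y ∈ B.gapRegion L := by
  have h1 := h.left_lt
  have h2 := h.lt_right
  refine ⟨⟨hy, fun k => ?_⟩, a, h.left, b, h.right,
    (κ.mem_seg' hκ hy h.left.2 h.right.2).2 ⟨self_mem_fibre hy, ?_⟩⟩
  · rcases h.out y ⟨k, self_mem_fibre hy⟩ with k | k <;> linarith
  · rw [uIcc_of_le (by linarith)]
    exact ⟨h1.le, h2.le⟩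

theorem mem_gapRegion_of_joined {y w : M} (hy : y ∈ B.gapRegion L) (hw : w ∈ B.fibre y)
    (hj : B.Joined L.carrier y w) : w ∈ B.gapRegion L := by
  have hN := gapRegion_subset hy
  obtain ⟨κ, hκ, -⟩ := exists_column B hN
  obtain ⟨a, b, h⟩ := exists_ends hκ hy
  exact (h.of_joined hκ hN hw hj).mem_gapRegion (κ.fibre_source hκ hN hw) (fibre_subset hN hw)

theorem isPreconnected_seg {y w : M} (hy : y ∈ B.nbhd) (hw : w ∈ B.fibre y) :
    IsPreconnected (B.seg y w) := by
  obtain ⟨κ, hκ, -⟩ := exists_column B hy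
  have e : B.seg y w = (fun t => κ.pt (κ.v y) t) '' uIcc (κ.z y) (κ.z w) := by
    ext x
    rw [κ.mem_seg hκ hy hw]
    constructor
    · rintro ⟨h1, h2⟩
      refine ⟨_, h2, ?_⟩
      rw [← κ.fibre_v hκ hy h1]
      exact κ.pt_v_z (κ.fibre_source hκ hy h1)
    · rintro ⟨t, ht, rfl⟩
      exact ⟨κ.fibre_uIcc hκ hy (self_mem_fibre hy) hw ht, by rwa [κ.z_pt]⟩
  rw [e]
  exact isPreconnected_uIcc.image _ (κ.continuous_pt_right _).continuousOn

theorem Joined.seg_subset_gapRegion {y w : M} (hj : B.Joined L.carrier y w)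
    (hy : y ∈ B.gapRegion L) (hw : w ∈ B.fibre y) : B.seg y w ⊆ B.gapRegion L := by
  intro x hx
  refine mem_gapRegion_of_joined hy hx.1 (hj.mono_left ?_)
  have hN := gapRegion_subset hy
  obtain ⟨κ, hκ, -⟩ := exists_column B hN
  intro x' hx'
  rw [κ.mem_seg hκ hN hw] at hx ⊢
  rw [κ.mem_seg hκ hN hx.1] at hx'
  exact ⟨hx'.1, uIcc_subset_uIcc_left hx.2 hx'.2⟩

theorem mem_cuspRegion_of_joined {y w : M} (hy : y ∈ B.cuspRegion L) (hw : w ∈ B.fibre y)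
    (hj : B.Joined L.carrier y w) : w ∈ B.cuspRegion L := by
  obtain ⟨v, hv, hyv⟩ := hy
  have hyG := connectedComponentIn_subset _ _ hyv
  have hN := gapRegion_subset hyG
  refine ⟨v, hv, ?_⟩
  rw [connectedComponentIn_eq hyv]
  exact (isPreconnected_seg hN hw).subset_connectedComponentIn (left_mem_seg hN _)
    (hj.seg_subset_gapRegion hyG hw) (right_mem_seg hw)

/-- The components of the traces of the cusp region on the fibres are the gaps. -/
theorem mem_component_iff {y w : M} (hy : y ∈ B.cuspRegion L) :
    w ∈ connectedComponentIn (B.cuspRegion L ∩ B.fibre y) y ↔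
      w ∈ B.fibre y ∧ B.Joined L.carrier y w := by
  have hN := gapRegion_subset (cuspRegion_subset hy)
  have h0 := self_mem_fibre hN
  constructor
  · intro h
    have hsub := connectedComponentIn_subset _ _ h
    refine ⟨hsub.2, ?_⟩
    obtain ⟨κ, hκ, -⟩ := exists_column B hN
    rw [joined_iff hκ hN h0 hsub.2]
    intro x hx hxz
    have hc : IsPreconnected (κ.z '' connectedComponentIn (B.cuspRegion L ∩ B.fibre y) y) := by
      refine isPreconnected_connectedComponentIn.image _ ?_
      refine (κ.isCoordinate_z hκ hN).1.mono ?_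
      exact (connectedComponentIn_subset _ _).trans inter_subset_right
    have := hc.ordConnected.uIcc_subset ⟨y, mem_connectedComponentIn ⟨hy, h0⟩, rfl⟩ ⟨w, h, rfl⟩ hxz
    obtain ⟨x', hx', e⟩ := this
    have hs := connectedComponentIn_subset _ _ hx'
    have := (κ.isCoordinate_z hκ hN).2 hs.2 hx.2 e
    subst this
    exact (cuspRegion_subset hs.1).1.2 hx.1
  · rintro ⟨hw, hj⟩
    refine (isPreconnected_seg hN hw).subset_connectedComponentIn (left_mem_seg hN _) ?_
      (right_mem_seg hw)
    intro x hx
    refine ⟨mem_cuspRegion_of_joined hy hx.1 (hj.mono_left ?_), hx.1⟩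
    obtain ⟨κ, hκ, -⟩ := exists_column B hN
    intro x' hx'
    rw [κ.mem_seg hκ hN hw] at hx ⊢
    rw [κ.mem_seg hκ hN hx.1] at hx'
    exact ⟨hx'.1, uIcc_subset_uIcc_left hx.2 hx'.2⟩

variable {L : Lamination M} {κ : Column B}

/-! ### The blow-down -/

section core
variable {S : Type u} {ι : S → M}

theorem IsCoreSurface.mem (h : B.IsCoreSurface L ι) (s : S) : ι s ∈ B.cuspRegion L := h.1 ⟨s, rfl⟩

theorem IsCoreSurface.eq_of_joined (h : B.IsCoreSurface L ι) {y : M} (hy : y ∈ B.cuspRegion L)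
    {s s' : S} (hs : ι s ∈ B.fibre y) (hs' : ι s' ∈ B.fibre y) (h1 : B.Joined L.carrier y (ι s))
    (h2 : B.Joined L.carrier y (ι s')) : s = s' :=
  (h.2 y hy).unique ((mem_component_iff hy).2 ⟨hs, h1⟩) ((mem_component_iff hy).2 ⟨hs', h2⟩)

theorem IsCoreSurface.disjoint (h : B.IsCoreSurface L ι) : Disjoint L.carrier (range ι) := by
  rw [Set.disjoint_left]
  rintro _ hx ⟨s, rfl⟩
  exact (cuspRegion_subset (h.mem s)).1.2 hx

theorem IsCoreSurface.cuts (h : B.IsCoreSurface L ι) : B.Cuts ι L.carrier := by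
  intro s
  have hG := cuspRegion_subset (h.mem s)
  have hN := gapRegion_subset hG
  have h0 := self_mem_fibre hN
  obtain ⟨κ, hκ, -⟩ := exists_column B hN
  obtain ⟨a, b, hab⟩ := exists_ends hκ hG
  have h1 := hab.left_lt
  have h2 := hab.lt_right
  have hinj := (κ.isCoordinate_z hκ hN).2
  have hms := fun x => κ.mem_seg' (x := x) hκ hN hab.left.2 hab.right.2
  rw [uIcc_of_le (by linarith)] at hms
  refine ⟨a, hab.left, b, hab.right, (hms _).2 ⟨h0, h1.le, h2.le⟩, fun s' hs' => ?_⟩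
  rw [hms] at hs'
  refine h.eq_of_joined (h.mem s) hs'.1 h0 ((hab.joined_iff hκ hN hs'.1).2
    ⟨lt_of_le_of_ne hs'.2.1 fun e => ?_, lt_of_le_of_ne hs'.2.2 fun e => ?_⟩)
    ((joined_self hN).2 hG.1.2)
  · exact h.disjoint.le_bot ⟨hinj hab.left.2 hs'.1 e ▸ hab.left.1, s', rfl⟩
  · exact h.disjoint.le_bot ⟨hinj hs'.1 hab.right.2 e ▸ hab.right.1, s', rfl⟩

theorem IsCoreSurface.exists_blowDown [TopologicalSpace S] {O : Set M} {ρ : O → S}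
    (h : B.IsCoreSurface L ι) (hL : B.FullyCarries L) (hO : B.IsTube ι O ρ) {L' : Lamination M}
    {q : M → M} (hq : B.IsCollapse O L' q) (hint : interior L'.carrier = ∅) :
    ∃ b : M → M, B.IsBlowDown L L' b ∧
      (∀ y ∈ L.carrier, ∀ z ∈ L.carrier ∩ B.fibre y,
        b y = b z ↔ Disjoint (B.seg y z) (range ι)) ∧
      (∀ y ∈ L.carrier, ∀ z ∈ B.fibre y \ O, b y = q z ↔ Disjoint (B.seg y z) (range ι)) := by
  obtain ⟨f, hfc, hfim, hfm, h1, h2⟩ := hO.exists_transfer hq hL.1.isCompact hL.1.1 hL.2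
    h.disjoint h.cuts
  refine ⟨f, ⟨hfc, hfim, ?_, hfm⟩, h1, h2⟩
  exact Lamination.plaquePreserving hint hfc fun y hy => hfim ▸ ⟨y, hy, rfl⟩

end core

/-! ### Continuity of the ends of the gaps -/

section continuity
variable {α : Type*} {l : Filter α} {y a b : α → M} {y₀ a₀ b₀ : M}

theorem Ends.tendsto_left (hL : B.Carries L) (hκ : y₀ ∈ κ.chart.source) (hy₀ : y₀ ∈ B.nbhd)
    (h₀ : B.Ends L.carrier κ y₀ a₀ b₀) (hy : Tendsto y l (𝓝 y₀))
    (h : ∀ᶠ i in l, y i ∈ B.nbhd ∧ B.Ends L.carrier κ (y i) (a i) (b i)) :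
    Tendsto a l (𝓝 a₀) := by
  refine hL.isCompact.tendsto_of_ultrafilter (h.mono fun i k => k.2.left.1) fun U hU m hm => ?_
  have hUy := hy.mono_left hU
  have hU1 := h.filter_mono hU
  have hmL : m ∈ L.carrier := L.isClosed_carrier.mem_of_tendsto hm (hU1.mono fun i k => k.2.left.1)
  have hUN : ∀ᶠ i in (U : Filter α), y i ∈ B.nbhd := hU1.mono fun i k => k.1
  have hUa : ∀ᶠ i in (U : Filter α), a i ∈ B.fibre (y i) := hU1.mono fun i k => k.2.left.2
  have hmf := fibre_of_tendsto hUy hUN hm hUa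
  have hms := κ.fibre_source hκ hy₀ hmf
  have hinj := (κ.isCoordinate_z hκ hy₀).2
  have hz : ∀ {f : α → M} {x : M}, x ∈ κ.chart.source → Tendsto f U (𝓝 x) →
      Tendsto (fun i => κ.z (f i)) U (𝓝 (κ.z x)) := fun hx hf => (κ.continuousAt_z hx).tendsto.comp hf
  have hle : κ.z m ≤ κ.z y₀ :=
    le_of_tendsto_of_tendsto (hz hms hm) (hz hκ hUy) (hU1.mono fun i k => k.2.left_lt.le)
  have hle' : κ.z m ≤ κ.z a₀ := by
    rcases h₀.out m ⟨hmL, hmf⟩ with k | k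
    · exact k
    · linarith [h₀.lt_right]
  by_contra hne
  have hlt : κ.z m < κ.z a₀ := lt_of_le_of_ne hle' fun e => hne (hinj hmf h₀.left.2 e)
  have has : a₀ ∈ B.seg y₀ m := (κ.mem_seg hκ hy₀ hmf).2 ⟨h₀.left.2, by
    rw [uIcc_of_ge hle]; exact ⟨hlt.le, h₀.left_lt.le⟩⟩
  have hay : a₀ ≠ y₀ := fun e => by have := h₀.left_lt; rw [e] at this; exact lt_irrefl _ this
  obtain ⟨x, hx, hxs⟩ := exists_tendsto_seg hUy hy₀ hUN hm hmf hUa has hay (Ne.symm hne)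
  have hxN : ∀ᶠ i in (U : Filter α), x i ∈ B.nbhd := by
    filter_upwards [hxs, hUN] with i k1 k2 using fibre_subset k2 k1.1
  obtain ⟨w, hw, hwL⟩ := hL.exists_tendsto h₀.left.1 hx hxN
  have hsrc : ∀ᶠ i in (U : Filter α), y i ∈ κ.chart.source := hUy (κ.source_mem_nhds hκ)
  have h1 := (hz (κ.fibre_source hκ hy₀ h₀.left.2) hw).eventually_lt (hz hκ hUy) h₀.left_lt
  have h2 := (hz hms hm).eventually_lt (hz (κ.fibre_source hκ hy₀ h₀.left.2) hw) hlt
  obtain ⟨i, k1, k2, k3, k4, k5, k6⟩ :=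
    (h1.and (h2.and (hwL.and (hxs.and (hU1.and hsrc))))).exists
  have hwf : w i ∈ B.fibre (y i) := by
    rw [← B.fibre_eq _ k5.1 _ k4.1]; exact k3.2
  rcases k5.2.out (w i) ⟨k3.1, hwf⟩ with k | k
  · linarith
  · linarith [k5.2.lt_right]

theorem Ends.tendsto_right (hL : B.Carries L) (hκ : y₀ ∈ κ.chart.source) (hy₀ : y₀ ∈ B.nbhd)
    (h₀ : B.Ends L.carrier κ y₀ a₀ b₀) (hy : Tendsto y l (𝓝 y₀))
    (h : ∀ᶠ i in l, y i ∈ B.nbhd ∧ B.Ends L.carrier κ (y i) (a i) (b i)) :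
    Tendsto b l (𝓝 b₀) := by
  refine (h₀.flip hκ hy₀).tendsto_left hL (κ.flip_source.2 hκ) hy₀ hy (b := a) ?_
  filter_upwards [h, hy (κ.source_mem_nhds hκ)] with i k1 k2
  exact ⟨k1.1, k1.2.flip k2 k1.1⟩

end continuity

/-! ### Slots and gaps -/

namespace Column

theorem S.shrink {a : ℝ × ℝ} {t : ℝ} (h : κ.S a t) {r : ℝ} (hr : r ∈ Icc (0 : ℝ) 1) :
    κ.S (r • a) t := by
  have aux : ∀ (m : SlotMode) (x : ℝ), m.Active (r * x) → m.Active x := by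
    intro m x hm
    cases m
    · exact hm
    · exact hm
    · change 0 < r * x at hm
      change 0 < x
      by_contra hx
      nlinarith [hr.1]
  rw [κ.S_iff] at h ⊢
  exact ⟨h.1, fun k => h.2.1 ⟨aux _ _ k.1, k.2⟩, fun k => h.2.2 ⟨aux _ _ k.1, k.2⟩⟩

end Column

section slots
variable {y₀ a₀ b₀ : M}

theorem Ends.source (h₀ : B.Ends L.carrier κ y₀ a₀ b₀) (hκ : y₀ ∈ κ.chart.source)
    (hN : y₀ ∈ B.nbhd) : a₀ ∈ κ.chart.source ∧ b₀ ∈ κ.chart.source ∧ κ.v a₀ = κ.v y₀ ∧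
      κ.v b₀ = κ.v y₀ :=
  ⟨κ.fibre_source hκ hN h₀.left.2, κ.fibre_source hκ hN h₀.right.2, κ.fibre_v hκ hN h₀.left.2,
    κ.fibre_v hκ hN h₀.right.2⟩

/-- Near a point of the lamination, all neighbouring fibres meet the lamination nearby. -/
theorem Carries.eventually_exists (hL : B.Carries L) (hκ : a₀ ∈ κ.chart.source)
    (ha₀ : a₀ ∈ L.carrier) {η : ℝ} (hη : 0 < η) :
    ∀ᶠ v in 𝓝 (κ.v a₀), κ.S v (κ.z a₀) ∧
      ∃ x ∈ L.carrier ∩ B.fibre (κ.pt v (κ.z a₀)), |κ.z x - κ.z a₀| < η := by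
  have hS := (κ.mem_nbhd hκ).1 (hL.1 ha₀)
  have hno : ¬ κ.OpenArc (κ.v a₀) (κ.z a₀) := fun k =>
    hL.not_mem_vertInterior ha₀ ((κ.mem_vertInterior hκ).2 k)
  have hSv := hS.eventually hno
  have hpt : Tendsto (fun v => κ.pt v (κ.z a₀)) (𝓝 (κ.v a₀)) (𝓝 a₀) := by
    have h1 : Continuous fun v => κ.pt v (κ.z a₀) :=
      κ.continuous_pt.comp (by fun_prop : Continuous fun v : ℝ × ℝ => (v, κ.z a₀))
    have := h1.tendsto (κ.v a₀)
    rwa [κ.pt_v_z hκ] at this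
  obtain ⟨w, hw, hwL⟩ := hL.exists_tendsto ha₀ hpt (hSv.mono fun v k => (κ.pt_mem_nbhd _ _).2 k)
  have hz := ((κ.continuousAt_z hκ).tendsto.comp hw)
  filter_upwards [hSv, hwL, hz.eventually (Metric.ball_mem_nhds _ hη)] with v h1 h2 h3
  exact ⟨h1, w v, h2, h3⟩

/-- The points near a gap are in the gap region if the gap is not interrupted in their fibres. -/
theorem Ends.eventually_mem_gapRegion (hL : B.Carries L) (h₀ : B.Ends L.carrier κ y₀ a₀ b₀)
    (hκ : y₀ ∈ κ.chart.source) (hN : y₀ ∈ B.nbhd) :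
    ∀ᶠ y in 𝓝 y₀, (∀ t ∈ Icc (κ.z a₀) (κ.z b₀), κ.S (κ.v y) t) → y ∈ B.gapRegion L := by
  obtain ⟨sa, sb, va, vb⟩ := h₀.source hκ hN
  have h1 := h₀.left_lt
  have h2 := h₀.lt_right
  set η := min (1 / 2) (min (κ.z y₀ - κ.z a₀) (κ.z b₀ - κ.z y₀) / 2) with hη
  have hη0 : 0 < η := lt_min (by norm_num) (half_pos (lt_min (by linarith) (by linarith)))
  have hη1 : η ≤ 1 / 2 := min_le_left _ _
  have hη2 : 2 * η ≤ κ.z y₀ - κ.z a₀ := by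
    have : η ≤ min (κ.z y₀ - κ.z a₀) (κ.z b₀ - κ.z y₀) / 2 := min_le_right _ _
    have := min_le_left (κ.z y₀ - κ.z a₀) (κ.z b₀ - κ.z y₀)
    linarith
  have hη3 : 2 * η ≤ κ.z b₀ - κ.z y₀ := by
    have : η ≤ min (κ.z y₀ - κ.z a₀) (κ.z b₀ - κ.z y₀) / 2 := min_le_right _ _
    have := min_le_right (κ.z y₀ - κ.z a₀) (κ.z b₀ - κ.z y₀)
    linarith
  have hA := hL.eventually_exists sa h₀.left.1 hη0
  have hB := hL.eventually_exists sb h₀.right.1 hη0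
  rw [va] at hA
  rw [vb] at hB
  have hv := (κ.continuousAt_v hκ).tendsto.eventually (hA.and hB)
  have hz := (κ.continuousAt_z hκ).tendsto.eventually (Metric.ball_mem_nhds _ hη0)
  have hyL : ∀ᶠ y in 𝓝 y₀, y ∉ L.carrier := by
    refine L.isClosed_carrier.isOpen_compl.mem_nhds fun k => ?_
    rcases h₀.out y₀ ⟨k, self_mem_fibre hN⟩ with k | k <;> linarith
  filter_upwards [hv, hz, hyL, κ.source_mem_nhds hκ] with y hv hz hyL hys hS
  obtain ⟨⟨-, x, ⟨hxL, hxf⟩, hxz⟩, -, x', ⟨hxL', hxf'⟩, hxz'⟩ := hv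
  replace hz : |κ.z y - κ.z y₀| < η := hz
  rw [abs_lt] at hxz hxz' hz
  have hSy : κ.S (κ.v y) (κ.z y) := hS _ ⟨by linarith, by linarith⟩
  have hyN : y ∈ B.nbhd := (κ.mem_nbhd hys).2 hSy
  have hmem : ∀ t ∈ Icc (κ.z a₀) (κ.z b₀), κ.pt (κ.v y) t ∈ B.fibre y := by
    intro t ht
    have := κ.pt_mem_fibre (t := t) hSy
    rw [κ.pt_v_z hys] at this
    refine this.2 fun r hr => hS r ?_
    have : κ.z y ∈ Icc (κ.z a₀) (κ.z b₀) := ⟨by linarith, by linarith⟩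
    exact ordConnected_Icc.uIcc_subset this ht hr
  have ha := hmem (κ.z a₀) ⟨le_rfl, by linarith⟩
  have hb := hmem (κ.z b₀) ⟨by linarith, le_rfl⟩
  rw [B.fibre_eq _ hyN _ ha] at hxf
  rw [B.fibre_eq _ hyN _ hb] at hxf'
  refine ⟨⟨hyN, hyL⟩, x, ⟨hxL, hxf⟩, x', ⟨hxL', hxf'⟩, (κ.mem_seg' hys hyN hxf hxf').2
    ⟨self_mem_fibre hyN, ?_⟩⟩
  rw [uIcc_of_le (by linarith)]
  exact ⟨by linarith, by linarith⟩

/-- The components of the gap region are open in it. -/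
theorem eventually_mem_component (hL : B.Carries L) {y₀ : M} (hy₀ : y₀ ∈ B.gapRegion L) :
    ∀ᶠ y in 𝓝 y₀, y ∈ B.gapRegion L → y ∈ connectedComponentIn (B.gapRegion L) y₀ := by
  have hN := gapRegion_subset hy₀
  obtain ⟨κ, hκ, hv0⟩ := exists_column B hN
  replace hv0 : κ.v y₀ = 0 := hv0
  obtain ⟨a₀, b₀, h₀⟩ := exists_ends hκ hy₀
  obtain ⟨sa, sb, va, vb⟩ := h₀.source hκ hN
  have h1 := h₀.left_lt
  have h2 := h₀.lt_right
  -- near `y₀` the whole gap of `y₀` persists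
  have hpers : ∀ᶠ y in 𝓝 y₀, y ∈ B.gapRegion L →
      ∀ t ∈ Icc (κ.z a₀) (κ.z b₀), κ.S (κ.v y) t := by
    have hex : ∀ y, ∃ x : M × M, y ∈ κ.chart.source → y ∈ B.gapRegion L →
        B.Ends L.carrier κ y x.1 x.2 := by
      intro y
      by_cases k : y ∈ κ.chart.source ∧ y ∈ B.gapRegion L
      · obtain ⟨a, b, hab⟩ := exists_ends k.1 k.2
        exact ⟨(a, b), fun _ _ => hab⟩
      · exact ⟨(y, y), fun k1 k2 => absurd ⟨k1, k2⟩ k⟩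
    choose x hx using hex
    rw [← eventually_inf_principal (s := B.gapRegion L)]
    have hsrc : ∀ᶠ y in 𝓝 y₀ ⊓ 𝓟 (B.gapRegion L), y ∈ κ.chart.source :=
      (show ∀ᶠ y in 𝓝 y₀, y ∈ κ.chart.source from κ.source_mem_nhds hκ).filter_mono inf_le_left
    have hG : ∀ᶠ y in 𝓝 y₀ ⊓ 𝓟 (B.gapRegion L), y ∈ B.gapRegion L :=
      mem_inf_of_right (mem_principal_self _)
    have hE : ∀ᶠ y in 𝓝 y₀ ⊓ 𝓟 (B.gapRegion L),
        y ∈ B.nbhd ∧ B.Ends L.carrier κ y (x y).1 (x y).2 := by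
      filter_upwards [hsrc, hG] with y k1 k2 using ⟨gapRegion_subset k2, hx y k1 k2⟩
    have ha := h₀.tendsto_left hL hκ hN (tendsto_id.mono_left inf_le_left) hE
    have hb := h₀.tendsto_right hL hκ hN (tendsto_id.mono_left inf_le_left) hE
    have ha' := ((κ.continuousAt_z sa).tendsto.comp ha).eventually
      (Metric.ball_mem_nhds _ one_pos)
    have hb' := ((κ.continuousAt_z sb).tendsto.comp hb).eventually
      (Metric.ball_mem_nhds _ one_pos)
    have hA := hL.eventually_exists sa h₀.left.1 one_pos
    have hB := hL.eventually_exists sb h₀.right.1 one_pos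
    rw [va] at hA
    rw [vb] at hB
    have hv := ((κ.continuousAt_v hκ).tendsto.eventually (hA.and hB)).filter_mono
      (inf_le_left (b := 𝓟 (B.gapRegion L)))
    filter_upwards [hE, ha', hb', hv, hsrc] with y k1 k2 k3 k4 k5 t ht
    replace k2 : |κ.z (x y).1 - κ.z a₀| < 1 := k2
    replace k3 : |κ.z (x y).2 - κ.z b₀| < 1 := k3
    have g1 := κ.fibre_S k5 k1.1 k1.2.left.2
    have g2 := κ.fibre_S k5 k1.1 k1.2.right.2
    have g3 := k1.2.left_lt.trans k1.2.lt_right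
    rcases lt_or_ge t (κ.z (x y).1) with c1 | c1
    · refine Column.S_uIcc g1 k4.1.1 k2 t ?_
      rw [uIcc_of_ge (by linarith [ht.1])]
      exact ⟨ht.1, c1.le⟩
    rcases lt_or_ge (κ.z (x y).2) t with c2 | c2
    · refine Column.S_uIcc g2 k4.2.1 k3 t ?_
      rw [uIcc_of_le (by linarith [ht.2])]
      exact ⟨c2.le, ht.2⟩
    have := κ.fibre_uIcc k5 k1.1 k1.2.left.2 k1.2.right.2 (t := t)
      (by rw [uIcc_of_le g3.le]; exact ⟨c1, c2⟩)
    exact (κ.pt_mem_nbhd _ _).1 (fibre_subset k1.1 this)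
  have hgap := h₀.eventually_mem_gapRegion hL hκ hN
  -- along the section through `y₀`
  have hsec : ∀ᶠ v in 𝓝 (0 : ℝ × ℝ), (∀ t ∈ Icc (κ.z a₀) (κ.z b₀), κ.S v t) →
      κ.pt v (κ.z y₀) ∈ B.gapRegion L := by
    have h3 : Continuous fun v => κ.pt v (κ.z y₀) :=
      κ.continuous_pt.comp (by fun_prop : Continuous fun v : ℝ × ℝ => (v, κ.z y₀))
    have h4 := h3.tendsto 0
    rw [← hv0, κ.pt_v_z hκ] at h4
    rw [← hv0]
    filter_upwards [h4.eventually hgap] with v hv hS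
    exact hv (by simpa using hS)
  obtain ⟨r, hr, hball⟩ := Metric.eventually_nhds_iff_ball.1 hsec
  have hvr := (κ.continuousAt_v hκ).tendsto.eventually
    (show ∀ᶠ v in 𝓝 (κ.v y₀), v ∈ Metric.ball 0 r by rw [hv0]; exact Metric.ball_mem_nhds _ hr)
  have hzr := (κ.continuousAt_z hκ).tendsto.eventually
    (Metric.ball_mem_nhds (κ.z y₀) one_pos)
  have hjoin : ∀ᶠ y in 𝓝 y₀, y ∈ B.nbhd ∧ κ.pt (κ.v y) (κ.z y₀) ∈ B.fibre y →
      B.Joined L.carrier y (κ.pt (κ.v y) (κ.z y₀)) := by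
    refine eventually_inf_principal
      (s := {y | y ∈ B.nbhd ∧ κ.pt (κ.v y) (κ.z y₀) ∈ B.fibre y}).1 ?_
    have hj0 : B.Joined L.carrier y₀ y₀ := (joined_self hN).2 hy₀.1.2
    refine hj0.eventually L.isClosed_carrier (tendsto_id.mono_left inf_le_left) ?_
      (mem_inf_of_right (mem_principal_self _))
    have h3 : ContinuousAt (fun y => κ.pt (κ.v y) (κ.z y₀)) y₀ :=
      κ.continuous_pt.continuousAt.comp (f := fun y => (κ.v y, κ.z y₀))
        ((κ.continuousAt_v hκ).prodMk continuousAt_const)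
    have h4 := h3.tendsto
    rw [κ.pt_v_z hκ] at h4
    exact h4.mono_left inf_le_left
  filter_upwards [hpers, hvr, hzr, hjoin, κ.source_mem_nhds hκ] with y k1 k2 k3 k4 k5 hyG
  have hS := k1 hyG
  have hyN := gapRegion_subset hyG
  set w := κ.pt (κ.v y) (κ.z y₀) with hw
  have hwf : w ∈ B.fibre y := by
    have hSy := (κ.mem_nbhd k5).1 hyN
    have := κ.pt_mem_fibre (t := κ.z y₀) hSy
    rw [κ.pt_v_z k5] at this
    exact this.2 (Column.S_uIcc hSy (hS _ ⟨h1.le, h2.le⟩) k3)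
  have hseg := (k4 ⟨hyN, hwf⟩).seg_subset_gapRegion hyG hwf
  set T : Set M := (fun r : ℝ => κ.pt (r • κ.v y) (κ.z y₀)) '' Icc 0 1 with hT
  have hTG : T ⊆ B.gapRegion L := by
    rintro _ ⟨r', hr', rfl⟩
    refine hball _ ?_ fun t ht => Column.S.shrink (hS t ht) hr'
    rw [Metric.mem_ball, dist_zero_right] at k2 ⊢
    rw [norm_smul, Real.norm_of_nonneg hr'.1]
    nlinarith [norm_nonneg (κ.v y), hr'.2]
  have hTc : IsPreconnected T := by
    refine isPreconnected_Icc.image _ (Continuous.continuousOn ?_)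
    exact κ.continuous_pt.comp (by fun_prop : Continuous fun r : ℝ => (r • κ.v y, κ.z y₀))
  have hwT : w ∈ T := ⟨1, by simp, by simp [hw]⟩
  have hyT : y₀ ∈ T := by
    refine ⟨0, by simp, ?_⟩
    simp only [zero_smul]
    rw [← hv0, κ.pt_v_z hκ]
  have hconn : IsPreconnected (B.seg y w ∪ T) :=
    (isPreconnected_seg hyN hwf).union w (right_mem_seg hwf) hwT hTc
  exact hconn.subset_connectedComponentIn (.inr hyT) (union_subset hseg hTG)
    (.inl (left_mem_seg hyN _))

theorem eventually_mem_cuspRegion (hL : B.Carries L) {y₀ : M} (hy₀ : y₀ ∈ B.cuspRegion L) :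
    ∀ᶠ y in 𝓝 y₀, y ∈ B.gapRegion L → y ∈ B.cuspRegion L := by
  obtain ⟨v, hv, hyv⟩ := hy₀
  filter_upwards [eventually_mem_component hL (connectedComponentIn_subset _ _ hyv)] with y h1 h2
  exact ⟨v, hv, connectedComponentIn_eq hyv ▸ h1 h2⟩

theorem mem_cuspRegion_of_frequently (hL : B.Carries L) {y₀ : M} (hy₀ : y₀ ∈ B.gapRegion L)
    (h : ∃ᶠ y in 𝓝 y₀, y ∈ B.cuspRegion L) : y₀ ∈ B.cuspRegion L := by
  obtain ⟨y, hy, h1⟩ := (h.and_eventually (eventually_mem_component hL hy₀)).exists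
  have := h1 (cuspRegion_subset hy)
  obtain ⟨v, hv, hyv⟩ := hy
  refine ⟨v, hv, ?_⟩
  rw [connectedComponentIn_eq hyv, ← connectedComponentIn_eq this]
  exact mem_connectedComponentIn hy₀

end slots

/-! ### Gaps and the vertical boundary -/

theorem FullyCarries.exists_above (hL : B.FullyCarries L) (hm : κ.m = .branch) {a : ℝ × ℝ}
    (ha : a.1 = 0) :
    (∃ x ∈ L.carrier ∩ B.fibre (κ.pt a (3 / 2)), 3 / 2 ≤ κ.z x) ∧
    ∃ x ∈ L.carrier ∩ B.fibre (κ.pt a (1 / 2)), κ.z x ≤ 1 / 2 ∧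
      (κ.n = .branch → a.2 = 0 → -(1 / 2) ≤ κ.z x) := by
  set u : ℝ → ℝ × ℝ := fun t => a + (t, t) with hu
  have hu0 : Tendsto u (𝓝[>] 0) (𝓝 a) := by
    have : Continuous u := by fun_prop
    have h := this.tendsto 0
    have e : u 0 = a := by simp [hu]
    rw [e] at h
    exact h.mono_left inf_le_left
  have hS1 : ∀ b, κ.S b (3 / 2) := fun b => by
    rw [κ.S_iff]; norm_num
  have hS2 : ∀ b, κ.S b (1 / 2) := fun b => by
    rw [κ.S_iff]; norm_num
  have lim : ∀ h : ℝ, (∀ b, κ.S b h) → ∀ P : ℝ → Prop, IsClosed {t | P t} →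
      (∀ t > 0, ∀ x ∈ B.fibre (κ.pt (u t) h), P (κ.z x)) →
      ∃ x ∈ L.carrier ∩ B.fibre (κ.pt a h), P (κ.z x) := by
    intro h hS P hP hPt
    have hex : ∀ t, ∃ x, x ∈ L.carrier ∩ B.fibre (κ.pt (u t) h) := fun t =>
      hL.2 _ ((κ.pt_mem_nbhd _ _).2 (hS _))
    choose x hx using hex
    let U := Ultrafilter.of (𝓝[>] (0 : ℝ))
    have hU : (U : Filter ℝ) ≤ 𝓝[>] 0 := Ultrafilter.of_le _
    obtain ⟨x₀, hx₀, hlim⟩ := hL.1.isCompact.ultrafilter_le_nhds (U.map x)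
      (le_principal_iff.2 (Filter.mem_map.2 (Eventually.of_forall fun t => (hx t).1)))
    have hlim : Tendsto x U (𝓝 x₀) := hlim
    have hpt : Tendsto (fun t => κ.pt (u t) h) U (𝓝 (κ.pt a h)) := by
      have h1 : Continuous fun v => κ.pt v h :=
        κ.continuous_pt.comp (by fun_prop : Continuous fun v : ℝ × ℝ => (v, h))
      exact (h1.tendsto a).comp (hu0.mono_left hU)
    have hN : ∀ t, κ.pt (u t) h ∈ B.nbhd := fun t => (κ.pt_mem_nbhd _ _).2 (hS _)
    have hf := fibre_of_tendsto hpt (Eventually.of_forall hN) hlim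
      (Eventually.of_forall fun t => (hx t).2)
    refine ⟨x₀, ⟨hx₀, hf⟩, ?_⟩
    have hsrc := κ.fibre_source (κ.pt_mem a h) ((κ.pt_mem_nbhd _ _).2 (hS a)) hf
    have hz := (κ.continuousAt_z hsrc).tendsto.comp hlim
    refine hP.mem_of_tendsto hz ?_
    have : ∀ᶠ t in (U : Filter ℝ), t ∈ Ioi (0 : ℝ) := hU self_mem_nhdsWithin
    exact this.mono fun t ht => hPt t ht _ (hx t).2
  have act : ∀ t > 0, κ.m.Active (u t).1 := by
    intro t ht
    rw [hm]
    change 0 < a.1 + t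
    linarith
  have mem : ∀ (h : ℝ), (∀ b, κ.S b h) → ∀ t, ∀ x ∈ B.fibre (κ.pt (u t) h),
      ∀ r ∈ uIcc h (κ.z x), κ.S (u t) r := by
    intro h hS t x hx r hr
    have := ((κ.mem_fibre (κ.pt_mem _ _) ((κ.pt_mem_nbhd _ _).2 (hS _))).1 hx).2.2 r (by simpa using hr)
    simpa using this
  constructor
  · refine lim (3 / 2) hS1 (fun r => 3 / 2 ≤ r) isClosed_Ici fun t ht x hx => ?_
    by_contra! hlt
    obtain ⟨r, hr1, hr2⟩ := exists_between (max_lt hlt (by norm_num : (1 / 2 : ℝ) < 3 / 2))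
    rw [max_lt_iff] at hr1
    have := mem _ hS1 t x hx r (by rw [uIcc_of_ge hlt.le]; exact ⟨hr1.1.le, hr2.le⟩)
    exact this.2.1 ⟨act t ht, hr1.2, hr2⟩
  · refine lim (1 / 2) hS2 (fun r => r ≤ 1 / 2 ∧ (κ.n = .branch → a.2 = 0 → -(1 / 2) ≤ r)) ?_
      fun t ht x hx => ⟨?_, fun hn ha2 => ?_⟩
    · refine isClosed_Iic.inter
        (show IsClosed {r : ℝ | κ.n = .branch → a.2 = 0 → -(1 / 2) ≤ r} from ?_)
      by_cases hc : κ.n = .branch ∧ a.2 = 0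
      · simp only [hc.1, hc.2, true_implies]
        exact isClosed_Ici
      · have : {r : ℝ | κ.n = .branch → a.2 = 0 → -(1 / 2) ≤ r} = univ :=
          eq_univ_of_forall fun r h1 h2 => absurd ⟨h1, h2⟩ hc
        rw [this]
        exact isClosed_univ
    · by_contra! hlt
      obtain ⟨r, hr1, hr2⟩ := exists_between (lt_min hlt (by norm_num : (1 / 2 : ℝ) < 3 / 2))
      rw [lt_min_iff] at hr2
      have := mem _ hS2 t x hx r (by rw [uIcc_of_le hlt.le]; exact ⟨hr1.le, hr2.1.le⟩)
      exact this.2.1 ⟨act t ht, hr1, hr2.2⟩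
    · by_contra! hlt
      obtain ⟨r, hr1, hr2⟩ := exists_between (max_lt hlt (by norm_num : (-(3 / 2) : ℝ) < -(1 / 2)))
      rw [max_lt_iff] at hr1
      have := mem _ hS2 t x hx r (by
        rw [uIcc_of_ge (by linarith)]; exact ⟨hr1.1.le, by linarith⟩)
      refine this.2.2 ⟨?_, hr1.2, hr2⟩
      rw [hn]
      change 0 < a.2 + t
      linarith

theorem Column.pt_mem_fibre_of_Icc {y : M} (hκ : y ∈ κ.chart.source) {s : ℝ}
    (h : ∀ t ∈ uIcc (κ.z y) s, κ.S (κ.v y) t) : κ.pt (κ.v y) s ∈ B.fibre y := by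
  have := κ.pt_mem_fibre (t := s) (h _ left_mem_uIcc)
  rw [κ.pt_v_z hκ] at this
  exact this.2 h

/-- The heights of an arc of the vertical boundary belong to the slab. -/
theorem Column.OpenArc.S_Icc {a : ℝ × ℝ} {t : ℝ} (h : κ.m = .branch) (ha : a.1 = 0)
    (ht : t ∈ Icc (-(1 / 2) : ℝ) 3) : κ.S a t := by
  rw [κ.S_iff]
  refine ⟨abs_le.2 ⟨by linarith [ht.1], ht.2⟩, fun k => ?_, fun k => by linarith [ht.1, k.2.2]⟩
  rw [h, ha] at k
  exact lt_irrefl _ k.1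

theorem FullyCarries.vertInterior_subset (hL : B.FullyCarries L) :
    B.vertInterior ⊆ B.gapRegion L := by
  have main : ∀ (κ : Column B) (y : M), y ∈ κ.chart.source → y ∈ B.vertInterior →
      κ.m = .branch → (κ.v y).1 = 0 → κ.z y ∈ Ioo (1 / 2 : ℝ) (3 / 2) → y ∈ B.gapRegion L := by
    intro κ y hκ hy hm ha hz
    have hN : y ∈ B.nbhd := hy.1.1
    obtain ⟨⟨x, ⟨hxL, hxf⟩, hxz⟩, x', ⟨hxL', hxf'⟩, hxz', -⟩ := hL.exists_above hm ha
    have hmem : ∀ s ∈ Icc (-(1 / 2) : ℝ) 3, κ.pt (κ.v y) s ∈ B.fibre y := fun s hs =>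
      κ.pt_mem_fibre_of_Icc hκ fun t ht => Column.OpenArc.S_Icc hm ha
        (ordConnected_Icc.uIcc_subset ⟨by linarith [hz.1], by linarith [hz.2]⟩ hs ht)
    rw [B.fibre_eq _ hN _ (hmem _ (by norm_num))] at hxf hxf'
    refine ⟨⟨hN, fun k => hL.1.not_mem_vertInterior k hy⟩, x', ⟨hxL', hxf'⟩, x, ⟨hxL, hxf⟩,
      (κ.mem_seg' hκ hN hxf' hxf).2 ⟨self_mem_fibre hN, ?_⟩⟩
    rw [uIcc_of_le (by linarith)]
    exact ⟨by linarith [hz.1], by linarith [hz.2]⟩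
  intro y hy
  obtain ⟨κ, hκ, -⟩ := exists_column B hy.1.1
  rcases (κ.mem_vertInterior hκ).1 hy with ⟨h1, h2, h3⟩ | ⟨h1, h2, h3⟩
  · exact main κ y hκ hy h1 h2 h3
  · refine main κ.flip y (κ.flip_source.2 hκ) hy h1 ?_ ?_
    · rw [κ.flip_v hκ]; exact h2
    · rw [κ.flip_z hκ]; exact ⟨by linarith [h3.2], by linarith [h3.1]⟩

theorem FullyCarries.vertInterior_subset_cusp (hL : B.FullyCarries L) :
    B.vertInterior ⊆ B.cuspRegion L := fun y hy =>
  ⟨y, hy, mem_connectedComponentIn (hL.vertInterior_subset hy)⟩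

/-- Near a gap that does not meet the vertical boundary, and near the interior of the vertical
boundary, all points of `N(B)` are in the gap region. -/
theorem FullyCarries.eventually_mem_gapRegion (hL : B.FullyCarries L) {y₀ : M}
    (hy₀ : y₀ ∈ B.gapRegion L) (h : y₀ ∈ B.vertInterior ∨
      ∀ w ∈ B.fibre y₀, B.Joined L.carrier y₀ w → w ∉ B.vertInterior) :
    ∀ᶠ y in 𝓝 y₀, y ∈ B.nbhd → y ∈ B.gapRegion L := by
  have hN := gapRegion_subset hy₀
  have main : ∀ (κ : Column B) (a₀ b₀ : M), y₀ ∈ κ.chart.source → κ.v y₀ = 0 →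
      B.Ends L.carrier κ y₀ a₀ b₀ → ∀ᶠ y in 𝓝 y₀, y ∈ B.nbhd → ∀ t ∈ Icc (κ.z a₀) (κ.z b₀),
        ¬ (κ.m.Active (κ.v y).1 ∧ 1 / 2 < t ∧ t < 3 / 2) := by
    intro κ a₀ b₀ hκ hv h₀
    have h1 := h₀.left_lt
    have h2 := h₀.lt_right
    have hmem : ∀ t ∈ Icc (κ.z a₀) (κ.z b₀), κ.pt (κ.v y₀) t ∈ B.fibre y₀ := fun t ht =>
      κ.fibre_uIcc hκ hN h₀.left.2 h₀.right.2 (by rwa [uIcc_of_le (by linarith)])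
    have hS0 : ∀ t ∈ Icc (κ.z a₀) (κ.z b₀), κ.S (κ.v y₀) t := fun t ht =>
      (κ.pt_mem_nbhd _ _).1 (fibre_subset hN (hmem t ht))
    by_cases hmeet : ∃ t ∈ Icc (κ.z a₀) (κ.z b₀), 1 / 2 < t ∧ t < 3 / 2
    swap
    · push Not at hmeet
      exact Eventually.of_forall fun y _ t ht k => by linarith [hmeet t ht k.2.1, k.2.2]
    obtain ⟨t₀, ht₀, ht1, ht2⟩ := hmeet
    cases hm : κ.m with
    | absent => exact Eventually.of_forall fun y _ t ht k => k.1
    | full =>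
      exact absurd ⟨by rw [hm]; trivial, ht1, ht2⟩ (hS0 t₀ ht₀).2.1
    | branch =>
      obtain ⟨t, ht3, ht4⟩ : ∃ t, max (κ.z a₀) (1 / 2) < t ∧ t < min (κ.z b₀) (3 / 2) :=
        exists_between (max_lt (lt_min (by linarith) (by linarith [ht₀.1]))
          (lt_min (by linarith [ht₀.2]) (by norm_num)))
      rw [max_lt_iff] at ht3
      rw [lt_min_iff] at ht4
      have hv1 : (κ.v y₀).1 = 0 := by rw [hv]; rfl
      have hvert : κ.pt (κ.v y₀) t ∈ B.vertInterior := by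
        rw [κ.mem_vertInterior (κ.pt_mem _ _), κ.v_pt, κ.z_pt]
        exact .inl ⟨hm, hv1, ht3.2, ht4.2⟩
      have hf := hmem t ⟨ht3.1.le, ht4.1.le⟩
      have hj : B.Joined L.carrier y₀ (κ.pt (κ.v y₀) t) :=
        (h₀.joined_iff hκ hN hf).2 (by simpa using ⟨ht3.1, ht4.1⟩)
      rcases h with h | h
      swap
      · exact absurd hvert (h _ hf hj)
      rcases (κ.mem_vertInterior hκ).1 h with ⟨-, -, k⟩ | ⟨k1, k2, k3⟩
      · have hz := (κ.continuousAt_z hκ).tendsto.eventually (Ioo_mem_nhds k.1 k.2)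
        filter_upwards [hz, κ.source_mem_nhds hκ] with y g1 g2 g3 t _ g4
        exact ((κ.mem_nbhd g2).1 g3).2.1 ⟨by rw [hm]; exact g4.1, g1.1, g1.2⟩
      · exfalso
        obtain ⟨-, x, ⟨hxL, hxf⟩, hx1, hx2⟩ := hL.exists_above hm hv1
        have hx2 := hx2 k1 k2
        have hhalf := hmem (1 / 2) ⟨by linarith [k3.2], by linarith⟩
        rw [B.fibre_eq _ hN _ hhalf] at hxf
        rcases h₀.out x ⟨hxL, hxf⟩ with k | k <;> linarith [k3.2]
  obtain ⟨κ, hκ, hv⟩ := exists_column B hN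
  obtain ⟨a₀, b₀, h₀⟩ := exists_ends hκ hy₀
  obtain ⟨sa, sb, -, -⟩ := h₀.source hκ hN
  have hκ' := κ.flip_source.2 hκ
  have hv' : κ.v y₀ = 0 := hv
  have e1 := main κ a₀ b₀ hκ hv' h₀
  have e2 := main κ.flip b₀ a₀ hκ' (by rw [κ.flip_v hκ, hv']; rfl) (h₀.flip hκ hN)
  rw [κ.flip_z sa, κ.flip_z sb] at e2
  have hS0 : ∀ t ∈ Icc (κ.z a₀) (κ.z b₀), κ.S (κ.v y₀) t := fun t ht =>
    (κ.pt_mem_nbhd _ _).1 (fibre_subset hN (κ.fibre_uIcc hκ hN h₀.left.2 h₀.right.2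
      (by rwa [uIcc_of_le (h₀.left_lt.trans h₀.lt_right).le])))
  filter_upwards [h₀.eventually_mem_gapRegion hL.1 hκ hN, e1, e2, κ.source_mem_nhds hκ]
    with y g1 g2 g3 g4 g5
  refine g1 fun t ht => (κ.S_iff _ _).2 ⟨(hS0 t ht).1, g2 g5 t ht, fun k => ?_⟩
  refine g3 g5 (-t) ⟨by linarith [ht.2], by linarith [ht.1]⟩ ⟨?_, by linarith [k.2.2], by linarith [k.2.1]⟩
  rw [κ.flip_v g4]
  exact k.1

/-- Each point of the vertical boundary has the point of the pared locus in its arc. -/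
theorem exists_pared (hp : B.IsParedLocus p) {y : M} (hy : y ∈ B.vertInterior) :
    ∃ q ∈ p, y ∈ B.fibre q ∧ B.seg q y ⊆ B.vertInterior := by
  obtain ⟨κ, hκ, -, hn⟩ := Column.exists_normal hp hy.1.1
  have hN : y ∈ B.nbhd := hy.1.1
  have aux : ∀ s, |s - κ.z y| < 1 → κ.S (κ.v y) s → κ.pt (κ.v y) s ∈ p → |s - κ.z y| < 1 / 2 →
      ∃ q ∈ p, y ∈ B.fibre q ∧ B.seg q y ⊆ B.vertInterior := by
    intro s hs1 hS hq hs2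
    have hf : κ.pt (κ.v y) s ∈ B.fibre y := κ.pt_mem_fibre_of_Icc hκ
      (Column.S_uIcc ((κ.mem_nbhd hκ).1 hN) hS (by rwa [abs_sub_comm]))
    have hf' := mem_fibre_symm hN hf
    exact ⟨_, hq, hf', (hn.seg_subset_iff hp (κ.pt_mem _ _) hq hf').2 (by rwa [κ.z_pt])⟩
  rcases (κ.mem_vertInterior hκ).1 hy with ⟨h1, h2, h3⟩ | ⟨h1, h2, h3⟩
  · refine aux 1 ?_ ?_ (hn.upper_mem h1 h2) ?_
    · rw [abs_lt]; constructor <;> linarith [h3.1, h3.2]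
    · exact (κ.pt_mem_nbhd _ _).1 (hp.2.1 (hn.upper_mem h1 h2)).1.1
    · rw [abs_lt]; constructor <;> linarith [h3.1, h3.2]
  · refine aux (-1) ?_ ?_ (hn.lower_mem h1 h2) ?_
    · rw [abs_lt]; constructor <;> linarith [h3.1, h3.2]
    · exact (κ.pt_mem_nbhd _ _).1 (hp.2.1 (hn.lower_mem h1 h2)).1.1
    · rw [abs_lt]; constructor <;> linarith [h3.1, h3.2]

/-! ### Sections of the gaps -/

/-- The map `ι` is a continuous section of the quotient `ς` of the cusp region that collapses the
gaps, and passes through the pared locus. -/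
structure IsCoreSection (B : BranchedSurface M) (p : Set M) (L : Lamination M) {S : Type u}
    [TopologicalSpace S] (ι : S → M) (ς : B.cuspRegion L → S) : Prop where
  continuous_ι : Continuous ι
  continuous_ς : Continuous ς
  sect : ∀ s, ∃ h : ι s ∈ B.cuspRegion L, ς ⟨ι s, h⟩ = s
  eq_iff : ∀ y y', ς y = ς y' ↔ (y' : M) ∈ B.fibre y ∧ B.Joined L.carrier y y'
  pared : ∀ y : B.cuspRegion L, (y : M) ∈ p → ι (ς y) = y

namespace IsCoreSection
variable {S : Type u} [TopologicalSpace S] {ι : S → M} {ς : B.cuspRegion L → S}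

theorem mem (h : B.IsCoreSection p L ι ς) (s : S) : ι s ∈ B.cuspRegion L := (h.sect s).1

theorem ι_mem (h : B.IsCoreSection p L ι ς) (s : S) : ι s ∈ B.nbhd :=
  gapRegion_subset (cuspRegion_subset (h.mem s))

theorem joined (h : B.IsCoreSection p L ι ς) (y : B.cuspRegion L) :
    ι (ς y) ∈ B.fibre y ∧ B.Joined L.carrier y (ι (ς y)) := by
  obtain ⟨h1, h2⟩ := h.sect (ς y)
  exact (h.eq_iff y ⟨_, h1⟩).1 h2.symm

theorem injective (h : B.IsCoreSection p L ι ς) : Function.Injective ι := by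
  intro s s' hs
  obtain ⟨h1, h2⟩ := h.sect s
  obtain ⟨h3, h4⟩ := h.sect s'
  rw [← h2, ← h4]
  congr 1
  exact Subtype.ext hs

theorem isCoreSurface (h : B.IsCoreSection p L ι ς) : B.IsCoreSurface L ι := by
  refine ⟨range_subset_iff.2 h.mem, fun y hy => ⟨ς ⟨y, hy⟩, ?_, fun s hs => ?_⟩⟩
  · exact (mem_component_iff hy).2 (h.joined ⟨y, hy⟩)
  · dsimp only at hs
    rw [mem_component_iff hy] at hs
    obtain ⟨h1, h2⟩ := h.sect s
    rw [← h2]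
    exact ((h.eq_iff ⟨y, hy⟩ ⟨_, h1⟩).2 hs).symm

/-- A gap that meets the vertical boundary contains exactly one arc, and the section passes
through its core. -/
theorem exists_pared (h : B.IsCoreSection p L ι ς) (hp : B.IsParedLocus p) (hL : B.FullyCarries L)
    (y : B.cuspRegion L) {w : M} (hw : w ∈ B.fibre y) (hj : B.Joined L.carrier y w)
    (hwv : w ∈ B.vertInterior) :
    ι (ς y) ∈ p ∧ w ∈ B.fibre (ι (ς y)) ∧ B.seg (ι (ς y)) w ⊆ B.vertInterior := by
  obtain ⟨q, hq, hf, hs⟩ := BranchedSurface.exists_pared hp hwv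
  have hqv := hp.2.1 hq
  have hqN : q ∈ B.nbhd := hqv.1.1
  have hyN := gapRegion_subset (cuspRegion_subset y.2)
  have hjq : B.Joined L.carrier q w :=
    Set.disjoint_left.2 fun x hx hxL => hL.1.not_mem_vertInterior hxL (hs hx)
  have hqw := mem_fibre_symm hqN hf
  have e : ς y = ς ⟨q, hL.vertInterior_subset_cusp hqv⟩ := by
    refine (h.eq_iff _ _).2 ⟨?_, hj.trans (hjq.symm hqN hf) hyN hw ?_⟩ <;>
    · rw [← B.fibre_eq _ hyN _ hw]; exact hqw
  have e' : ι (ς y) = q := by rw [e, h.pared _ hq]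
  rw [e']
  exact ⟨hq, hf, hs⟩

end IsCoreSection

theorem Column.mem_seg_coord {y w w' x : M} {c : M → ℝ} (hy : y ∈ κ.chart.source) (hN : y ∈ B.nbhd)
    (hc : IsCoordinate (B.fibre y) c) (hw : w ∈ B.fibre y) (hw' : w' ∈ B.fibre y) :
    x ∈ B.seg w w' ↔ x ∈ B.fibre y ∧ c x ∈ uIcc (c w) (c w') := by
  rw [κ.mem_seg' hy hN hw hw']
  refine and_congr_right fun hx => ?_
  rw [mem_uIcc, mem_uIcc]
  rcases κ.coordinate_iff hy hN hc with k | k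
  · rw [k _ hw _ hx, k _ hx _ hw', k _ hw' _ hx, k _ hx _ hw]
  · rw [k _ hw _ hx, k _ hx _ hw', k _ hw' _ hx, k _ hx _ hw]
    tauto

namespace FibreMetric
variable {D : FibreMetric B}

theorem exists_coord (D : FibreMetric B) {y : M} (hκ : y ∈ κ.chart.source) (hN : y ∈ B.nbhd) :
    ∃ c, B.IsIsometric D.d y c ∧
      ∀ w ∈ B.fibre y, ∀ w' ∈ B.fibre y, c w < c w' ↔ κ.z w < κ.z w' := by
  obtain ⟨c, hc⟩ := D.coord y hN
  rcases κ.coordinate_iff hκ hN hc.1 with k | k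
  · exact ⟨c, hc, fun w hw w' hw' => by rw [← not_le, ← not_le, k _ hw' _ hw]⟩
  · refine ⟨fun w => - c w, ⟨⟨hc.1.1.neg, fun w hw w' hw' e => hc.1.2 hw hw' (neg_injective e)⟩,
      fun w hw w' hw' => ?_⟩, fun w hw w' hw' => ?_⟩
    · rw [hc.2 w hw w' hw', ← abs_neg]
      congr 1
      ring
    · rw [neg_lt_neg_iff, ← not_le, ← not_le, k _ hw _ hw']

theorem d_self {y : M} (hy : y ∈ B.nbhd) : D.d y y = 0 := by
  obtain ⟨c, hc⟩ := D.coord y hy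
  rw [hc.2 y (self_mem_fibre hy) y (self_mem_fibre hy)]
  simp

end FibreMetric

/-- Points of the vertical boundary off the lamination are in gaps meeting its interior. -/
theorem exists_joined_vertInterior {y : M} (hy : y ∈ B.vertBoundary) (hyL : y ∉ L.carrier) :
    ∃ w ∈ B.fibre y, B.Joined L.carrier y w ∧ w ∈ B.vertInterior := by
  have main : ∀ κ : Column B, y ∈ κ.chart.source → κ.m = .branch → (κ.v y).1 = 0 →
      κ.z y ∈ Icc (1 / 2 : ℝ) (3 / 2) →
      ∃ w ∈ B.fibre y, B.Joined L.carrier y w ∧ w ∈ B.vertInterior := by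
    intro κ hκ hm hv hz
    have hN : y ∈ B.nbhd := hy.1
    have hf : ∀ t ∈ Icc (1 / 2 : ℝ) (3 / 2), κ.pt (κ.v y) t ∈ B.fibre y := fun t ht =>
      κ.pt_mem_fibre_of_Icc hκ fun s hs => Column.OpenArc.S_Icc hm hv (by
        have := ordConnected_Icc.uIcc_subset hz ht hs
        exact ⟨by linarith [this.1], by linarith [this.2]⟩)
    have hfr : ∃ᶠ t in 𝓝 (κ.z y), t ∈ Ioo (1 / 2 : ℝ) (3 / 2) := by
      rw [← mem_closure_iff_frequently, closure_Ioo (by norm_num)]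
      exact hz
    have hpt : Tendsto (fun t => κ.pt (κ.v y) t) (𝓝 (κ.z y)) (𝓝 y) := by
      have := (κ.continuous_pt_right (κ.v y)).tendsto (κ.z y)
      rwa [κ.pt_v_z hκ] at this
    have hj : ∀ᶠ t in 𝓝 (κ.z y) ⊓ 𝓟 (Icc (1 / 2 : ℝ) (3 / 2)),
        B.Joined L.carrier y (κ.pt (κ.v y) t) :=
      ((joined_self hN).2 hyL).eventually L.isClosed_carrier tendsto_const_nhds
        (hpt.mono_left inf_le_left)
        ((eventually_mem_nhdsWithin (a := κ.z y)).mono fun t ht => ⟨hN, hf t ht⟩)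
    obtain ⟨t, ht, hj⟩ := (hfr.and_eventually (eventually_inf_principal.1 hj)).exists
    have ht' := Ioo_subset_Icc_self ht
    refine ⟨_, hf t ht', hj ht', (κ.mem_vertInterior (κ.pt_mem _ _)).2 (.inl ⟨hm, ?_, ?_⟩)⟩
    · rw [κ.v_pt]; exact hv
    · rw [κ.z_pt]; exact ht
  obtain ⟨κ, hκ, -⟩ := exists_column B hy.1
  rcases (κ.mem_vertBoundary hκ).1 hy with ⟨h1, h2, h3⟩ | ⟨h1, h2, h3⟩
  · exact main κ hκ h1 h2 h3
  · refine main κ.flip (κ.flip_source.2 hκ) h1 ?_ ?_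
    · rw [κ.flip_v hκ]; exact h2
    · rw [κ.flip_z hκ]; exact ⟨by linarith [h3.2], by linarith [h3.1]⟩

namespace IsCoreSection
variable {S : Type u} [TopologicalSpace S] {ι : S → M} {ς : B.cuspRegion L → S}

theorem ι_fibre (h : B.IsCoreSection p L ι ς) (y : B.cuspRegion L) :
    (y : M) ∈ B.fibre (ι (ς y)) ∧ B.Joined L.carrier (ι (ς y)) y := by
  have hN := gapRegion_subset (cuspRegion_subset y.2)
  obtain ⟨h1, h2⟩ := h.joined y
  exact ⟨mem_fibre_symm hN h1, h2.symm hN h1⟩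

theorem ς_ι (h : B.IsCoreSection p L ι ς) {s : S} {y : M} (hy : y ∈ B.fibre (ι s))
    (hj : B.Joined L.carrier (ι s) y) : ∃ k : y ∈ B.cuspRegion L, ς ⟨y, k⟩ = s := by
  obtain ⟨h1, h2⟩ := h.sect s
  have k := mem_cuspRegion_of_joined h1 hy hj
  exact ⟨k, by rw [← h2]; exact ((h.eq_iff ⟨_, h1⟩ ⟨y, k⟩).2 ⟨hy, hj⟩).symm⟩

theorem discreteTopology (h : B.IsCoreSection p L ι ς) {y : M} (hy : y ∈ B.nbhd) :
    DiscreteTopology ↥(range ι ∩ B.fibre y) := by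
  rw [discreteTopology_subtype_iff']
  rintro _ ⟨⟨s, rfl⟩, hs⟩
  have hN := h.ι_mem s
  have hL := (cuspRegion_subset (h.mem s)).1.2
  have hj : ∀ᶠ w in 𝓝 (ι s) ⊓ 𝓟 (B.fibre (ι s)), B.Joined L.carrier (ι s) w :=
    ((joined_self hN).2 hL).eventually L.isClosed_carrier tendsto_const_nhds
      (tendsto_id.mono_left inf_le_left)
      ((eventually_mem_nhdsWithin (a := ι s)).mono fun t ht => ⟨hN, ht⟩)
  obtain ⟨U, hU, hUo, hsU⟩ := eventually_nhds_iff.1 (eventually_inf_principal.1 hj)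
  refine ⟨U, hUo, Subset.antisymm ?_ (singleton_subset_iff.2 ⟨hsU, ⟨s, rfl⟩, hs⟩)⟩
  rintro _ ⟨hw, ⟨s', rfl⟩, hs'⟩
  rw [← B.fibre_eq _ hy _ hs] at hs'
  obtain ⟨k, e⟩ := h.ς_ι hs' (hU _ hw hs')
  obtain ⟨h1, h2⟩ := h.sect s'
  rw [← h2, e, mem_singleton_iff]

theorem isRegularNbhd (h : B.IsCoreSection p L ι ς) (hp : B.IsParedLocus p)
    (hL : B.FullyCarries L) (D : FibreMetric B)
    (hD : ∀ q ∈ p, ∀ y ∈ B.fibre q, (B.seg q y ⊆ B.vertInterior ↔ D.d q y < 1 / 2)) :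
    ∃ O, B.IsRegularNbhd ι O := by
  set O : Set M := {y | ∃ k : y ∈ B.cuspRegion L, D.d (ι (ς ⟨y, k⟩)) y < 1 / 2} with hO
  have hOc : O ⊆ B.cuspRegion L := fun y hy => hy.1
  have hON : O ⊆ B.nbhd := fun y hy => gapRegion_subset (cuspRegion_subset hy.1)
  have hopen : ∀ y₀ ∈ O, ∀ᶠ y in 𝓝 y₀, y ∈ B.nbhd → y ∈ O := by
    rintro y₀ ⟨k₀, hd₀⟩
    have hG : ∀ᶠ y in 𝓝 y₀, y ∈ B.nbhd → y ∈ B.gapRegion L := by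
      refine hL.eventually_mem_gapRegion (cuspRegion_subset k₀) ?_
      by_cases hv : ∃ w ∈ B.fibre y₀, B.Joined L.carrier y₀ w ∧ w ∈ B.vertInterior
      · obtain ⟨w, h1, h2, h3⟩ := hv
        obtain ⟨h4, -, -⟩ := h.exists_pared hp hL ⟨y₀, k₀⟩ h1 h2 h3
        have h5 := (h.ι_fibre ⟨y₀, k₀⟩).1
        exact .inl ((hD _ h4 _ h5).2 hd₀ (right_mem_seg h5))
      · push Not at hv
        exact .inr hv
    have hd : ∀ᶠ y : B.cuspRegion L in 𝓝 ⟨y₀, k₀⟩, (y : M) ∈ O := by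
      have ht := D.tendsto_d (l := 𝓝 (⟨y₀, k₀⟩ : B.cuspRegion L))
        (y := fun y => ι (ς y)) (w := fun y => (y : M))
        ((h.continuous_ι.comp h.continuous_ς).tendsto _) (continuous_subtype_val.tendsto _)
        (h.ι_mem _) (h.ι_fibre ⟨y₀, k₀⟩).1
        (Eventually.of_forall fun y => ⟨h.ι_mem _, (h.ι_fibre y).1⟩)
      filter_upwards [ht.eventually_lt_const hd₀] with y hy using ⟨y.2, hy⟩
    rw [eventually_nhds_subtype_iff (P := fun y => y ∈ O)] at hd
    filter_upwards [hG, eventually_mem_cuspRegion hL.1 k₀, eventually_nhdsWithin_iff.1 hd]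
      with y h1 h2 h3 h4 using h3 (h2 (h1 h4))
  refine ⟨O, ⟨interior {y | y ∈ B.nbhd → y ∈ O}, isOpen_interior, ?_⟩, ?_, ?_⟩
  · refine Subset.antisymm (fun y hy => ⟨hON hy, mem_interior_iff_mem_nhds.2 (hopen y hy)⟩) ?_
    exact fun y hy => interior_subset hy.2 hy.1
  · refine Subset.antisymm ?_ ?_
    · rintro y ⟨⟨k, hd⟩, hv⟩
      obtain ⟨w, h1, h2, h3⟩ := exists_joined_vertInterior hv (cuspRegion_subset k).1.2
      obtain ⟨h4, -, -⟩ := h.exists_pared hp hL ⟨y, k⟩ h1 h2 h3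
      have h5 := (h.ι_fibre ⟨y, k⟩).1
      exact (hD _ h4 _ h5).2 hd (right_mem_seg h5)
    · intro y hy
      have k := hL.vertInterior_subset_cusp hy
      have hN : y ∈ B.nbhd := hy.1.1
      obtain ⟨h4, h5, h6⟩ := h.exists_pared hp hL ⟨y, k⟩ (self_mem_fibre hN)
        ((joined_self hN).2 (cuspRegion_subset k).1.2) hy
      exact ⟨⟨k, (hD _ h4 _ h5).1 h6⟩, hy.1⟩
  · refine ⟨fun y => ς ⟨y, hOc y.2⟩, h.continuous_ς.comp (continuous_inclusion hOc), fun s => ?_,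
      fun s => ?_⟩
    · obtain ⟨h1, h2⟩ := h.sect s
      refine ⟨⟨h1, ?_⟩, h2⟩
      rw [h2, D.d_self (h.ι_mem s)]
      norm_num
    obtain ⟨κ, hκ, -⟩ := exists_column B (h.ι_mem s)
    set W : Set S := ι ⁻¹' κ.chart.source with hW
    have hE : ∀ w : S, ∃ x : M × M, w ∈ W → B.Ends L.carrier κ (ι w) x.1 x.2 := by
      intro w
      by_cases hw : w ∈ W
      · obtain ⟨a, b, hab⟩ := exists_ends hw (cuspRegion_subset (h.mem w))
        exact ⟨(a, b), fun _ => hab⟩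
      · exact ⟨(ι w, ι w), fun k => absurd k hw⟩
    choose x hx using hE
    have hWo : IsOpen W := κ.isOpen_source.preimage h.continuous_ι
    set τ : M → S → ℝ := fun a w => min (1 / 2) (D.d (ι w) a) / D.d (ι w) a with hτ
    have hpos : ∀ w ∈ W, 0 < D.d (ι w) (x w).1 ∧ 0 < D.d (ι w) (x w).2 := by
      intro w hw
      obtain ⟨c, hc, -⟩ := D.exists_coord hw (h.ι_mem w)
      have h0 := self_mem_fibre (h.ι_mem w)
      have hE := hx w hw
      rw [hc.2 _ h0 _ hE.left.2, hc.2 _ h0 _ hE.right.2, abs_pos, abs_pos, sub_ne_zero, sub_ne_zero]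
      constructor
      · intro e
        have := hE.left_lt
        rw [hc.1.2 h0 hE.left.2 e] at this
        exact lt_irrefl _ this
      · intro e
        have := hE.lt_right
        rw [hc.1.2 h0 hE.right.2 e] at this
        exact lt_irrefl _ this
    have hτI : ∀ d : ℝ, 0 < d → min (1 / 2) d / d ∈ Icc (0 : ℝ) 1 := fun d hd =>
      ⟨div_nonneg (le_min (by norm_num) hd.le) hd.le, div_le_one_of_le₀ (min_le_right _ _) hd.le⟩
    have hcont : ∀ f : S → M, (∀ w ∈ W, f w ∈ B.fibre (ι w) ∧ 0 < D.d (ι w) (f w)) →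
        (∀ w ∈ W, Tendsto f (𝓝 w) (𝓝 (f w))) →
        ContinuousOn (fun w => D.mix (τ (f w) w) (ι w) (f w)) W := by
      intro f hf hfc w hw
      have hιw := h.continuous_ι.tendsto w
      have hWw : ∀ᶠ w' in 𝓝 w, w' ∈ W := hWo.mem_nhds hw
      have hd := D.tendsto_d hιw (hfc w hw) (h.ι_mem w) (hf w hw).1
        (hWw.mono fun w' hw' => ⟨h.ι_mem w', (hf w' hw').1⟩)
      refine Tendsto.mono_left ?_ inf_le_left
      refine D.tendsto_mix (h.ι_mem w) (hf w hw).1 (hτI _ (hf w hw).2) hιw (hfc w hw) ?_ ?_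
      · exact (tendsto_const_nhds.min hd).div hd (hf w hw).2.ne'
      · exact hWw.mono fun w' hw' => ⟨h.ι_mem w', (hf w' hw').1, hτI _ (hf w' hw').2⟩
    refine ⟨W, hWo, hκ, fun w => D.mix (τ (x w).1 w) (ι w) (x w).1,
      fun w => D.mix (τ (x w).2 w) (ι w) (x w).2,
      hcont _ (fun w hw => ⟨(hx w hw).left.2, (hpos w hw).1⟩) fun w hw => ?_,
      hcont _ (fun w hw => ⟨(hx w hw).right.2, (hpos w hw).2⟩) fun w hw => ?_, fun w hw => ?_⟩
    · exact (hx w hw).tendsto_left hL.1 hw (h.ι_mem w) (h.continuous_ι.tendsto w)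
        ((show ∀ᶠ w' in 𝓝 w, w' ∈ W from hWo.mem_nhds hw).mono fun w' hw' => ⟨h.ι_mem w', hx w' hw'⟩)
    · exact (hx w hw).tendsto_right hL.1 hw (h.ι_mem w) (h.continuous_ι.tendsto w)
        ((show ∀ᶠ w' in 𝓝 w, w' ∈ W from hWo.mem_nhds hw).mono fun w' hw' => ⟨h.ι_mem w', hx w' hw'⟩)
    have hE := hx w hw
    have hN := h.ι_mem w
    have h0 := self_mem_fibre hN
    have hA := D.mix_mem hN hE.left.2 (hτI _ (hpos w hw).1)
    have hB := D.mix_mem hN hE.right.2 (hτI _ (hpos w hw).2)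
    refine ⟨hA, hB, ?_⟩
    obtain ⟨c, hc, hcm⟩ := D.exists_coord hw hN
    have cA := D.coord_mix hN hE.left.2 (hτI _ (hpos w hw).1) hc
    have cB := D.coord_mix hN hE.right.2 (hτI _ (hpos w hw).2) hc
    have l1 : c (x w).1 < c (ι w) := (hcm _ hE.left.2 _ h0).2 hE.left_lt
    have l2 : c (ι w) < c (x w).2 := (hcm _ h0 _ hE.right.2).2 hE.lt_right
    have d1 : D.d (ι w) (x w).1 = c (ι w) - c (x w).1 := by
      rw [hc.2 _ h0 _ hE.left.2, abs_of_pos (by linarith)]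
    have d2 : D.d (ι w) (x w).2 = c (x w).2 - c (ι w) := by
      rw [hc.2 _ h0 _ hE.right.2, abs_of_neg (by linarith)]; ring
    have eA : c (D.mix (τ (x w).1 w) (ι w) (x w).1) =
        c (ι w) - min (1 / 2) (c (ι w) - c (x w).1) := by
      have hne : c (ι w) - c (x w).1 ≠ 0 := by linarith
      rw [hτ, cA, d1]
      field_simp
      ring
    have eB : c (D.mix (τ (x w).2 w) (ι w) (x w).2) =
        c (ι w) + min (1 / 2) (c (x w).2 - c (ι w)) := by
      have hne : c (x w).2 - c (ι w) ≠ 0 := by linarith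
      rw [hτ, cB, d2]
      field_simp
      ring
    set a := D.mix (τ (x w).1 w) (ι w) (x w).1
    set b := D.mix (τ (x w).2 w) (ι w) (x w).2
    have hab : c a ≤ c b := by
      rw [eA, eB]
      have := le_min (by norm_num : (0 : ℝ) ≤ 1 / 2) (by linarith : 0 ≤ c (ι w) - c (x w).1)
      have := le_min (by norm_num : (0 : ℝ) ≤ 1 / 2) (by linarith : 0 ≤ c (x w).2 - c (ι w))
      linarith
    have hseg : ∀ y, y ∈ B.seg a b \ {a, b} ↔ y ∈ B.fibre (ι w) ∧ c a < c y ∧ c y < c b := by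
      intro y
      rw [Set.mem_sdiff, κ.mem_seg_coord hw hN hc.1 hA hB, uIcc_of_le hab]
      simp only [mem_insert_iff, mem_singleton_iff, not_or, and_assoc]
      refine and_congr_right fun hy => ?_
      rw [← hc.1.2.eq_iff hy hA, ← hc.1.2.eq_iff hy hB]
      constructor
      · rintro ⟨⟨k1, k2⟩, k3, k4⟩
        exact ⟨lt_of_le_of_ne k1 (Ne.symm k3), lt_of_le_of_ne k2 k4⟩
      · rintro ⟨k1, k2⟩
        exact ⟨⟨k1.le, k2.le⟩, k1.ne', k2.ne⟩
    have hfib : ∀ y, (∃ k : y ∈ O, ς ⟨y, hOc k⟩ = w) ↔ y ∈ B.fibre (ι w) ∧ c a < c y ∧ c y < c b := by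
      intro y
      have hkey : ∀ y ∈ B.fibre (ι w), (B.Joined L.carrier (ι w) y ∧ D.d (ι w) y < 1 / 2) ↔
          c a < c y ∧ c y < c b := by
        intro y hy
        have m1 : c a < c y ↔ c (ι w) - c y < 1 / 2 ∧ c (ι w) - c y < c (ι w) - c (x w).1 := by
          rw [eA, sub_lt_comm, lt_min_iff]
        have m2 : c y < c b ↔ c y - c (ι w) < 1 / 2 ∧ c y - c (ι w) < c (x w).2 - c (ι w) := by
          rw [eB, ← sub_lt_iff_lt_add', lt_min_iff]
        rw [hE.joined_iff hw hN hy, ← hcm _ hE.left.2 _ hy, ← hcm _ hy _ hE.right.2,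
          hc.2 _ h0 _ hy, abs_lt, m1, m2]
        constructor
        · rintro ⟨⟨k1, k2⟩, k3, k4⟩
          refine ⟨⟨?_, ?_⟩, ?_, ?_⟩ <;> linarith
        · rintro ⟨⟨k1, k2⟩, k3, k4⟩
          refine ⟨⟨?_, ?_⟩, ?_, ?_⟩ <;> linarith
      constructor
      · rintro ⟨⟨k, hd⟩, rfl⟩
        have h5 := h.ι_fibre ⟨y, k⟩
        exact ⟨h5.1, (hkey y h5.1).1 ⟨h5.2, hd⟩⟩
      · rintro ⟨hy, hy2⟩
        obtain ⟨h1, h2⟩ := (hkey y hy).2 hy2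
        obtain ⟨k, e⟩ := h.ς_ι hy h1
        exact ⟨⟨k, by rwa [e]⟩, e⟩
    ext y
    rw [hseg, ← hfib]
    constructor
    · rintro ⟨⟨y', hy'⟩, e, rfl⟩
      exact ⟨hy', e⟩
    · rintro ⟨hy', e⟩
      exact ⟨⟨y, hy'⟩, e, rfl⟩

end IsCoreSection

end BranchedSurface

theorem exists_isOpenEmbedding_ball {r : ℝ} (hr : 0 < r) : ∃ e : ℝ × ℝ → ℝ × ℝ,
    IsOpenEmbedding e ∧ range e = Metric.ball 0 r ∧ ∀ x, ∃ c > (0 : ℝ), e x = c • x := by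
  have h1 := (OpenPartialHomeomorph.univUnitBall (E := ℝ × ℝ)).isOpenEmbedding rfl
  refine ⟨fun x => r • OpenPartialHomeomorph.univUnitBall x,
    (Homeomorph.smulOfNeZero r hr.ne').isOpenEmbedding.comp h1, ?_, fun x => ?_⟩
  · have h2 : range (OpenPartialHomeomorph.univUnitBall (E := ℝ × ℝ)) = Metric.ball 0 1 := by
      rw [← image_univ]
      exact (OpenPartialHomeomorph.univUnitBall (E := ℝ × ℝ)).image_source_eq_target
    rw [← smul_unitBall_of_pos hr, ← h2]
    ext y
    simp [Set.mem_smul_set]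
  · refine ⟨r * (√(1 + ‖x‖ ^ 2))⁻¹, by positivity, ?_⟩
    change r • OpenPartialHomeomorph.univUnitBall x = _
    rw [OpenPartialHomeomorph.univUnitBall_apply, smul_smul]

namespace BranchedSurface

variable {M : Type u} [TopologicalSpace M] [T2Space M] {B : BranchedSurface M} {p : Set M}
variable {L : Lamination M} {κ : Column B}

theorem Column.eventually_joined {X : Set M} (hX : IsClosed X) {y₀ : M} (hκ : y₀ ∈ κ.chart.source)
    (hN : y₀ ∈ B.nbhd) (hyX : y₀ ∉ X) :
    ∀ᶠ y in 𝓝 y₀, y ∈ B.nbhd → κ.pt (κ.v y) (κ.z y₀) ∈ B.fibre y →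
      B.Joined X y (κ.pt (κ.v y) (κ.z y₀)) := by
  have hj0 : B.Joined X y₀ y₀ := (joined_self hN).2 hyX
  have h3 : ContinuousAt (fun y => κ.pt (κ.v y) (κ.z y₀)) y₀ :=
    κ.continuous_pt.continuousAt.comp (f := fun y => (κ.v y, κ.z y₀))
      ((κ.continuousAt_v hκ).prodMk continuousAt_const)
  have h4 := h3.tendsto
  rw [κ.pt_v_z hκ] at h4
  have := hj0.eventually hX (l := 𝓝 y₀ ⊓ 𝓟 {y | y ∈ B.nbhd ∧ κ.pt (κ.v y) (κ.z y₀) ∈ B.fibre y})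
    (tendsto_id.mono_left inf_le_left) (h4.mono_left inf_le_left)
    (mem_inf_of_right (mem_principal_self _))
  filter_upwards [eventually_inf_principal.1 this] with y h1 h2 h3 using h1 ⟨h2, h3⟩

namespace IsCoreSection
variable {S : Type u} [TopologicalSpace S] {ι : S → M} {ς : B.cuspRegion L → S}

/-- In a column in which `N(B)` is everything or a half space near a point of the surface, the
surface is a graph. -/
theorem exists_chart (h : B.IsCoreSection p L ι ς) {s₀ : S} (hκ : ι s₀ ∈ κ.chart.source)
    (hv : κ.v (ι s₀) = 0) (half : Prop)
    (hbox : ∀ᶠ q : (ℝ × ℝ) × ℝ in 𝓝 (0, κ.z (ι s₀)), κ.S q.1 q.2 ↔ (half → q.1.1 ≤ 0))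
    (hc : ∀ᶠ y in 𝓝 (ι s₀), y ∈ B.nbhd → y ∈ B.cuspRegion L) {δ : ℝ} (hδ : 0 < δ) :
    ∃ W : Set S, IsOpen W ∧ s₀ ∈ W ∧ ∃ φ, B.IsVertical φ ∧
      ι '' W = {y | y ∈ φ.source ∧ (φ y).2 = 0 ∧ (half → (φ y).1.1 ≤ 0)} ∧
      ∀ w ∈ W, ι w ∈ κ.chart.source ∧ |κ.z (ι w) - κ.z (ι s₀)| < δ ∧
        ((φ (ι w)).1.1 = 0 ↔ (κ.v (ι w)).1 = 0) ∧ (¬ half → B.nbhd ∈ 𝓝 (ι w)) := by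
  set z₀ := κ.z (ι s₀) with hz₀
  set P : ℝ × ℝ → Prop := fun v => half → v.1 ≤ 0 with hP
  have hN₀ := h.ι_mem s₀
  have hpt0 : κ.pt 0 z₀ = ι s₀ := by rw [← hv, hz₀]; exact κ.pt_v_z hκ
  -- a box in which everything is as expected
  obtain ⟨r, hr, hrδ, hr1, hbx⟩ : ∃ r > 0, r ≤ δ ∧ r ≤ 1 ∧ ∀ v z, ‖v‖ < r → |z - z₀| < r →
      (κ.S v z ↔ P v) ∧ (P v → κ.pt v z ∈ B.cuspRegion L ∧
        κ.pt v z₀ ∈ B.fibre (κ.pt v z) ∧ B.Joined L.carrier (κ.pt v z) (κ.pt v z₀)) := by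
    have hpt : Tendsto (fun q : (ℝ × ℝ) × ℝ => κ.pt q.1 q.2) (𝓝 (0, z₀)) (𝓝 (ι s₀)) := by
      have := κ.continuous_pt.tendsto (0, z₀)
      dsimp only at this
      rwa [hpt0] at this
    have hj := κ.eventually_joined L.isClosed_carrier hκ hN₀ (cuspRegion_subset (h.mem s₀)).1.2
    obtain ⟨r, hr, hball⟩ := Metric.eventually_nhds_iff_ball.1
      (hbox.and (hpt.eventually (hc.and hj)))
    refine ⟨min r (min δ 1), by positivity, (min_le_right _ _).trans (min_le_left _ _),
      (min_le_right _ _).trans (min_le_right _ _), fun v z hvr hzr => ?_⟩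
    have hb : ∀ t, |t - z₀| < min r (min δ 1) → ((v, t) : (ℝ × ℝ) × ℝ) ∈ Metric.ball (0, z₀) r := by
      intro t ht
      rw [Metric.mem_ball, Prod.dist_eq, max_lt_iff]
      exact ⟨by rw [dist_zero_right]; exact hvr.trans_le (min_le_left _ _),
        ht.trans_le (min_le_left _ _)⟩
    obtain ⟨h1, h2, h3⟩ := hball _ (hb z hzr)
    have h1' := (hball _ (hb z₀ (by rw [sub_self, abs_zero]; positivity))).1
    refine ⟨h1, fun hPv => ?_⟩
    have hS : κ.S v z := h1.2 hPv
    have hS' : κ.S v z₀ := h1'.2 hPv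
    have hN := (κ.pt_mem_nbhd v z).2 hS
    have hf : κ.pt v z₀ ∈ B.fibre (κ.pt v z) := (κ.pt_mem_fibre hS).2
      (Column.S_uIcc hS hS' (hzr.trans_le ((min_le_right _ _).trans (min_le_right _ _))))
    refine ⟨h2 hN, hf, ?_⟩
    have := h3 hN
    rw [κ.v_pt] at this
    exact this hf
  have hself : |z₀ - z₀| < r := by rw [sub_self, abs_zero]; exact hr
  -- the height of the surface
  let D' : Set (ℝ × ℝ) := {v | ‖v‖ < r ∧ P v}
  have hD'c : ∀ v ∈ D', κ.pt v z₀ ∈ B.cuspRegion L := fun v hv => ((hbx v z₀ hv.1 hself).2 hv.2).1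
  let F : D' → ℝ := fun v => κ.z (ι (ς ⟨κ.pt v z₀, hD'c v v.2⟩))
  have hFsrc : ∀ v : D', ι (ς ⟨κ.pt v z₀, hD'c v v.2⟩) ∈ κ.chart.source ∧
      κ.v (ι (ς ⟨κ.pt v z₀, hD'c v v.2⟩)) = v := by
    intro v
    have hN := gapRegion_subset (cuspRegion_subset (hD'c v v.2))
    have hf := (h.joined ⟨κ.pt v z₀, hD'c v v.2⟩).1
    exact ⟨κ.fibre_source (κ.pt_mem _ _) hN hf, by rw [κ.fibre_v (κ.pt_mem _ _) hN hf, κ.v_pt]⟩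
  have hFc : Continuous F := by
    rw [continuous_iff_continuousAt]
    intro v
    refine (κ.continuousAt_z (hFsrc v).1).comp
      (f := fun v : D' => ι (ς ⟨κ.pt v z₀, hD'c v v.2⟩)) ?_
    refine (h.continuous_ι.comp (h.continuous_ς.comp (Continuous.subtype_mk ?_ _))).continuousAt
    exact κ.continuous_pt.comp (by fun_prop : Continuous fun v : D' => ((v : ℝ × ℝ), z₀))
  have hP0 : P 0 := fun _ => le_rfl
  have h0D : (0 : ℝ × ℝ) ∈ D' := ⟨by rw [norm_zero]; exact hr, hP0⟩
  have hF0 : F ⟨0, h0D⟩ = z₀ := by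
    obtain ⟨k, e⟩ := h.sect s₀
    have : (⟨κ.pt 0 z₀, hD'c 0 h0D⟩ : B.cuspRegion L) = ⟨ι s₀, k⟩ := Subtype.ext hpt0
    change κ.z (ι (ς ⟨κ.pt 0 z₀, _⟩)) = z₀
    rw [this, e]
  obtain ⟨r', hr', hr'r, hF'⟩ : ∃ r' > 0, r' ≤ r ∧ ∀ v : D', ‖(v : ℝ × ℝ)‖ < r' → |F v - z₀| < r := by
    have := hFc.tendsto ⟨0, h0D⟩
    rw [hF0] at this
    obtain ⟨r', hr', hb⟩ := Metric.eventually_nhds_iff_ball.1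
      (this.eventually (Metric.ball_mem_nhds z₀ hr))
    refine ⟨min r' r, lt_min hr' hr, min_le_right _ _, fun v hv => hb v ?_⟩
    rw [Metric.mem_ball, Subtype.dist_eq, dist_zero_right]
    exact hv.trans_le (min_le_left _ _)
  obtain ⟨e, he, hre, hscale⟩ := exists_isOpenEmbedding_ball hr'
  have hPe : ∀ x, P (e x) ↔ P x := by
    intro x
    obtain ⟨c, hc, ex⟩ := hscale x
    refine forall_congr' fun _ => ?_
    rw [ex]
    change c * x.1 ≤ 0 ↔ x.1 ≤ 0
    exact ⟨fun k => by by_contra h'; nlinarith [mul_pos hc (not_le.1 h')],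
      fun k => mul_nonpos_of_nonneg_of_nonpos hc.le k⟩
  classical
  let ret : ℝ × ℝ → ℝ × ℝ := fun v => if half then (min v.1 0, v.2) else v
  have hretc : Continuous ret := by
    by_cases hh : half
    · simp only [ret, hh, if_true]; fun_prop
    · simp only [ret, hh, if_false]; fun_prop
  have hret : ∀ v, P (ret v) ∧ ‖ret v‖ ≤ ‖v‖ ∧ (P v → ret v = v) := by
    intro v
    by_cases hh : half
    · simp only [ret, hP, hh, if_true, true_implies]
      refine ⟨min_le_right _ _, ?_, fun k => ?_⟩
      · rw [Prod.norm_def, Prod.norm_def]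
        refine max_le_max ?_ le_rfl
        rw [Real.norm_eq_abs, Real.norm_eq_abs]
        rcases le_total v.1 0 with k | k
        · rw [min_eq_left k]
        · rw [min_eq_right k, abs_zero]; exact abs_nonneg _
      · rw [min_eq_left k]
    · simp only [ret, hP, hh, if_false, false_implies, true_and, true_implies]
      exact ⟨le_rfl, trivial⟩
  have hex : ∀ x, ‖e x‖ < r' := by
    intro x
    have : e x ∈ Metric.ball 0 r' := hre ▸ ⟨x, rfl⟩
    rwa [Metric.mem_ball, dist_zero_right] at this
  have hrD : ∀ x, ret (e x) ∈ D' := fun x =>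
    ⟨((hret _).2.1.trans_lt (hex x)).trans_le hr'r, (hret _).1⟩
  let g : ℝ × ℝ → ℝ := fun x => F ⟨ret (e x), hrD x⟩
  have hgc : Continuous g := hFc.comp (Continuous.subtype_mk (hretc.comp he.continuous) _)
  let Ξ : Space3 ≃ₜ Space3 :=
    { toFun := fun q => (q.1, q.2 - g q.1)
      invFun := fun q => (q.1, q.2 + g q.1)
      left_inv := fun q => by simp
      right_inv := fun q => by simp
      continuous_toFun := by fun_prop
      continuous_invFun := by fun_prop }
  set φ := reparam κ.chart he Ξ with hφ
  have hsrc : ∀ y, y ∈ φ.source ↔ y ∈ κ.chart.source ∧ ‖κ.v y‖ < r' := by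
    intro y
    rw [hφ, mem_reparam_source, hre, Metric.mem_ball, dist_zero_right]
    rfl
  have happ : ∀ y ∈ φ.source, κ.v y = e (φ y).1 ∧ κ.z y = (φ y).2 + g (φ y).1 := by
    intro y hy
    have := apply_eq_reparam hy
    exact ⟨congrArg Prod.fst this, congrArg Prod.snd this⟩
  have hgF : ∀ x (hx : P x), ∃ k : e x ∈ D', g x = F ⟨e x, k⟩ := by
    intro x hx
    have e1 := (hret (e x)).2.2 ((hPe x).2 hx)
    exact ⟨e1 ▸ hrD x, by simp only [g, e1]⟩
  set box : Set M := κ.chart.source ∩ κ.chart ⁻¹' {q : Space3 | ‖q.1‖ < r' ∧ |q.2 - z₀| < r} with hbox'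
  have hboxo : IsOpen box := by
    refine κ.chart.isOpen_inter_preimage ?_
    exact (isOpen_lt continuous_fst.norm continuous_const).inter
      (isOpen_lt (continuous_snd.sub continuous_const).abs continuous_const)
  have hmb : ∀ y, y ∈ box ↔ y ∈ κ.chart.source ∧ ‖κ.v y‖ < r' ∧ |κ.z y - z₀| < r := fun y => Iff.rfl
  refine ⟨ι ⁻¹' box, hboxo.preimage h.continuous_ι,
    (hmb _).2 ⟨hκ, by rw [hv, norm_zero]; exact hr', hself⟩, φ, ?_, ?_, fun w hw => ?_⟩
  · exact IsVertical.reparam κ.fibreChart.1 fun q => rfl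
  · ext y
    constructor
    · rintro ⟨w, hw, rfl⟩
      obtain ⟨w1, w2, w3⟩ := (hmb _).1 hw
      have hys := (hsrc _).2 ⟨w1, w2⟩
      obtain ⟨a1, a2⟩ := happ _ hys
      have hPv : P (κ.v (ι w)) := (hbx _ _ (w2.trans_le hr'r) w3).1.1 ((κ.mem_nbhd w1).1 (h.ι_mem w))
      have hPx : P (φ (ι w)).1 := by rw [← hPe, ← a1]; exact hPv
      refine ⟨hys, ?_, hPx⟩
      obtain ⟨k, eg⟩ := hgF _ hPx
      obtain ⟨-, b2, b3⟩ := (hbx _ _ (w2.trans_le hr'r) w3).2 hPv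
      rw [κ.pt_v_z w1] at b2 b3
      obtain ⟨k', e'⟩ := h.ς_ι b2 b3
      have : F ⟨e (φ (ι w)).1, k⟩ = κ.z (ι w) := by
        change κ.z (ι (ς ⟨κ.pt (e (φ (ι w)).1) z₀, _⟩)) = _
        refine congrArg (fun x => κ.z (ι x)) ((congrArg ς (Subtype.ext ?_)).trans e')
        exact congrArg (fun v => κ.pt v z₀) a1.symm
      rw [eg, this] at a2
      linarith
    · rintro ⟨hys, hy0, hPx⟩
      obtain ⟨a1, a2⟩ := happ _ hys
      obtain ⟨y1, y2⟩ := (hsrc _).1 hys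
      obtain ⟨k, eg⟩ := hgF _ hPx
      obtain ⟨c1, c2⟩ := hFsrc ⟨e (φ y).1, k⟩
      have hzF : κ.z y = F ⟨e (φ y).1, k⟩ := by rw [a2, hy0, zero_add, eg]
      have hy : ι (ς ⟨κ.pt (e (φ y).1) z₀, hD'c _ k⟩) = y :=
        κ.ext c1 y1 (c2.trans a1.symm) hzF.symm
      refine ⟨_, ?_, hy⟩
      rw [mem_preimage, hy, hmb]
      refine ⟨y1, y2, ?_⟩
      rw [hzF]
      exact hF' _ (by change ‖e _‖ < r'; rw [← a1]; exact y2)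
  · obtain ⟨w1, w2, w3⟩ := (hmb _).1 hw
    obtain ⟨a1, -⟩ := happ _ ((hsrc _).2 ⟨w1, w2⟩)
    refine ⟨w1, w3.trans_le hrδ, ?_, fun hh => ?_⟩
    · rw [a1]
      obtain ⟨c, hc, ex⟩ := hscale (φ (ι w)).1
      rw [ex]
      change _ ↔ c * _ = 0
      rw [mul_eq_zero]
      exact ⟨.inr, fun k => k.resolve_left hc.ne'⟩
    · filter_upwards [hboxo.mem_nhds hw] with y hy
      obtain ⟨y1, y2, y3⟩ := (hmb _).1 hy
      exact (κ.mem_nbhd y1).2 ((hbx _ _ (y2.trans_le hr'r) y3).1.2 fun k => absurd k hh)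

theorem isEmbedding (h : B.IsCoreSection p L ι ς) : IsEmbedding ι := by
  let ι' : S → B.cuspRegion L := fun s => ⟨ι s, h.mem s⟩
  have h1 : Function.LeftInverse ς ι' := fun s => (h.sect s).2
  exact IsEmbedding.subtypeVal.comp (h1.isEmbedding h.continuous_ς (h.continuous_ι.subtype_mk _))

theorem isCarriedSurface (h : B.IsCoreSection p L ι ς) (hp : B.IsParedLocus p)
    (hL : B.FullyCarries L) : B.IsCarriedSurface p ι := by
  refine ⟨h.injective, range_subset_iff.2 h.ι_mem, fun q hq =>
    ⟨_, h.pared ⟨q, hL.vertInterior_subset_cusp (hp.2.1 hq)⟩ hq⟩, fun s => ?_⟩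
  have hN := h.ι_mem s
  have hcusp := h.mem s
  have hG := cuspRegion_subset hcusp
  have hemb : ∀ W : Set S, IsEmbedding fun w : W => ι w := fun W =>
    h.isEmbedding.comp IsEmbedding.subtypeVal
  by_cases hv : ∃ w ∈ B.fibre (ι s), B.Joined L.carrier (ι s) w ∧ w ∈ B.vertInterior
  · have hsp : ι s ∈ p := by
      obtain ⟨w, h1, h2, h3⟩ := hv
      obtain ⟨k, e⟩ := h.sect s
      have := (h.exists_pared hp hL ⟨ι s, k⟩ h1 h2 h3).1
      rwa [e] at this
    have hc : ∀ᶠ y in 𝓝 (ι s), y ∈ B.nbhd → y ∈ B.cuspRegion L := by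
      filter_upwards [hL.eventually_mem_gapRegion hG (.inl (hp.2.1 hsp)),
        eventually_mem_cuspRegion hL.1 hcusp] with y h1 h2 h3 using h2 (h1 h3)
    have main : ∀ κ : Column B, ι s ∈ κ.chart.source → κ.v (ι s) = 0 → κ.m = .branch →
        κ.z (ι s) = 1 → (∀ y, y ∈ κ.chart.source → (κ.v y).1 = 0 → κ.pt (κ.v y) 1 ∈ p) →
        (∀ q ∈ p, q ∈ κ.chart.source → |κ.z q - 1| < 1 / 2 → (κ.v q).1 = 0) →
        ∃ W : Set S, IsOpen W ∧ s ∈ W ∧ IsEmbedding (fun w : W => ι w) ∧ ∃ φ, B.IsVertical φ ∧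
          ((ι '' W = {y | y ∈ φ.source ∧ (φ y).2 = 0} ∧ ∀ w ∈ W, ι w ∉ p) ∨
           (ι '' W = {y | y ∈ φ.source ∧ (φ y).2 = 0 ∧ (φ y).1.1 ≤ 0} ∧
              ∀ w ∈ W, ι w ∈ p ↔ (φ (ι w)).1.1 = 0)) := by
      intro κ hκ hv0 hm hz1 hp1 hp2
      obtain ⟨W, hW, hsW, φ, hφ, him, hw⟩ := h.exists_chart hκ hv0 True (by
        have : ∀ᶠ q : (ℝ × ℝ) × ℝ in 𝓝 (0, κ.z (ι s)), q.2 ∈ Ioo (1 / 2 : ℝ) (3 / 2) :=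
          continuousAt_snd.eventually (Ioo_mem_nhds (by rw [hz1]; norm_num) (by rw [hz1]; norm_num))
        filter_upwards [this] with q hq
        rw [κ.S_iff, hm, true_implies]
        constructor
        · rintro ⟨-, k, -⟩
          by_contra hlt
          exact k ⟨not_le.1 hlt, hq.1, hq.2⟩
        · intro k
          refine ⟨abs_le.2 ⟨by linarith [hq.1], by linarith [hq.2]⟩, fun k' => ?_, fun k' => ?_⟩
          · exact absurd k'.1 (not_lt.2 k)
          · linarith [k'.2.2, hq.1]) hc (δ := 1 / 2) (by norm_num)
      refine ⟨W, hW, hsW, hemb W, φ, hφ, .inr ⟨by simpa using him, fun w hwW => ?_⟩⟩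
      obtain ⟨w1, w2, w3, -⟩ := hw w hwW
      rw [hz1] at w2
      rw [w3]
      refine ⟨fun k => hp2 _ k w1 w2, fun k => ?_⟩
      have hq := hp1 _ w1 k
      have hqN : κ.pt (κ.v (ι w)) 1 ∈ B.nbhd := (hp.2.1 hq).1.1
      have hf : κ.pt (κ.v (ι w)) 1 ∈ B.fibre (ι w) := κ.pt_mem_fibre_of_Icc w1
        (Column.S_uIcc ((κ.mem_nbhd w1).1 (h.ι_mem w)) ((κ.pt_mem_nbhd _ _).1 hqN) (by linarith))
      -- the segment to the pared locus lies in the arc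
      have hvert : ∀ x ∈ B.seg (ι w) (κ.pt (κ.v (ι w)) 1), x ∈ B.vertInterior := by
        intro x hx
        rw [κ.mem_seg w1 (h.ι_mem w) hf, κ.z_pt] at hx
        rw [κ.mem_vertInterior (κ.fibre_source w1 (h.ι_mem w) hx.1)]
        refine .inl ⟨hm, ?_, ?_⟩
        · rw [κ.fibre_v w1 (h.ι_mem w) hx.1]; exact k
        · rw [abs_lt] at w2
          exact ordConnected_Ioo.uIcc_subset (by constructor <;> linarith) (by norm_num) hx.2
      have hj : B.Joined L.carrier (ι w) (κ.pt (κ.v (ι w)) 1) :=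
        Set.disjoint_left.2 fun x hx hxL => hL.1.not_mem_vertInterior hxL (hvert x hx)
      obtain ⟨k', e⟩ := h.ς_ι hf hj
      have := h.pared ⟨_, k'⟩ hq
      rw [e] at this
      rw [this]
      exact hq
    obtain ⟨κ, hκ, hv0, hn⟩ := Column.exists_normal hp hN
    have hnorm := fun q (hq : q ∈ p) (hqs : q ∈ κ.chart.source) => hn.height hp hqs hq
    rcases hnorm _ hsp hκ with ⟨h1, h2, h3⟩ | ⟨h1, h2, h3⟩
    · refine main κ hκ hv0 h1 h3 (fun y _ hy => hn.upper_mem h1 hy) fun q hq hqs hz => ?_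
      rcases hnorm q hq hqs with k | k
      · exact k.2.1
      · rw [k.2.2] at hz; norm_num [abs_lt] at hz
    · refine main κ.flip (κ.flip_source.2 hκ) ?_ h1 ?_ (fun y hys hy => ?_) fun q hq hqs hz => ?_
      · rw [κ.flip_v hκ, hv0]; rfl
      · rw [κ.flip_z hκ, h3]; norm_num
      · rw [κ.flip_pt]
        exact hn.lower_mem h1 hy
      · rw [κ.flip_source] at hqs
        rw [κ.flip_z hqs] at hz
        rw [κ.flip_v hqs]
        rcases hnorm q hq hqs with k | k
        · rw [k.2.2] at hz; norm_num [abs_lt] at hz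
        · exact k.2.1
  · obtain ⟨κ, hκ, hv0⟩ := exists_column B hN
    replace hv0 : κ.v (ι s) = 0 := hv0
    have hc : ∀ᶠ y in 𝓝 (ι s), y ∈ B.nbhd → y ∈ B.cuspRegion L := by
      filter_upwards [hL.eventually_mem_gapRegion hG (.inr (by push Not at hv; exact hv)),
        eventually_mem_cuspRegion hL.1 hcusp] with y h1 h2 h3 using h2 (h1 h3)
    have harc : ¬ κ.Arc (κ.v (ι s)) (κ.z (ι s)) := fun k =>
      hv (exists_joined_vertInterior ((κ.mem_vertBoundary hκ).2 k) hG.1.2)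
    obtain ⟨a, b, hab⟩ := exists_ends hκ hG
    have hbox := Column.S_mem_nhds hab.left_lt hab.lt_right (fun t ht => (κ.pt_mem_nbhd _ _).1
      (fibre_subset hN (κ.fibre_uIcc hκ hN hab.left.2 hab.right.2
        (by rwa [uIcc_of_le (hab.left_lt.trans hab.lt_right).le])))) harc
    rw [hv0] at hbox
    obtain ⟨W, hW, hsW, φ, hφ, him, hw⟩ := h.exists_chart hκ hv0 False
      (by filter_upwards [hbox] with q hq; simpa using hq) hc one_pos
    refine ⟨W, hW, hsW, hemb W, φ, hφ, .inl ⟨by simpa using him, fun w hwW k => ?_⟩⟩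
    have := (hp.2.1 k).1.2.1
    exact this.2 (mem_interior_iff_mem_nhds.2 ((hw w hwW).2.2.2 (by simp)))

end IsCoreSection

/-! ### Paths along the leaves that bound the gaps -/

/-- The point `w` of `X` is an end of a gap of `X` in its fibre. -/
def IsGapEnd (B : BranchedSurface M) (X : Set M) (w : M) : Prop :=
  w ∈ X ∧ w ∈ B.nbhd ∧ ∃ b ∈ B.fibre w, b ≠ w ∧ ∀ x ∈ X ∩ B.seg w b, x = w ∨ x = b

theorem Ends.isGapEnd {X : Set M} {y a b : M} (h : B.Ends X κ y a b) (hκ : y ∈ κ.chart.source)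
    (hy : y ∈ B.nbhd) : B.IsGapEnd X a := by
  have h1 := h.left_lt
  have h2 := h.lt_right
  have e := B.fibre_eq _ hy _ h.left.2
  have hinj := (κ.isCoordinate_z hκ hy).2
  refine ⟨h.left.1, fibre_subset hy h.left.2, b, e ▸ h.right.2, fun k => ?_, fun x hx => ?_⟩
  · rw [k] at h2; linarith
  · have := (κ.mem_seg' hκ hy h.left.2 h.right.2).1 hx.2
    rw [uIcc_of_le (by linarith)] at this
    rcases h.out x ⟨hx.1, this.1⟩ with k | k
    · exact .inl (hinj this.1 h.left.2 (le_antisymm k this.2.1))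
    · exact .inr (hinj this.1 h.right.2 (le_antisymm this.2.2 k))

section chart
variable {φ : OpenPartialHomeomorph M Space3} {C : Set ℝ} {e : ℝ × ℝ → ℝ × ℝ}

/-- In a vertical product chart, the ends of the gaps have countably many heights. -/
theorem Carries.countable_heights (hL : B.Carries L) (ht : φ.target = univ)
    (hC : ∀ y ∈ φ.source, y ∈ L.carrier ↔ (φ y).2 ∈ C) (hs : φ.source ⊆ κ.chart.source)
    (he : ∀ y ∈ φ.source, κ.v y = e (φ y).1) :
    {c | ∃ w ∈ φ.source, B.IsGapEnd L.carrier w ∧ (φ w).2 = c}.Countable := by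
  refine ((countable_setOfPred_isolated_right_within (s := C)).union
    (countable_setOfPred_isolated_left_within (s := C))).mono ?_
  rintro _ ⟨w, hw, ⟨hwL, hwN, b, hb, hbw, hbx⟩, rfl⟩
  have htar : ∀ q, q ∈ φ.target := fun q => by rw [ht]; trivial
  have hwC := (hC _ hw).1 hwL
  set G : ℝ → M := fun c => φ.symm ((φ w).1, c) with hG
  have hGs : ∀ c, G c ∈ φ.source := fun c => φ.map_target (htar _)
  have hGφ : ∀ c, φ (G c) = ((φ w).1, c) := fun c => φ.right_inv (htar _)
  have hGv : ∀ c, κ.v (G c) = κ.v w := fun c => by rw [he _ (hGs c), hGφ, he _ hw]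
  have hG0 : G (φ w).2 = w := φ.left_inv hw
  have hGc : Continuous G := by
    have := φ.continuousOn_symm
    rw [ht, continuousOn_univ] at this
    exact this.comp (by fun_prop)
  set f : ℝ → ℝ := fun c => κ.z (G c) with hf
  have hfc : Continuous f := continuous_iff_continuousAt.2 fun c =>
    (κ.continuousAt_z (hs (hGs c))).comp hGc.continuousAt
  have hfi : Function.Injective f := by
    intro c c' h
    have := κ.ext (hs (hGs c)) (hs (hGs c')) (by rw [hGv, hGv]) h
    simpa [hGφ] using congrArg (fun x => (φ x).2) this
  have hf0 : f (φ w).2 = κ.z w := congrArg κ.z hG0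
  have hbs := κ.fibre_source (hs hw) hwN hb
  have hne : κ.z b ≠ κ.z w := fun k =>
    hbw ((κ.isCoordinate_z (hs hw) hwN).2 hb (self_mem_fibre hwN) k)
  have key : ∀ᶠ c in 𝓝 (φ w).2, c ∈ C → c ≠ (φ w).2 → f c ∉ uIcc (κ.z w) (κ.z b) := by
    have h1 : ∀ᶠ c in 𝓝 (φ w).2, |f c - κ.z w| < min 1 |κ.z b - κ.z w| := by
      refine ((hfc.sub continuous_const).abs).continuousAt.eventually_lt_const ?_
      change |f (φ w).2 - κ.z w| < _
      rw [hf0, sub_self, abs_zero]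
      exact lt_min one_pos (abs_pos.2 (sub_ne_zero.2 hne))
    filter_upwards [h1] with c hc hcC hcw hmem
    have hGL : G c ∈ L.carrier := (hC _ (hGs c)).2 (by rw [hGφ]; exact hcC)
    have hGN := (κ.mem_nbhd (hs (hGs c))).1 (hL.1 hGL)
    rw [hGv] at hGN
    have hGf : G c ∈ B.fibre w := (κ.mem_fibre (hs hw) hwN).2 ⟨hs (hGs c), hGv c,
      Column.S_uIcc ((κ.mem_nbhd (hs hw)).1 hwN) hGN
        (by rw [abs_sub_comm]; exact hc.trans_le (min_le_left _ _))⟩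
    rcases hbx (G c) ⟨hGL, (κ.mem_seg (hs hw) hwN hb).2 ⟨hGf, hmem⟩⟩ with k | k
    · exact hcw (hfi ((congrArg κ.z k).trans hf0.symm))
    · have := hc.trans_le (min_le_right _ _)
      rw [show f c = κ.z b from congrArg κ.z k] at this
      exact lt_irrefl _ this
  have fin : ∀ I : Set ℝ, (φ w).2 ∉ I → (∀ᶠ c in 𝓝 (φ w).2, c ∈ I → f c ∈ uIcc (κ.z w) (κ.z b)) →
      𝓝[C ∩ I] (φ w).2 = ⊥ := by
    intro I hI h
    rw [← eventually_false_iff_eq_bot]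
    filter_upwards [mem_nhdsWithin_of_mem_nhds key, mem_nhdsWithin_of_mem_nhds h,
      self_mem_nhdsWithin] with c h1 h2 h3
    exact h1 h3.1 (fun k => hI (k ▸ h3.2)) (h2 h3.2)
  have hlt : ∀ {x y : ℝ}, x < y → f (φ w).2 = x → ∀ᶠ c in 𝓝 (φ w).2, f c < y := fun h k =>
    hfc.continuousAt.eventually_lt_const (k ▸ h)
  have hgt : ∀ {x y : ℝ}, y < x → f (φ w).2 = x → ∀ᶠ c in 𝓝 (φ w).2, y < f c := fun h k =>
    hfc.continuousAt.eventually_const_lt (k ▸ h)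
  rcases hfc.strictMono_of_inj hfi with hm | hm <;> rcases lt_or_gt_of_ne hne with k | k
  · refine .inr ⟨hwC, fin _ self_notMem_Iio ?_⟩
    filter_upwards [hgt k hf0] with c h1 h2
    rw [uIcc_of_ge k.le]
    exact ⟨h1.le, hf0 ▸ (hm h2).le⟩
  · refine .inl ⟨hwC, fin _ self_notMem_Ioi ?_⟩
    filter_upwards [hlt k hf0] with c h1 h2
    rw [uIcc_of_le k.le]
    exact ⟨hf0 ▸ (hm h2).le, h1.le⟩
  · refine .inl ⟨hwC, fin _ self_notMem_Ioi ?_⟩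
    filter_upwards [hgt k hf0] with c h1 h2
    rw [uIcc_of_ge k.le]
    exact ⟨h1.le, hf0 ▸ (hm h2).le⟩
  · refine .inr ⟨hwC, fin _ self_notMem_Iio ?_⟩
    filter_upwards [hlt k hf0] with c h1 h2
    rw [uIcc_of_le k.le]
    exact ⟨hf0 ▸ (hm h2).le, h1.le⟩

/-- A path of ends of gaps stays at a constant height. -/
theorem Carries.height_const (hL : B.Carries L) (ht : φ.target = univ)
    (hC : ∀ y ∈ φ.source, y ∈ L.carrier ↔ (φ y).2 ∈ C) (hs : φ.source ⊆ κ.chart.source)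
    (he : ∀ y ∈ φ.source, κ.v y = e (φ y).1) {I : Set ℝ} (hI : IsPreconnected I) {a : ℝ → M}
    (ha : ContinuousOn a I) (h : ∀ t ∈ I, a t ∈ φ.source ∧ B.IsGapEnd L.carrier (a t)) :
    ∀ t ∈ I, ∀ t' ∈ I, (φ (a t)).2 = (φ (a t')).2 := by
  have hc : ContinuousOn (fun t => (φ (a t)).2) I :=
    continuous_snd.comp_continuousOn (φ.continuousOn.comp ha fun t ht => (h t ht).1)
  have := (hL.countable_heights ht hC hs he).isTotallyDisconnected _ (image_subset_iff.2 fun t ht =>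
    ⟨a t, (h t ht).1, (h t ht).2, rfl⟩) (hI.image _ hc)
  exact fun t ht t' ht' => this ⟨t, ht, rfl⟩ ⟨t', ht', rfl⟩

end chart

/-- A path of ends of gaps over a convergent path converges to each of its cluster points. -/
theorem Carries.tendsto_gapEnd (hL : B.Carries L) {a : ℝ → M} {t₀ : ℝ} (ht₀ : t₀ < 1)
    (hac : ContinuousOn a (Ioo t₀ 1)) (ha : ∀ t ∈ Ioo t₀ 1, B.IsGapEnd L.carrier (a t)) {l₁ : M}
    (hκ : l₁ ∈ κ.chart.source) (hl₁ : MapClusterPt l₁ (𝓝[<] 1) a)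
    (hsrc : ∀ t ∈ Ioo t₀ 1, a t ∈ κ.chart.source)
    (hv : Tendsto (fun t => κ.v (a t)) (𝓝[<] 1) (𝓝 (κ.v l₁))) : Tendsto a (𝓝[<] 1) (𝓝 l₁) := by
  have hev0 : ∀ᶠ t in 𝓝[<] (1 : ℝ), t ∈ Ioo t₀ 1 := Ioo_mem_nhdsLT ht₀
  have hl₁L : l₁ ∈ L.carrier := by
    refine L.isClosed_carrier.closure_eq ▸ mem_closure_iff_nhds.2 fun U hU => ?_
    obtain ⟨t, h1, h2⟩ := ((hl₁.frequently hU).and_eventually hev0).exists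
    exact ⟨a t, h1, (ha t h2).1⟩
  obtain ⟨φ, C, hφ, htar, hC, ⟨κ', hs, e, -, he⟩, hbase, hev⟩ := hL.exists_chart hl₁L
  set z₁ := κ.z l₁ with hz₁
  have hpt : Tendsto (fun v => κ.pt v z₁) (𝓝 (κ.v l₁)) (𝓝 l₁) := by
    have h1 : Continuous fun v => κ.pt v z₁ :=
      κ.continuous_pt.comp (by fun_prop : Continuous fun v : ℝ × ℝ => (v, z₁))
    have := h1.tendsto (κ.v l₁)
    rwa [κ.pt_v_z hκ] at this
  -- the leaves, as graphs over the base
  let X : ℝ × ℝ → ℝ × ℝ := fun v => (φ (κ.pt v z₁)).1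
  let G : (ℝ × ℝ) → ℝ → M := fun v c => φ.symm (X v, c)
  have hGcont : ∀ v c, κ.pt v z₁ ∈ φ.source →
      ContinuousAt (fun q : (ℝ × ℝ) × ℝ => G q.1 q.2) (v, c) := by
    intro v c hvs
    have h1 : ContinuousAt X v := continuous_fst.continuousAt.comp
      ((φ.continuousAt hvs).comp (f := fun v => κ.pt v z₁)
        (κ.continuous_pt.comp (by fun_prop : Continuous fun v : ℝ × ℝ => (v, z₁))).continuousAt)
    have h2 := φ.continuousOn_symm
    rw [htar, continuousOn_univ] at h2
    refine h2.continuousAt.comp (f := fun q : (ℝ × ℝ) × ℝ => (X q.1, q.2)) ?_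
    exact (h1.comp_of_eq continuousAt_fst rfl).prodMk continuousAt_snd
  have hptl : κ.pt (κ.v l₁) z₁ = l₁ := κ.pt_v_z hκ
  have hG1 : G (κ.v l₁) (φ l₁).2 = l₁ := by
    change φ.symm ((φ (κ.pt (κ.v l₁) z₁)).1, _) = _
    rw [hptl]
    exact φ.left_inv hφ
  have hS : ∀ᶠ v in 𝓝 (κ.v l₁), κ.S v z₁ :=
    ((hL.eventually_exists hκ hl₁L one_pos).mono fun v k => k.1)
  have hpt1 : Tendsto (fun q : (ℝ × ℝ) × ℝ => κ.pt q.1 z₁) (𝓝 (κ.v l₁, (φ l₁).2)) (𝓝 l₁) :=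
    hpt.comp (continuous_fst.tendsto (κ.v l₁, (φ l₁).2))
  have hGlim := (hGcont (κ.v l₁) (φ l₁).2 (hptl.symm ▸ hφ)).tendsto
  dsimp only at hGlim
  rw [hG1] at hGlim
  -- everything near `l₁` lies on these graphs
  have hnear : ∀ᶠ w in 𝓝 l₁, w ∈ φ.source ∧ (w ∈ L.carrier → w = G (κ.v w) (φ w).2) := by
    have h1 : ∀ᶠ w in 𝓝 l₁, κ.S (κ.v w) z₁ ∧ κ.pt (κ.v w) z₁ ∈ φ.source :=
      (κ.continuousAt_v hκ).eventually (hS.and (hpt.eventually (φ.open_source.mem_nhds hφ)))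
    have h2 : ∀ᶠ w in 𝓝 l₁, |κ.z w - z₁| < 1 :=
      (κ.continuousAt_z hκ).eventually (Metric.ball_mem_nhds _ one_pos)
    filter_upwards [h1, h2, φ.open_source.mem_nhds hφ, κ.source_mem_nhds hκ] with w h1 h2 h3 h4
    refine ⟨h3, fun hwL => ?_⟩
    have hwS := (κ.mem_nbhd h4).1 (hL.1 hwL)
    have hf : κ.pt (κ.v w) z₁ ∈ B.fibre w := by
      have := (κ.pt_mem_fibre hwS).2 (Column.S_uIcc hwS h1.1 h2)
      rwa [κ.pt_v_z h4] at this
    have := hbase w ⟨h3, hL.1 hwL⟩ _ ⟨h1.2, hf⟩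
    change w = φ.symm ((φ (κ.pt (κ.v w) z₁)).1, _)
    rw [this]
    exact (φ.left_inv h3).symm
  have hall : ∀ᶠ q : (ℝ × ℝ) × ℝ in 𝓝 (κ.v l₁, (φ l₁).2),
      (∀ᶠ w in 𝓝 (G q.1 q.2), w ∈ φ.source ∧ (w ∈ L.carrier → w = G (κ.v w) (φ w).2)) ∧
      κ.pt q.1 z₁ ∈ φ.source :=
    (hGlim.eventually hnear.eventually_nhds).and
      (hpt1.eventually (φ.open_source.mem_nhds hφ))
  rw [nhds_prod_eq] at hall
  obtain ⟨P, hP, Q, hQ, hPQ⟩ := eventually_prod_iff.1 hall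
  obtain ⟨t₁, ht₁, hP1⟩ := mem_nhdsLT_iff_exists_Ioo_subset.1 ((hv.eventually hP).and hev0)
  obtain ⟨s, hs1, hs2⟩ := ((hl₁.frequently ((hnear.and ((continuous_snd.continuousAt.comp
    (φ.continuousAt hφ)).eventually hQ)))).and_eventually (Ioo_mem_nhdsLT ht₁)).exists
  set c := (φ (a s)).2 with hc
  have hcQ : Q c := hs1.2
  have has : a s = G (κ.v (a s)) c := hs1.1.2 (ha s (hP1 hs2).2).1
  have hIoo : ∀ t ∈ Ico s 1, t ∈ Ioo t₁ 1 := fun t ht => ⟨hs2.1.trans_le ht.1, ht.2⟩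
  have htail : ∀ t ∈ Ico s 1, a t = G (κ.v (a t)) c := by
    intro t ht
    have hsub : Icc s t ⊆ Ioo t₀ 1 := fun x hx => (hP1 (hIoo x ⟨hx.1, hx.2.trans_lt ht.2⟩)).2
    have hva : ContinuousOn (fun t => κ.v (a t)) (Icc s t) := fun x hx =>
      (κ.continuousAt_v (hsrc x (hsub hx))).comp_continuousWithinAt ((hac.mono hsub) x hx)
    have hGa : ContinuousOn (fun t => G (κ.v (a t)) c) (Icc s t) := by
      intro x hx
      have h1 := (hPQ (hP1 (hIoo x ⟨hx.1, hx.2.trans_lt ht.2⟩)).1 hcQ).2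
      exact ContinuousAt.comp_continuousWithinAt (f := fun t => (κ.v (a t), c)) (hGcont _ c h1)
        ((hva x hx).prodMk continuousWithinAt_const)
    have hcl := isClosed_Icc.isClosed_eq (hac.mono hsub) hGa
    have := IsClosed.Icc_subset_of_forall_mem_nhdsWithin (s := {x | a x = G (κ.v (a x)) c})
      (a := s) (b := t) (by convert hcl using 1; ext x; exact and_comm) has ?_
    · exact this ⟨ht.1, le_rfl⟩
    rintro x ⟨hx, hxI⟩
    replace hx : a x = G (κ.v (a x)) c := hx
    have hxm := hsub (Ico_subset_Icc_self hxI)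
    have hev1 := (hPQ (hP1 (hIoo x ⟨hxI.1, hxI.2.trans ht.2⟩)).1 hcQ).1
    simp only at hev1
    rw [← hx] at hev1
    have hcx := hac.continuousAt (isOpen_Ioo.mem_nhds hxm)
    obtain ⟨r, hr, hball⟩ := Metric.eventually_nhds_iff_ball.1
      ((hcx.eventually hev1).and (isOpen_Ioo.mem_nhds hxm))
    have hI : IsPreconnected (Metric.ball x r) := (convex_ball x r).isPreconnected
    have hconst := hL.height_const htar hC hs he hI (hac.mono fun y hy => (hball y hy).2)
      fun y hy => ⟨(hball y hy).1.1, ha y (hball y hy).2⟩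
    refine mem_nhdsWithin_of_mem_nhds (Filter.mem_of_superset (Metric.ball_mem_nhds x hr) ?_)
    intro y hy
    have e1 := (hball y hy).1.2 (ha y (hball y hy).2).1
    have e2 := hconst y hy x (Metric.mem_ball_self hr)
    have e3 : (φ (a x)).2 = c := by
      have : φ (G (κ.v (a x)) c) = (X (κ.v (a x)), c) := φ.right_inv (by rw [htar]; trivial)
      rw [hx, this]
    rw [e2, e3] at e1
    exact e1
  have hlim2 : Tendsto a (𝓝[<] 1) (𝓝 (G (κ.v l₁) c)) := by
    have h1 := (hGcont (κ.v l₁) c (hptl.symm ▸ hφ)).tendsto.comp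
      (hv.prodMk_nhds (tendsto_const_nhds (x := c)))
    refine h1.congr' ?_
    filter_upwards [Ico_mem_nhdsLT hs2.2] with t ht using (htail t ht).symm
  have : l₁ = G (κ.v l₁) c := by
    by_contra hne
    obtain ⟨U, V, hU, hV, h1, h2, h3⟩ := t2_separation hne
    obtain ⟨t, k1, k2⟩ := ((hl₁.frequently (hU.mem_nhds h1)).and_eventually
      (hlim2.eventually (hV.mem_nhds h2))).exists
    exact h3.le_bot ⟨k1, k2⟩
  rwa [← this] at hlim2

/-- Two paths of ends of gaps in the same fibres with the same limit have a point in common. -/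
theorem Carries.exists_eq_of_tendsto (hL : B.Carries L) {a b : ℝ → M} {t₀ : ℝ} (ht₀ : t₀ < 1)
    (hac : ContinuousOn a (Ioo t₀ 1)) (hbc : ContinuousOn b (Ioo t₀ 1))
    (ha : ∀ t ∈ Ioo t₀ 1, B.IsGapEnd L.carrier (a t))
    (hb : ∀ t ∈ Ioo t₀ 1, B.IsGapEnd L.carrier (b t)) (hab : ∀ t ∈ Ioo t₀ 1, b t ∈ B.fibre (a t))
    {l₁ : M} (hl₁ : l₁ ∈ L.carrier) (hal : Tendsto a (𝓝[<] 1) (𝓝 l₁))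
    (hbl : Tendsto b (𝓝[<] 1) (𝓝 l₁)) : ∃ t ∈ Ioo t₀ 1, a t = b t := by
  obtain ⟨φ, C, hφ, htar, hC, ⟨κ', hs, e, -, he⟩, hbase, -⟩ := hL.exists_chart hl₁
  have hφs := φ.open_source.mem_nhds hφ
  have hI : Ioo t₀ 1 ∈ 𝓝[<] (1 : ℝ) := Ioo_mem_nhdsLT ht₀
  obtain ⟨t₁, ht₁, h1⟩ := mem_nhdsLT_iff_exists_Ioo_subset.1
    (inter_mem (inter_mem (hal hφs) (hbl hφs)) hI)
  have key : ∀ f : ℝ → M, ContinuousOn f (Ioo t₀ 1) → (∀ t ∈ Ioo t₀ 1, B.IsGapEnd L.carrier (f t)) →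
      Tendsto f (𝓝[<] 1) (𝓝 l₁) → (∀ t ∈ Ioo t₁ 1, f t ∈ φ.source) →
      ∀ t ∈ Ioo t₁ 1, (φ (f t)).2 = (φ l₁).2 := by
    intro f hf hg hfl hfs t ht
    have hconst := hL.height_const htar hC hs he isPreconnected_Ioo
      (hf.mono fun y hy => (h1 hy).2) fun y hy => ⟨hfs y hy, hg y (h1 hy).2⟩
    refine tendsto_nhds_unique (tendsto_const_nhds.congr' ?_)
      ((continuous_snd.continuousAt.comp (φ.continuousAt hφ)).tendsto.comp hfl)
    filter_upwards [Ioo_mem_nhdsLT ht₁] with s hs using hconst t ht s hs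
  obtain ⟨t, ht⟩ := nonempty_Ioo.2 (show t₁ < 1 from ht₁)
  have hat : a t ∈ φ.source := (h1 ht).1.1
  have hbt : b t ∈ φ.source := (h1 ht).1.2
  refine ⟨t, (h1 ht).2, φ.injOn hat hbt (Prod.ext ?_ ?_)⟩
  · exact (hbase _ ⟨hat, (ha t (h1 ht).2).2.1⟩ _ ⟨hbt, hab t (h1 ht).2⟩).symm
  · rw [key a hac ha hal (fun s hs => (h1 hs).1.1) t ht,
      key b hbc hb hbl (fun s hs => (h1 hs).1.2) t ht]

namespace IsCoreSection
variable {S : Type u} [TopologicalSpace S] {ι : S → M} {ς : B.cuspRegion L → S}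

theorem isCompleteSurface (h : B.IsCoreSection p L ι ς) (hL : B.Carries L) :
    B.IsCompleteSurface ι := by
  intro γ hγ y hy hlim
  obtain ⟨κ, hκ, -⟩ := exists_column B hy
  replace hκ : y ∈ κ.chart.source := hκ
  set x : ℝ → M := fun t => ι (γ t) with hx
  have hxN : ∀ t, x t ∈ B.nbhd := fun t => h.ι_mem _
  have hxs : ∀ᶠ t in 𝓝[<] (1 : ℝ), x t ∈ κ.chart.source := hlim
    (κ.isOpen_source.mem_nhdsSet.2 fun w hw => κ.fibre_source hκ hy hw)
  have hv : Tendsto (fun t => κ.v (x t)) (𝓝[<] 1) (𝓝 (κ.v y)) := by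
    intro U hU
    refine hlim (mem_nhdsSet_iff_forall.2 fun w hw => ?_ : κ.v ⁻¹' U ∈ 𝓝ˢ (B.fibre y))
    exact (κ.continuousAt_v (κ.fibre_source hκ hy hw)).tendsto (by rwa [κ.fibre_v hκ hy hw])
  have hex : ∀ t, ∃ ab : M × M, x t ∈ κ.chart.source → B.Ends L.carrier κ (x t) ab.1 ab.2 := by
    intro t
    by_cases k : x t ∈ κ.chart.source
    · obtain ⟨a, b, hab⟩ := exists_ends k (cuspRegion_subset (h.mem (γ t)))
      exact ⟨(a, b), fun _ => hab⟩
    · exact ⟨(x t, x t), fun k' => absurd k' k⟩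
  choose ab hab using hex
  obtain ⟨t₀, ht₀, h0⟩ := mem_nhdsLT_iff_exists_Ioo_subset.1
    (inter_mem (inter_mem hxs (hv (Metric.closedBall_mem_nhds _ one_pos)))
      (Ioo_mem_nhdsLT (zero_lt_one (α := ℝ))))
  have hsrc : ∀ t ∈ Ioo t₀ 1, x t ∈ κ.chart.source := fun t ht => (h0 ht).1.1
  have hE := fun t ht => hab t (hsrc t ht)
  have hxc : ∀ t ∈ Ioo t₀ 1, ContinuousAt x t := fun t ht =>
    h.continuous_ι.continuousAt.comp ((hγ.mono Ioo_subset_Ico_self).continuousAt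
      (isOpen_Ioo.mem_nhds (h0 ht).2))
  have hnh : ∀ t ∈ Ioo t₀ 1, ∀ᶠ s in 𝓝 t, x s ∈ B.nbhd ∧
      B.Ends L.carrier κ (x s) (ab s).1 (ab s).2 := fun t ht => by
    filter_upwards [isOpen_Ioo.mem_nhds ht] with s hs using ⟨hxN s, hE s hs⟩
  have conv : ∀ f : ℝ → M, ContinuousOn f (Ioo t₀ 1) →
      (∀ t ∈ Ioo t₀ 1, f t ∈ B.fibre (x t) ∧ B.IsGapEnd L.carrier (f t)) →
      ∃ l₁ ∈ L.carrier, l₁ ∈ κ.chart.source ∧ Tendsto f (𝓝[<] 1) (𝓝 l₁) := by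
    intro f hf hg
    have hfs : ∀ t ∈ Ioo t₀ 1, f t ∈ κ.chart.source ∧ κ.v (f t) = κ.v (x t) := fun t ht =>
      ⟨κ.fibre_source (hsrc t ht) (hxN t) (hg t ht).1, κ.fibre_v (hsrc t ht) (hxN t) (hg t ht).1⟩
    have hev : ∀ᶠ t in 𝓝[<] (1 : ℝ), t ∈ Ioo t₀ 1 := Ioo_mem_nhdsLT ht₀
    have hfv : Tendsto (fun t => κ.v (f t)) (𝓝[<] 1) (𝓝 (κ.v y)) :=
      hv.congr' (hev.mono fun t ht => (hfs t ht).2.symm)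
    obtain ⟨l₁, hl₁, hcl⟩ := hL.isCompact.exists_mapClusterPt (f := 𝓝[<] (1 : ℝ)) (u := f)
      (le_principal_iff.2 (hev.mono fun t ht => (hg t ht).2.1))
    have hbox : l₁ ∈ κ.box (κ.v y) 1 := by
      refine (κ.isClosed_box _ _).closure_eq ▸ mem_closure_iff_nhds.2 fun U hU => ?_
      obtain ⟨t, h1, h2⟩ := ((hcl.frequently hU).and_eventually hev).exists
      refine ⟨f t, h1, κ.mem_box.2 ⟨(hfs t h2).1, ?_, κ.z_mem_Icc (hfs t h2).1 (hg t h2).2.2.1⟩⟩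
      rw [(hfs t h2).2]
      exact (h0 h2).1.2
    have hl₁s := (κ.mem_box.1 hbox).1
    have hvl : κ.v l₁ = κ.v y := by
      by_contra hne
      obtain ⟨U, V, hU, hV, h1, h2, h3⟩ := t2_separation hne
      obtain ⟨t, k1, k2⟩ := ((hcl.frequently ((κ.continuousAt_v hl₁s) (hU.mem_nhds h1))).and_eventually
        (hfv.eventually (hV.mem_nhds h2))).exists
      exact h3.le_bot ⟨k1, k2⟩
    exact ⟨l₁, hl₁, hl₁s, hL.tendsto_gapEnd ht₀ hf (fun t ht => (hg t ht).2) hl₁s hcl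
      (fun t ht => (hfs t ht).1) (hvl ▸ hfv)⟩
  have hga : ∀ t ∈ Ioo t₀ 1, B.IsGapEnd L.carrier (ab t).1 := fun t ht =>
    (hE t ht).isGapEnd (hsrc t ht) (hxN t)
  have hgb : ∀ t ∈ Ioo t₀ 1, B.IsGapEnd L.carrier (ab t).2 := fun t ht =>
    ((hE t ht).flip (hsrc t ht) (hxN t)).isGapEnd (κ.flip_source.2 (hsrc t ht)) (hxN t)
  have hac : ContinuousOn (fun t => (ab t).1) (Ioo t₀ 1) := fun t ht =>
    ContinuousAt.continuousWithinAt
      ((hE t ht).tendsto_left hL (hsrc t ht) (hxN t) (hxc t ht) (hnh t ht))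
  have hbc : ContinuousOn (fun t => (ab t).2) (Ioo t₀ 1) := fun t ht =>
    ContinuousAt.continuousWithinAt
      ((hE t ht).tendsto_right hL (hsrc t ht) (hxN t) (hxc t ht) (hnh t ht))
  obtain ⟨a₁, ha₁, sa, hal⟩ := conv _ hac fun t ht => ⟨(hE t ht).left.2, hga t ht⟩
  obtain ⟨b₁, hb₁, sb, hbl⟩ := conv _ hbc fun t ht => ⟨(hE t ht).right.2, hgb t ht⟩
  have hfib : ∀ t ∈ Ioo t₀ 1, (ab t).2 ∈ B.fibre (ab t).1 := fun t ht => by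
    rw [B.fibre_eq _ (hxN t) _ (hE t ht).left.2]; exact (hE t ht).right.2
  have hne : a₁ ≠ b₁ := by
    rintro rfl
    obtain ⟨t, ht, e⟩ := hL.exists_eq_of_tendsto ht₀ hac hbc hga hgb hfib ha₁ hal hbl
    have h1 := (hE t ht).left_lt.trans (hE t ht).lt_right
    have e' : (ab t).1 = (ab t).2 := e
    rw [e'] at h1
    exact lt_irrefl _ h1
  have hev : ∀ᶠ t in 𝓝[<] (1 : ℝ), t ∈ Ioo t₀ 1 := Ioo_mem_nhdsLT ht₀
  have haN : ∀ᶠ t in 𝓝[<] (1 : ℝ), (ab t).1 ∈ B.nbhd := hev.mono fun t ht => (hga t ht).2.1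
  have hbf : ∀ᶠ t in 𝓝[<] (1 : ℝ), (ab t).2 ∈ B.fibre (ab t).1 := hev.mono fun t ht => hfib t ht
  have haN₁ := hL.1 ha₁
  have hbf₁ : b₁ ∈ B.fibre a₁ := fibre_of_tendsto hal haN hbl hbf
  -- no point of the lamination lies between the limits
  have hout : ∀ l ∈ L.carrier ∩ B.seg a₁ b₁, l = a₁ ∨ l = b₁ := by
    rintro l ⟨hlL, hls⟩
    by_contra! hcon
    obtain ⟨u, hu, hus⟩ := exists_tendsto_seg hal haN₁ haN hbl hbf₁ hbf hls hcon.1 hcon.2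
    have huN : ∀ᶠ t in 𝓝[<] (1 : ℝ), u t ∈ B.nbhd := by
      filter_upwards [hus, haN] with t k1 k2 using fibre_subset k2 k1.1
    obtain ⟨w, hw, hwL⟩ := hL.exists_tendsto hlL hu huN
    have hwf : ∀ᶠ t in 𝓝[<] (1 : ℝ), w t ∈ B.fibre (ab t).1 := by
      filter_upwards [hwL, hus, haN] with t k1 k2 k3
      rw [← B.fibre_eq _ k3 _ k2.1]; exact k1.2
    obtain ⟨t, ⟨k1, k2, k3⟩, k4, k5⟩ := ((eventually_mem_seg hal haN₁ haN hbl hbf₁ hbf hls hcon.1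
      hcon.2 hw hwf).and (hwL.and hev)).exists
    have hE := hE t k5
    have h1 := hE.left_lt.trans hE.lt_right
    rw [κ.mem_seg' (hsrc t k5) (hxN t) hE.left.2 hE.right.2, uIcc_of_le h1.le] at k1
    have hinj := (κ.isCoordinate_z (hsrc t k5) (hxN t)).2
    rcases hE.out (w t) ⟨k4.1, k1.1⟩ with k | k
    · exact k2 (hinj k1.1 hE.left.2 (le_antisymm k k1.2.1))
    · exact k3 (hinj k1.1 hE.right.2 (le_antisymm k1.2.2 k))
  obtain ⟨m, hm, hma, hmb⟩ : ∃ m ∈ B.seg a₁ b₁, m ≠ a₁ ∧ m ≠ b₁ := by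
    have hz : κ.z a₁ ≠ κ.z b₁ := fun k =>
      hne ((κ.isCoordinate_z sa haN₁).2 (self_mem_fibre haN₁) hbf₁ k)
    have hu : (κ.z a₁ + κ.z b₁) / 2 ∈ uIcc (κ.z a₁) (κ.z b₁) := by
      rw [mem_uIcc]
      rcases le_total (κ.z a₁) (κ.z b₁) with k | k
      · exact .inl ⟨by linarith, by linarith⟩
      · exact .inr ⟨by linarith, by linarith⟩
    refine ⟨κ.pt (κ.v a₁) ((κ.z a₁ + κ.z b₁) / 2), (κ.mem_seg sa haN₁ hbf₁).2
      ⟨κ.fibre_uIcc sa haN₁ (self_mem_fibre haN₁) hbf₁ hu, by rwa [κ.z_pt]⟩, fun k => hz ?_,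
      fun k => hz ?_⟩
    · have := congrArg κ.z k
      rw [κ.z_pt] at this; linarith
    · have := congrArg κ.z k
      rw [κ.z_pt] at this; linarith
  have hmG : m ∈ B.gapRegion L := by
    refine ⟨⟨fibre_subset haN₁ hm.1, fun k => ?_⟩, a₁, ?_, b₁, ?_, hm⟩
    · exact (hout m ⟨k, hm⟩).elim hma hmb
    · exact ⟨ha₁, mem_fibre_symm haN₁ hm.1⟩
    · exact ⟨hb₁, by rw [B.fibre_eq _ haN₁ _ hm.1]; exact hbf₁⟩
  obtain ⟨u, hu, hus⟩ := exists_tendsto_seg hal haN₁ haN hbl hbf₁ hbf hm hma hmb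
  have hus' := eventually_mem_seg hal haN₁ haN hbl hbf₁ hbf hm hma hmb hu
    ((hus.and haN).mono fun t k => k.1.1)
  have huj : ∀ᶠ t in 𝓝[<] (1 : ℝ), ∃ k : u t ∈ B.cuspRegion L, ς ⟨u t, k⟩ = γ t := by
    filter_upwards [hus', hev] with t k1 k2
    have hE := hE t k2
    have hlt := hE.left_lt.trans hE.lt_right
    obtain ⟨k1, k3, k4⟩ := k1
    rw [κ.mem_seg' (hsrc t k2) (hxN t) hE.left.2 hE.right.2, uIcc_of_le hlt.le] at k1
    have hinj := (κ.isCoordinate_z (hsrc t k2) (hxN t)).2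
    refine h.ς_ι k1.1 ((hE.joined_iff (hsrc t k2) (hxN t) k1.1).2 ⟨?_, ?_⟩)
    · exact lt_of_le_of_ne k1.2.1 fun k => k3 (hinj k1.1 hE.left.2 k.symm)
    · exact lt_of_le_of_ne k1.2.2 fun k => k4 (hinj k1.1 hE.right.2 k)
  have hmc : m ∈ B.cuspRegion L :=
    mem_cuspRegion_of_frequently hL hmG (hu.frequently (huj.mono fun t k => k.1).frequently)
  refine ⟨ς ⟨m, hmc⟩, fun U hU => ?_⟩
  have := h.continuous_ς.continuousAt (x := ⟨m, hmc⟩) hU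
  rw [mem_map, nhds_subtype_eq_comap, mem_comap] at this
  obtain ⟨V, hV, hVU⟩ := this
  refine Filter.mem_map.2 ?_
  filter_upwards [hu hV, huj] with t k1 ⟨k2, k3⟩
  have := @hVU ⟨u t, k2⟩ k1
  rwa [mem_preimage, k3] at this

theorem isSplittingSurface (h : B.IsCoreSection p L ι ς) (hp : B.IsParedLocus p)
    (hL : B.FullyCarries L) : B.IsSplittingSurface p ι := by
  obtain ⟨D, hD⟩ := exists_fibreMetric hp
  exact ⟨h.isCarriedSurface hp hL, h.isCompleteSurface hL.1, fun y hy => h.discreteTopology hy,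
    h.isRegularNbhd hp hL D hD⟩

end IsCoreSection

/-! ### Uniqueness of the core surface -/

/-- A core surface with a regular neighbourhood is a section of the interval bundle. -/
theorem IsCoreSurface.exists_section (hL : B.Carries L) {S : Type u} [TopologicalSpace S] {ι : S → M} {O : Set M}
    {ρ : O → S} (h : B.IsCoreSurface L ι) (hO : B.IsTube ι O ρ) (hp : p ⊆ range ι) :
    ∃ ς, B.IsCoreSection p L ι ς := by
  have hex : ∀ y : B.cuspRegion L, ∃ s, ι s ∈ B.fibre y ∧ B.Joined L.carrier y (ι s) := by
    intro y
    obtain ⟨s, hs, -⟩ := h.2 y y.2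
    exact ⟨s, (mem_component_iff y.2).1 hs⟩
  choose ς hς1 hς2 using hex
  have hN : ∀ y : B.cuspRegion L, (y : M) ∈ B.nbhd := fun y =>
    gapRegion_subset (cuspRegion_subset y.2)
  have huniq : ∀ (y : B.cuspRegion L) s, ι s ∈ B.fibre y → B.Joined L.carrier y (ι s) → ς y = s :=
    fun y s h1 h2 => h.eq_of_joined y.2 (hς1 y) h1 (hς2 y) h2
  have hself : ∀ s, ς ⟨ι s, h.mem s⟩ = s := fun s => huniq _ s (self_mem_fibre (hN ⟨_, h.mem s⟩))
    ((joined_self (hN ⟨_, h.mem s⟩)).2 (cuspRegion_subset (h.mem s)).1.2)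
  refine ⟨ς, hO.continuous_ι, ?_, fun s => ⟨h.mem s, hself s⟩, fun y y' => ⟨fun e => ?_, ?_⟩,
    fun y hy => ?_⟩
  · rw [continuous_iff_continuousAt]
    intro y₀
    have hG₀ := cuspRegion_subset y₀.2
    obtain ⟨κ, hκ, -⟩ := exists_column B (hN y₀)
    replace hκ : (y₀ : M) ∈ κ.chart.source := hκ
    have hexE : ∀ y : B.cuspRegion L, ∃ ab : M × M, (y : M) ∈ κ.chart.source →
        B.Ends L.carrier κ y ab.1 ab.2 := by
      intro y
      by_cases k : (y : M) ∈ κ.chart.source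
      · obtain ⟨a, b, hab⟩ := exists_ends k (cuspRegion_subset y.2)
        exact ⟨(a, b), fun _ => hab⟩
      · exact ⟨(y, y), fun k' => absurd k' k⟩
    choose ab hab using hexE
    have hE₀ := hab y₀ hκ
    have hy := continuous_subtype_val.tendsto y₀
    have hE : ∀ᶠ y : B.cuspRegion L in 𝓝 y₀, (y : M) ∈ B.nbhd ∧
        B.Ends L.carrier κ y (ab y).1 (ab y).2 := by
      filter_upwards [hy (κ.source_mem_nhds hκ)] with y k using ⟨hN y, hab y k⟩
    have hal := hE₀.tendsto_left hL hκ (hN y₀) hy hE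
    have hbl := hE₀.tendsto_right hL hκ (hN y₀) hy hE
    have e₀ := B.fibre_eq _ (hN y₀) _ hE₀.left.2
    have haN : ∀ᶠ y in 𝓝 y₀, (ab y).1 ∈ B.nbhd := hE.mono fun y k => fibre_subset k.1 k.2.left.2
    have hbf : ∀ᶠ y in 𝓝 y₀, (ab y).2 ∈ B.fibre (ab y).1 := hE.mono fun y k => by
      rw [B.fibre_eq _ k.1 _ k.2.left.2]; exact k.2.right.2
    have hj := (hE₀.joined_iff hκ (hN y₀) (hς1 y₀)).1 (hς2 y₀)
    have hlt := hE₀.left_lt.trans hE₀.lt_right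
    obtain ⟨w, hw, hws⟩ := exists_tendsto_seg hal (fibre_subset (hN y₀) hE₀.left.2) haN hbl
      (e₀ ▸ hE₀.right.2) hbf (x₀ := ι (ς y₀))
      ((κ.mem_seg' hκ (hN y₀) hE₀.left.2 hE₀.right.2).2
        ⟨hς1 y₀, by rw [uIcc_of_le hlt.le]; exact ⟨hj.1.le, hj.2.le⟩⟩)
      (fun k => by rw [k] at hj; exact lt_irrefl _ hj.1)
      (fun k => by rw [k] at hj; exact lt_irrefl _ hj.2)
    have hwf : ∀ᶠ y : B.cuspRegion L in 𝓝 y₀, w y ∈ B.fibre y := by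
      filter_upwards [hws, hE] with y k1 k2
      rw [← B.fibre_eq _ k2.1 _ k2.2.left.2]; exact k1.1
    have hwN : ∀ᶠ y in 𝓝 y₀, w y ∈ B.nbhd := hwf.mono fun y k => fibre_subset (hN y) k
    have hwO : ∀ᶠ y in 𝓝 y₀, w y ∈ O := by
      filter_upwards [hw (hO.eventually_mem (hO.mem (ς y₀))), hwN] with y k1 k2 using k1 k2
    have hjw : ∀ᶠ y : B.cuspRegion L in 𝓝 y₀, B.Joined L.carrier y (w y) :=
      (hς2 y₀).eventually L.isClosed_carrier hy hw (hwf.mono fun y k => ⟨hN y, k⟩)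
    obtain ⟨k₀, hk₀⟩ := hO.sect (ς y₀)
    have hρ : ∀ U ∈ 𝓝 (ς y₀), ∀ᶠ y in 𝓝 y₀, ∃ k : w y ∈ O, ρ ⟨w y, k⟩ ∈ U := by
      intro U hU
      rw [← hk₀] at hU
      have := hO.continuous_ρ.continuousAt hU
      rw [mem_map, nhds_subtype_eq_comap, mem_comap] at this
      obtain ⟨V, hV, hVU⟩ := this
      filter_upwards [hw hV, hwO] with y k1 k2 using ⟨k2, @hVU ⟨w y, k2⟩ k1⟩
    have hρj : ∀ᶠ y in 𝓝 y₀, ∃ k : w y ∈ O, B.Joined L.carrier (w y) (ι (ρ ⟨w y, k⟩)) := by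
      have hx : ∀ y, ∃ x : M, ∀ k : w y ∈ O, x = ι (ρ ⟨w y, k⟩) := fun y => by
        by_cases k : w y ∈ O
        exacts [⟨ι (ρ ⟨w y, k⟩), fun _ => rfl⟩, ⟨w y, fun k' => absurd k' k⟩]
      choose x hx using hx
      have hxl : Tendsto x (𝓝 y₀) (𝓝 (ι (ς y₀))) := by
        intro V hV
        refine Filter.mem_map.2 ?_
        filter_upwards [hρ _ (hO.continuous_ι.continuousAt hV)] with y ⟨k1, k2⟩
        change x y ∈ V
        rw [hx y k1]; exact k2
      have hj0 : B.Joined L.carrier (ι (ς y₀)) (ι (ς y₀)) :=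
        (joined_self (hO.ι_mem _)).2 (cuspRegion_subset (h.mem _)).1.2
      filter_upwards [hj0.eventually L.isClosed_carrier hw hxl (by
        filter_upwards [hwN, hwO] with y k1 k2
        exact ⟨k1, by rw [hx y k2]; exact hO.ι_fibre k2⟩), hwO] with y k1 k2
      exact ⟨k2, hx y k2 ▸ k1⟩
    intro U hU
    refine Filter.mem_map.2 ?_
    filter_upwards [hρ U hU, hρj, hjw, hwf] with y ⟨k, k1⟩ ⟨_, k2⟩ k3 k4
    have hf : ι (ρ ⟨w y, k⟩) ∈ B.fibre y := B.fibre_eq _ (hN y) _ k4 ▸ hO.ι_fibre k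
    change ς y ∈ U
    rwa [huniq y _ hf (k3.trans k2 (hN y) k4 hf)]
  · have h1 := hς2 y'
    have e1 := B.fibre_eq _ (hN y) _ (hς1 y)
    have e2 := B.fibre_eq _ (hN y') _ (hς1 y')
    rw [← e] at e2
    have hy' : (y' : M) ∈ B.fibre y := by rw [← e1, e2]; exact self_mem_fibre (hN y')
    refine ⟨hy', (hς2 y).trans (e ▸ h1.symm (hN y') (hς1 y')) (hN y) (hς1 y) hy'⟩
  · rintro ⟨h1, h2⟩
    have hf := B.fibre_eq _ (hN y) _ h1
    exact huniq y _ (hf ▸ hς1 y') (h2.trans (hς2 y') (hN y) h1 (hf ▸ hς1 y'))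
  · obtain ⟨s, hs⟩ := hp hy
    have : y = ⟨ι s, h.mem s⟩ := Subtype.ext hs.symm
    rw [this, hself]

theorem FibreMetric.mix_mem_seg {D : FibreMetric B} {y w : M} {t : ℝ} (hy : y ∈ B.nbhd)
    (hw : w ∈ B.fibre y) (ht : t ∈ Icc (0 : ℝ) 1) : D.mix t y w ∈ B.seg y w := by
  obtain ⟨κ, hκ, -⟩ := exists_column B hy
  obtain ⟨c, hc⟩ := D.coord y hy
  rw [Column.mem_seg_coord hκ hy hc.1 (self_mem_fibre hy) hw]
  refine ⟨mix_mem hy hw ht, ?_⟩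
  rw [coord_mix hy hw ht hc, mem_uIcc]
  obtain ⟨h0, h1⟩ := ht
  rcases le_total (c y) (c w) with k | k
  · exact .inl ⟨by nlinarith, by nlinarith⟩
  · exact .inr ⟨by nlinarith, by nlinarith⟩

theorem FibreMetric.mix_self {D : FibreMetric B} {y : M} {t : ℝ} (hy : y ∈ B.nbhd)
    (ht : t ∈ Icc (0 : ℝ) 1) : D.mix t y y = y := by
  have := mix_mem_seg (D := D) hy (self_mem_fibre hy) ht
  rwa [seg_self hy] at this

namespace IsCoreSection
variable {S S' : Type u} [TopologicalSpace S] [TopologicalSpace S'] {ι : S → M} {ι' : S' → M}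
  {ς : B.cuspRegion L → S} {ς' : B.cuspRegion L → S'}

/-- Any two sections of the bundle of gaps are isotopic through sections. -/
theorem isotopicSurfaces (h : B.IsCoreSection p L ι ς) (h' : B.IsCoreSection p L ι' ς')
    (hp : B.IsParedLocus p) (hL : B.FullyCarries L) : B.IsotopicSurfaces p ι ι' := by
  obtain ⟨D, -⟩ := exists_fibreMetric hp
  have hinv : ∀ {S S' : Type u} [TopologicalSpace S] [TopologicalSpace S'] {ι : S → M} {ι' : S' → M}
      {ς : B.cuspRegion L → S} {ς' : B.cuspRegion L → S'} (h : B.IsCoreSection p L ι ς)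
      (h' : B.IsCoreSection p L ι' ς') (s : S), ς ⟨ι' (ς' ⟨ι s, h.mem s⟩), h'.mem _⟩ = s := by
    intro S S' _ _ ι ι' ς ς' h h' s
    obtain ⟨h1, h2⟩ := h'.joined ⟨ι s, h.mem s⟩
    exact (h.ς_ι h1 h2).2
  let θ : S ≃ₜ S' :=
    { toFun := fun s => ς' ⟨ι s, h.mem s⟩
      invFun := fun s => ς ⟨ι' s, h'.mem s⟩
      left_inv := hinv h h'
      right_inv := hinv h' h
      continuous_toFun := h'.continuous_ς.comp (h.continuous_ι.subtype_mk _)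
      continuous_invFun := h.continuous_ς.comp (h'.continuous_ι.subtype_mk _) }
  have hj : ∀ s, ι' (θ s) ∈ B.fibre (ι s) ∧ B.Joined L.carrier (ι s) (ι' (θ s)) := fun s =>
    h'.joined ⟨ι s, h.mem s⟩
  have hcont : ContinuousOn (fun x : ℝ × S => D.mix x.1 (ι x.2) (ι' (θ x.2)))
      (Icc (0 : ℝ) 1 ×ˢ univ) := by
    rintro ⟨t, s⟩ ⟨ht, -⟩
    refine FibreMetric.tendsto_mix (h.ι_mem s) (hj s).1 ht
      ((h.continuous_ι.comp continuous_snd).continuousAt.tendsto.mono_left nhdsWithin_le_nhds)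
      ((h'.continuous_ι.comp (θ.continuous.comp
        continuous_snd)).continuousAt.tendsto.mono_left nhdsWithin_le_nhds)
      (continuous_fst.continuousAt.tendsto.mono_left nhdsWithin_le_nhds) ?_
    filter_upwards [self_mem_nhdsWithin] with x hx using ⟨h.ι_mem _, (hj _).1, hx.1⟩
  refine ⟨θ, fun t s => D.mix t (ι s) (ι' (θ s)), hcont, funext fun s =>
    FibreMetric.mix_zero (h.ι_mem s) (hj s).1, funext fun s =>
    FibreMetric.mix_one (h.ι_mem s) (hj s).1, fun t ht =>
    ⟨?_, fun s => FibreMetric.mix_mem (h.ι_mem s) (hj s).1 ht⟩⟩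
  have hs : B.IsCoreSection p L (fun s => D.mix t (ι s) (ι' (θ s))) ς := by
    refine ⟨?_, h.continuous_ς, fun s => ?_, h.eq_iff, fun y hy => ?_⟩
    · exact hcont.comp_continuous (f := fun s : S => (t, s)) (by fun_prop) fun s => ⟨ht, trivial⟩
    · have hm := FibreMetric.mix_mem_seg (D := D) (h.ι_mem s) (hj s).1 ht
      refine h.ς_ι hm.1 ((hj s).2.mono_left fun x hx => ?_)
      obtain ⟨κ, hκ, -⟩ := exists_column B (h.ι_mem s)
      rw [κ.mem_seg hκ (h.ι_mem s) hm.1] at hx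
      rw [κ.mem_seg hκ (h.ι_mem s) (hj s).1] at hm ⊢
      exact ⟨hx.1, uIcc_subset_uIcc_left hm.2 hx.2⟩
    · have e1 := h.pared y hy
      have e2 : ι' (θ (ς y)) = y := by
        have : θ (ς y) = ς' y := congrArg ς' (Subtype.ext e1)
        rw [this, h'.pared y hy]
      change D.mix t (ι (ς y)) (ι' (θ (ς y))) = y
      rw [e1, e2]
      exact FibreMetric.mix_self (e1 ▸ h.ι_mem _) ht
  exact hs.isSplittingSurface hp hL

end IsCoreSection

/-- A splitting surface that is a core surface of `L` is a section of the bundle of gaps. -/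
theorem IsSplittingSurface.exists_section {S : Type u} [TopologicalSpace S] {ι : S → M}
    (h : B.IsSplittingSurface p ι) (hL : B.Carries L) (hc : B.IsCoreSurface L ι) :
    ∃ ς, B.IsCoreSection p L ι ς := by
  obtain ⟨hcar, -, -, O, hO⟩ := h
  obtain ⟨ρ, hρ, -⟩ := hO.exists_tube hcar.continuous
  exact hc.exists_section hL hρ hcar.2.2.1

/-! ### Existence of the core surface -/

/-- Over the ball of radius `r`, no gap crosses both slots of the column. -/
def Column.SeparatesSlots (κ : Column B) (L : Lamination M) (r : ℝ) : Prop :=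
  κ.m = .branch → κ.n = .branch → ∀ v, ‖v‖ < r → ∃ t ∈ Icc (-(3 / 4) : ℝ) (3 / 4),
    κ.pt v t ∈ L.carrier

theorem FullyCarries.exists_separatesSlots (hL : B.FullyCarries L) (κ : Column B) :
    ∃ r > 0, κ.SeparatesSlots L r := by
  by_cases h : κ.m = .branch ∧ κ.n = .branch
  · obtain ⟨-, x, hx, h1, h2⟩ := hL.exists_above h.1 (a := 0) rfl
    have h3 := h2 h.2 rfl
    have hS : κ.S 0 (1 / 2) := Column.OpenArc.S_Icc h.1 rfl ⟨by norm_num, by norm_num⟩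
    have hN := (κ.pt_mem_nbhd _ _).2 hS
    have hxs := κ.fibre_source (κ.pt_mem _ _) hN hx.2
    have hxv : κ.v x = 0 := by rw [κ.fibre_v (κ.pt_mem _ _) hN hx.2, κ.v_pt]
    have hev := hL.1.eventually_exists hxs hx.1 (η := 1 / 4) (by norm_num)
    rw [hxv] at hev
    obtain ⟨r, hr, hb⟩ := Metric.eventually_nhds_iff_ball.1 hev
    refine ⟨r, hr, fun _ _ v hv => ?_⟩
    obtain ⟨hS', w, hw, hwz⟩ := hb v (by rwa [Metric.mem_ball, dist_zero_right])
    have hN' := (κ.pt_mem_nbhd _ _).2 hS'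
    have e : κ.pt v (κ.z w) = w := by
      have e1 := κ.fibre_v (κ.pt_mem _ _) hN' hw.2
      rw [κ.v_pt] at e1
      rw [← e1]
      exact κ.pt_v_z (κ.fibre_source (κ.pt_mem _ _) hN' hw.2)
    rw [abs_lt] at hwz
    exact ⟨κ.z w, ⟨by linarith, by linarith⟩, by rw [e]; exact hw.1⟩
  · exact ⟨1, one_pos, fun h1 h2 => absurd ⟨h1, h2⟩ h⟩

/-- The weight of the midpoint `c` of a slot in the choice of a point of the gap `(A, B)`. -/
noncomputable def slotWeight (c A B : ℝ) : ℝ := max 0 (min 1 (2 * min (c - A) (B - c)))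

theorem slotWeight_mem (c A B : ℝ) : slotWeight c A B ∈ Icc (0 : ℝ) 1 :=
  ⟨le_max_left _ _, max_le zero_le_one (min_le_left _ _)⟩

theorem slotWeight_eq_zero {c A B : ℝ} (h : c ≤ A ∨ B ≤ c) : slotWeight c A B = 0 := by
  refine max_eq_left ((min_le_right _ _).trans ?_)
  rcases h with h | h
  · linarith [min_le_left (c - A) (B - c)]
  · linarith [min_le_right (c - A) (B - c)]

theorem slotWeight_eq_one {c A B : ℝ} (h1 : A ≤ c - 1 / 2) (h2 : c + 1 / 2 ≤ B) :
    slotWeight c A B = 1 := by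
  have : 1 / 2 ≤ min (c - A) (B - c) := le_min (by linarith) (by linarith)
  rw [slotWeight, min_eq_left (by linarith), max_eq_right zero_le_one]

open Classical in
/-- A point of the gap `(A, B)`, which is the midpoint of a slot if the gap contains it. -/
noncomputable def Column.gapHeight (κ : Column B) (A B : ℝ) : ℝ :=
  let α := if κ.m = .branch then slotWeight 1 A B else 0
  let β := if κ.n = .branch then slotWeight (-1) A B else 0
  α - β + (1 - α - β) * ((A + B) / 2)

theorem Column.continuous_gapHeight : Continuous fun q : ℝ × ℝ => κ.gapHeight q.1 q.2 := by
  unfold Column.gapHeight slotWeight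
  split_ifs <;> fun_prop

theorem Column.gapHeight_mem {A B' : ℝ} (hAB : A < B')
    (h : κ.m = .branch → κ.n = .branch → ¬ (A < -(3 / 4) ∧ 3 / 4 < B')) :
    A < κ.gapHeight A B' ∧ κ.gapHeight A B' < B' := by
  have key : ∀ c w : ℝ, w ∈ Icc (0 : ℝ) 1 → (c ≤ A ∨ B' ≤ c → w = 0) →
      A < w * c + (1 - w) * ((A + B') / 2) ∧ w * c + (1 - w) * ((A + B') / 2) < B' := by
    intro c w hw h0
    by_cases hc : c ≤ A ∨ B' ≤ c
    · rw [h0 hc]; constructor <;> linarith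
    · push Not at hc
      obtain ⟨w0, w1⟩ := hw
      constructor
      · rcases eq_or_lt_of_le w0 with e | e
        · rw [← e]; linarith
        · nlinarith [mul_pos e (sub_pos.2 hc.1)]
      · rcases eq_or_lt_of_le w0 with e | e
        · rw [← e]; linarith
        · nlinarith [mul_pos e (sub_pos.2 hc.2)]
  have k1 := key 1 _ (slotWeight_mem 1 A B') slotWeight_eq_zero
  have k2 := key (-1) _ (slotWeight_mem (-1) A B') slotWeight_eq_zero
  unfold Column.gapHeight
  by_cases hm : κ.m = .branch <;> by_cases hn : κ.n = .branch
  · simp only [hm, hn, if_true]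
    by_cases hA : A < -(3 / 4)
    · have hB : B' ≤ 3 / 4 := not_lt.1 fun hB => h hm hn ⟨hA, hB⟩
      rw [slotWeight_eq_zero (c := 1) (.inr (by linarith))]
      convert k2 using 2 <;> ring
    · rw [slotWeight_eq_zero (c := -1) (.inl (by linarith))]
      convert k1 using 2 <;> ring
  · simp only [hm, hn, if_true, if_false]
    convert k1 using 2 <;> ring
  · simp only [hm, hn, if_true, if_false]
    convert k2 using 2 <;> ring
  · simp only [hm, hn, if_false]
    constructor <;> linarith

/-- The gap region has a section over the part of a column where no gap crosses both slots. -/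
theorem FullyCarries.exists_local_section (hL : B.FullyCarries L) (hp : B.IsParedLocus p)
    (hκ : κ.Normal p) {r : ℝ} (hr : κ.SeparatesSlots L r) :
    ∃ τ : B.cuspRegion L → M, ∀ y : B.cuspRegion L, (y : M) ∈ κ.chart.source → ‖κ.v y‖ < r →
      τ y ∈ B.fibre y ∧ B.Joined L.carrier y (τ y) ∧ ((y : M) ∈ p → τ y = y) ∧
      (∀ y' : B.cuspRegion L, (y' : M) ∈ B.fibre y → B.Joined L.carrier y y' → τ y' = τ y) ∧
      ContinuousAt τ y := by
  have hN : ∀ y : B.cuspRegion L, (y : M) ∈ B.nbhd := fun y =>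
    gapRegion_subset (cuspRegion_subset y.2)
  have hexE : ∀ y : B.cuspRegion L, ∃ ab : M × M, (y : M) ∈ κ.chart.source →
      B.Ends L.carrier κ y ab.1 ab.2 := by
    intro y
    by_cases k : (y : M) ∈ κ.chart.source
    · obtain ⟨a, b, hab⟩ := exists_ends k (cuspRegion_subset y.2)
      exact ⟨(a, b), fun _ => hab⟩
    · exact ⟨(y, y), fun k' => absurd k' k⟩
  choose ab hab using hexE
  refine ⟨fun y => κ.pt (κ.v y) (κ.gapHeight (κ.z (ab y).1) (κ.z (ab y).2)), fun y hy hyr => ?_⟩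
  have hE := hab y hy
  have hlt := hE.left_lt.trans hE.lt_right
  have hno : κ.m = .branch → κ.n = .branch →
      ¬ (κ.z (ab y).1 < -(3 / 4) ∧ 3 / 4 < κ.z (ab y).2) := by
    rintro hm hn ⟨h1, h2⟩
    obtain ⟨t, ht, htL⟩ := hr hm hn _ hyr
    have := κ.fibre_uIcc hy (hN y) hE.left.2 hE.right.2 (t := t) (by
      rw [uIcc_of_le hlt.le]; exact ⟨by linarith [ht.1], by linarith [ht.2]⟩)
    have := hE.out _ ⟨htL, this⟩
    rw [κ.z_pt] at this
    rcases this with k | k <;> linarith [ht.1, ht.2]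
  have hm := Column.gapHeight_mem hlt hno
  have hf := κ.fibre_uIcc hy (hN y) hE.left.2 hE.right.2
    (t := κ.gapHeight (κ.z (ab y).1) (κ.z (ab y).2)) (by
      rw [uIcc_of_le hlt.le]; exact ⟨hm.1.le, hm.2.le⟩)
  refine ⟨hf, (hE.joined_iff hy (hN y) hf).2 (by rwa [κ.z_pt]), fun hyp => ?_, fun y' h1 h2 => ?_, ?_⟩
  · obtain ⟨sa, sb, va, vb⟩ := hE.source hy (hN y)
    have h1 := hE.left_lt
    have h2 := hE.lt_right
    have hva := hL.1.not_mem_vertInterior hE.left.1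
    have hvb := hL.1.not_mem_vertInterior hE.right.1
    rw [κ.mem_vertInterior sa, va] at hva
    rw [κ.mem_vertInterior sb, vb] at hvb
    have fin : κ.gapHeight (κ.z (ab y).1) (κ.z (ab y).2) = κ.z y := by
      rcases hκ.height hp hy hyp with ⟨c1, c2, c3⟩ | ⟨c1, c2, c3⟩
      · rw [c3] at h1 h2 ⊢
        have hA : κ.z (ab y).1 ≤ 1 / 2 := by
          by_contra k
          exact hva (.inl ⟨c1, c2, not_le.1 k, by linarith⟩)
        have hB : 3 / 2 ≤ κ.z (ab y).2 := by
          by_contra k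
          exact hvb (.inl ⟨c1, c2, by linarith, not_le.1 k⟩)
        unfold Column.gapHeight
        rw [if_pos c1, slotWeight_eq_one (c := 1) (by linarith) (by linarith)]
        by_cases hn : κ.n = .branch
        · rw [if_pos hn, slotWeight_eq_zero (c := -1) (.inl (by
            by_contra k
            exact hno c1 hn ⟨by linarith, by linarith⟩))]
          ring
        · rw [if_neg hn]; ring
      · rw [c3] at h1 h2 ⊢
        have hA : κ.z (ab y).1 ≤ -(3 / 2) := by
          by_contra k
          exact hva (.inr ⟨c1, c2, not_le.1 k, by linarith⟩)
        have hB : -(1 / 2) ≤ κ.z (ab y).2 := by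
          by_contra k
          exact hvb (.inr ⟨c1, c2, by linarith, not_le.1 k⟩)
        unfold Column.gapHeight
        rw [if_pos c1, slotWeight_eq_one (c := -1) (by linarith) (by linarith)]
        by_cases hn : κ.m = .branch
        · rw [if_pos hn, slotWeight_eq_zero (c := 1) (.inr (by
            by_contra k
            exact hno hn c1 ⟨by linarith, by linarith⟩))]
          ring
        · rw [if_neg hn]; ring
    change κ.pt (κ.v y) (κ.gapHeight _ _) = y
    rw [fin]
    exact κ.pt_v_z hy
  · have hy' := κ.fibre_source hy (hN y) h1
    obtain ⟨e1, e2⟩ := (hE.of_joined hy (hN y) h1 h2).unique (hab y' hy') hy' (hN y')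
    simp only [e1, e2, κ.fibre_v hy (hN y) h1]
  · obtain ⟨sa, sb, -, -⟩ := hE.source hy (hN y)
    have hyl := continuous_subtype_val.tendsto y
    have hEv : ∀ᶠ y' : B.cuspRegion L in 𝓝 y, (y' : M) ∈ B.nbhd ∧
        B.Ends L.carrier κ y' (ab y').1 (ab y').2 := by
      filter_upwards [hyl (κ.source_mem_nhds hy)] with y' k using ⟨hN y', hab y' k⟩
    have ha := (κ.continuousAt_z sa).tendsto.comp (hE.tendsto_left hL.1 hy (hN y) hyl hEv)
    have hb := (κ.continuousAt_z sb).tendsto.comp (hE.tendsto_right hL.1 hy (hN y) hyl hEv)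
    have hv := (κ.continuousAt_v hy).tendsto.comp hyl
    have hg := (Column.continuous_gapHeight (κ := κ)).continuousAt.tendsto.comp (ha.prodMk_nhds hb)
    exact κ.continuous_pt.continuousAt.tendsto.comp (hv.prodMk_nhds hg)

theorem FullyCarries.exists_section (hL : B.FullyCarries L) (hp : B.IsParedLocus p) :
    ∃ σ : B.cuspRegion L → M, Continuous σ ∧ ∀ y : B.cuspRegion L,
      σ y ∈ B.fibre y ∧ B.Joined L.carrier y (σ y) ∧ ((y : M) ∈ p → σ y = y) ∧
      ∀ y' : B.cuspRegion L, (y' : M) ∈ B.fibre y → B.Joined L.carrier y y' → σ y' = σ y := by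
  obtain ⟨D, -⟩ := exists_fibreMetric hp
  choose κ hκs hκv hκn using fun y : B.nbhd => Column.exists_normal hp y.2
  choose r hr hrs using fun y : B.nbhd => hL.exists_separatesSlots (κ y)
  obtain ⟨s, wt, wc, w0, w1, wf, wne⟩ := B.exists_partition κ r fun y => ⟨hr y, hκs y, hκv y⟩
  choose τ hτ using fun y : B.nbhd => hL.exists_local_section hp (hκn y) (hrs y)
  have hN : ∀ y : B.cuspRegion L, (y : M) ∈ B.nbhd := fun y =>
    gapRegion_subset (cuspRegion_subset y.2)
  have hτ' : ∀ i, ∀ y : B.cuspRegion L, wt i y ≠ 0 → _ := fun i y h =>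
    hτ i y (wne i y (hN y) h).1 (wne i y (hN y) h).2
  set σ : B.cuspRegion L → M := fun y => D.bary s y (fun i => wt i y) (fun i => τ i y) with hσ
  have hx : ∀ y : B.cuspRegion L, ∀ i ∈ s, wt i y ≠ 0 → τ i y ∈ B.fibre y := fun y i _ h =>
    (hτ' i y h).1
  have hmem : ∀ y : B.cuspRegion L, σ y ∈ B.fibre y := fun y =>
    (D.bary_spec (hN y) (fun i _ => w0 i y (hN y)) (w1 y (hN y)) (hx y)).1
  have hcoord : ∀ (y : B.cuspRegion L) (c : M → ℝ), B.IsIsometric D.d y c →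
      c (σ y) = ∑ i ∈ s, wt i y * c (τ i y) := fun y c hc =>
    D.coord_bary (hN y) hc (fun i _ => w0 i y (hN y)) (w1 y (hN y)) (hx y)
  refine ⟨σ, ?_, fun y => ⟨hmem y, ?_, fun hyp => ?_, fun y' h1 h2 => ?_⟩⟩
  · rw [continuous_iff_continuousAt]
    intro y₀
    have hwt : ∀ i, Tendsto (fun y : B.cuspRegion L => wt i y) (𝓝 y₀) (𝓝 (wt i y₀)) := fun i =>
      ((wc i).comp_continuous continuous_subtype_val hN).continuousAt
    refine FibreMetric.tendsto_bary (hN y₀) continuousAt_subtype_val (Eventually.of_forall hN)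
      (Eventually.of_forall fun y i _ => w0 i y (hN y)) (Eventually.of_forall fun y => w1 y (hN y))
      (Eventually.of_forall hx) (fun i _ => hwt i) (fun i _ => w0 i y₀ (hN y₀)) (w1 y₀ (hN y₀))
      (hx y₀) fun i _ h => (hτ' i y₀ h).2.2.2.2
  · obtain ⟨κ, hκ, -⟩ := exists_column B (hN y)
    obtain ⟨a, b, hE⟩ := exists_ends hκ (cuspRegion_subset y.2)
    obtain ⟨c, hc, hcz⟩ := D.exists_coord hκ (hN y)
    have hj : ∀ w ∈ B.fibre y, B.Joined L.carrier y w ↔ c w ∈ Ioo (c a) (c b) := fun w hw => by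
      rw [hE.joined_iff hκ (hN y) hw, ← hcz _ hE.left.2 _ hw, ← hcz _ hw _ hE.right.2]; rfl
    rw [hj _ (hmem y), hcoord y c hc]
    have h0 : c y ∈ Ioo (c a) (c b) := (hj _ (self_mem_fibre (hN y))).1
      ((joined_self (hN y)).2 (cuspRegion_subset y.2).1.2)
    have : ∑ i ∈ s, wt i y * c (τ i y) =
        ∑ i ∈ s, wt i y * (if wt i y = 0 then c y else c (τ i y)) := by
      refine Finset.sum_congr rfl fun i _ => ?_
      split_ifs with h
      · rw [h, zero_mul, zero_mul]
      · rfl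
    rw [this]
    refine (convex_Ioo (c a) (c b)).sum_mem (fun i _ => w0 i y (hN y)) (w1 y (hN y)) fun i _ => ?_
    split_ifs with h
    · exact h0
    · exact (hj _ (hτ' i y h).1).1 (hτ' i y h).2.1
  · obtain ⟨c, hc⟩ := D.coord y (hN y)
    refine hc.1.2 (hmem y) (self_mem_fibre (hN y)) ?_
    have : ∀ i ∈ s, wt i y * c (τ i y) = wt i y * c y := fun i _ => by
      by_cases h : wt i y = 0
      · rw [h, zero_mul, zero_mul]
      · rw [(hτ' i y h).2.2.1 hyp]
    rw [hcoord y c hc, Finset.sum_congr rfl this, ← Finset.sum_mul, w1 y (hN y), one_mul]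
  · obtain ⟨c, hc⟩ := D.coord y (hN y)
    have e := B.fibre_eq _ (hN y) _ h1
    have hc' : B.IsIsometric D.d y' c := by rw [IsIsometric, e]; exact hc
    refine hc.1.2 (e ▸ hmem y') (hmem y) ?_
    rw [hcoord y c hc, hcoord y' c hc']
    refine Finset.sum_congr rfl fun i _ => ?_
    rw [wf i y (hN y) y' h1]
    by_cases h : wt i y = 0
    · rw [h, zero_mul, zero_mul]
    · rw [(hτ' i y h).2.2.2.1 y' h1 h2]

/-- A fully carried lamination determines a splitting surface. -/
theorem FullyCarries.exists_coreSection (hL : B.FullyCarries L) (hp : B.IsParedLocus p) :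
    ∃ (S : Type u) (_ : TopologicalSpace S) (ι : S → M) (ς : B.cuspRegion L → S),
      B.IsCoreSection p L ι ς := by
  obtain ⟨σ, hσ, h⟩ := hL.exists_section hp
  have hN : ∀ y : B.cuspRegion L, (y : M) ∈ B.nbhd := fun y =>
    gapRegion_subset (cuspRegion_subset y.2)
  have hmem : ∀ y, σ y ∈ B.cuspRegion L := fun y => mem_cuspRegion_of_joined y.2 (h y).1 (h y).2.1
  have hidem : ∀ y, σ ⟨σ y, hmem y⟩ = σ y := fun y => (h y).2.2.2 ⟨σ y, hmem y⟩ (h y).1 (h y).2.1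
  refine ⟨range σ, inferInstance, Subtype.val, fun y => ⟨σ y, y, rfl⟩, continuous_subtype_val,
    hσ.subtype_mk _, ?_, fun y y' => ⟨fun e => ?_, fun e => Subtype.ext ((h y).2.2.2 y' e.1 e.2).symm⟩,
    fun y hy => (h y).2.2.1 hy⟩
  · rintro ⟨_, y, rfl⟩
    exact ⟨hmem y, Subtype.ext (hidem y)⟩
  · have e : σ y = σ y' := congrArg Subtype.val e
    have e1 := B.fibre_eq _ (hN y) _ (h y).1
    have e2 := B.fibre_eq _ (hN y') _ (h y').1
    rw [← e] at e2
    have hy' : (y' : M) ∈ B.fibre y := by rw [← e1, e2]; exact self_mem_fibre (hN y')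
    exact ⟨hy', (h y).2.1.trans (e ▸ (h y').2.1.symm (hN y') (h y').1) (hN y) (h y).1 hy'⟩

end BranchedSurface

/-! ### Sections of local homeomorphisms over a vector space -/

section lift
variable {E X : Type*} [TopologicalSpace E] [T2Space E] [NormedAddCommGroup X] [NormedSpace ℝ X]
  {π : E → X}

/-- A lift, on the interval `[0, r]`, of the segment from `u` in the direction `w`. -/
def IsSegmentLift (π : E → X) (e₀ : E) (u w : X) (r : ℝ) (γ : ℝ → E) : Prop :=
  ContinuousOn γ (Icc 0 r) ∧ γ 0 = e₀ ∧ ∀ t ∈ Icc 0 r, π (γ t) = u + t • w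

theorem IsSegmentLift.eqOn (hπ : IsLocalHomeomorph π) {e₀ : E} {u w : X} {r r' : ℝ} {γ γ' : ℝ → E}
    (h : IsSegmentLift π e₀ u w r γ) (h' : IsSegmentLift π e₀ u w r' γ') (h0 : 0 ≤ r)
    (hr : r ≤ r') : EqOn γ γ' (Icc 0 r) :=
  (T2Space.isSeparatedMap π).eqOn_of_comp_eqOn hπ.isLocallyInjective isPreconnected_Icc h.1
    (h'.1.mono (Icc_subset_Icc_right hr))
    (fun t ht => (h.2.2 t ht).trans (h'.2.2 t (Icc_subset_Icc_right hr ht)).symm)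
    (left_mem_Icc.2 h0) (h.2.1.trans h'.2.1.symm)

theorem exists_segmentLift (hπ : IsLocalHomeomorph π)
    (hc : ∀ u w (γ : ℝ → E), ContinuousOn γ (Ico 0 1) → (∀ t ∈ Ico (0 : ℝ) 1, π (γ t) = u + t • w) →
      ∃ e, Tendsto γ (𝓝[<] 1) (𝓝 e)) (e₀ : E) (w : X) :
    ∃ γ, IsSegmentLift π e₀ (π e₀) w 1 γ := by
  set u := π e₀
  have hseg : Continuous fun t : ℝ => u + t • w := by fun_prop
  set J : Set ℝ := {r | ∃ γ, IsSegmentLift π e₀ u w r γ} with hJ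
  have hmono : ∀ {r r'}, r' ∈ J → r ≤ r' → r ∈ J := fun ⟨γ, h1, h2, h3⟩ h =>
    ⟨γ, h1.mono (Icc_subset_Icc_right h), h2, fun t ht => h3 t (Icc_subset_Icc_right h ht)⟩
  have h0 : (0 : ℝ) ∈ J := by
    refine ⟨fun _ => e₀, continuousOn_const, rfl, fun t ht => ?_⟩
    rw [Icc_self, mem_singleton_iff] at ht
    rw [ht, zero_smul, add_zero]
  -- the lifts on shorter intervals fit together
  have hcl : ∀ r ∈ Ioc (0 : ℝ) 1, (∀ s ∈ Ico 0 r, s ∈ J) → r ∈ J := by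
    intro r hr hs
    have hex : ∀ s, ∃ γ, s ∈ Ico 0 r → IsSegmentLift π e₀ u w s γ := fun s => by
      by_cases k : s ∈ Ico 0 r
      · exact (hs s k).imp fun γ h _ => h
      · exact ⟨fun _ => e₀, fun k' => absurd k' k⟩
    choose γ hγ using hex
    set Γ : ℝ → E := fun s => γ s s with hΓ
    have hΓe : ∀ s ∈ Ico 0 r, EqOn Γ (γ s) (Icc 0 s) := fun s hs x hx =>
      (hγ x ⟨hx.1, hx.2.trans_lt hs.2⟩).eqOn hπ (hγ s hs) hx.1 hx.2 (right_mem_Icc.2 hx.1)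
    have hΓp : ∀ s ∈ Ico 0 r, π (Γ s) = u + s • w := fun s hs =>
      (hγ s hs).2.2 s (right_mem_Icc.2 hs.1)
    have hΓc : ContinuousOn Γ (Ico 0 r) := by
      intro x hx
      obtain ⟨y, hy1, hy2⟩ := exists_between hx.2
      have hyI : y ∈ Ico 0 r := ⟨hx.1.trans hy1.le, hy2⟩
      have := (((hγ y hyI).1.congr (hΓe y hyI)) x ⟨hx.1, hy1.le⟩)
      refine this.mono_of_mem_nhdsWithin ?_
      filter_upwards [self_mem_nhdsWithin, mem_nhdsWithin_of_mem_nhds (Iio_mem_nhds hy1)] with z h1 h2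
      exact ⟨h1.1, le_of_lt h2⟩
    have hsub : ∀ t ∈ Ico (0 : ℝ) 1, t * r ∈ Ico 0 r := fun t ht =>
      ⟨mul_nonneg ht.1 hr.1.le, by nlinarith [ht.2, hr.1]⟩
    obtain ⟨e, he⟩ := hc u (r • w) (fun t => Γ (t * r))
      (hΓc.comp (continuous_mul_const r).continuousOn hsub)
      fun t ht => by rw [hΓp _ (hsub t ht), smul_smul]
    have he' : Tendsto Γ (𝓝[<] r) (𝓝 e) := by
      have h1 : Tendsto (fun s : ℝ => s / r) (𝓝[<] r) (𝓝[<] 1) := by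
        refine tendsto_nhdsWithin_iff.2 ⟨?_, ?_⟩
        · have : Continuous fun s : ℝ => s / r := by fun_prop
          have := this.tendsto r
          rw [div_self hr.1.ne'] at this
          exact this.mono_left nhdsWithin_le_nhds
        · filter_upwards [self_mem_nhdsWithin] with s hs
          exact (div_lt_one hr.1).2 hs
      refine (he.comp h1).congr fun s => ?_
      simp only [Function.comp_apply, div_mul_cancel₀ _ hr.1.ne']
    have hπe : π e = u + r • w := tendsto_nhds_unique (hπ.continuous.continuousAt.tendsto.comp he')
      (((hseg.tendsto r).mono_left nhdsWithin_le_nhds).congr' (by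
        filter_upwards [Ico_mem_nhdsLT hr.1] with s hs using (hΓp s hs).symm))
    have hup : ∀ t ∈ Ico 0 r, Function.update Γ r e t = Γ t := fun t ht =>
      Function.update_of_ne ht.2.ne _ _
    refine ⟨Function.update Γ r e, fun t ht => ?_, ?_, fun t ht => ?_⟩
    · rcases eq_or_lt_of_le ht.2 with rfl | k
      · rw [continuousWithinAt_update_same]
        refine he'.mono_left (nhdsWithin_mono _ ?_)
        rintro x ⟨hx, hne⟩
        exact lt_of_le_of_ne hx.2 hne
      · have : ContinuousWithinAt (Function.update Γ r e) (Ico 0 r) t :=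
          (hΓc.congr hup) t ⟨ht.1, k⟩
        refine this.mono_of_mem_nhdsWithin ?_
        filter_upwards [self_mem_nhdsWithin, mem_nhdsWithin_of_mem_nhds (Iio_mem_nhds k)] with z h1 h2
        exact ⟨h1.1, h2⟩
    · rw [hup 0 ⟨le_rfl, hr.1⟩]
      exact (hγ 0 ⟨le_rfl, hr.1⟩).2.1
    · rcases eq_or_lt_of_le ht.2 with rfl | k
      · rw [Function.update_self, hπe]
      · rw [hup t ⟨ht.1, k⟩, hΓp t ⟨ht.1, k⟩]
  have hclosed : IsClosed (J ∩ Icc 0 1) := by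
    refine isClosed_of_closure_subset fun r hr => ?_
    have hrI : r ∈ Icc (0 : ℝ) 1 := isClosed_Icc.closure_subset (closure_mono inter_subset_right hr)
    refine ⟨?_, hrI⟩
    rcases eq_or_lt_of_le hrI.1 with rfl | k
    · exact h0
    refine hcl r ⟨k, hrI.2⟩ fun s hs => ?_
    obtain ⟨r', h1, h2⟩ := mem_closure_iff.1 hr (Ioi s) isOpen_Ioi hs.2
    exact hmono h2.1 (le_of_lt h1)
  refine hclosed.Icc_subset_of_forall_exists_gt h0 ?_ (right_mem_Icc.2 zero_le_one)
  rintro r ⟨⟨γ, h1, h2, h3⟩, hr⟩ y (hy : r < y)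
  obtain ⟨q, hq, rfl⟩ := hπ (γ r)
  have hrI : r ∈ Icc 0 r := right_mem_Icc.2 hr.1
  have hq' : ∀ᶠ t in 𝓝 r, u + t • w ∈ q.target := by
    refine hseg.continuousAt.eventually (q.open_target.mem_nhds ?_)
    change u + r • w ∈ q.target
    rw [← h3 r hrI]; exact q.map_source hq
  obtain ⟨r₁, hr₁, hball⟩ := mem_nhdsGE_iff_exists_Icc_subset.1 (mem_nhdsWithin_of_mem_nhds hq')
  set r₂ := min r₁ y
  have hr₂ : r < r₂ := lt_min hr₁ hy
  set δ : ℝ → E := fun t => if t ≤ r then γ t else q.symm (u + t • w) with hδ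
  have e1 : EqOn δ γ (Icc 0 r) := fun t ht => if_pos ht.2
  have hsub : ∀ t ∈ Icc r r₂, u + t • w ∈ q.target := fun t ht =>
    hball ⟨ht.1, ht.2.trans (min_le_left _ _)⟩
  have e2 : EqOn δ (fun t => q.symm (u + t • w)) (Icc r r₂) := by
    intro t ht
    rcases eq_or_lt_of_le ht.1 with rfl | k
    · change (if r ≤ r then γ r else _) = q.symm (u + r • w)
      rw [if_pos le_rfl, ← h3 r hrI, q.left_inv hq]
    · exact if_neg (not_le.2 k)
  refine ⟨r₂, ⟨δ, ?_, ?_, fun t ht => ?_⟩, hr₂, min_le_right _ _⟩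
  · rw [← Icc_union_Icc_eq_Icc hr.1 hr₂.le]
    refine ContinuousOn.union_of_isClosed (h1.congr e1) (ContinuousOn.congr ?_ e2) isClosed_Icc
      isClosed_Icc
    exact q.continuousOn_symm.comp hseg.continuousOn hsub
  · rw [e1 (left_mem_Icc.2 hr.1), h2]
  · rcases le_or_gt t r with k | k
    · rw [e1 ⟨ht.1, k⟩, h3 t ⟨ht.1, k⟩]
    · rw [e2 ⟨k.le, ht.2⟩]
      exact q.right_inv (hsub t ⟨k.le, ht.2⟩)

/-- A local homeomorphism onto a vector space that is complete along segments has a section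
through every point. -/
theorem exists_section_of_isLocalHomeomorph (hπ : IsLocalHomeomorph π)
    (hc : ∀ u w (γ : ℝ → E), ContinuousOn γ (Ico 0 1) → (∀ t ∈ Ico (0 : ℝ) 1, π (γ t) = u + t • w) →
      ∃ e, Tendsto γ (𝓝[<] 1) (𝓝 e)) (e₀ : E) :
    ∃ σ : X → E, Continuous σ ∧ (∀ x, π (σ x) = x) ∧ σ (π e₀) = e₀ := by
  choose γ hγ using fun w => exists_segmentLift hπ hc e₀ w
  let f : C(unitInterval × X, X) := ⟨fun q => π e₀ + (q.1 : ℝ) • (q.2 - π e₀), by fun_prop⟩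
  have hg : Continuous fun q : unitInterval × X => γ (q.2 - π e₀) q.1 := by
    refine hπ.continuous_lift (T2Space.isSeparatedMap π) f ?_ ?_ fun x => ?_
    · ext q; exact (hγ _).2.2 q.1 q.1.2
    · exact continuous_const.congr fun x => (hγ _).2.1.symm
    · exact (hγ (x - π e₀)).1.comp_continuous continuous_subtype_val fun t => t.2
  refine ⟨fun x => γ (x - π e₀) 1, hg.comp (by fun_prop : Continuous fun x : X =>
    ((1 : unitInterval), x)), fun x => ?_, ?_⟩
  · rw [(hγ _).2.2 1 (right_mem_Icc.2 zero_le_one), one_smul, add_sub_cancel]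
  · have hconst : IsSegmentLift π e₀ (π e₀) 0 1 fun _ => e₀ :=
      ⟨continuousOn_const, rfl, fun t _ => by simp⟩
    have h1 := hγ (π e₀ - π e₀)
    rw [sub_self] at h1
    change γ (π e₀ - π e₀) 1 = e₀
    rw [sub_self]
    exact h1.eqOn hπ hconst zero_le_one le_rfl (right_mem_Icc.2 zero_le_one)

end lift

/-! ### Families of disjoint intervals over a space -/

/-- The function that is `0` up to `a`, `1` from `b` on, and affine in between. -/
noncomputable def ramp (a b z : ℝ) : ℝ := max 0 (min 1 ((z - a) / (b - a)))

theorem ramp_mem (a b z : ℝ) : ramp a b z ∈ Icc (0 : ℝ) 1 :=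
  ⟨le_max_left _ _, max_le zero_le_one (min_le_left _ _)⟩

theorem ramp_of_le {a b z : ℝ} (h : a < b) (hz : z ≤ a) : ramp a b z = 0 :=
  max_eq_left ((min_le_right _ _).trans (div_nonpos_of_nonpos_of_nonneg (by linarith) (by linarith)))

theorem ramp_of_ge {a b z : ℝ} (h : a < b) (hz : b ≤ z) : ramp a b z = 1 := by
  rw [ramp, min_eq_left ((one_le_div (by linarith)).2 (by linarith)), max_eq_right zero_le_one]

theorem ramp_mono {a b : ℝ} (h : a < b) : Monotone (ramp a b) := fun z z' hz =>
  max_le_max le_rfl (min_le_min le_rfl ((div_le_div_iff_of_pos_right (by linarith)).2 (by linarith)))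

theorem ramp_lt {a b z z' : ℝ} (h : a < b) (h1 : z < b) (h2 : a < z') (hz : z < z') :
    ramp a b z < ramp a b z' := by
  have h0 : 0 < b - a := by linarith
  have e1 : 0 < (z' - a) / (b - a) := div_pos (by linarith) h0
  have e2 : (z - a) / (b - a) < 1 := (div_lt_one h0).2 (by linarith)
  have e3 : (z - a) / (b - a) < (z' - a) / (b - a) :=
    (div_lt_div_iff_of_pos_right h0).2 (by linarith)
  have e4 : 0 < min 1 ((z' - a) / (b - a)) := lt_min one_pos e1
  rw [ramp, ramp, max_eq_right e4.le]
  exact max_lt e4 (by rw [min_eq_right e2.le]; exact lt_min e2 e3)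

/-- Disjoint intervals `(a i x, b i x)` in `[lo x, hi x]` that depend continuously on `x` and
whose order does not depend on `x`. -/
structure IsGapFamily {X I : Type*} [TopologicalSpace X] (lo hi : X → ℝ) (a b : I → X → ℝ) :
    Prop where
  continuous_lo : Continuous lo
  continuous_hi : Continuous hi
  continuous_left : ∀ i, Continuous (a i)
  continuous_right : ∀ i, Continuous (b i)
  lo_le_hi : ∀ x, lo x ≤ hi x
  lt : ∀ i x, a i x < b i x
  lo_le : ∀ i x, lo x ≤ a i x
  le_hi : ∀ i x, b i x ≤ hi x
  order : ∀ i j, i ≠ j → (∀ x, b i x ≤ a j x) ∨ ∀ x, b j x ≤ a i x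

section gapFamily
variable {X I : Type*} [TopologicalSpace X] {lo hi : X → ℝ} {a b : I → X → ℝ} {c : I → ℝ}

/-- The heights of `[lo x, hi x]` outside the intervals. -/
def OffGaps (lo hi : X → ℝ) (a b : I → X → ℝ) (x : X) (z : ℝ) : Prop :=
  z ∈ Icc (lo x) (hi x) ∧ ∀ i, z ≤ a i x ∨ b i x ≤ z

/-- A function of the height that increases on the intervals and outside `[lo x, hi x]`. -/
noncomputable def gapSum (lo hi : X → ℝ) (a b : I → X → ℝ) (c : I → ℝ) (x : X) (z : ℝ) : ℝ :=
  min (z - lo x) 0 + max (z - hi x) 0 + ∑' i, c i * ramp (a i x) (b i x) z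

namespace IsGapFamily
variable (h : IsGapFamily lo hi a b) (hc : ∀ i, 0 < c i) (hs : Summable c)
include h hc hs

theorem summable (x : X) (z : ℝ) : Summable fun i => c i * ramp (a i x) (b i x) z :=
  hs.of_nonneg_of_le (fun i => mul_nonneg (hc i).le (ramp_mem _ _ _).1)
    fun i => mul_le_of_le_one_right (hc i).le (ramp_mem _ _ _).2

theorem continuous_gapSum : Continuous fun q : X × ℝ => gapSum lo hi a b c q.1 q.2 := by
  have h1 := h.continuous_lo
  have h2 := h.continuous_hi
  refine Continuous.add (by fun_prop) (continuous_tsum (u := c) (fun i => ?_) hs fun i q => ?_)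
  · have h3 := h.continuous_left i
    have h4 := h.continuous_right i
    unfold ramp
    refine continuous_const.mul (continuous_const.max (continuous_const.min
      (Continuous.div (by fun_prop) (by fun_prop) fun q => ?_)))
    exact (sub_pos.2 (h.lt i q.1)).ne'
  · rw [Real.norm_of_nonneg (mul_nonneg (hc i).le (ramp_mem _ _ _).1)]
    exact mul_le_of_le_one_right (hc i).le (ramp_mem _ _ _).2

theorem tsum_mono (x : X) {z z' : ℝ} (hz : z ≤ z') :
    ∑' i, c i * ramp (a i x) (b i x) z ≤ ∑' i, c i * ramp (a i x) (b i x) z' :=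
  (h.summable hc hs x z).tsum_le_tsum
    (fun i => mul_le_mul_of_nonneg_left (ramp_mono (h.lt i x) hz) (hc i).le) (h.summable hc hs x z')

theorem gapSum_mono (x : X) : Monotone (gapSum lo hi a b c x) := fun z z' hz =>
  add_le_add (add_le_add (min_le_min (by linarith) le_rfl) (max_le_max (by linarith) le_rfl))
    (h.tsum_mono hc hs x hz)

theorem gapSum_lt {x : X} {z z' : ℝ} (hz : z < z')
    (h' : z < lo x ∨ hi x < z' ∨ ∃ i, z < b i x ∧ a i x < z') :
    gapSum lo hi a b c x z < gapSum lo hi a b c x z' := by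
  have h1 : min (z - lo x) 0 ≤ min (z' - lo x) 0 := min_le_min (by linarith) le_rfl
  have h2 : max (z - hi x) 0 ≤ max (z' - hi x) 0 := max_le_max (by linarith) le_rfl
  have h3 := h.tsum_mono hc hs x hz.le
  unfold gapSum
  rcases h' with k | k | ⟨i, k1, k2⟩
  · have : min (z - lo x) 0 < min (z' - lo x) 0 := by
      rw [min_eq_left (by linarith : z - lo x ≤ 0)]
      exact lt_min (by linarith) (by linarith)
    linarith
  · have : max (z - hi x) 0 < max (z' - hi x) 0 := by
      rw [max_eq_left (by linarith : 0 ≤ z' - hi x)]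
      exact max_lt (by linarith) (by linarith)
    linarith
  · have : ∑' i, c i * ramp (a i x) (b i x) z < ∑' i, c i * ramp (a i x) (b i x) z' :=
      (h.summable hc hs x z).tsum_lt_tsum (i := i)
        (fun i => mul_le_mul_of_nonneg_left (ramp_mono (h.lt i x) hz.le) (hc i).le)
        (mul_lt_mul_of_pos_left (ramp_lt (h.lt i x) k1 k2 hz) (hc i)) (h.summable hc hs x z')
    linarith

omit hc hs in
theorem gapSum_eq {x : X} {z z' : ℝ} (h1 : lo x ≤ z) (hz : z ≤ z') (h2 : z' ≤ hi x)
    (h' : ∀ i, z < b i x → z' ≤ a i x) : gapSum lo hi a b c x z = gapSum lo hi a b c x z' := by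
  unfold gapSum
  rw [min_eq_right (by linarith), min_eq_right (by linarith), max_eq_right (by linarith),
    max_eq_right (by linarith)]
  congr 2
  funext i
  rcases lt_or_ge z (b i x) with k | k
  · rw [ramp_of_le (h.lt i x) (h' i k), ramp_of_le (h.lt i x) (hz.trans (h' i k))]
  · rw [ramp_of_ge (h.lt i x) k, ramp_of_ge (h.lt i x) (k.trans hz)]

omit hc hs in
theorem gapSum_eq_of_off {x x' : X} {z z' : ℝ} (hz : OffGaps lo hi a b x z)
    (hz' : OffGaps lo hi a b x' z') (h' : ∀ i, b i x ≤ z ↔ b i x' ≤ z') :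
    gapSum lo hi a b c x z = gapSum lo hi a b c x' z' := by
  unfold gapSum
  rw [min_eq_right (by linarith [hz.1.1]), min_eq_right (by linarith [hz'.1.1]),
    max_eq_right (by linarith [hz.1.2]), max_eq_right (by linarith [hz'.1.2])]
  congr 2
  funext i
  rcases hz.2 i with k | k
  · rcases hz'.2 i with k' | k'
    · rw [ramp_of_le (h.lt i x) k, ramp_of_le (h.lt i x') k']
    · linarith [h.lt i x, (h' i).2 k']
  · rw [ramp_of_ge (h.lt i x) k, ramp_of_ge (h.lt i x') ((h' i).1 k)]

omit hc hs in
/-- The image of the complement of the intervals does not depend on `x`. -/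
theorem exists_off {x : X} {z : ℝ} (hz : OffGaps lo hi a b x z) (x' : X) :
    ∃ z', OffGaps lo hi a b x' z' ∧ gapSum lo hi a b c x' z' = gapSum lo hi a b c x z := by
  set Z : Set ℝ := insert (lo x') {t | ∃ i, b i x ≤ z ∧ t = b i x'} with hZ
  have hne : Z.Nonempty := ⟨_, mem_insert _ _⟩
  have hbd : ∀ t ∈ Z, t ≤ hi x' := by
    rintro t (rfl | ⟨i, -, rfl⟩)
    exacts [h.lo_le_hi x', h.le_hi i x']
  have hin : ∀ i, b i x ≤ z → b i x' ≤ sSup Z := fun i hi' =>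
    le_csSup ⟨_, hbd⟩ (.inr ⟨i, hi', rfl⟩)
  have hout : ∀ j, z ≤ a j x → sSup Z ≤ a j x' := by
    intro j hj
    refine csSup_le hne ?_
    rintro t (rfl | ⟨i, hi', rfl⟩)
    · exact h.lo_le j x'
    · rcases eq_or_ne i j with rfl | hij
      · linarith [h.lt i x]
      · rcases h.order i j hij with k | k
        · exact k x'
        · linarith [k x, h.lt i x, h.lt j x]
  have hoff : OffGaps lo hi a b x' (sSup Z) :=
    ⟨⟨le_csSup ⟨_, hbd⟩ (mem_insert _ _), csSup_le hne hbd⟩, fun i =>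
      (hz.2 i).imp (hout i) (hin i)⟩
  refine ⟨_, hoff, h.gapSum_eq_of_off hoff hz fun i => ⟨fun k => ?_, hin i⟩⟩
  rcases hz.2 i with k' | k'
  · linarith [hout i k', h.lt i x']
  · exact k'

theorem surjective_gapSum (x : X) : Function.Surjective (gapSum lo hi a b c x) := by
  refine surjective_of_eq_of_large ((h.continuous_gapSum hc hs).comp
    (by fun_prop : Continuous fun z : ℝ => (x, z))) (C := |lo x| + |hi x| + ∑' i, c i) fun z => ?_
  have h1 : 0 ≤ ∑' i, c i * ramp (a i x) (b i x) z :=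
    tsum_nonneg fun i => mul_nonneg (hc i).le (ramp_mem _ _ _).1
  have h2 : ∑' i, c i * ramp (a i x) (b i x) z ≤ ∑' i, c i :=
    (h.summable hc hs x z).tsum_le_tsum
      (fun i => mul_le_of_le_one_right (hc i).le (ramp_mem _ _ _).2) hs
  have h3 := h.lo_le_hi x
  have h4 := neg_abs_le (lo x)
  have h5 := le_abs_self (lo x)
  have h6 := neg_abs_le (hi x)
  have h7 := le_abs_self (hi x)
  unfold gapSum
  rw [abs_le]
  rcases le_total (z - lo x) 0 with k | k <;> rcases le_total (z - hi x) 0 with k' | k'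
  · rw [min_eq_left k, max_eq_right k']; constructor <;> linarith
  · rw [min_eq_left k, max_eq_left k']; constructor <;> linarith
  · rw [min_eq_right k, max_eq_right k']; constructor <;> linarith
  · rw [min_eq_right k, max_eq_left k']; constructor <;> linarith

end IsGapFamily
end gapFamily

/-! ### The gaps of a closed set over a vector space -/

theorem ContinuousOn.lt_or_gt_of_ne {f g : ℝ → ℝ} {s : Set ℝ} (hs : IsPreconnected s)
    (hf : ContinuousOn f s) (hg : ContinuousOn g s) (h : ∀ t ∈ s, f t ≠ g t) :
    (∀ t ∈ s, f t < g t) ∨ ∀ t ∈ s, g t < f t := by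
  by_contra! hc
  obtain ⟨⟨t, ht, h1⟩, t', ht', h2⟩ := hc
  obtain ⟨x, hx, hxe⟩ := hs.intermediate_value₂ ht' ht hf hg h2 h1
  exact h x hx hxe

/-- `(A, B)` is a gap over `x` of the set `K`. -/
def IsGap {X : Type*} (K : Set (X × ℝ)) (x : X) (A B : ℝ) : Prop :=
  A < B ∧ (x, A) ∈ K ∧ (x, B) ∈ K ∧ ∀ t ∈ Ioo A B, (x, t) ∉ K

namespace IsGap

theorem le_or_le {X : Type*} {K : Set (X × ℝ)} {x : X} {A B A' B' : ℝ} (h : IsGap K x A B)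
    (h' : IsGap K x A' B') : (A = A' ∧ B = B') ∨ B ≤ A' ∨ B' ≤ A := by
  obtain ⟨h1, h2, h3, h4⟩ := h
  obtain ⟨k1, k2, k3, k4⟩ := h'
  by_contra! hc
  have e1 : ¬ A < A' := fun h => h4 A' ⟨h, hc.2.1⟩ k2
  have e2 : ¬ A' < A := fun h => k4 A ⟨h, hc.2.2⟩ h2
  have e3 : ¬ B < B' := fun h => k4 B ⟨hc.2.1, h⟩ h3
  have e4 : ¬ B' < B := fun h => h4 B' ⟨hc.2.2, h⟩ k3
  exact hc.1 (le_antisymm (not_lt.1 e2) (not_lt.1 e1)) (le_antisymm (not_lt.1 e4) (not_lt.1 e3))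

theorem unique {X : Type*} {K : Set (X × ℝ)} {x : X} {A B A' B' m : ℝ} (h : IsGap K x A B)
    (h' : IsGap K x A' B') (hm : m ∈ Ioo A B) (hm' : m ∈ Ioo A' B') : A = A' ∧ B = B' := by
  rcases h.le_or_le h' with k | k | k
  · exact k
  · linarith [hm.2, hm'.1]
  · linarith [hm.1, hm'.2]

theorem exists_of_notMem {X : Type*} [TopologicalSpace X] {K : Set (X × ℝ)} (hK : IsClosed K)
    {x : X} {l r t : ℝ} (hl : (x, l) ∈ K) (hr : (x, r) ∈ K) (ht : t ∈ Icc l r) (hn : (x, t) ∉ K) :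
    ∃ A B, IsGap K x A B ∧ t ∈ Ioo A B := by
  have hc : IsClosed {s | (x, s) ∈ K} := hK.preimage (by fun_prop : Continuous fun s : ℝ => (x, s))
  obtain ⟨A, hA, hA'⟩ := (isCompact_Icc.inter_right hc : IsCompact (Icc l t ∩ _)).exists_isGreatest
    ⟨l, ⟨le_rfl, ht.1⟩, hl⟩
  obtain ⟨C, hC, hC'⟩ := (isCompact_Icc.inter_right hc : IsCompact (Icc t r ∩ _)).exists_isLeast
    ⟨r, ⟨ht.2, le_rfl⟩, hr⟩
  have h1 : A < t := lt_of_le_of_ne hA.1.2 fun h => hn (h ▸ hA.2)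
  have h2 : t < C := lt_of_le_of_ne hC.1.1 fun h => hn (h ▸ hC.2)
  refine ⟨A, C, ⟨h1.trans h2, hA.2, hC.2, fun s hs hsK => ?_⟩, h1, h2⟩
  rcases le_total s t with k | k
  · linarith [hs.1, hA' ⟨⟨hA.1.1.trans hs.1.le, k⟩, hsK⟩]
  · linarith [hs.2, hC' ⟨⟨k, hs.2.le.trans hC.1.2⟩, hsK⟩]

variable {X : Type u} [NormedAddCommGroup X] [NormedSpace ℝ X] {K : Set (X × ℝ)}

/-- If the gaps persist under small changes of the base point, and along half-open segments of the
base, then they form families that depend continuously on the base point. -/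
theorem exists_family (hI : ∀ x t, (x, t) ∈ K → t ∈ Icc (-3) 3)
    (H1 : ∀ x A B, IsGap K x A B → ∀ m ∈ Ioo A B, ∀ V ∈ 𝓝 (A, B), ∀ᶠ x' in 𝓝 x,
      ∃ A' B', IsGap K x' A' B' ∧ m ∈ Ioo A' B' ∧ (A', B') ∈ V)
    (H2 : ∀ (u w : X) (A B : ℝ → ℝ), ContinuousOn A (Ico 0 1) → ContinuousOn B (Ico 0 1) →
      (∀ t ∈ Ico (0 : ℝ) 1, IsGap K (u + t • w) (A t) (B t)) →
      ∃ A₁ B₁, IsGap K (u + w) A₁ B₁ ∧ Tendsto A (𝓝[<] 1) (𝓝 A₁) ∧ Tendsto B (𝓝[<] 1) (𝓝 B₁)) :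
    ∃ (I : Type u) (_ : Countable I) (a b : I → X → ℝ),
      IsGapFamily (fun _ => -3) (fun _ => 3) a b ∧ (∀ i x, IsGap K x (a i x) (b i x)) ∧
      ∀ x A B, IsGap K x A B → ∃ i, a i x = A ∧ b i x = B := by
  let E := {e : X × ℝ × ℝ // IsGap K e.1 e.2.1 e.2.2}
  let π : E → X := fun e => e.1.1
  have hπc : Continuous π := by fun_prop
  have hEext : ∀ e e' : E, e.1.1 = e'.1.1 → (∃ m, m ∈ Ioo e.1.2.1 e.1.2.2 ∧
      m ∈ Ioo e'.1.2.1 e'.1.2.2) → e = e' := by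
    rintro ⟨⟨x, A, B⟩, h⟩ ⟨⟨x', A', B'⟩, h'⟩ (rfl : x = x') ⟨m, hm, hm'⟩
    obtain ⟨rfl, rfl⟩ := h.unique h' hm hm'
    rfl
  have hπ : IsLocalHomeomorph π := by
    have ho : IsOpenMap π := by
      refine isOpenMap_iff_nhds_le.2 ?_
      rintro ⟨⟨x, A, B⟩, h⟩ V hV
      have hV' : π ⁻¹' V ∈ 𝓝 (⟨(x, A, B), h⟩ : E) := hV
      rw [nhds_subtype_eq_comap, mem_comap, nhds_prod_eq] at hV'
      obtain ⟨T, hT, hTV⟩ := hV'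
      obtain ⟨V₁, hV₁, V₂, hV₂, hVT⟩ := mem_prod_iff.1 hT
      have hm : (A + B) / 2 ∈ Ioo A B := ⟨by linarith [h.1], by linarith [h.1]⟩
      filter_upwards [H1 x A B h _ hm V₂ hV₂, hV₁] with x' ⟨A', B', h', _, h''⟩ hx'
      exact hTV (show (⟨(x', A', B'), h'⟩ : E) ∈ _ from hVT ⟨hx', h''⟩)
    refine isLocalHomeomorph_iff_isOpenEmbedding_restrict.2 fun e => ?_
    set m := (e.1.2.1 + e.1.2.2) / 2 with hm
    have hU : IsOpen {e' : E | e'.1.2.1 < m ∧ m < e'.1.2.2} := by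
      have h1 : Continuous fun e' : E => e'.1.2.1 := by fun_prop
      have h2 : Continuous fun e' : E => e'.1.2.2 := by fun_prop
      exact (isOpen_lt h1 continuous_const).inter (isOpen_lt continuous_const h2)
    refine ⟨_, hU.mem_nhds (?_ : e.1.2.1 < m ∧ m < e.1.2.2), ?_⟩
    · have := e.2.1; constructor <;> linarith
    · refine .of_continuous_injective_isOpenMap (by fun_prop) ?_ (ho.domRestrict hU)
      exact fun e₁ e₂ h12 => Subtype.ext (hEext _ _ h12 ⟨m, e₁.2, e₂.2⟩)
  have hsec := exists_section_of_isLocalHomeomorph hπ (fun u w γ hγ hγu => by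
    obtain ⟨A₁, B₁, h1, hA, hB⟩ := H2 u w (fun t => (γ t).1.2.1) (fun t => (γ t).1.2.2)
      ((by fun_prop : Continuous fun e : E => e.1.2.1).comp_continuousOn hγ)
      ((by fun_prop : Continuous fun e : E => e.1.2.2).comp_continuousOn hγ)
      (fun t ht => by rw [← hγu t ht]; exact (γ t).2)
    refine ⟨⟨(u + w, A₁, B₁), h1⟩, tendsto_subtype_rng.2 ?_⟩
    refine Tendsto.prodMk_nhds ?_ (Tendsto.prodMk_nhds hA hB)
    have h2 : Tendsto (fun t : ℝ => u + t • w) (𝓝[<] 1) (𝓝 (u + w)) := by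
      have : Continuous fun t : ℝ => u + t • w := by fun_prop
      simpa using (this.tendsto 1).mono_left nhdsWithin_le_nhds
    refine h2.congr' ?_
    filter_upwards [Ico_mem_nhdsLT (zero_lt_one' ℝ)] with t ht using (hγu t ht).symm)
  have huniq : ∀ σ σ' : X → E, Continuous σ → Continuous σ' → (∀ x, π (σ x) = x) →
      (∀ x, π (σ' x) = x) → ∀ x, σ x = σ' x → σ = σ' := fun σ σ' h h' k k' x hx =>
    (T2Space.isSeparatedMap π).eq_of_comp_eq hπ.isLocallyInjective h h'
      (funext fun x => (k x).trans (k' x).symm) x hx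
  let I := {e : E // π e = 0}
  choose σ hσ using fun i : I => hsec i.1
  have hσ0 : ∀ i, σ i 0 = i.1 := fun i => by have := (hσ i).2.2; rwa [i.2] at this
  have hgap : ∀ i x, IsGap K x (σ i x).1.2.1 (σ i x).1.2.2 := fun i x => by
    have h2 : (σ i x).1.1 = x := (hσ i).2.1 x
    have := (σ i x).2
    rwa [h2] at this
  refine ⟨I, ?_, fun i x => (σ i x).1.2.1, fun i x => (σ i x).1.2.2, ⟨continuous_const,
    continuous_const, fun i => ?_, fun i => ?_, fun _ => by norm_num, fun i x => (hgap i x).1,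
    fun i x => (hI _ _ (hgap i x).2.1).1, fun i x => (hI _ _ (hgap i x).2.2.1).2, ?_⟩, hgap, ?_⟩
  · refine Pairwise.countable_of_isOpen_disjoint (s := fun i : I => Ioo i.1.1.2.1 i.1.1.2.2)
      (fun i j hij => Set.disjoint_left.2 fun m hm hm' => hij ?_) (fun i => isOpen_Ioo)
      fun i => nonempty_Ioo.2 i.1.2.1
    exact Subtype.ext (hEext _ _ (i.2.trans j.2.symm) ⟨m, hm, hm'⟩)
  · exact (by fun_prop : Continuous fun e : E => e.1.2.1).comp (hσ i).1
  · exact (by fun_prop : Continuous fun e : E => e.1.2.2).comp (hσ i).1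
  · intro i j hij
    have hd : ∀ x, (σ i x).1.2.2 ≤ (σ j x).1.2.1 ∨ (σ j x).1.2.2 ≤ (σ i x).1.2.1 := fun x => by
      refine ((hgap i x).le_or_le (hgap j x)).resolve_left fun h => hij (Subtype.ext ?_)
      have h3 : σ i x = σ j x := Subtype.ext (Prod.ext
        (((hσ i).2.1 x).trans ((hσ j).2.1 x).symm) (Prod.ext h.1 h.2))
      rw [← hσ0 i, ← hσ0 j, huniq _ _ (hσ i).1 (hσ j).1 (hσ i).2.1 (hσ j).2.1 x h3]
    by_contra! hc
    obtain ⟨⟨x, hx⟩, y, hy⟩ := hc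
    have hx' := (hd x).resolve_left hx.not_ge
    have hy' := (hd y).resolve_right hy.not_ge
    have hl : ∀ i, Continuous fun x => (σ i x).1.2.1 := fun i =>
      (by fun_prop : Continuous fun e : E => e.1.2.1).comp (hσ i).1
    obtain ⟨z, hz⟩ : ∃ z, (σ i z).1.2.1 - (σ j z).1.2.1 = 0 :=
      mem_range_of_exists_le_of_exists_ge (c := 0) ((hl i).sub (hl j))
        ⟨y, sub_nonpos.2 ((hgap i y).1.le.trans hy')⟩ ⟨x, sub_nonneg.2 ((hgap j x).1.le.trans hx')⟩
    rcases hd z with k | k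
    · linarith [(hgap i z).1]
    · linarith [(hgap j z).1]
  · intro x A B h
    obtain ⟨τ, h1, h2, h3⟩ := hsec ⟨(x, A, B), h⟩
    have h4 : σ ⟨τ 0, h2 0⟩ = τ := huniq _ _ (hσ _).1 h1 (hσ _).2.1 h2 0 (hσ0 _)
    refine ⟨⟨τ 0, h2 0⟩, ?_⟩
    change (σ ⟨τ 0, h2 0⟩ x).1.2.1 = A ∧ (σ ⟨τ 0, h2 0⟩ x).1.2.2 = B
    rw [h4]
    have h5 : τ x = ⟨(x, A, B), h⟩ := h3
    rw [h5]
    exact ⟨rfl, rfl⟩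

end IsGap

/-! ### The gaps of the complement of a regular neighbourhood in a column -/

namespace BranchedSurface

variable {M : Type u} [TopologicalSpace M] [T2Space M] {B : BranchedSurface M}

/-- The closed set of parameters over which the slot is present or has zero width. -/
def SlotMode.Closed : SlotMode → ℝ → Prop
  | absent, _ => False
  | full, _ => True
  | branch, t => 0 ≤ t

theorem SlotMode.closed_iff {m : SlotMode} {t : ℝ} :
    m.Closed t ↔ m.Active t ∨ (m = .branch ∧ t = 0) := by
  cases m <;> simp [Closed, Active, le_iff_lt_or_eq, eq_comm]

theorem SlotMode.eventually_closed {m : SlotMode} {t : ℝ} :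
    ∀ᶠ s in 𝓝 t, m.Closed s → m.Closed t := by
  by_cases h : m.Closed t
  · exact Eventually.of_forall fun _ _ => h
  · rw [closed_iff, not_or] at h
    cases m with
    | absent => exact Eventually.of_forall fun _ h => h
    | full => exact Eventually.of_forall fun _ h => h
    | branch =>
      have h0 : t < 0 := lt_of_le_of_ne (not_lt.1 h.1) fun h' => h.2 ⟨rfl, h'⟩
      filter_upwards [eventually_lt_nhds h0] with s hs hs' using absurd hs' hs.not_ge

theorem SlotMode.closed_affine (m : SlotMode) (u w : ℝ) : ∃ t₀ ∈ Ico (0 : ℝ) 1,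
    (∀ t ∈ Ico t₀ 1, m.Closed (u + t * w)) ∨ ∀ t ∈ Ico t₀ 1, ¬ m.Closed (u + t * w) := by
  cases m with
  | absent => exact ⟨0, by simp, .inr fun _ _ h => h⟩
  | full => exact ⟨0, by simp, .inl fun _ _ => trivial⟩
  | branch =>
    by_cases h : ∃ t₀ ∈ Ico (0 : ℝ) 1, ∀ t ∈ Ico t₀ 1, ¬ 0 ≤ u + t * w
    · obtain ⟨t₀, h1, h2⟩ := h
      exact ⟨t₀, h1, .inr h2⟩
    · push Not at h
      obtain ⟨a, ha, ha'⟩ := h 0 (by simp)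
      refine ⟨a, ha, .inl fun t ht => ?_⟩
      obtain ⟨b, hb, hb'⟩ := h t ⟨ha.1.trans ht.1, ht.2⟩
      change 0 ≤ u + t * w
      rcases le_total 0 w with hw | hw
      · nlinarith [ht.1]
      · nlinarith [hb.1]

namespace Column
variable (κ : Column B) (O : Set M)

/-- A slot, possibly of zero width, between the heights `l` and `r`. -/
def Slot (a : ℝ × ℝ) (l r : ℝ) : Prop :=
  (κ.m.Closed a.1 ∧ l = 1 / 2 ∧ r = 3 / 2) ∨ (κ.n.Closed a.2 ∧ l = -(3 / 2) ∧ r = -(1 / 2))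

/-- The complement of `O` in the column. -/
def solid : Set ((ℝ × ℝ) × ℝ) := {q | κ.pt q.1 q.2 ∈ B.nbhd \ O}

variable {κ O}

theorem pt_mem_nbhd_iff {a : ℝ × ℝ} {t : ℝ} : κ.pt a t ∈ B.nbhd ↔ κ.S a t := by
  rw [κ.mem_nbhd (κ.pt_mem a t)]; simp

theorem mem_solid {a : ℝ × ℝ} {t : ℝ} : (a, t) ∈ κ.solid O ↔ κ.S a t ∧ κ.pt a t ∉ O :=
  and_congr_left' pt_mem_nbhd_iff

theorem mem_solid_of {y : M} (hy : y ∈ κ.chart.source) :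
    (κ.v y, κ.z y) ∈ κ.solid O ↔ y ∈ B.nbhd \ O := by
  change κ.pt (κ.v y) (κ.z y) ∈ B.nbhd \ O ↔ _
  rw [κ.pt_v_z hy]

theorem exists_slot {a : ℝ × ℝ} {t : ℝ} (h : ¬ κ.S a t) (ht : t ∈ Icc (-3) 3) :
    ∃ l r, t ∈ Ioo l r ∧ ∀ᶠ b in 𝓝 a, κ.Slot b l r := by
  rw [S_iff, not_and, Classical.not_and_iff_not_or_not, not_not, not_not] at h
  rcases h (abs_le.2 ht) with ⟨h1, h2⟩ | ⟨h1, h2⟩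
  · refine ⟨_, _, h2, ?_⟩
    filter_upwards [continuous_fst.continuousAt.eventually (κ.m.isOpen_active.mem_nhds h1)]
      with b hb using .inl ⟨SlotMode.closed_iff.2 (.inl hb), rfl, rfl⟩
  · refine ⟨_, _, h2, ?_⟩
    filter_upwards [continuous_snd.continuousAt.eventually (κ.n.isOpen_active.mem_nhds h1)]
      with b hb using .inr ⟨SlotMode.closed_iff.2 (.inl hb), rfl, rfl⟩

theorem eventually_slot (a : ℝ × ℝ) : ∀ᶠ b in 𝓝 a, ∀ l r, κ.Slot b l r → κ.Slot a l r := by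
  filter_upwards [continuous_fst.continuousAt.eventually (SlotMode.eventually_closed (m := κ.m)),
    continuous_snd.continuousAt.eventually (SlotMode.eventually_closed (m := κ.n))]
    with b h1 h2 l r using Or.imp (And.imp_left h1) (And.imp_left h2)

theorem slot_affine (u w : ℝ × ℝ) : ∃ t₀ ∈ Ico (0 : ℝ) 1, ∀ l r,
    (∀ t ∈ Ico t₀ 1, κ.Slot (u + t • w) l r) ∨ ∀ t ∈ Ico t₀ 1, ¬ κ.Slot (u + t • w) l r := by
  obtain ⟨t₁, ht₁, h1⟩ := κ.m.closed_affine u.1 w.1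
  obtain ⟨t₂, ht₂, h2⟩ := κ.n.closed_affine u.2 w.2
  refine ⟨max t₁ t₂, ⟨ht₁.1.trans (le_max_left _ _), max_lt ht₁.2 ht₂.2⟩, fun l r => ?_⟩
  have k1 : ∀ {t}, t ∈ Ico (max t₁ t₂) 1 → t ∈ Ico t₁ 1 := fun h =>
    ⟨(le_max_left _ _).trans h.1, h.2⟩
  have k2 : ∀ {t}, t ∈ Ico (max t₁ t₂) 1 → t ∈ Ico t₂ 1 := fun h =>
    ⟨(le_max_right _ _).trans h.1, h.2⟩
  by_cases e1 : l = 1 / 2 ∧ r = 3 / 2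
  · refine h1.imp (fun h t ht => .inl ⟨h t (k1 ht), e1⟩) fun h t ht => ?_
    rintro (h' | h')
    · exact h t (k1 ht) h'.1
    · linarith [e1.1, h'.2.1]
  · by_cases e2 : l = -(3 / 2) ∧ r = -(1 / 2)
    · refine h2.imp (fun h t ht => .inr ⟨h t (k2 ht), e2⟩) fun h t ht => ?_
      rintro (h' | h')
      · exact e1 h'.2
      · exact h t (k2 ht) h'.1
    · exact .inr fun t _ h => h.elim (fun h => e1 h.2) fun h => e2 h.2

end Column

variable {S : Type u} [TopologicalSpace S] {ι : S → M} {O : Set M} {ρ : O → S} {κ : Column B}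

namespace IsTube

theorem isClosed_solid (h : B.IsTube ι O ρ) (κ : Column B) : IsClosed (κ.solid O) :=
  h.isClosed_sdiff.preimage κ.continuous_pt

theorem exists_gap (h : B.IsTube ι O ρ) {y : M} (hy : y ∈ κ.chart.source) (hO : y ∈ O) :
    ∃ A C, IsGap (κ.solid O) (κ.v y) A C ∧ κ.z y ∈ Ioo A C ∧
      ∀ t, t ∈ Ioo A C ↔ κ.pt (κ.v y) t ∈ B.fibre y ∧
        ∃ hO' : κ.pt (κ.v y) t ∈ O, ρ ⟨_, hO'⟩ = ρ ⟨y, hO⟩ := by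
  have hN := h.subset hO
  obtain ⟨a, ha, b, hb, h1, h2, h3⟩ := h.exists_ends hy hN (h.ι_fibre hO)
  have hend : ∀ c ∈ B.fibre y \ O, (κ.v y, κ.z c) ∈ κ.solid O := fun c hc => by
    rw [← κ.fibre_v hy hN hc.1, Column.mem_solid_of (κ.fibre_source hy hN hc.1)]
    exact ⟨fibre_subset hN hc.1, hc.2⟩
  have hpt : ∀ t, t ∈ Ioo (κ.z a) (κ.z b) → κ.pt (κ.v y) t ∈ B.fibre y := fun t ht =>
    κ.fibre_uIcc hy hN ha.1 hb.1 (by rw [uIcc_of_le (h1.trans h2).le]; exact ⟨ht.1.le, ht.2.le⟩)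
  have hiff : ∀ t, t ∈ Ioo (κ.z a) (κ.z b) ↔ κ.pt (κ.v y) t ∈ B.fibre y ∧
        ∃ hO' : κ.pt (κ.v y) t ∈ O, ρ ⟨_, hO'⟩ = ρ ⟨y, hO⟩ := fun t => by
    refine ⟨fun ht => ⟨hpt t ht, (h3 _ (hpt t ht)).2 (by simpa using ht)⟩, fun ht => ?_⟩
    simpa using (h3 _ ht.1).1 ht.2
  exact ⟨_, _, ⟨h1.trans h2, hend a ha, hend b hb, fun t ht hK => hK.2 ((hiff t).1 ht).2.1⟩,
    (h3 y (self_mem_fibre hN)).1 ⟨hO, rfl⟩, hiff⟩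

theorem exists_S (h : B.IsTube ι O ρ) {a : ℝ × ℝ} {t : ℝ} (hO : κ.pt a t ∈ O) :
    ∃ l r, t ∈ Ioo l r ∧ ∀ s ∈ Ioo l r, κ.S a s := by
  obtain ⟨l, r, -, h1, h2⟩ := h.exists_gap (κ.pt_mem a t) hO
  simp only [κ.v_pt, κ.z_pt] at h1 h2
  exact ⟨l, r, h1, fun s hs => Column.pt_mem_nbhd_iff.1 (h.subset ((h2 s).1 hs).2.1)⟩

theorem solid_end (h : B.IsTube ι O ρ) (a : ℝ × ℝ) : (a, -3) ∈ κ.solid O ∧ (a, 3) ∈ κ.solid O := by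
  rw [Column.mem_solid, Column.mem_solid, κ.S_iff, κ.S_iff]
  refine ⟨⟨by norm_num, fun hO => ?_⟩, by norm_num, fun hO => ?_⟩
  · obtain ⟨l, r, h1, h2⟩ := h.exists_S hO
    obtain ⟨s, hs, hs'⟩ := exists_between h1.1
    exact absurd (h2 s ⟨hs, hs'.trans h1.2⟩).ge (by linarith)
  · obtain ⟨l, r, h1, h2⟩ := h.exists_S hO
    obtain ⟨s, hs, hs'⟩ := exists_between h1.2
    exact absurd (h2 s ⟨h1.1.trans hs, hs'⟩).le (by linarith)

theorem isGap_of_slot (h : B.IsTube ι O ρ) {a : ℝ × ℝ} {l r : ℝ} (hs : κ.Slot a l r) :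
    IsGap (κ.solid O) a l r := by
  have h1 : l < r ∧ κ.S a l ∧ κ.S a r := by
    simp only [κ.S_iff]
    rcases hs with ⟨-, rfl, rfl⟩ | ⟨-, rfl, rfl⟩ <;> norm_num [abs_le]
  have h2 : (∀ t ∈ Ioo l r, ¬ κ.S a t) ∨
      ∀ t ∈ Icc l r, κ.Arc a t ∧ (κ.OpenArc a t ↔ t ∈ Ioo l r) := by
    rcases hs with ⟨hc, rfl, rfl⟩ | ⟨hc, rfl, rfl⟩ <;>
      rcases SlotMode.closed_iff.1 hc with hc | ⟨hc, h0⟩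
    · exact .inl fun t ht hS => ((κ.S_iff _ _).1 hS).2.1 ⟨hc, ht⟩
    · refine .inr fun t ht => ⟨.inl ⟨hc, h0, ht⟩, ?_, fun ht => .inl ⟨hc, h0, ht⟩⟩
      rintro (h | h)
      exacts [h.2.2, by linarith [h.2.2.2, ht.1]]
    · exact .inl fun t ht hS => ((κ.S_iff _ _).1 hS).2.2 ⟨hc, ht⟩
    · refine .inr fun t ht => ⟨.inr ⟨hc, h0, ht⟩, ?_, fun ht => .inr ⟨hc, h0, ht⟩⟩
      rintro (h | h)
      exacts [by linarith [h.2.2.1, ht.2], h.2.2]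
  have hend : ∀ t ∈ Icc l r, t ∉ Ioo l r → κ.pt a t ∉ O := fun t ht ht' hO => by
    rcases h2 with h2 | h2
    · obtain ⟨l', r', k1, k2⟩ := h.exists_S hO
      obtain ⟨s, k3, k4⟩ := exists_between (max_lt (lt_min (k1.1.trans k1.2) (k1.1.trans_le ht.2))
        (lt_min (ht.1.trans_lt k1.2) h1.1))
      rw [max_lt_iff] at k3
      rw [lt_min_iff] at k4
      exact h2 s ⟨k3.2, k4.2⟩ (k2 s ⟨k3.1, k4.1⟩)
    · have : κ.pt a t ∈ B.vertInterior := h.vert ▸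
        ⟨hO, (κ.mem_vertBoundary (κ.pt_mem a t)).2 (by simpa using (h2 t ht).1)⟩
      rw [κ.mem_vertInterior (κ.pt_mem a t), κ.v_pt, κ.z_pt, (h2 t ht).2] at this
      exact ht' this
  refine ⟨h1.1, Column.mem_solid.2 ⟨h1.2.1, hend l ⟨le_rfl, h1.1.le⟩ fun k => k.1.false⟩,
    Column.mem_solid.2 ⟨h1.2.2, hend r ⟨h1.1.le, le_rfl⟩ fun k => k.2.false⟩, fun t ht hK => ?_⟩
  · rw [Column.mem_solid] at hK
    rcases h2 with h2 | h2
    · exact h2 t ht hK.1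
    · refine hK.2 (h.vert.symm ▸ ?_ : κ.pt a t ∈ O ∩ B.vertBoundary).1
      rw [κ.mem_vertInterior (κ.pt_mem a t), κ.v_pt, κ.z_pt, (h2 t ⟨ht.1.le, ht.2.le⟩).2]
      exact ht

/-- An interior point of a gap lies in `O`, unless the gap is a slot. -/
theorem mem_or_slot (h : B.IsTube ι O ρ) {a : ℝ × ℝ} {l r t : ℝ} (hg : IsGap (κ.solid O) a l r)
    (ht : t ∈ Ioo l r) : κ.pt a t ∈ O ∨ ∀ᶠ b in 𝓝 a, κ.Slot b l r := by
  by_cases hO : κ.pt a t ∈ O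
  · exact .inl hO
  · have h1 : ¬ κ.S a t := fun hS => hg.2.2.2 t ht (Column.mem_solid.2 ⟨hS, hO⟩)
    obtain ⟨l', r', h2, h3⟩ := Column.exists_slot h1
      ⟨(Column.mem_solid.1 hg.2.1).1.ge.trans ht.1.le, ht.2.le.trans (Column.mem_solid.1 hg.2.2.1).1.le⟩
    obtain ⟨rfl, rfl⟩ := hg.unique (h.isGap_of_slot h3.self_of_nhds) ht h2
    exact .inr h3

theorem isGap_of_ends (h : B.IsTube ι O ρ) {y : M} (hy : y ∈ κ.chart.source) (hO : y ∈ O) {a b : M}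
    (hab : a ∈ B.fibre (ι (ρ ⟨y, hO⟩)) ∧ b ∈ B.fibre (ι (ρ ⟨y, hO⟩)) ∧
      (fun x : O => (x : M)) '' {x | ρ x = ρ ⟨y, hO⟩} = B.seg a b \ {a, b}) :
    IsGap (κ.solid O) (κ.v y) (min (κ.z a) (κ.z b)) (max (κ.z a) (κ.z b)) ∧
      κ.z y ∈ Ioo (min (κ.z a) (κ.z b)) (max (κ.z a) (κ.z b)) := by
  have hN := h.subset hO
  rw [B.fibre_eq _ hN _ (h.ι_fibre hO)] at hab
  obtain ⟨ha, hb, e⟩ := hab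
  obtain ⟨A, C, hg, hz, hiff⟩ := h.exists_gap hy hO
  have key : ∀ t, t ∈ Ioo A C ↔ t ∈ Ioo (min (κ.z a) (κ.z b)) (max (κ.z a) (κ.z b)) := fun t => by
    rw [hiff, and_congr_right fun k => sect_iff hy hN ha hb e k, κ.z_pt]
    exact and_iff_right_of_imp fun k => κ.fibre_uIcc hy hN ha hb ⟨k.1.le, k.2.le⟩
  have h3 := (key _).1 hz
  obtain ⟨k1, k2⟩ := (Ioo_subset_Ioo_iff hg.1).1 fun t => (key t).1
  obtain ⟨k3, k4⟩ := (Ioo_subset_Ioo_iff (h3.1.trans h3.2)).1 fun t => (key t).2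
  rw [le_antisymm k1 k3, le_antisymm k4 k2]
  exact ⟨hg, hz⟩

theorem exists_continuousOn (h : B.IsTube ι O ρ) (s₀ : S) :
    ∃ g : M → S, ContinuousOn g O ∧ ∀ y (hy : y ∈ O), g y = ρ ⟨y, hy⟩ := by
  classical
  refine ⟨fun y => if hy : y ∈ O then ρ ⟨y, hy⟩ else s₀, ?_, fun y hy => dif_pos hy⟩
  refine continuousOn_iff_continuous_domRestrict.2 (h.continuous_ρ.congr fun y => ?_)
  simp [y.2]

end IsTube

theorem ContinuousEnds.tendsto (hE : ContinuousEnds B ι ρ) (h : B.IsTube ι O ρ) {α : Type*}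
    {l : Filter α} {x : α → M} {y₀ : M} (hy₀ : y₀ ∈ κ.chart.source) (hO : y₀ ∈ O) {A C : ℝ}
    (hg : IsGap (κ.solid O) (κ.v y₀) A C) (hz : κ.z y₀ ∈ Ioo A C)
    (hx : ∀ᶠ i in l, x i ∈ κ.chart.source ∧ x i ∈ O) (g : M → S)
    (hgρ : ∀ y (hy : y ∈ O), g y = ρ ⟨y, hy⟩) (hl : Tendsto (fun i => g (x i)) l (𝓝 (g y₀))) :
    ∃ A' C' : α → ℝ, Tendsto A' l (𝓝 A) ∧ Tendsto C' l (𝓝 C) ∧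
      ∀ᶠ i in l, IsGap (κ.solid O) (κ.v (x i)) (A' i) (C' i) ∧ κ.z (x i) ∈ Ioo (A' i) (C' i) := by
  obtain ⟨a, b, ha, hb, hab⟩ := hE (g y₀)
  have h0 := hab.self_of_nhds
  have hN := h.subset hO
  have hsrc : ∀ w ∈ B.fibre (ι (g y₀)), w ∈ κ.chart.source := fun w hw => by
    rw [hgρ _ hO, B.fibre_eq _ hN _ (h.ι_fibre hO)] at hw
    exact κ.fibre_source hy₀ hN hw
  have ha' : Tendsto (fun i => κ.z (a (g (x i)))) l (𝓝 (κ.z (a (g y₀)))) :=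
    (κ.continuousAt_z (hsrc _ h0.1)).tendsto.comp (ha.tendsto.comp hl)
  have hb' : Tendsto (fun i => κ.z (b (g (x i)))) l (𝓝 (κ.z (b (g y₀)))) :=
    (κ.continuousAt_z (hsrc _ h0.2.1)).tendsto.comp (hb.tendsto.comp hl)
  rw [hgρ _ hO] at h0
  obtain ⟨k1, k2⟩ := h.isGap_of_ends hy₀ hO h0
  obtain ⟨e1, e2⟩ := hg.unique k1 hz k2
  rw [← hgρ _ hO] at e1 e2
  refine ⟨_, _, e1 ▸ ha'.min hb', e2 ▸ ha'.max hb', ?_⟩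
  filter_upwards [hl.eventually hab, hx] with i hi hxi
  rw [hgρ _ hxi.2] at hi ⊢
  exact h.isGap_of_ends hxi.1 hxi.2 hi

theorem IsTube.eventually_gap (h : B.IsTube ι O ρ) (hE : ContinuousEnds B ι ρ) {x : ℝ × ℝ} {A C : ℝ}
    (hg : IsGap (κ.solid O) x A C) {m : ℝ} (hm : m ∈ Ioo A C) {V : Set (ℝ × ℝ)} (hV : V ∈ 𝓝 (A, C)) :
    ∀ᶠ x' in 𝓝 x, ∃ A' C', IsGap (κ.solid O) x' A' C' ∧ m ∈ Ioo A' C' ∧ (A', C') ∈ V := by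
  rcases h.mem_or_slot hg hm with hO | hs
  · have hpc : Continuous fun x' => κ.pt x' m :=
      κ.continuous_pt.comp (by fun_prop : Continuous fun x' : ℝ × ℝ => (x', m))
    obtain ⟨g, hgc, hgρ⟩ := h.exists_continuousOn (ρ ⟨_, hO⟩)
    set T : Set (ℝ × ℝ) := {x' | κ.pt x' m ∈ O} with hT
    obtain ⟨A', C', hA', hC', hev⟩ := hE.tendsto h (l := 𝓝[T] x) (x := fun x' => κ.pt x' m)
      (κ.pt_mem x m) hO (by simpa using hg) (by simpa using hm)
      (eventually_nhdsWithin_of_forall fun x' hx' => ⟨κ.pt_mem x' m, hx'⟩) g hgρ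
      ((hgc _ hO).tendsto.comp (tendsto_nhdsWithin_iff.2 ⟨hpc.continuousAt.tendsto.mono_left
        nhdsWithin_le_nhds, eventually_mem_nhdsWithin⟩))
    have hV' := (hA'.prodMk_nhds hC').eventually hV
    filter_upwards [hpc.continuousAt.eventually (h.eventually_mem hO),
      Column.eventually_slot (κ := κ) x,
      eventually_nhdsWithin_iff.1 hev, eventually_nhdsWithin_iff.1 hV'] with x' h1 h2 h3 h4
    by_cases hx' : κ.pt x' m ∈ O
    · have := h3 hx'
      rw [κ.v_pt, κ.z_pt] at this
      exact ⟨_, _, this.1, this.2, h4 hx'⟩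
    · have h5 : ¬ κ.S x' m := fun hS => hx' (h1 (Column.pt_mem_nbhd_iff.2 hS))
      obtain ⟨l, r, h6, h7⟩ := Column.exists_slot h5
        ⟨(Column.mem_solid.1 hg.2.1).1.ge.trans hm.1.le,
          hm.2.le.trans (Column.mem_solid.1 hg.2.2.1).1.le⟩
      obtain ⟨rfl, rfl⟩ := hg.unique (h.isGap_of_slot (h2 l r h7.self_of_nhds)) hm h6
      exact ⟨_, _, h.isGap_of_slot h7.self_of_nhds, hm, mem_of_mem_nhds hV⟩
  · filter_upwards [hs] with x' hx' using ⟨A, C, h.isGap_of_slot hx', hm, mem_of_mem_nhds hV⟩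

/-! ### The gaps of a column form a family -/

/-- Limits of a continuous height along a segment of the base lie in a single fibre. -/
theorem Column.fibre_of_ultrafilter {u w : ℝ × ℝ} {t₀ : ℝ} (ht₀ : t₀ < 1) {f : ℝ → ℝ}
    (hf : ContinuousOn f (Ico t₀ 1)) (hS : ∀ t ∈ Ico t₀ 1, κ.S (u + t • w) (f t))
    {U U' : Ultrafilter ℝ} (hU : (U : Filter ℝ) ≤ 𝓝[<] 1) (hU' : (U' : Filter ℝ) ≤ 𝓝[<] 1)
    {h h' : ℝ} (hh : Tendsto f U (𝓝 h)) (hh' : Tendsto f U' (𝓝 h')) :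
    κ.pt (u + w) h' ∈ B.fibre (κ.pt (u + w) h) := by
  have hc : Tendsto (fun t : ℝ => u + t • w) (𝓝[<] 1) (𝓝 (u + w)) := by
    have : Continuous fun t : ℝ => u + t • w := by fun_prop
    simpa using (this.tendsto 1).mono_left nhdsWithin_le_nhds
  have hlim : ∀ {U : Ultrafilter ℝ}, (U : Filter ℝ) ≤ 𝓝[<] 1 → ∀ {h : ℝ}, Tendsto f U (𝓝 h) →
      κ.S (u + w) h := fun {U} hU h hh =>
    κ.isClosed_S.mem_of_tendsto ((hc.mono_left hU).prodMk_nhds hh)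
      (hU (by filter_upwards [Ico_mem_nhdsLT ht₀] with t ht using hS t ht))
  rw [Column.pt_mem_fibre (hlim hU hh)]
  intro r hr
  by_contra hn
  have hev : ∀ᶠ t in 𝓝[<] (1 : ℝ), t ∈ Ico t₀ 1 ∧ ¬ κ.S (u + t • w) r :=
    Eventually.and (Ico_mem_nhdsLT ht₀) ((hc.prodMk_nhds tendsto_const_nhds).eventually
      (κ.isClosed_S.isOpen_compl.mem_nhds hn))
  obtain ⟨t₁, ht₁, hsub⟩ := mem_nhdsLT_iff_exists_Ico_subset.1 hev
  have hne : ∀ t ∈ Ico t₁ 1, f t ≠ r := fun t ht hr => (hsub ht).2 (hr ▸ hS t (hsub ht).1)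
  rcases ContinuousOn.lt_or_gt_of_ne isPreconnected_Ico (hf.mono fun t ht => (hsub ht).1)
    continuousOn_const hne with k | k
  · have hb : ∀ {U : Ultrafilter ℝ}, (U : Filter ℝ) ≤ 𝓝[<] 1 → ∀ {h : ℝ}, Tendsto f U (𝓝 h) →
        h < r := fun {U} hU h hh => lt_of_le_of_ne (le_of_tendsto hh
          (hU (by filter_upwards [Ico_mem_nhdsLT ht₁] with t ht using (k t ht).le)))
          fun h' => hn (h' ▸ hlim hU hh)
    exact (max_lt (hb hU hh) (hb hU' hh')).not_ge hr.2
  · have hb : ∀ {U : Ultrafilter ℝ}, (U : Filter ℝ) ≤ 𝓝[<] 1 → ∀ {h : ℝ}, Tendsto f U (𝓝 h) →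
        r < h := fun {U} hU h hh => lt_of_le_of_ne (ge_of_tendsto hh
          (hU (by filter_upwards [Ico_mem_nhdsLT ht₁] with t ht using (k t ht).le)))
          fun h' => hn (h' ▸ hlim hU hh)
    exact (lt_min (hb hU hh) (hb hU' hh')).not_ge hr.1

namespace IsTube

/-- A continuous family of gaps over a segment consists of one slot or of tube segments, on a
terminal part of the segment. -/
theorem slot_or_mem (h : B.IsTube ι O ρ) {u w : ℝ × ℝ} {A C : ℝ → ℝ}
    (hA : ContinuousOn A (Ico 0 1)) (hC : ContinuousOn C (Ico 0 1))
    (hg : ∀ t ∈ Ico (0 : ℝ) 1, IsGap (κ.solid O) (u + t • w) (A t) (C t)) :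
    ∃ t₀ ∈ Ico (0 : ℝ) 1, (∃ l r, ∀ t ∈ Ico t₀ 1, κ.Slot (u + t • w) l r ∧ A t = l ∧ C t = r) ∨
      ∀ t ∈ Ico t₀ 1, κ.pt (u + t • w) ((A t + C t) / 2) ∈ O := by
  obtain ⟨t₀, ht₀, hs⟩ := κ.slot_affine u w
  refine ⟨t₀, ht₀, or_iff_not_imp_left.2 fun hn t ht => ?_⟩
  have hsub : ∀ {t}, t ∈ Ico t₀ 1 → t ∈ Ico (0 : ℝ) 1 := fun ht => ⟨ht₀.1.trans ht.1, ht.2⟩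
  have hmid : ∀ t ∈ Ico t₀ 1, (A t + C t) / 2 ∈ Ioo (A t) (C t) := fun t ht => by
    have := (hg t (hsub ht)).1; constructor <;> linarith
  have hcont : ContinuousOn (fun t => (A t + C t) / 2) (Ico t₀ 1) :=
    ((hA.add hC).div_const 2).mono fun t => hsub
  refine (h.mem_or_slot (hg t (hsub ht)) (hmid t ht)).resolve_right fun hsl => hn ?_
  refine ⟨A t, C t, fun t' ht' => ?_⟩
  have hsl := (hs (A t) (C t)).resolve_right fun k => k t ht hsl.self_of_nhds
  have hne : ∀ e, (e = A t ∨ e = C t) → ∀ t' ∈ Ico t₀ 1, (A t' + C t') / 2 ≠ e :=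
    fun e he t' ht' h' => by
      have hgt := h.isGap_of_slot (hsl t' ht')
      have := (hg t' (hsub ht')).2.2.2 e (h' ▸ hmid t' ht')
      rcases he with rfl | rfl
      exacts [this hgt.2.1, this hgt.2.2.1]
  have h1 := (ContinuousOn.lt_or_gt_of_ne isPreconnected_Ico hcont continuousOn_const
    (hne _ (.inl rfl))).resolve_left fun k => by linarith [k t ht, (hmid t ht).1]
  have h2 := (ContinuousOn.lt_or_gt_of_ne isPreconnected_Ico hcont continuousOn_const
    (hne _ (.inr rfl))).resolve_right fun k => by linarith [k t ht, (hmid t ht).2]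
  exact ⟨hsl t' ht', (hg t' (hsub ht')).unique (h.isGap_of_slot (hsl t' ht')) (hmid t' ht')
    ⟨h1 t' ht', h2 t' ht'⟩⟩

/-- Completeness of the surface: gaps over a half-open segment converge to a gap. -/
theorem exists_tendsto_gap (h : B.IsTube ι O ρ) (hE : ContinuousEnds B ι ρ)
    (hcomp : B.IsCompleteSurface ι) {u w : ℝ × ℝ} {A C : ℝ → ℝ}
    (hA : ContinuousOn A (Ico 0 1)) (hC : ContinuousOn C (Ico 0 1))
    (hg : ∀ t ∈ Ico (0 : ℝ) 1, IsGap (κ.solid O) (u + t • w) (A t) (C t)) :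
    ∃ A₁ C₁, IsGap (κ.solid O) (u + w) A₁ C₁ ∧ Tendsto A (𝓝[<] 1) (𝓝 A₁) ∧
      Tendsto C (𝓝[<] 1) (𝓝 C₁) := by
  have hcc : Continuous fun t : ℝ => u + t • w := by fun_prop
  have hc : Tendsto (fun t : ℝ => u + t • w) (𝓝[<] 1) (𝓝 (u + w)) := by
    simpa using (hcc.tendsto 1).mono_left nhdsWithin_le_nhds
  obtain ⟨t₀, ht₀, ⟨l, r, hs⟩ | hO⟩ := h.slot_or_mem hA hC hg
  · obtain ⟨t, k1, k2⟩ := ((hc.eventually (Column.eventually_slot (κ := κ) _)).and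
      (Ico_mem_nhdsLT ht₀.2)).exists
    refine ⟨l, r, h.isGap_of_slot (k1 l r (hs t k2).1), ?_, ?_⟩ <;>
      refine tendsto_const_nhds.congr' ?_ <;> filter_upwards [Ico_mem_nhdsLT ht₀.2] with t ht
    exacts [(hs t ht).2.1.symm, (hs t ht).2.2.symm]
  set f : ℝ → ℝ := fun t => (A t + C t) / 2 with hf
  have hsub : Ico t₀ 1 ⊆ Ico (0 : ℝ) 1 := Ico_subset_Ico_left ht₀.1
  have hfc : ContinuousOn f (Ico t₀ 1) := ((hA.add hC).div_const 2).mono hsub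
  have hfS : ∀ t ∈ Ico t₀ 1, κ.S (u + t • w) (f t) := fun t ht =>
    Column.pt_mem_nbhd_iff.1 (h.subset (hO t ht))
  have hmid : ∀ t ∈ Ico t₀ 1, f t ∈ Ioo (A t) (C t) := fun t ht => by
    have := (hg t (hsub ht)).1; constructor <;> simp only [hf] <;> linarith
  obtain ⟨g, hgc, hgρ⟩ := h.exists_continuousOn (ρ ⟨_, hO t₀ ⟨le_rfl, ht₀.2⟩⟩)
  set x : ℝ → M := fun t => κ.pt (u + t • w) (f t) with hx
  have hxc : ContinuousOn x (Ico t₀ 1) :=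
    κ.continuous_pt.comp_continuousOn (hcc.continuousOn.prodMk hfc)
  have hsc : ContinuousOn (fun t => g (x t)) (Ico t₀ 1) := hgc.comp hxc hO
  have hxf : ∀ t ∈ Ico t₀ 1, x t ∈ B.nbhd ∧ ι (g (x t)) ∈ B.fibre (x t) := fun t ht => by
    rw [hgρ _ (hO t ht)]; exact ⟨h.subset (hO t ht), h.ι_fibre (hO t ht)⟩
  have hlim : ∀ U : Ultrafilter ℝ, (U : Filter ℝ) ≤ 𝓝[<] 1 → ∃ e, Tendsto f U (𝓝 e) := by
    intro U hU
    have : Icc (-3) 3 ∈ U.map f := hU (by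
      filter_upwards [Ico_mem_nhdsLT ht₀.2] with t ht using ⟨(hfS t ht).ge, (hfS t ht).le⟩)
    obtain ⟨e, -, he⟩ := isCompact_Icc.ultrafilter_le_nhds (U.map f) (le_principal_iff.2 this)
    exact ⟨e, he⟩
  set U₀ : Ultrafilter ℝ := Ultrafilter.of (𝓝[<] 1)
  have hU₀ : (U₀ : Filter ℝ) ≤ 𝓝[<] 1 := Ultrafilter.of_le _
  obtain ⟨e₀, he₀⟩ := hlim U₀ hU₀
  set y := κ.pt (u + w) e₀ with hy
  have hfib : ∀ U : Ultrafilter ℝ, (U : Filter ℝ) ≤ 𝓝[<] 1 → ∀ z,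
      Tendsto (fun t => ι (g (x t))) U (𝓝 z) → z ∈ B.fibre y ∧ y ∈ B.nbhd := by
    intro U hU z hz
    obtain ⟨e, he⟩ := hlim U hU
    have hxl : Tendsto x U (𝓝 (κ.pt (u + w) e)) := (κ.continuous_pt.tendsto (u + w, e)).comp
      ((hc.mono_left hU).prodMk_nhds he)
    have hev : ∀ᶠ t in (U : Filter ℝ), x t ∈ B.nbhd ∧ ι (g (x t)) ∈ B.fibre (x t) :=
      hU (by filter_upwards [Ico_mem_nhdsLT ht₀.2] with t ht using hxf t ht)
    have h1 := fibre_of_tendsto hxl (hev.mono fun _ k => k.1) hz (hev.mono fun _ k => k.2)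
    have h2 : κ.pt (u + w) e ∈ B.nbhd :=
      isClosed_nbhd.mem_of_tendsto hxl (hev.mono fun _ k => k.1)
    have h3 := Column.fibre_of_ultrafilter ht₀.2 hfc hfS hU hU₀ he he₀
    exact ⟨by rwa [B.fibre_eq _ h2 _ h3], fibre_subset h2 h3⟩
  have hnb : ∀ U : Ultrafilter ℝ, (U : Filter ℝ) ≤ 𝓝[<] 1 →
      ∃ z, Tendsto (fun t => ι (g (x t))) U (𝓝 z) := by
    intro U hU
    have : B.nbhd ∈ U.map fun t => ι (g (x t)) := hU (by
      filter_upwards [Ico_mem_nhdsLT ht₀.2] with t ht using fibre_subset (hxf t ht).1 (hxf t ht).2)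
    obtain ⟨e, -, he⟩ := B.isCompact_nbhd.ultrafilter_le_nhds _ (le_principal_iff.2 this)
    exact ⟨e, he⟩
  obtain ⟨z₀, hz₀⟩ := hnb U₀ hU₀
  have hyN := (hfib U₀ hU₀ z₀ hz₀).2
  have hmax : ∀ t ∈ Ico (0 : ℝ) 1, max t t₀ ∈ Ico t₀ 1 := fun t ht =>
    ⟨le_max_right _ _, max_lt ht.2 ht₀.2⟩
  have heq : (fun t => g (x (max t t₀))) =ᶠ[𝓝[<] 1] fun t => g (x t) := by
    filter_upwards [Ico_mem_nhdsLT ht₀.2] with t ht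
    rw [max_eq_left ht.1]
  obtain ⟨s₁, hs₁⟩ := hcomp (fun t => g (x (max t t₀)))
    (hsc.comp (by fun_prop : Continuous fun t : ℝ => max t t₀).continuousOn hmax) y hyN (by
      refine Tendsto.congr' (heq.symm.fun_comp ι) ?_
      refine tendsto_iff_ultrafilter _ _ _ |>.2 fun U hU => ?_
      obtain ⟨z, hz⟩ := hnb U hU
      exact hz.trans (nhds_le_nhdsSet (hfib U hU z hz).1))
  replace hs₁ := hs₁.congr' heq
  have h1 : ι s₁ ∈ B.fibre y :=
    (hfib U₀ hU₀ _ ((h.continuous_ι.tendsto s₁).comp (hs₁.mono_left hU₀))).1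
  have hsrc := κ.fibre_source (κ.pt_mem _ _) hyN h1
  have hv : κ.v (ι s₁) = u + w := by rw [κ.fibre_v (κ.pt_mem _ _) hyN h1, κ.v_pt]
  obtain ⟨A₁, C₁, k1, k2, -⟩ := h.exists_gap hsrc (h.mem s₁)
  obtain ⟨A', C', k3, k4, k5⟩ := hE.tendsto h (l := 𝓝[<] 1) (x := x) hsrc (h.mem s₁) k1 k2
    (by filter_upwards [Ico_mem_nhdsLT ht₀.2] with t ht using ⟨κ.pt_mem _ _, hO t ht⟩) g hgρ
    (by rw [hgρ _ (h.mem s₁), (h.sect s₁).2]; exact hs₁)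
  refine ⟨A₁, C₁, hv ▸ k1, k3.congr' ?_, k4.congr' ?_⟩ <;>
    filter_upwards [k5, Ico_mem_nhdsLT ht₀.2] with t k6 ht <;>
    rw [hx, κ.v_pt, κ.z_pt] at k6
  · exact (k6.1.unique (hg t (hsub ht)) k6.2 (hmid t ht)).1
  · exact (k6.1.unique (hg t (hsub ht)) k6.2 (hmid t ht)).2

theorem exists_gapFamily (h : B.IsTube ι O ρ) (hE : ContinuousEnds B ι ρ)
    (hcomp : B.IsCompleteSurface ι) (κ : Column B) :
    ∃ (I : Type) (_ : Countable I) (a b : I → ℝ × ℝ → ℝ),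
      IsGapFamily (fun _ => -3) (fun _ => 3) a b ∧
      (∀ i x, IsGap (κ.solid O) x (a i x) (b i x)) ∧
      ∀ x A C, IsGap (κ.solid O) x A C → ∃ i, a i x = A ∧ b i x = C :=
  IsGap.exists_family (fun _ _ hx => ⟨(Column.mem_solid.1 hx).1.ge, (Column.mem_solid.1 hx).1.le⟩)
    (fun _ _ _ hg _ hm _ hV => h.eventually_gap hE hg hm hV)
    fun _ _ _ _ hA hC hg => h.exists_tendsto_gap hE hcomp hA hC hg

end IsTube

variable {M : Type u} [TopologicalSpace M] [T2Space M] {B : BranchedSurface M} {p : Set M}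

/-! ### The collapsing map -/

/-- A step of height two across a slot, if there is one. -/
noncomputable def slotStep (m : SlotMode) (l r T : ℝ) : ℝ :=
  open Classical in if m = .absent then 0 else 2 * ramp l r T

section slotStep
variable {m : SlotMode} {l r : ℝ} (h : m ≠ .absent → l < r)

theorem slotStep_mem (T : ℝ) : slotStep m l r T ∈ Icc (0 : ℝ) 2 := by
  have := ramp_mem l r T
  unfold slotStep
  split_ifs
  · simp
  · constructor <;> linarith [this.1, this.2]

include h

theorem slotStep_mono : Monotone (slotStep m l r) := fun T T' hT => by
  unfold slotStep
  split_ifs with hm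
  · exact le_rfl
  · linarith [ramp_mono (h hm) hT]

theorem slotStep_of_le {T : ℝ} (hT : T ≤ l) : slotStep m l r T = 0 := by
  unfold slotStep
  split_ifs with hm
  · rfl
  · rw [ramp_of_le (h hm) hT, mul_zero]

theorem slotStep_of_ge {T : ℝ} (hm : m ≠ .absent) (hT : r ≤ T) : slotStep m l r T = 2 := by
  rw [slotStep, if_neg hm, ramp_of_ge (h hm) hT, mul_one]

end slotStep

theorem continuousAt_slotStep {X : Type*} [TopologicalSpace X] {m : SlotMode} {l r T : X → ℝ}
    (hl : Continuous l) (hr : Continuous r) (hT : Continuous T) {x : X}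
    (h : m ≠ .absent → l x < r x) : ContinuousAt (fun x => slotStep m (l x) (r x) (T x)) x := by
  unfold slotStep
  split_ifs with hm
  · exact continuousAt_const
  · have := sub_ne_zero.2 (h hm).ne'
    unfold ramp
    fun_prop (disch := assumption)

theorem Column.S_uIcc_of {κ : Column B} {x : ℝ × ℝ} {z q : ℝ} (hz : κ.S x z) (hq : |q| ≤ 3)
    (h1 : κ.m.Active x.1 → (3 / 2 ≤ z → 3 / 2 ≤ q) ∧ (z ≤ 1 / 2 → q ≤ 1 / 2))
    (h2 : κ.n.Active x.2 → (-(1 / 2) ≤ z → -(1 / 2) ≤ q) ∧ (z ≤ -(3 / 2) → q ≤ -(3 / 2))) :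
    ∀ r ∈ uIcc z q, κ.S x r := by
  have aux : ∀ {l r t : ℝ}, ¬ (l < z ∧ z < r) → (r ≤ z → r ≤ q) → (z ≤ l → q ≤ l) →
      t ∈ uIcc z q → l < t → t < r → False := fun {l r t} k1 k2 k3 ht k4 k5 => by
    rw [not_and_or, not_lt, not_lt] at k1
    rcases k1 with k1 | k1
    · exact (ht.2.trans (max_le k1 (k3 k1))).not_gt k4
    · exact ((le_min k1 (k2 k1)).trans ht.1).not_gt k5
  intro r hr
  rw [S_iff] at hz ⊢
  refine ⟨abs_le.2 ⟨(le_min (abs_le.1 hz.1).1 (abs_le.1 hq).1).trans hr.1,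
    hr.2.trans (max_le (abs_le.1 hz.1).2 (abs_le.1 hq).2)⟩, fun k => ?_, fun k => ?_⟩
  · exact aux (fun h => hz.2.1 ⟨k.1, h⟩) (h1 k.1).1 (h1 k.1).2 hr k.2.1 k.2.2
  · exact aux (fun h => hz.2.2 ⟨k.1, h⟩) (h2 k.1).1 (h2 k.1).2 hr k.2.1 k.2.2

variable {S : Type u} [TopologicalSpace S] {ι : S → M} {O : Set M} {ρ : O → S} {κ : Column B}

namespace IsTube

theorem joined_iff_gap (h : B.IsTube ι O ρ) {y w w' : M} (hy : y ∈ κ.chart.source)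
    (hN : y ∈ B.nbhd) (hw : w ∈ B.fibre y) (hw' : w' ∈ B.fibre y) (hlt : κ.z w < κ.z w') :
    B.Joined O w w' ↔ ∀ A C, IsGap (κ.solid O) (κ.v y) A C → C ≤ κ.z w ∨ κ.z w' ≤ A := by
  rw [BranchedSurface.joined_iff hy hN hw hw', uIcc_of_le hlt.le]
  constructor
  · intro hj A C hg
    by_contra! hc
    obtain ⟨t, h1, h2⟩ := exists_between (max_lt (lt_min hlt hc.1) (lt_min hc.2 hg.1))
    rw [max_lt_iff] at h1
    rw [lt_min_iff] at h2
    have ht : κ.pt (κ.v y) t ∈ B.fibre y := κ.fibre_uIcc hy hN hw hw'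
      (by rw [uIcc_of_le hlt.le]; exact ⟨h1.1.le, h2.1.le⟩)
    have hO : κ.pt (κ.v y) t ∈ O := by
      by_contra hO
      exact hg.2.2.2 t ⟨h1.2, h2.2⟩ ⟨fibre_subset hN ht, hO⟩
    exact hj _ ⟨hO, ht⟩ (by simpa using ⟨h1.1.le, h2.1.le⟩)
  · rintro hg x ⟨hxO, hx⟩ hxz
    obtain ⟨A, C, h1, h2, -⟩ := h.exists_gap (κ.fibre_source hy hN hx) hxO
    rw [κ.fibre_v hy hN hx] at h1
    rcases hg A C h1 with k | k
    · linarith [hxz.1, h2.2]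
    · linarith [hxz.2, h2.1]

/-- In a column there is a monotone function of the height that is constant exactly on the
intervals that meet no gap. -/
theorem exists_height (h : B.IsTube ι O ρ) (hE : ContinuousEnds B ι ρ)
    (hcomp : B.IsCompleteSurface ι) (κ : Column B) :
    ∃ T : ℝ × ℝ → ℝ → ℝ, (Continuous fun q : (ℝ × ℝ) × ℝ => T q.1 q.2) ∧ (∀ x, Monotone (T x)) ∧
      (∀ x, ∀ z ∈ Icc (-3) 3, T x z ∈ Icc (0 : ℝ) 1) ∧
      ∀ x, ∀ z ∈ Icc (-3) 3, ∀ z' ∈ Icc (-3) 3, z < z' → (T x z = T x z' ↔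
        ∀ A C, IsGap (κ.solid O) x A C → C ≤ z ∨ z' ≤ A) := by
  obtain ⟨I, _, a, b, hf, hgap, hall⟩ := h.exists_gapFamily hE hcomp κ
  have := Encodable.ofCountable I
  obtain ⟨c, hc, e, hce, he⟩ := posSumOfEncodable zero_lt_one I
  have hs := hce.summable
  refine ⟨gapSum _ _ a b c, hf.continuous_gapSum hc hs, hf.gapSum_mono hc hs, fun x z hz => ?_,
    fun x z hz z' hz' hlt => ⟨fun heq A C hg => ?_, fun hg => ?_⟩⟩
  · have h1 : 0 ≤ ∑' i, c i * ramp (a i x) (b i x) z :=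
      tsum_nonneg fun i => mul_nonneg (hc i).le (ramp_mem _ _ _).1
    have h2 : ∑' i, c i * ramp (a i x) (b i x) z ≤ ∑' i, c i :=
      (hf.summable hc hs x z).tsum_le_tsum
        (fun i => mul_le_of_le_one_right (hc i).le (ramp_mem _ _ _).2) hs
    rw [hce.tsum_eq] at h2
    rw [gapSum, min_eq_right (by linarith [hz.1]), max_eq_right (by linarith [hz.2])]
    constructor <;> linarith
  · obtain ⟨i, rfl, rfl⟩ := hall x A C hg
    by_contra! k
    exact (hf.gapSum_lt hc hs hlt (.inr (.inr ⟨i, k⟩))).ne heq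
  · exact hf.gapSum_eq hz.1 hlt.le hz'.2 fun i hi => (hg _ _ (hgap i x)).resolve_left hi.not_ge

theorem exists_local_collapse (h : B.IsTube ι O ρ) (hE : ContinuousEnds B ι ρ)
    (hcomp : B.IsCompleteSurface ι) (κ : Column B) :
    ∃ r > 0, ∃ f : M → M, ∀ y ∈ κ.chart.source, y ∈ B.nbhd → ‖κ.v y‖ < r →
      ContinuousAt f y ∧ ∀ w ∈ B.fibre y, f w ∈ B.fibre y ∧ ∀ w' ∈ B.fibre y,
        (κ.z w ≤ κ.z w' → κ.z (f w) ≤ κ.z (f w')) ∧ (f w = f w' ↔ w = w' ∨ B.Joined O w w') := by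
  obtain ⟨T, hTc, hTm, hT1, hTg⟩ := h.exists_height hE hcomp κ
  have hTx : ∀ z, Continuous fun x => T x z := fun z =>
    hTc.comp (by fun_prop : Continuous fun x : ℝ × ℝ => (x, z))
  have hslot : ∀ {l r : ℝ}, -3 ≤ l → r ≤ 3 → κ.Slot 0 l r → T 0 l < T 0 r := fun {l r} hl hr hs => by
    have hg := h.isGap_of_slot hs
    refine lt_of_le_of_ne (hTm 0 hg.1.le) fun heq => ?_
    have := (hTg 0 l ⟨hl, hg.1.le.trans hr⟩ r ⟨hl.trans hg.1.le, hr⟩ hg.1).1 heq l r hg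
    linarith [hg.1, this.elim id id]
  have hmode : ∀ {m : SlotMode}, m ≠ .absent → m.Closed 0 := fun {m} hm => by
    cases m
    exacts [hm rfl, trivial, le_rfl]
  have hev : ∀ᶠ x in 𝓝 (0 : ℝ × ℝ), (κ.m ≠ .absent → T x (1 / 2) < T x (3 / 2)) ∧
      (κ.n ≠ .absent → -T x (-(1 / 2)) < -T x (-(3 / 2))) := by
    refine Eventually.and ?_ ?_
    · by_cases hm : κ.m = .absent
      · exact .of_forall fun x k => absurd hm k
      · filter_upwards [(hTx _).continuousAt.eventually_lt (hTx _).continuousAt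
          (hslot (by norm_num) (by norm_num) (.inl ⟨hmode hm, rfl, rfl⟩))] with x hx _ using hx
    · by_cases hm : κ.n = .absent
      · exact .of_forall fun x k => absurd hm k
      · filter_upwards [(hTx _).continuousAt.eventually_lt (hTx _).continuousAt
          (hslot (by norm_num) (by norm_num) (.inr ⟨hmode hm, rfl, rfl⟩))] with x hx _
          using neg_lt_neg hx
  obtain ⟨r, hr, hr'⟩ := Metric.eventually_nhds_iff.1 hev
  set Q : ℝ × ℝ → ℝ → ℝ := fun x z => T x z / 4 +
    slotStep κ.m (T x (1 / 2)) (T x (3 / 2)) (T x z) -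
    slotStep κ.n (-T x (-(1 / 2))) (-T x (-(3 / 2))) (-T x z) with hQ
  refine ⟨r, hr, fun y => κ.pt (κ.v y) (Q (κ.v y) (κ.z y)), fun y hy hN hyr => ?_⟩
  obtain ⟨hm, hn⟩ := hr' (y := κ.v y) (by simpa using hyr)
  set x := κ.v y with hx
  have hlt : ∀ {z z'}, T x z < T x z' → Q x z < Q x z' := fun {z z'} k => by
    have h1 := slotStep_mono hm k.le
    have h2 := slotStep_mono hn (neg_le_neg k.le)
    simp only [hQ]; linarith
  have heq : ∀ {z z'}, T x z = T x z' → Q x z = Q x z' := fun {z z'} k => by simp only [hQ, k]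
  have hIcc : ∀ w ∈ B.fibre y, κ.z w ∈ Icc (-3) 3 := fun w hw =>
    ⟨(κ.fibre_S hy hN hw).ge, (κ.fibre_S hy hN hw).le⟩
  refine ⟨?_, fun w hw => ⟨?_, fun w' hw' => ?_⟩⟩
  · have hv := κ.continuousAt_v hy
    have hz := κ.continuousAt_z hy
    have hQc : ContinuousAt (fun q : (ℝ × ℝ) × ℝ => Q q.1 q.2) (x, κ.z y) := by
      have k : ∀ z, Continuous fun q : (ℝ × ℝ) × ℝ => T q.1 z := fun z => (hTx z).comp continuous_fst
      exact ((hTc.div_const 4).continuousAt.add (continuousAt_slotStep (k _) (k _) hTc hm)).sub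
        (continuousAt_slotStep (k _).neg (k _).neg hTc.neg hn)
    exact (κ.continuous_pt.tendsto (x, Q x (κ.z y))).comp
      (hv.tendsto.prodMk_nhds (hQc.tendsto.comp (hv.tendsto.prodMk_nhds hz)))
  · have e := B.fibre_eq _ hN _ hw
    beta_reduce
    rw [κ.fibre_v hy hN hw, ← e]
    have hws := κ.fibre_source hy hN hw
    have hS := κ.fibre_S hy hN hw
    have e' : κ.pt x (κ.z w) = w := by rw [hx, ← κ.fibre_v hy hN hw, κ.pt_v_z hws]
    rw [show B.fibre w = B.fibre (κ.pt x (κ.z w)) by rw [e'], Column.pt_mem_fibre hS]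
    have h1 := hT1 x _ (hIcc w hw)
    have h2 := slotStep_mem (m := κ.m) (l := T x (1 / 2)) (r := T x (3 / 2)) (T x (κ.z w))
    have h3 := slotStep_mem (m := κ.n) (l := -T x (-(1 / 2))) (r := -T x (-(3 / 2))) (-T x (κ.z w))
    refine Column.S_uIcc_of hS (abs_le.2 ⟨?_, ?_⟩) (fun k => ?_) fun k => ?_
    · simp only [hQ]; linarith [h1.1, h2.1, h3.2]
    · simp only [hQ]; linarith [h1.2, h2.2, h3.1]
    · have hm' : κ.m ≠ .absent := fun e => by rw [e] at k; exact k
      refine ⟨fun hz => ?_, fun hz => ?_⟩ <;> simp only [hQ]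
      · rw [slotStep_of_ge hm hm' (hTm x hz), slotStep_of_le hn (neg_le_neg (hTm x (by linarith)))]
        linarith [h1.1]
      · rw [slotStep_of_le hm (hTm x hz)]
        linarith [h1.2, h3.1]
    · have hn' : κ.n ≠ .absent := fun e => by rw [e] at k; exact k
      refine ⟨fun hz => ?_, fun hz => ?_⟩ <;> simp only [hQ]
      · rw [slotStep_of_le hn (neg_le_neg (hTm x hz))]
        linarith [h1.1, h2.1]
      · rw [slotStep_of_ge hn hn' (neg_le_neg (hTm x hz)), slotStep_of_le hm (hTm x (by linarith))]
        linarith [h1.2]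
  · beta_reduce
    rw [κ.z_pt, κ.z_pt, κ.fibre_v hy hN hw, κ.fibre_v hy hN hw']
    refine ⟨fun k => ?_, ?_⟩
    · rcases (hTm x k).lt_or_eq with k | k
      exacts [(hlt k).le, (heq k).le]
    · have h1 : κ.pt x (Q x (κ.z w)) = κ.pt x (Q x (κ.z w')) ↔ T x (κ.z w) = T x (κ.z w') := by
        refine ⟨fun k => ?_, fun k => by rw [heq k]⟩
        have k := congrArg κ.z k
        rw [κ.z_pt, κ.z_pt] at k
        by_contra hne
        rcases lt_or_gt_of_ne hne with k' | k'
        exacts [(hlt k').ne k, (hlt k').ne' k]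
      have hinj := (κ.isCoordinate_z hy hN).2
      rw [h1]
      rcases lt_trichotomy (κ.z w) (κ.z w') with k | k | k
      · rw [hTg x _ (hIcc w hw) _ (hIcc w' hw') k, ← h.joined_iff_gap hy hN hw hw' k,
          or_iff_right fun e => k.ne (congrArg κ.z e)]
      · exact iff_of_true (by rw [k]) (.inl (hinj hw hw' k))
      · rw [eq_comm, hTg x _ (hIcc w' hw') _ (hIcc w hw) k, ← h.joined_iff_gap hy hN hw' hw k,
          or_iff_right fun e => k.ne' (congrArg κ.z e)]
        have e := B.fibre_eq _ hN _ hw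
        have e' := B.fibre_eq _ hN _ hw'
        exact ⟨fun j => j.symm (fibre_subset hN hw') (e' ▸ hw),
          fun j => j.symm (fibre_subset hN hw) (e ▸ hw')⟩

end IsTube

/-- `q` collapses the components of the complement of `O` in the fibres. -/
def CollapsesFibres (B : BranchedSurface M) (O : Set M) (q : M → M) : Prop :=
  ContinuousOn q B.nbhd ∧ ∀ y ∈ B.nbhd, q y ∈ B.fibre y ∧ ∀ z ∈ B.fibre y,
    (q y = q z ↔ y = z ∨ Disjoint (B.seg y z) O) ∧
    ∀ c, IsCoordinate (B.fibre y) c → c y ≤ c z → c (q y) ≤ c (q z)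

variable {S : Type u} [TopologicalSpace S] {ι : S → M} {O : Set M} {ρ : O → S} {κ : Column B}
  {q : M → M}

theorem IsTube.exists_collapsesFibres (h : B.IsTube ι O ρ) (hE : ContinuousEnds B ι ρ)
    (hcomp : B.IsCompleteSurface ι) (D : FibreMetric B) : ∃ q, B.CollapsesFibres O q := by
  choose κ hκs hκv using fun y : B.nbhd => exists_column B y.2
  choose r hr f hf using fun y : B.nbhd => h.exists_local_collapse hE hcomp (κ y)
  obtain ⟨s, wt, wc, w0, w1, wf, wne⟩ := B.exists_partition κ r fun y => ⟨hr y, hκs y, hκv y⟩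
  have hf' : ∀ i, ∀ y ∈ B.nbhd, wt i y ≠ 0 → _ := fun i y hy k =>
    hf i y (wne i y hy k).1 hy (wne i y hy k).2
  set q : M → M := fun y => D.bary s y (fun i => wt i y) (fun i => f i y) with hq
  have hx : ∀ y ∈ B.nbhd, ∀ i ∈ s, wt i y ≠ 0 → f i y ∈ B.fibre y := fun y hy i _ k =>
    ((hf' i y hy k).2 y (self_mem_fibre hy)).1
  have hmem : ∀ y ∈ B.nbhd, q y ∈ B.fibre y := fun y hy =>
    (D.bary_spec hy (fun i _ => w0 i y hy) (w1 y hy) (hx y hy)).1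
  have hcoord : ∀ y ∈ B.nbhd, ∀ c : M → ℝ, B.IsIsometric D.d y c → ∀ w ∈ B.fibre y,
      c (q w) = ∑ i ∈ s, wt i y * c (f i w) := fun y hy c hc w hw => by
    have hwN := fibre_subset hy hw
    have hc' : B.IsIsometric D.d w c := by rw [IsIsometric, B.fibre_eq _ hy _ hw]; exact hc
    rw [D.coord_bary hwN hc' (fun i _ => w0 i w hwN) (w1 w hwN) (hx w hwN)]
    exact Finset.sum_congr rfl fun i _ => by rw [wf i y hy w hw]
  have hterm : ∀ y ∈ B.nbhd, ∀ c : M → ℝ, B.IsIsometric D.d y c → ∀ w ∈ B.fibre y,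
      ∀ w' ∈ B.fibre y, c w ≤ c w' → ∀ i ∈ s, wt i y * c (f i w) ≤ wt i y * c (f i w') := by
    intro y hy c hc w hw w' hw' hle i _
    by_cases k : wt i y = 0
    · simp [k]
    · have hi := (hf' i y hy k).2
      refine mul_le_mul_of_nonneg_left ?_ (w0 i y hy)
      rcases (κ i).coordinate_iff (wne i y hy k).1 hy hc.1 with e | e
      · exact (e _ (hi w hw).1 _ (hi w' hw').1).2 (((hi w hw).2 w' hw').1 ((e _ hw _ hw').1 hle))
      · exact (e _ (hi w hw).1 _ (hi w' hw').1).2 (((hi w' hw').2 w hw).1 ((e _ hw _ hw').1 hle))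
  have hmono : B.FibreMono B.nbhd q := by
    refine fibreMono_of_height subset_rfl hmem fun y hy z hz κ' hκ' hle => ?_
    obtain ⟨c, hc, hcz⟩ := D.exists_coord hκ' hy
    have hcz' : ∀ w ∈ B.fibre y, ∀ w' ∈ B.fibre y, c w ≤ c w' ↔ κ'.z w ≤ κ'.z w' :=
      fun w hw w' hw' => by rw [← not_lt, hcz _ hw' _ hw, not_lt]
    have hy' := self_mem_fibre hy
    rw [← hcz' _ (hmem y hy) _ (B.fibre_eq _ hy _ hz.2 ▸ hmem z hz.1), hcoord y hy c hc y hy',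
      hcoord y hy c hc z hz.2]
    exact Finset.sum_le_sum (hterm y hy c hc y hy' z hz.2 ((hcz' _ hy' _ hz.2).2 hle))
  refine ⟨q, fun y₀ hy₀ => ?_, fun y hy => ⟨hmem y hy, fun z hz => ⟨?_, (hmono y hy).2 z
    ⟨fibre_subset hy hz, hz⟩⟩⟩⟩
  · refine FibreMetric.tendsto_bary hy₀ (tendsto_id.mono_left nhdsWithin_le_nhds)
      eventually_mem_nhdsWithin (eventually_nhdsWithin_of_forall fun y hy i _ => w0 i y hy)
      (eventually_nhdsWithin_of_forall w1) (eventually_nhdsWithin_of_forall hx)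
      (fun i _ => wc i y₀ hy₀) (fun i _ => w0 i y₀ hy₀) (w1 y₀ hy₀) (hx y₀ hy₀) fun i _ k =>
      (hf' i y₀ hy₀ k).1.tendsto.mono_left nhdsWithin_le_nhds
  · obtain ⟨c, hc⟩ := D.coord y hy
    have hy' := self_mem_fibre hy
    have h1 : q y = q z ↔ ∀ i ∈ s, wt i y * c (f i y) = wt i y * c (f i z) := by
      rw [← hc.1.2.eq_iff (hmem y hy) (B.fibre_eq _ hy _ hz ▸ hmem z (fibre_subset hy hz)),
        hcoord y hy c hc y hy', hcoord y hy c hc z hz]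
      rcases le_total (c y) (c z) with k | k
      · exact Finset.sum_eq_sum_iff_of_le (hterm y hy c hc y hy' z hz k)
      · simp only [eq_comm (a := ∑ i ∈ s, wt i y * c (f i y)), Finset.sum_eq_sum_iff_of_le
          (hterm y hy c hc z hz y hy' k), eq_comm]
    rw [h1]
    refine ⟨fun k => ?_, fun k i _ => ?_⟩
    · obtain ⟨i, hi, hne⟩ := Finset.exists_ne_zero_of_sum_ne_zero ((w1 y hy).trans_ne one_ne_zero)
      have hfi := (hf' i y hy hne).2
      exact ((hfi y hy').2 z hz).2.1
        (hc.1.2 (hfi y hy').1 (hfi z hz).1 (mul_left_cancel₀ hne (k i hi)))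
    · by_cases hne : wt i y = 0
      · simp [hne]
      · rw [(((hf' i y hy hne).2 y hy').2 z hz).2.2 k]

/-! ### The lamination of a splitting surface -/

/-- The height of the image of a point of the column. -/
noncomputable def Column.imageHeight (κ : Column B) (q : M → M) (x : ℝ × ℝ) (z : ℝ) : ℝ :=
  κ.z (q (κ.pt x z))

namespace CollapsesFibres

theorem pt_imageHeight (hq : B.CollapsesFibres O q) {x : ℝ × ℝ} {z : ℝ} (hz : κ.S x z) :
    κ.pt x (κ.imageHeight q x z) = q (κ.pt x z) := by
  have hN := Column.pt_mem_nbhd_iff.2 hz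
  have hs := κ.pt_mem x z
  have h1 := (hq.2 _ hN).1
  conv_rhs => rw [← κ.pt_v_z (κ.fibre_source hs hN h1), κ.fibre_v hs hN h1, κ.v_pt]
  rfl

theorem continuous_imageHeight (hq : B.CollapsesFibres O q) {X : Type*} [TopologicalSpace X]
    {T : Set X} {g : X → ℝ × ℝ} {f : X → ℝ} (hg : ContinuousOn g T) (hf : ContinuousOn f T)
    (hS : ∀ x ∈ T, κ.S (g x) (f x)) : ContinuousOn (fun x => κ.imageHeight q (g x) (f x)) T := by
  have h1 : ContinuousOn (fun x => q (κ.pt (g x) (f x))) T :=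
    hq.1.comp (κ.continuous_pt.comp_continuousOn (hg.prodMk hf))
      fun x hx => Column.pt_mem_nbhd_iff.2 (hS x hx)
  intro x hx
  have hN := Column.pt_mem_nbhd_iff.2 (hS x hx)
  have h2 := κ.continuousAt_z (κ.fibre_source (κ.pt_mem _ _) hN (hq.2 _ hN).1)
  exact h2.tendsto.comp (h1 x hx)

theorem imageHeight_le (hq : B.CollapsesFibres O q) (h : B.IsTube ι O ρ) {x : ℝ × ℝ} {z z' : ℝ}
    (hz : κ.S x z) (hz' : κ.S x z') (hlt : z < z') :
    κ.imageHeight q x z ≤ κ.imageHeight q x z' ∧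
      (κ.imageHeight q x z = κ.imageHeight q x z' ↔
        ∀ A C, IsGap (κ.solid O) x A C → C ≤ z ∨ z' ≤ A) := by
  have hs := κ.pt_mem x z
  have hN := Column.pt_mem_nbhd_iff.2 hz
  have hN' := Column.pt_mem_nbhd_iff.2 hz'
  by_cases hf : ∀ r ∈ uIcc z z', κ.S x r
  · have hw := (Column.pt_mem_fibre hz).2 hf
    have hm : B.FibreMono B.nbhd q := fun y hy => ⟨(hq.2 y hy).1, fun z hz => ((hq.2 y hy).2 z hz.2).2⟩
    refine ⟨hm.height subset_rfl hs hN ⟨hN', hw⟩ (by simpa using hlt.le), ?_⟩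
    have h1 := h.joined_iff_gap hs hN (self_mem_fibre hN) hw (by simpa using hlt)
    have h2 := ((hq.2 _ hN).2 _ hw).1
    rw [κ.v_pt, κ.z_pt, κ.z_pt] at h1
    rw [or_iff_right fun e => hlt.ne (by simpa using congrArg κ.z e)] at h2
    rw [← h1, BranchedSurface.Joined, ← h2]
    refine ⟨fun e => ?_, congrArg κ.z⟩
    rw [← hq.pt_imageHeight hz, ← hq.pt_imageHeight hz', e]
  · push Not at hf
    obtain ⟨r, hr, hrS⟩ := hf
    rw [uIcc_of_le hlt.le] at hr
    have k1 : ∀ t, κ.S x t → r ∉ uIcc t (κ.imageHeight q x t) := fun t ht hrt => by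
      have h1 := (hq.2 _ (Column.pt_mem_nbhd_iff.2 ht)).1
      rw [← hq.pt_imageHeight ht, Column.pt_mem_fibre ht] at h1
      exact hrS (h1 r hrt)
    have hzr : z < r := lt_of_le_of_ne hr.1 fun e => hrS (e ▸ hz)
    have hrz : r < z' := lt_of_le_of_ne hr.2 fun e => hrS (e ▸ hz')
    have h1 : κ.imageHeight q x z < r := by
      by_contra! k
      exact k1 z hz (by rw [uIcc_of_le (hzr.le.trans k)]; exact ⟨hzr.le, k⟩)
    have h2 : r < κ.imageHeight q x z' := by
      by_contra! k
      exact k1 z' hz' (by rw [uIcc_of_ge (k.trans hrz.le)]; exact ⟨k, hrz.le⟩)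
    refine ⟨(h1.trans h2).le, iff_of_false (h1.trans h2).ne fun k => ?_⟩
    obtain ⟨A, C, hg, hrg⟩ := IsGap.exists_of_notMem (h.isClosed_solid κ) (h.solid_end x).1
      (h.solid_end x).2 ⟨hz.ge.trans hzr.le, hrz.le.trans hz'.le⟩
      fun hK => hrS (Column.mem_solid.1 hK).1
    rcases k A C hg with k | k
    · linarith [hrg.2]
    · linarith [hrg.1]

theorem imageHeight_mono (hq : B.CollapsesFibres O q) (h : B.IsTube ι O ρ) {x : ℝ × ℝ} {z z' : ℝ}
    (hz : κ.S x z) (hz' : κ.S x z') (hle : z ≤ z') :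
    κ.imageHeight q x z ≤ κ.imageHeight q x z' := by
  rcases hle.lt_or_eq with k | rfl
  exacts [(hq.imageHeight_le h hz hz' k).1, le_rfl]

theorem pt_mem_image_iff (hq : B.CollapsesFibres O q) {x : ℝ × ℝ} {z : ℝ} :
    κ.pt x z ∈ q '' (B.nbhd \ O) ↔ ∃ t, (x, t) ∈ κ.solid O ∧ κ.imageHeight q x t = z := by
  constructor
  · rintro ⟨y, hy, e⟩
    have h1 := mem_fibre_symm hy.1 (e ▸ (hq.2 y hy.1).1)
    have hN : κ.pt x z ∈ B.nbhd := e ▸ fibre_subset hy.1 (hq.2 y hy.1).1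
    have hys := κ.fibre_source (κ.pt_mem _ _) hN h1
    have hyv : κ.v y = x := by rw [κ.fibre_v (κ.pt_mem _ _) hN h1, κ.v_pt]
    refine ⟨κ.z y, by rwa [← hyv, Column.mem_solid_of hys], ?_⟩
    rw [Column.imageHeight, ← hyv, κ.pt_v_z hys, e, κ.z_pt]
  · rintro ⟨t, ht, rfl⟩
    exact ⟨κ.pt x t, ht, (hq.pt_imageHeight (Column.mem_solid.1 ht).1).symm⟩

variable {I : Type} {a b : I → ℝ × ℝ → ℝ}

/-- The gaps of the image of the complement of `O`. -/
theorem isGapFamily (hq : B.CollapsesFibres O q) (h : B.IsTube ι O ρ)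
    (hf : IsGapFamily (fun _ => -3) (fun _ => 3) a b)
    (hg : ∀ i x, IsGap (κ.solid O) x (a i x) (b i x)) :
    IsGapFamily (fun x => κ.imageHeight q x (-3)) (fun x => κ.imageHeight q x 3)
      (fun i x => κ.imageHeight q x (a i x)) (fun i x => κ.imageHeight q x (b i x)) := by
  have hS : ∀ {x t}, (x, t) ∈ κ.solid O → κ.S x t := fun k => (Column.mem_solid.1 k).1
  have hl := fun x => hS (h.solid_end (κ := κ) x).1
  have hr := fun x => hS (h.solid_end (κ := κ) x).2
  have ha := fun i x => hS (hg i x).2.1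
  have hb := fun i x => hS (hg i x).2.2.1
  have hc : ∀ {f : ℝ × ℝ → ℝ}, Continuous f → (∀ x, κ.S x (f x)) →
      Continuous fun x => κ.imageHeight q x (f x) := fun k k' => continuousOn_univ.1
    (hq.continuous_imageHeight continuousOn_id k.continuousOn fun x _ => k' x)
  refine ⟨hc continuous_const hl, hc continuous_const hr, fun i => hc (hf.continuous_left i) (ha i),
    fun i => hc (hf.continuous_right i) (hb i), fun x => hq.imageHeight_mono h (hl x) (hr x)
    (by norm_num), fun i x => ?_, fun i x => hq.imageHeight_mono h (hl x) (ha i x) (hf.lo_le i x),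
    fun i x => hq.imageHeight_mono h (hb i x) (hr x) (hf.le_hi i x), fun i j hij =>
    (hf.order i j hij).imp (fun k x => hq.imageHeight_mono h (hb i x) (ha j x) (k x))
    fun k x => hq.imageHeight_mono h (hb j x) (ha i x) (k x)⟩
  obtain ⟨h1, h2⟩ := hq.imageHeight_le h (ha i x) (hb i x) (hg i x).1
  refine lt_of_le_of_ne h1 fun e => ?_
  have := h2.1 e _ _ (hg i x)
  linarith [(hg i x).1, this.elim id id]

theorem mem_image_iff_offGaps (hq : B.CollapsesFibres O q) (h : B.IsTube ι O ρ)
    (hg : ∀ i x, IsGap (κ.solid O) x (a i x) (b i x))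
    (hall : ∀ x A C, IsGap (κ.solid O) x A C → ∃ i, a i x = A ∧ b i x = C) {x : ℝ × ℝ} {z : ℝ} :
    κ.pt x z ∈ q '' (B.nbhd \ O) ↔
      OffGaps (fun x => κ.imageHeight q x (-3)) (fun x => κ.imageHeight q x 3)
        (fun i x => κ.imageHeight q x (a i x)) (fun i x => κ.imageHeight q x (b i x)) x z := by
  have hS : ∀ {t}, (x, t) ∈ κ.solid O → κ.S x t := fun k => (Column.mem_solid.1 k).1
  obtain ⟨hl, hr⟩ := h.solid_end (κ := κ) x
  rw [hq.pt_mem_image_iff]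
  constructor
  · rintro ⟨t, ht, rfl⟩
    refine ⟨⟨hq.imageHeight_mono h (hS hl) (hS ht) (hS ht).ge,
      hq.imageHeight_mono h (hS ht) (hS hr) (hS ht).le⟩, fun i => ?_⟩
    obtain ⟨-, h2, h3, h4⟩ := hg i x
    rcases le_or_gt t (a i x) with k | k
    · exact .inl (hq.imageHeight_mono h (hS ht) (hS h2) k)
    · exact .inr (hq.imageHeight_mono h (hS h3) (hS ht) (not_lt.1 fun k' => h4 t ⟨k, k'⟩ ht))
  · rintro ⟨⟨h1, h2⟩, h3⟩
    set K : Set ℝ := {t | (x, t) ∈ κ.solid O} with hK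
    have hKc : IsCompact K := isCompact_Icc.of_isClosed_subset ((h.isClosed_solid κ).preimage
      (by fun_prop : Continuous fun t : ℝ => (x, t))) fun t ht => ⟨(hS ht).ge, (hS ht).le⟩
    have hu : ContinuousOn (κ.imageHeight q x) K :=
      hq.continuous_imageHeight continuousOn_const continuousOn_id fun t ht => hS ht
    have k1 : IsCompact (K ∩ κ.imageHeight q x ⁻¹' Iic z) :=
      hKc.of_isClosed_subset (hu.preimage_isClosed_of_isClosed hKc.isClosed isClosed_Iic)
        inter_subset_left
    have k2 : IsCompact (K ∩ κ.imageHeight q x ⁻¹' Ici z) :=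
      hKc.of_isClosed_subset (hu.preimage_isClosed_of_isClosed hKc.isClosed isClosed_Ici)
        inter_subset_left
    obtain ⟨t, ht, htm⟩ := k1.exists_isGreatest ⟨-3, hl, h1⟩
    obtain ⟨t', ht', htm'⟩ := k2.exists_isLeast ⟨3, hr, h2⟩
    by_contra! hn
    have e1 : κ.imageHeight q x t < z := lt_of_le_of_ne ht.2 (hn t ht.1)
    have e2 : z < κ.imageHeight q x t' := lt_of_le_of_ne ht'.2 (hn t' ht'.1).symm
    have e3 : t < t' := not_le.1 fun k =>
      ((e1.trans e2).trans_le (hq.imageHeight_mono h (hS ht'.1) (hS ht.1) k)).false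
    obtain ⟨i, hi, hi'⟩ := hall x t t' ⟨e3, ht.1, ht'.1, fun s hs hsK => by
      rcases le_total (κ.imageHeight q x s) z with k | k
      · exact hs.1.not_ge (htm ⟨hsK, k⟩)
      · exact hs.2.not_ge (htm' ⟨hsK, k⟩)⟩
    rcases h3 i with k | k
    · exact (hi ▸ e1).not_ge k
    · exact (hi' ▸ e2).not_ge k

/-- The image of the complement of `O` contains no vertical segment. -/
theorem exists_notMem_image (hq : B.CollapsesFibres O q) (h : B.IsTube ι O ρ) {x : ℝ × ℝ}
    {z z' : ℝ} (hlt : z < z') : ∃ w ∈ Icc z z', κ.pt x w ∉ q '' (B.nbhd \ O) := by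
  by_contra! hc
  have hS : ∀ {t}, (x, t) ∈ κ.solid O → κ.S x t := fun k => (Column.mem_solid.1 k).1
  obtain ⟨t, ht, rfl⟩ := hq.pt_mem_image_iff.1 (hc z ⟨le_rfl, hlt.le⟩)
  obtain ⟨t', ht', rfl⟩ := hq.pt_mem_image_iff.1 (hc z' ⟨hlt.le, le_rfl⟩)
  have htt : t < t' := not_le.1 fun k => (hq.imageHeight_mono h (hS ht') (hS ht) k).not_gt hlt
  have h1 := mt (hq.imageHeight_le h (hS ht) (hS ht') htt).2.2 hlt.ne
  push Not at h1
  obtain ⟨A, C, hg, h2, h3⟩ := h1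
  have h4 : t ≤ A := not_lt.1 fun k => hg.2.2.2 t ⟨k, h2⟩ ht
  have h5 : C ≤ t' := not_lt.1 fun k => hg.2.2.2 t' ⟨h3, k⟩ ht'
  have h6 := hq.imageHeight_mono h (hS ht) (hS hg.2.1) h4
  have h7 := hq.imageHeight_mono h (hS hg.2.2.1) (hS ht') h5
  obtain ⟨h8, h9⟩ := hq.imageHeight_le h (hS hg.2.1) (hS hg.2.2.1) hg.1
  have h10 : κ.imageHeight q x A < κ.imageHeight q x C := lt_of_le_of_ne h8 fun e => by
    have := h9.1 e A C hg
    linarith [hg.1, this.elim id id]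
  obtain ⟨w, hw, hw'⟩ := exists_between h10
  obtain ⟨s, hs, rfl⟩ := hq.pt_mem_image_iff.1 (hc w ⟨h6.trans hw.le, hw'.le.trans h7⟩)
  refine hg.2.2.2 s ⟨not_le.1 fun k => ?_, not_le.1 fun k => ?_⟩ hs
  · exact (hq.imageHeight_mono h (hS hs) (hS hg.2.1) k).not_gt hw
  · exact (hq.imageHeight_mono h (hS hg.2.2.1) (hS hs) k).not_gt hw'

/-- A column carries a foliated chart of the image of the complement of `O`. -/
theorem exists_chart (hq : B.CollapsesFibres O q) (h : B.IsTube ι O ρ) (hE : ContinuousEnds B ι ρ)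
    (hcomp : B.IsCompleteSurface ι) (κ : Column B) :
    ∃ φ : OpenPartialHomeomorph M Space3, (∀ y ∈ κ.chart.source, y ∈ φ.source) ∧ B.IsVertical φ ∧
      IsProductChart (q '' (B.nbhd \ O)) φ := by
  obtain ⟨I, _, a, b, hf, hg, hall⟩ := h.exists_gapFamily hE hcomp κ
  have := Encodable.ofCountable I
  obtain ⟨c, hc, e, hce, -⟩ := posSumOfEncodable zero_lt_one I
  have hs := hce.summable
  have hL := hq.isGapFamily h hf hg
  have hoff := fun {x z} => hq.mem_image_iff_offGaps h hg hall (x := x) (z := z)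
  set T := gapSum (fun x => κ.imageHeight q x (-3)) (fun x => κ.imageHeight q x 3)
    (fun i x => κ.imageHeight q x (a i x)) (fun i x => κ.imageHeight q x (b i x)) c with hT
  have hTc : Continuous fun q : (ℝ × ℝ) × ℝ => T q.1 q.2 := hL.continuous_gapSum hc hs
  have hTm : ∀ x, StrictMono (T x) := fun x z z' hzz => by
    obtain ⟨w, hw, hwL⟩ := hq.exists_notMem_image h (x := x) (κ := κ) hzz
    refine hL.gapSum_lt hc hs hzz ?_
    by_contra! k
    refine hwL (hoff.2 ⟨⟨k.1.trans hw.1, hw.2.trans k.2.1⟩, fun i => ?_⟩)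
    rcases lt_or_ge z (κ.imageHeight q x (b i x)) with k' | k'
    exacts [.inl (hw.2.trans (k.2.2 i k')), .inr (k'.trans hw.1)]
  set Ξ : Space3 ≃ₜ Space3 := fibredHomeomorph T hTc hTm (hL.surjective_gapSum hc hs) with hΞ
  set φ := reparam κ.chart IsOpenEmbedding.id Ξ with hφ
  have hsrc : ∀ y, y ∈ φ.source ↔ y ∈ κ.chart.source := fun y => by
    rw [hφ, mem_reparam_source]; simp
  have happ : ∀ y ∈ φ.source, φ y = (κ.v y, T (κ.v y) (κ.z y)) := fun y hy => by
    have h1 : κ.chart y = Ξ.symm (φ y) := apply_eq_reparam hy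
    rw [← Ξ.apply_symm_apply (φ y), ← h1]
    rfl
  refine ⟨φ, fun y hy => (hsrc y).2 hy, κ.fibreChart.1.reparam fun _ => rfl,
    reparam_target κ.target_eq, T 0 '' {z | κ.pt 0 z ∈ q '' (B.nbhd \ O)}, ?_, fun y hy => ?_⟩
  · refine (IsCompact.image ?_ (hTc.comp (by fun_prop : Continuous fun z : ℝ =>
      ((0 : ℝ × ℝ), z)))).isClosed
    refine isCompact_Icc.of_isClosed_subset (IsClosed.preimage (κ.continuous_pt_right 0)
      (h.isCompact_sdiff.image_of_continuousOn (hq.1.mono Set.sdiff_subset)).isClosed)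
      fun z hz => (hoff.1 hz).1
  · rw [happ y hy, ← κ.pt_v_z ((hsrc y).1 hy), hoff, κ.v_pt, κ.z_pt]
    constructor
    · intro hy
      obtain ⟨z, hz, e⟩ := hL.exists_off (c := c) hy 0
      exact ⟨z, hoff.2 hz, e⟩
    · rintro ⟨z, hz, e⟩
      obtain ⟨z', hz', e'⟩ := hL.exists_off (c := c) (hoff.1 hz) (κ.v y)
      rwa [← (hTm _).injective (e'.trans e)]

theorem image_subset (hq : B.CollapsesFibres O q) : q '' (B.nbhd \ O) ⊆ B.nbhd := by
  rintro _ ⟨y, hy, rfl⟩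
  exact fibre_subset hy.1 (hq.2 y hy.1).1

theorem interior_eq_empty (hq : B.CollapsesFibres O q) (h : B.IsTube ι O ρ) :
    interior (q '' (B.nbhd \ O)) = ∅ := by
  refine eq_empty_iff_forall_notMem.2 fun y hy => ?_
  obtain ⟨κ, hκ, -⟩ := exists_column B (hq.image_subset (interior_subset hy))
  have h1 : ∀ᶠ t in 𝓝 (κ.z y), κ.pt (κ.v y) t ∈ q '' (B.nbhd \ O) := by
    refine (κ.continuous_pt_right (κ.v y)).continuousAt.eventually ?_
    beta_reduce
    rw [κ.pt_v_z hκ]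
    exact mem_interior_iff_mem_nhds.1 hy
  obtain ⟨l, r, hlr, h2⟩ := mem_nhds_iff_exists_Ioo_subset.1 h1
  obtain ⟨r', h3, h4⟩ := exists_between hlr.2
  obtain ⟨w, hw, hwL⟩ := hq.exists_notMem_image h (x := κ.v y) h3
  exact hwL (h2 ⟨hlr.1.trans_le hw.1, hw.2.trans_lt h4⟩)

theorem exists_lamination (hq : B.CollapsesFibres O q) (h : B.IsTube ι O ρ)
    (hE : ContinuousEnds B ι ρ) (hcomp : B.IsCompleteSurface ι) :
    ∃ L : Lamination M, B.FullyCarries L ∧ B.IsCollapse O L q := by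
  have hsub := hq.image_subset
  have hcov : ∀ y ∈ q '' (B.nbhd \ O), ∃ φ, y ∈ φ.source ∧ B.IsVertical φ ∧
      IsProductChart (q '' (B.nbhd \ O)) φ := fun y hy => by
    obtain ⟨κ, hκ, -⟩ := exists_column B (hsub hy)
    obtain ⟨φ, h1, h2⟩ := hq.exists_chart h hE hcomp κ
    exact ⟨φ, h1 y hκ, h2⟩
  have hint := hq.interior_eq_empty h
  let L : Lamination M :=
    { carrier := q '' (B.nbhd \ O)
      charts := {φ | B.IsVertical φ ∧ IsProductChart (q '' (B.nbhd \ O)) φ}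
      isClosed_carrier :=
        (h.isCompact_sdiff.image_of_continuousOn (hq.1.mono Set.sdiff_subset)).isClosed
      isProductChart := fun _ h => h.2
      covered := fun y hy => (hcov y hy).imp fun _ h => h.symm
      samePlaques := fun _ h _ h' => samePlaques_of_interior_eq_empty hint h.2 h'.2 }
  refine ⟨L, ⟨⟨hsub, fun y hy => ?_⟩, fun y hy => ?_⟩, hq.1, hq.2, rfl⟩
  · obtain ⟨φ, h1, h2, h3⟩ := hcov y hy
    exact ⟨φ, h1, h2, h3, fun ψ hψ => samePlaques_of_interior_eq_empty hint h3 hψ.2⟩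
  · obtain ⟨z, hz, hzy⟩ := h.fibre_sdiff_nonempty hy
    exact ⟨q z, ⟨z, hz, rfl⟩, B.fibre_eq _ hy _ hzy ▸ (hq.2 z hz.1).1⟩

end CollapsesFibres

end BranchedSurface

theorem mainTheorem8 {M : Type u} [TopologicalSpace M] [T2Space M]
    [ChartedSpace (EuclideanSpace ℝ (Fin 3)) M]
    (B : BranchedSurface M) (p : Set M) (hp : B.IsParedLocus p) :
    -- a splitting surface determines a fully carried lamination, unique up to isotopy
    (∀ (S : Type u) [TopologicalSpace S] (ι : S → M), B.IsSplittingSurface p ι →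
      (∀ O, B.IsRegularNbhd ι O →
        ∃ L : Lamination M, B.FullyCarries L ∧ ∃ q, B.IsCollapse O L q) ∧
      (∀ O O', B.IsRegularNbhd ι O → B.IsRegularNbhd ι O' → ∀ L L' : Lamination M,
        B.FullyCarries L → B.FullyCarries L' →
        (∃ q, B.IsCollapse O L q) → (∃ q, B.IsCollapse O' L' q) →
        B.IsotopicLaminations L L')) ∧
    -- a fully carried lamination determines a splitting surface, unique up to isotopy,
    -- and the lamination of that surface is a canonical blow-down of the given one
    (∀ L : Lamination M, B.FullyCarries L →
      (∃ (S : Type u) (_ : TopologicalSpace S) (ι : S → M),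
        B.IsSplittingSurface p ι ∧ B.IsCoreSurface L ι) ∧
      (∀ (S S' : Type u) [TopologicalSpace S] [TopologicalSpace S'] (ι : S → M) (ι' : S' → M),
        B.IsSplittingSurface p ι → B.IsCoreSurface L ι →
        B.IsSplittingSurface p ι' → B.IsCoreSurface L ι' → B.IsotopicSurfaces p ι ι') ∧
      (∀ (S : Type u) [TopologicalSpace S] (ι : S → M),
        B.IsSplittingSurface p ι → B.IsCoreSurface L ι →
        ∀ (O : Set M) (L' : Lamination M) (q : M → M),
          B.IsRegularNbhd ι O → B.FullyCarries L' → B.IsCollapse O L' q →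
          ∃ b : M → M, B.IsBlowDown L L' b ∧
            (∀ y ∈ L.carrier, ∀ z ∈ L.carrier ∩ B.fibre y,
              b y = b z ↔ Disjoint (B.seg y z) (range ι)) ∧
            (∀ y ∈ L.carrier, ∀ z ∈ B.fibre y \ O,
              b y = q z ↔ Disjoint (B.seg y z) (range ι)))) := by
  obtain ⟨D, -⟩ := BranchedSurface.exists_fibreMetric hp
  refine ⟨fun S _ ι hS => ⟨fun O hO => ?_, fun O O' hO hO' L L' _ _ ⟨q, hq⟩ ⟨q', hq'⟩ => ?_⟩,
    fun L hL => ⟨?_, fun S S' _ _ ι ι' hS hc hS' hc' => ?_, fun S _ ι hS hc O L' q hO _ hq => ?_⟩⟩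
  · obtain ⟨ρ, h, hE⟩ := hO.exists_tube hS.1.continuous
    obtain ⟨q, hq⟩ := h.exists_collapsesFibres hE hS.2.1 D
    obtain ⟨L, hL, hc⟩ := hq.exists_lamination h hE hS.2.1
    exact ⟨L, hL, q, hc⟩
  · obtain ⟨ρ, h, -⟩ := hO.exists_tube hS.1.continuous
    obtain ⟨ρ', h', -⟩ := hO'.exists_tube hS.1.continuous
    exact h.isotopicLaminations D h' hq hq'
      (hq.2.2 ▸ BranchedSurface.CollapsesFibres.interior_eq_empty ⟨hq.1, hq.2.1⟩ h)
      (hq'.2.2 ▸ BranchedSurface.CollapsesFibres.interior_eq_empty ⟨hq'.1, hq'.2.1⟩ h')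
  · obtain ⟨S, _, ι, ς, h⟩ := hL.exists_coreSection hp
    exact ⟨S, _, ι, h.isSplittingSurface hp hL, h.isCoreSurface⟩
  · obtain ⟨ς, h⟩ := hS.exists_section hL.1 hc
    obtain ⟨ς', h'⟩ := hS'.exists_section hL.1 hc'
    exact h.isotopicSurfaces h' hp hL
  · obtain ⟨ρ, h, -⟩ := hO.exists_tube hS.1.continuous
    exact hc.exists_blowDown hL h hq
      (hq.2.2 ▸ BranchedSurface.CollapsesFibres.interior_eq_empty ⟨hq.1, hq.2.1⟩ h)
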